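/- Let $\mathbb{C}_S$ be the complex Grassmann algebra with generators $\beta_0,\beta_1,\dots$, with elements $x=\sum_\lambda x_\lambda\beta_\lambda$ ($\lambda$ running over the finite subsets of $\mathbb N$), body $\mathbb{B}(x)=x_\emptyset$, conjugation $\bar x=\sum_\lambda\overline{x_\lambda}\beta_\lambda$ and even part $\mathbb{C}_{S_0}$; holomorphy, smoothness, integrals and limits of $\mathbb{C}_S$-valued functions are understood coefficientwise. Let $U\subseteq\mathbb{C}^n$ be open and consider the superdomain with body $U$ in $\mathbb{C}_S^{n,n}$, with even coordinates $z_1,\dots,z_n$ and odd coordinates $\xi_1,\dots,\xi_n$. A $\mathbb{C}_S$-valued function given on the body is evaluated at a point with even coordinates in $\mathbb{C}_{S_0}$ by Taylor expansion in the souls of the coordinates and their conjugates. Let $$V=\sum_{i=1}^n f_i\frac{\partial}{\partial z_i}+\sum_{i=1}^n g_i\frac{\partial}{\partial \xi_i}$$ be an odd holomorphic vector field, where $g_i=g_i(z)$ is even without odd variables ($g_i$ is holomorphic on $U$ with values in $\mathbb{C}_{S_0}$) and $f_i=\sum_\mu\xi_\mu f_{i,\mu}(z)$ is odd (only multi-indices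 $\mu$ of odd length occur, $f_{i,\mu}$ is holomorphic on $U$ with values in $\mathbb{C}_{S_0}$). Let $JV=(\partial g_i/\partial z_j)_{n\times n}$, and let $p$ be an isolated singularity of $V$: $V(p)=0$ and some ball about $\mathbb{B}(p)$ contains no other point of $\mathbb{B}(\mathrm{Sing}(V))$. Let $p$ be non-degenerate: $\det(JV)(p)$ is invertible, i.e. has nonzero body. Superforms are sums of terms $dX\,\xi_\mu\bar\xi_\lambda\,a(z,\bar z)$, where $dX$ is a product of the forms $dz_i,d\bar z_i,d\xi_i,d\bar\xi_i$ (in this order) and $a$ is a $\mathbb{C}_S$-valued function; the parity of a term is that of $dX\,\xi_\mu\bar\xi_\lambda$, and terms $K,L$ of degrees $k,l$ and parities $\varepsilon(K),\varepsilon(L)$ are multiplied by the rule $K\wedge L=(-1)^{kl}(-1)^{\varepsilon(K)\varepsilon(L)}L\wedge K$ for their monomials, the coefficients being multiplied in $\mathbb{C}_S$. Let $\eta$ be a superform with coefficients smooth on $U$ (for instance one with $(\bar\partial+i_V)(\eta)=0$). Let $\eta^{(0,0)|(n,n)}$ be the function multiplying $d\xi_1\wedge\cdots\wedge d\xi_n\wedge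 d\bar\xi_1\wedge\cdots\wedge d\bar\xi_n$ in $\eta$; let $\eta^{(1,0)|(n-1,n)}_{\widehat *}=\sum_{j=1}^n\eta^{(1,0)|(n-1,n)}_{\widehat j}$, where $\eta^{(1,0)|(n-1,n)}_{\widehat j}$ is the function multiplying $dz_j\wedge d\xi_1\wedge\cdots\wedge\widehat{d\xi_j}\wedge\cdots\wedge d\xi_n\wedge d\bar\xi_1\wedge\cdots\wedge d\bar\xi_n$; and let the subscript $(1\dots n;1\dots n)$ denote the coefficient of $\xi_1\cdots\xi_n\bar\xi_1\cdots\bar\xi_n$. Assume that in the expansions of $\eta^{(0,0)|(n,n)}$ and $\eta^{(1,0)|(n-1,n)}_{\widehat *}$ only terms occur in which the number of variables $\xi_j$ (not counting the $\bar\xi_j$) has the same parity as $n$. Put $\omega=\sum_i dz_i\,\bar g_i+\sum_i d\xi_i\,\bar g_i$. Then there is $\varepsilon>0$ such that the closed ball of radius $\varepsilon$ about $\mathbb{B}(p)$ lies in $U$ and $\mathbb{B}(g_1),\dots,\mathbb{B}(g_n)$ have no common zero in it other than $\mathbb{B}(p)$; and for every such $\varepsilon$, with $SB_\varepsilon(p)$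 the superball whose body is the open ball of radius $\varepsilon$ about $\mathbb{B}(p)$, the limit $$\mathrm{Res}_{p}(V,\eta)=\lim_{t\to0^+}\int_{SB_\varepsilon(p)}\eta\cdot\exp\left\{-\frac{\bar\partial\omega}{t}-\frac{i_V(\omega)}{t}\right\}$$ (the Berezin integral, which integrates over the body the coefficient of $dz_1\wedge\cdots\wedge dz_n\wedge d\bar z_1\wedge\cdots\wedge d\bar z_n\wedge d\xi_1\wedge\cdots\wedge d\xi_n\wedge d\bar\xi_1\wedge\cdots\wedge d\bar\xi_n\,\xi_1\cdots\xi_n\bar\xi_1\cdots\bar\xi_n$ against $dz_1\wedge\cdots\wedge dz_n\wedge d\bar z_1\wedge\cdots\wedge d\bar z_n$) exists and $$\mathrm{Res}_{p}(V,\eta)=\left(\frac{2\pi}{i}\right)^n\left[\frac{\eta^{(0,0)|(n,n)}_{(1\dots n;1\dots n)}+\eta^{(1,0)|(n-1,n)}_{\widehat *\,(1\dots n;1\dots n)}}{\det(JV)}\right](p).$$ -/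

import Mathlib

open scoped ContDiff Topology

/-! ### Signs -/

/-- The sign `(-1)^N`, where `N` is the number of pairs `(a, b) ∈ s × t` with `b < a`. For disjoint
`s`, `t` this is the sign obtained when the product of the anticommuting generators indexed by `s`
(in increasing order), times the same product for `t`, is sorted into increasing order. -/
def shuffleSign {α : Type*} [LinearOrder α] (s t : Finset α) : ℤ :=
  (-1) ^ ((s ×ˢ t).filter fun q => q.2 < q.1).card

theorem shuffleSign_union_left {α : Type*} [LinearOrder α] {s t u : Finset α}
    (h : Disjoint s t) : shuffleSign (s ∪ t) u = shuffleSign s u * shuffleSign t u := by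
  unfold shuffleSign
  rw [← pow_add, Finset.union_product, Finset.filter_union, Finset.card_union_of_disjoint]
  refine Finset.disjoint_filter_filter ?_
  rw [Finset.disjoint_left] at h ⊢
  intro q hq hq'
  simp only [Finset.mem_product] at hq hq'
  exact h hq.1 hq'.1

theorem shuffleSign_union_right {α : Type*} [LinearOrder α] {s t u : Finset α}
    (h : Disjoint t u) : shuffleSign s (t ∪ u) = shuffleSign s t * shuffleSign s u := by
  unfold shuffleSign
  rw [← pow_add, Finset.product_union, Finset.filter_union, Finset.card_union_of_disjoint]
  refine Finset.disjoint_filter_filter ?_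
  rw [Finset.disjoint_left] at h ⊢
  intro q hq hq'
  simp only [Finset.mem_product] at hq hq'
  exact h hq.2 hq'.2

theorem shuffleSign_swap {α : Type*} [LinearOrder α] {s t : Finset α} (h : Disjoint s t)
    (ht : Even (s.card * t.card)) : shuffleSign s t = shuffleSign t s := by
  have h1 : ((t ×ˢ s).filter fun q => q.2 < q.1).card
      = ((s ×ˢ t).filter fun q => ¬ q.2 < q.1).card := by
    refine Finset.card_bij' (fun q _ => (q.2, q.1)) (fun q _ => (q.2, q.1)) ?_ ?_ ?_ ?_
    · intro q hq
      simp only [Finset.mem_filter, Finset.mem_product] at hq ⊢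
      exact ⟨⟨hq.1.2, hq.1.1⟩, not_lt.2 hq.2.le⟩
    · intro q hq
      simp only [Finset.mem_filter, Finset.mem_product] at hq ⊢
      refine ⟨⟨hq.1.2, hq.1.1⟩, lt_of_le_of_ne (not_lt.1 hq.2) ?_⟩
      intro he
      exact (Finset.disjoint_left.1 h hq.1.1) (he ▸ hq.1.2)
    · intro q _; rfl
    · intro q _; rfl
  have h2 := Finset.card_filter_add_card_filter_not (s := s ×ˢ t) (fun q => q.2 < q.1)
  rw [Finset.card_product] at h2
  unfold shuffleSign
  rw [h1]
  rw [← h2] at ht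
  rcases Nat.even_or_odd ((s ×ˢ t).filter fun q => q.2 < q.1).card with he | ho
  · rw [he.neg_one_pow, ((Nat.even_add.1 ht).1 he).neg_one_pow]
  · have : Odd ((s ×ˢ t).filter fun q => ¬ q.2 < q.1).card := by
      rw [← Nat.not_even_iff_odd] at ho ⊢
      exact fun hh => ho ((Nat.even_add.1 ht).2 hh)
    rw [ho.neg_one_pow, this.neg_one_pow]

/-! ### The complex Grassmann algebra with infinitely many generators -/

/-- The complex Grassmann algebra `ℂ_S` with generators `β₀, β₁, β₂, …`: a formal combination
`x = ∑ x_l β_l` over all multi-indices, i.e. finite subsets `l = {l₁ < ⋯ < l_k}` of `ℕ`, where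
`β_l = β_{l₁} ⋯ β_{l_k}`, is given by its family of coefficients. The Grassmann algebra on finitely
many generators is contained in it. -/
def ComplexGrassmann : Type := Finset ℕ → ℂ

namespace ComplexGrassmann

noncomputable instance : AddCommGroup ComplexGrassmann := inferInstanceAs (AddCommGroup (Finset ℕ → ℂ))

noncomputable instance : Module ℂ ComplexGrassmann := inferInstanceAs (Module ℂ (Finset ℕ → ℂ))

instance : One ComplexGrassmann := ⟨fun l => if l = ∅ then 1 else 0⟩

/-- The product determined by `β_i β_j = - β_j β_i`. -/
noncomputable instance : Mul ComplexGrassmann :=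
  ⟨fun x y l => ∑ m ∈ l.powerset, (shuffleSign m (l \ m) : ℂ) * (x m * y (l \ m))⟩

theorem one_apply (l : Finset ℕ) : (1 : ComplexGrassmann) l = if l = ∅ then 1 else 0 := rfl

theorem zero_apply (l : Finset ℕ) : (0 : ComplexGrassmann) l = 0 := rfl

theorem add_apply (x y : ComplexGrassmann) (l : Finset ℕ) : (x + y) l = x l + y l := rfl

theorem neg_apply (x : ComplexGrassmann) (l : Finset ℕ) : (-x) l = -x l := rfl

theorem mul_apply (x y : ComplexGrassmann) (l : Finset ℕ) :
    (x * y) l = ∑ m ∈ l.powerset, (shuffleSign m (l \ m) : ℂ) * (x m * y (l \ m)) := rfl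

protected theorem one_mul' (x : ComplexGrassmann) : 1 * x = x := by
  funext l
  rw [mul_apply, Finset.sum_eq_single ∅]
  · simp [one_apply, shuffleSign]
  · intro m _ hm
    simp [one_apply, hm]
  · simp

protected theorem mul_one' (x : ComplexGrassmann) : x * 1 = x := by
  funext l
  rw [mul_apply, Finset.sum_eq_single l]
  · simp [one_apply, shuffleSign]
  · intro m hm hne
    have : l \ m ≠ ∅ := by
      intro h
      exact hne (Finset.Subset.antisymm (Finset.mem_powerset.1 hm) (Finset.sdiff_eq_empty_iff_subset.1 h))
    simp [one_apply, this]
  · simp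

protected theorem mul_assoc' (x y z : ComplexGrassmann) : x * y * z = x * (y * z) := by
  funext l
  simp only [mul_apply, Finset.mul_sum, Finset.sum_mul]
  rw [Finset.sum_sigma', Finset.sum_sigma']
  refine Finset.sum_bij' (fun q _ => ⟨q.2, q.1 \ q.2⟩) (fun q _ => ⟨q.1 ∪ q.2, q.1⟩) ?_ ?_ ?_ ?_ ?_
  · rintro ⟨a, b⟩ h
    simp only [Finset.mem_sigma, Finset.mem_powerset] at h ⊢
    exact ⟨h.2.trans h.1, Finset.sdiff_subset_sdiff h.1 le_rfl⟩
  · rintro ⟨a, b⟩ h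
    simp only [Finset.mem_sigma, Finset.mem_powerset] at h ⊢
    exact ⟨Finset.union_subset h.1 (h.2.trans Finset.sdiff_subset), Finset.subset_union_left⟩
  · rintro ⟨a, b⟩ h
    simp only [Finset.mem_sigma, Finset.mem_powerset] at h
    simp [Finset.union_sdiff_of_subset h.2]
  · rintro ⟨a, b⟩ h
    simp only [Finset.mem_sigma, Finset.mem_powerset] at h
    have hd : Disjoint b a := Finset.disjoint_of_subset_left h.2 Finset.sdiff_disjoint
    simp [Finset.union_sdiff_left, Finset.sdiff_eq_self_of_disjoint hd]
  · rintro ⟨a, b⟩ h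
    simp only [Finset.mem_sigma, Finset.mem_powerset] at h
    obtain ⟨hal, hba⟩ := h
    have e1 : (l \ b) \ (a \ b) = l \ a := by
      ext i
      simp only [Finset.mem_sdiff]
      constructor
      · rintro ⟨⟨h1, h2⟩, h3⟩
        exact ⟨h1, fun h4 => h3 ⟨h4, h2⟩⟩
      · rintro ⟨h1, h2⟩
        exact ⟨⟨h1, fun h3 => h2 (hba h3)⟩, fun h3 => h2 h3.1⟩
    have e2 : l \ b = (a \ b) ∪ (l \ a) := by
      ext i
      simp only [Finset.mem_sdiff, Finset.mem_union]
      constructor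
      · rintro ⟨h1, h2⟩
        by_cases h3 : i ∈ a
        · exact Or.inl ⟨h3, h2⟩
        · exact Or.inr ⟨h1, h3⟩
      · rintro (⟨h1, h2⟩ | ⟨h1, h2⟩)
        · exact ⟨hal h1, h2⟩
        · exact ⟨h1, fun h3 => h2 (hba h3)⟩
    have e3 : a = b ∪ (a \ b) := (Finset.union_sdiff_of_subset hba).symm
    have d1 : Disjoint b (a \ b) := Finset.disjoint_sdiff
    have d2 : Disjoint (a \ b) (l \ a) :=
      Finset.disjoint_of_subset_left Finset.sdiff_subset Finset.disjoint_sdiff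
    have s1 : shuffleSign a (l \ a) = shuffleSign b (l \ a) * shuffleSign (a \ b) (l \ a) := by
      conv_lhs => rw [e3, ← e3]
      rw [← shuffleSign_union_left d1, ← e3]
    have s2 : shuffleSign b (l \ b) = shuffleSign b (a \ b) * shuffleSign b (l \ a) := by
      rw [e2, shuffleSign_union_right d2]
    simp only [e1]
    rw [s1, s2]
    push_cast
    ring

noncomputable instance : Ring ComplexGrassmann :=
  { (inferInstance : AddCommGroup ComplexGrassmann) with
    one := 1
    mul := (· * ·)
    one_mul := ComplexGrassmann.one_mul'
    mul_one := ComplexGrassmann.mul_one'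
    mul_assoc := ComplexGrassmann.mul_assoc'
    zero_mul := by
      intro x
      funext l
      rw [mul_apply]
      simp [zero_apply]
    mul_zero := by
      intro x
      funext l
      rw [mul_apply]
      simp [zero_apply]
    left_distrib := by
      intro x y z
      funext l
      simp only [mul_apply, add_apply, mul_add, Finset.sum_add_distrib]
    right_distrib := by
      intro x y z
      funext l
      simp only [mul_apply, add_apply, add_mul, mul_add, Finset.sum_add_distrib] }

/-- The body `𝔹(x) = x_∅`. -/
def body (x : ComplexGrassmann) : ℂ := x ∅

/-- The soul `x - 𝔹(x)`. -/
noncomputable def soul (x : ComplexGrassmann) : ComplexGrassmann := x - x.body • (1 : ComplexGrassmann)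

/-- Complex conjugation: the coefficients are conjugated, the generators `β_i` are real. -/
noncomputable def conj (x : ComplexGrassmann) : ComplexGrassmann := fun l => star (x l)

/-- The subring `ℂ_{S₀}` of even elements. -/
noncomputable def evenPart : Subring ComplexGrassmann where
  carrier := {x | ∀ l : Finset ℕ, Odd l.card → x l = 0}
  mul_mem' := by
    intro x y hx hy l hl
    rw [mul_apply]
    refine Finset.sum_eq_zero fun m hm => ?_
    have hc := Finset.card_sdiff_add_card_eq_card (Finset.mem_powerset.1 hm)
    rcases Nat.even_or_odd m.card with he | ho
    · have : Odd (l \ m).card := by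
        rw [← hc] at hl
        exact (Nat.odd_add.1 hl).2 he
      rw [hy _ this]; simp
    · rw [hx _ ho]; simp
  one_mem' := by
    intro l hl
    rw [one_apply, if_neg]
    rintro rfl
    simp at hl
  add_mem' := by
    intro x y hx hy l hl
    rw [add_apply, hx l hl, hy l hl, add_zero]
  zero_mem' := fun _ _ => rfl
  neg_mem' := by
    intro x hx l hl
    rw [neg_apply, hx l hl, neg_zero]

noncomputable instance : CommRing evenPart :=
  { (inferInstance : Ring evenPart) with
    mul_comm := by
      rintro ⟨x, hx⟩ ⟨y, hy⟩
      apply Subtype.ext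
      funext l
      change (x * y) l = (y * x) l
      rw [mul_apply, mul_apply]
      refine Finset.sum_bij' (fun m _ => l \ m) (fun m _ => l \ m) ?_ ?_ ?_ ?_ ?_
      · intro m _; simp
      · intro m _; simp
      · intro m hm
        exact Finset.sdiff_sdiff_eq_self (Finset.mem_powerset.1 hm)
      · intro m hm
        exact Finset.sdiff_sdiff_eq_self (Finset.mem_powerset.1 hm)
      · intro m hm
        rw [Finset.sdiff_sdiff_eq_self (Finset.mem_powerset.1 hm)]
        rcases Nat.even_or_odd m.card with he | ho
        · rw [shuffleSign_swap Finset.disjoint_sdiff (he.mul_right _)]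
          ring
        · rw [hx m ho]; simp }

end ComplexGrassmann

/-! ### Superfunctions and superpoints -/

/-- The coordinate space `ℂⁿ`, the body of the superspace `ℂ_S^{n,n}`. -/
abbrev BodySpace (n : ℕ) : Type := Fin n → ℂ

/-- Indices for the holomorphic and antiholomorphic coordinates, the holomorphic ones first. -/
abbrev CoordIndex (n : ℕ) : Type := Fin n ⊕ₗ Fin n

/-- The index of a holomorphic coordinate (`z_i` or `ξ_i`). -/
def hol {n : ℕ} (i : Fin n) : CoordIndex n := Sum.inlₗ i

/-- The index of an antiholomorphic coordinate (`z̄_i` or `ξ̄_i`). -/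
def anti {n : ℕ} (i : Fin n) : CoordIndex n := Sum.inrₗ i

/-- A `ℂ_S`-valued function is holomorphic on `U` if each of its coefficients is. -/
def GrassmannHolomorphicOn {n : ℕ} (h : BodySpace n → ComplexGrassmann) (U : Set (BodySpace n)) :
    Prop :=
  ∀ l : Finset ℕ, DifferentiableOn ℂ (fun z => h z l) U

/-- A `ℂ_S`-valued function is smooth on `U` if each of its coefficients is. -/
def GrassmannSmoothOn {n : ℕ} (h : BodySpace n → ComplexGrassmann) (U : Set (BodySpace n)) : Prop :=
  ∀ l : Finset ℕ, ContDiffOn ℝ ∞ (fun z => h z l) U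

/-- The Wirtinger derivative `∂/∂z_j = (∂/∂x_j - i ∂/∂y_j)/2` of a `ℂ_S`-valued function. -/
noncomputable def dWirtinger {n : ℕ} (j : Fin n) (h : BodySpace n → ComplexGrassmann) :
    BodySpace n → ComplexGrassmann := fun z l =>
  (fderiv ℝ (fun w => h w l) z (Pi.single j 1)
    - Complex.I * fderiv ℝ (fun w => h w l) z (Pi.single j Complex.I)) / 2

/-- The Wirtinger derivative `∂/∂z̄_j = (∂/∂x_j + i ∂/∂y_j)/2` of a `ℂ_S`-valued function. -/
noncomputable def dbarWirtinger {n : ℕ} (j : Fin n) (h : BodySpace n → ComplexGrassmann) :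
    BodySpace n → ComplexGrassmann := fun z l =>
  (fderiv ℝ (fun w => h w l) z (Pi.single j 1)
    + Complex.I * fderiv ℝ (fun w => h w l) z (Pi.single j Complex.I)) / 2

/-- The operator `∑_j (s_j ∂/∂z_j + s̄_j ∂/∂z̄_j)`. -/
noncomputable def soulDerivative {n : ℕ} (s : Fin n → ComplexGrassmann)
    (h : BodySpace n → ComplexGrassmann) : BodySpace n → ComplexGrassmann := fun z =>
  ∑ j, (s j * dWirtinger j h z + (s j).conj * dbarWirtinger j h z)

/-- The value at a point `z` with even coordinates `z_j ∈ ℂ_{S₀}` of a function `h` given on the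
body: the Taylor expansion of `h` at the body of `z` in powers of the soul `s` of `z`,
`∑_k (1/k!) (s·∂ + s̄·∂̄)^k h (𝔹(z))`. As `s` has no terms of degree less than `2` in the generators,
the `k`-th term has no `β_l` component for `2k > |l|`, so the sum is finite. -/
noncomputable def superEval {n : ℕ} (h : BodySpace n → ComplexGrassmann)
    (z : Fin n → ComplexGrassmann.evenPart) : ComplexGrassmann := fun l =>
  ∑ k ∈ Finset.range (l.card + 1), (k.factorial : ℂ)⁻¹ *
    ((soulDerivative fun j => (z j : ComplexGrassmann).soul)^[k] h
      fun j => (z j : ComplexGrassmann).body) l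

/-- A point `(z, ξ)` of the superspace `ℂ_S^{n,n}`: even coordinates `z_j`, odd coordinates `ξ_j`. -/
structure SuperPoint (n : ℕ) where
  z : Fin n → ComplexGrassmann.evenPart
  ξ : Fin n → ComplexGrassmann
  ξ_odd : ∀ j, ∀ l : Finset ℕ, Even l.card → ξ j l = 0

/-- The body of a point. -/
def SuperPoint.body {n : ℕ} (p : SuperPoint n) : BodySpace n := fun j =>
  (p.z j : ComplexGrassmann).body

/-- The product `ξ_μ = ξ_{μ₁} ⋯ ξ_{μ_k}` for `μ = {μ₁ < ⋯ < μ_k}`, in `ℂ_S`. -/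
noncomputable def SuperPoint.oddMonomial {n : ℕ} (p : SuperPoint n) (μ : Finset (Fin n)) :
    ComplexGrassmann :=
  ((μ.sort (· ≤ ·)).map p.ξ).prod

/-- A superfunction `∑_Q ξ_Q h_Q(z, z̄)`, where `ξ_Q` is the product of the odd coordinates `ξ_i`
(`hol i ∈ Q`) and `ξ̄_i` (`anti i ∈ Q`) in increasing order, the `ξ_i` first. -/
abbrev SuperFunction (n : ℕ) : Type := Finset (CoordIndex n) → BodySpace n → ComplexGrassmann

/-- On `U` the expansion of `h` contains only terms in which the number of variables `ξ_j` has the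
same parity as `n` (the variables `ξ̄_j` are not counted). -/
def SuperFunction.HasDimensionParityOn {n : ℕ} (h : SuperFunction n) (U : Set (BodySpace n)) :
    Prop :=
  ∀ Q : Finset (CoordIndex n),
    (Finset.univ.filter fun i : Fin n => hol i ∈ Q).card % 2 ≠ n % 2 → ∀ z ∈ U, h Q z = 0

/-- The coefficient `h_{(1…n;1…n)}` of `ξ₁ ⋯ ξₙ ξ̄₁ ⋯ ξ̄ₙ`. -/
def SuperFunction.top {n : ℕ} (h : SuperFunction n) : BodySpace n → ComplexGrassmann :=
  h Finset.univ

/-! ### Superforms -/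

/-- A monomial `dZ_A dΞ^m ξ_Q`. Here `dZ_A` is the product in increasing order of the even 1-forms
`dz_i` (`hol i ∈ A`) and `dz̄_i` (`anti i ∈ A`), `dΞ^m` is the product of the powers `(dξ_i)^{m (hol i)}`
and `(dξ̄_i)^{m (anti i)}` of the odd 1-forms (which commute with each other), and `ξ_Q` is the
product in increasing order of the odd coordinates in `Q`. -/
@[ext] structure SuperMonomial (n : ℕ) where
  A : Finset (CoordIndex n)
  m : CoordIndex n → ℕ
  Q : Finset (CoordIndex n)

/-- The sign in `(dZ_A dΞ^m ξ_Q) ∧ (dZ_{A'} dΞ^{m'} ξ_{Q'}) = ± dZ_{A ∪ A'} dΞ^{m + m'} ξ_{Q ∪ Q'}`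
(`A`, `A'` disjoint and `Q`, `Q'` disjoint) that results from the rule
`K ∧ L = (-1)^{kl} (-1)^{ε(K) ε(L)} L ∧ K` for `K`, `L` of degrees `k`, `l` and parities `ε(K)`,
`ε(L)`, where `z`, `dz` are even and `ξ`, `dξ` are odd. -/
def SuperMonomial.sign {n : ℕ} (I J : SuperMonomial n) : ℤ :=
  (-1) ^ ((∑ c, I.m c) * J.A.card + I.Q.card * ∑ c, J.m c)
    * shuffleSign I.A J.A * shuffleSign I.Q J.Q

/-- A superform `∑_I I · η_I`, given by the coefficients `η_I` of the monomials `I`, which are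
`ℂ_S`-valued functions of `z`, `z̄`. The parity of a term is that of its monomial. Elements of
`⨁ A^{(p,q)|(r,s)}` are those with only finitely many nonzero coefficients. -/
abbrev SuperForm (n : ℕ) : Type := SuperMonomial n → BodySpace n → ComplexGrassmann

namespace SuperForm

variable {n : ℕ}

/-- All coefficients are smooth on `U`. -/
def SmoothOn (η : SuperForm n) (U : Set (BodySpace n)) : Prop :=
  ∀ I, GrassmannSmoothOn (η I) U

open Classical in
/-- The form `I · a` with a single term. -/
noncomputable def term (I : SuperMonomial n) (a : BodySpace n → ComplexGrassmann) : SuperForm n :=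
  Pi.single I a

/-- The wedge product: the coefficient of a monomial is the sum over all its factorizations into
two monomials. -/
noncomputable def wedge (η θ : SuperForm n) : SuperForm n := fun K z =>
  ∑ A ∈ K.A.powerset, ∑ m ∈ Finset.Iic K.m, ∑ Q ∈ K.Q.powerset,
    SuperMonomial.sign ⟨A, m, Q⟩ ⟨K.A \ A, K.m - m, K.Q \ Q⟩ •
      (η ⟨A, m, Q⟩ z * θ ⟨K.A \ A, K.m - m, K.Q \ Q⟩ z)

/-- Powers with respect to the wedge product. -/
noncomputable def wedgePow (X : SuperForm n) : ℕ → SuperForm n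
  | 0 => term ⟨∅, 0, ∅⟩ 1
  | k + 1 => wedge (wedgePow X k) X

/-- The exponential `∑_k X^k / k!`, computed coefficientwise. -/
noncomputable def exp (X : SuperForm n) : SuperForm n := fun K z l =>
  ∑' k : ℕ, (k.factorial : ℂ)⁻¹ * wedgePow X k K z l

/-- `∂/∂z̄_i`, applied to the coefficients. -/
noncomputable def dbarEven (i : Fin n) (η : SuperForm n) : SuperForm n := fun I =>
  dbarWirtinger i (η I)

/-- `∂/∂ξ̄_j`, an odd left derivation: it picks up a sign from each of the odd 1-forms `dξ`, `dξ̄`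
and from each of the odd coordinates that precede `ξ̄_j`. -/
noncomputable def dbarOdd (j : Fin n) (η : SuperForm n) : SuperForm n := fun I =>
  if anti j ∈ I.Q then 0
  else ((-1 : ℤ) ^ ((∑ c, I.m c) + (I.Q.filter fun q => q < anti j).card)) •
    η ⟨I.A, I.m, insert (anti j) I.Q⟩

/-- `∂̄ = ∑_i dz̄_i ∧ ∂/∂z̄_i + ∑_j dξ̄_j ∧ ∂/∂ξ̄_j`. -/
noncomputable def dbar (η : SuperForm n) : SuperForm n :=
  ∑ i, wedge (term ⟨{anti i}, 0, ∅⟩ 1) (dbarEven i η)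
    + ∑ j, wedge (term ⟨∅, Pi.single (anti j) 1, ∅⟩ 1) (dbarOdd j η)

/-- Contraction with the even vector field `∂/∂z_j`: it removes `dz_j`, with a sign for each of the
1-forms that precede it. -/
noncomputable def contractEven (j : Fin n) (η : SuperForm n) : SuperForm n := fun I =>
  if hol j ∈ I.A then 0
  else ((-1 : ℤ) ^ (I.A.filter fun c => c < hol j).card) • η ⟨insert (hol j) I.A, I.m, I.Q⟩

/-- Contraction with the odd vector field `∂/∂ξ_j`: it picks up a sign from each of the even
1-forms `dz`, `dz̄` and acts as a derivation on the powers of `dξ_j`. -/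
noncomputable def contractOdd (j : Fin n) (η : SuperForm n) : SuperForm n := fun I =>
  ((-1 : ℤ) ^ I.A.card * ((I.m (hol j) : ℤ) + 1)) • η ⟨I.A, I.m + Pi.single (hol j) 1, I.Q⟩

/-- The function `η^{(0,0)|(n,n)}` that goes along with `dξ₁ ∧ ⋯ ∧ dξₙ ∧ dξ̄₁ ∧ ⋯ ∧ dξ̄ₙ`. -/
def coeffTopOdd (η : SuperForm n) : SuperFunction n := fun Q => η ⟨∅, 1, Q⟩

/-- The function `η^{(1,0)|(n-1,n)}_{\hat *}`, the sum over `j` of the functions that go along with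
`dz_j ∧ dξ₁ ∧ ⋯ (dξ_j omitted) ⋯ ∧ dξₙ ∧ dξ̄₁ ∧ ⋯ ∧ dξ̄ₙ`. -/
noncomputable def coeffStar (η : SuperForm n) : SuperFunction n := fun Q =>
  ∑ j : Fin n, η ⟨{hol j}, Function.update 1 (hol j) 0, Q⟩

/-- The Berezin integral of a form over the superdomain with body `W`: the coefficient of
`dz₁ ⋯ dzₙ dz̄₁ ⋯ dz̄ₙ dξ₁ ⋯ dξₙ dξ̄₁ ⋯ dξ̄ₙ ξ₁ ⋯ ξₙ ξ̄₁ ⋯ ξ̄ₙ` is integrated over `W`, where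
`dz₁ ∧ ⋯ ∧ dzₙ ∧ dz̄₁ ∧ ⋯ ∧ dz̄ₙ = (-1)^{n(n-1)/2} (-2i)^n dx₁ ∧ dy₁ ∧ ⋯ ∧ dxₙ ∧ dyₙ`. -/
noncomputable def integral (W : Set (BodySpace n)) (Φ : SuperForm n) : ComplexGrassmann := fun l =>
  (-1) ^ (n * (n - 1) / 2) * (-2 * Complex.I) ^ n *
    ∫ z in W, Φ ⟨Finset.univ, 1, Finset.univ⟩ z l

end SuperForm

/-! ### Odd vector fields and residues -/

/-- An odd holomorphic vector field `V = ∑ f_i ∂/∂z_i + ∑ g_i ∂/∂ξ_i` on the superdomain with body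
`U ⊆ ℂⁿ`, where `f_i(z, ξ) = ∑_μ ξ_μ f_{i,μ}(z)` is odd (only multi-indices `μ` of odd length
occur) and `g_i(z)` is even without odd variables. -/
structure OddVectorField (n : ℕ) (U : Set (BodySpace n)) where
  f : Fin n → Finset (Fin n) → BodySpace n → ComplexGrassmann.evenPart
  g : Fin n → BodySpace n → ComplexGrassmann.evenPart
  f_holomorphic : ∀ i μ, GrassmannHolomorphicOn (fun z => (f i μ z : ComplexGrassmann)) U
  g_holomorphic : ∀ i, GrassmannHolomorphicOn (fun z => (g i z : ComplexGrassmann)) U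
  f_odd : ∀ i μ, Even μ.card → ∀ z ∈ U, f i μ z = 0

/-- The open ball of radius `ε` about `a` in `ℂⁿ`, for the Euclidean norm. -/
def bodyBall {n : ℕ} (a : BodySpace n) (ε : ℝ) : Set (BodySpace n) :=
  {z | ∑ i, ‖z i - a i‖ ^ 2 < ε ^ 2}

/-- The closed ball of radius `ε` about `a` in `ℂⁿ`, for the Euclidean norm. -/
def bodyClosedBall {n : ℕ} (a : BodySpace n) (ε : ℝ) : Set (BodySpace n) :=
  {z | ∑ i, ‖z i - a i‖ ^ 2 ≤ ε ^ 2}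

namespace OddVectorField

variable {n : ℕ} {U : Set (BodySpace n)}

/-- The superfunction `f_i = ∑_μ ξ_μ f_{i,μ}`, as a 0-form. -/
noncomputable def fForm (V : OddVectorField n U) (i : Fin n) : SuperForm n :=
  ∑ μ : Finset (Fin n), SuperForm.term ⟨∅, 0, μ.image hol⟩ fun z => (V.f i μ z : ComplexGrassmann)

/-- The superfunction `g_i`, as a 0-form. -/
noncomputable def gForm (V : OddVectorField n U) (i : Fin n) : SuperForm n :=
  SuperForm.term ⟨∅, 0, ∅⟩ fun z => (V.g i z : ComplexGrassmann)

/-- The contraction `i_V` with `V`, characterized by `i_V(dz_j) = f_j`, `i_V(dξ_j) = g_j`,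
`i_V(dz̄_j) = i_V(dξ̄_j) = 0` and
`i_V(α ∧ β) = i_V(α) ∧ β + (-1)^k (-1)^{ε(α) ε(V)} α ∧ i_V(β)` for `α` of degree `k`. -/
noncomputable def contract (V : OddVectorField n U) (η : SuperForm n) : SuperForm n :=
  ∑ j, SuperForm.wedge (V.fForm j) (SuperForm.contractEven j η)
    + ∑ j, SuperForm.wedge (V.gForm j) (SuperForm.contractOdd j η)

/-- The 1-form `ω = ∑ dz_i ḡ_i + ∑ dξ_i ḡ_i`. -/
noncomputable def omega (V : OddVectorField n U) : SuperForm n :=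
  ∑ i, SuperForm.term ⟨{hol i}, 0, ∅⟩ (fun z => (V.g i z : ComplexGrassmann).conj)
    + ∑ i, SuperForm.term ⟨∅, Pi.single (hol i) 1, ∅⟩ (fun z => (V.g i z : ComplexGrassmann).conj)

/-- The form `η · exp(-∂̄ω/t - i_V(ω)/t)`. -/
noncomputable def localizedForm (V : OddVectorField n U) (η : SuperForm n) (t : ℝ) : SuperForm n :=
  SuperForm.wedge η
    (SuperForm.exp ((-(1 / t : ℝ) : ℂ) • (SuperForm.dbar V.omega + V.contract V.omega)))

/-- The singular set `{p | V(p) = 0}`. -/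
def singularSet (V : OddVectorField n U) : Set (SuperPoint n) :=
  {p | p.body ∈ U ∧
    (∀ i, ∑ μ : Finset (Fin n),
      p.oddMonomial μ * superEval (fun z => (V.f i μ z : ComplexGrassmann)) p.z = 0) ∧
    ∀ i, superEval (fun z => (V.g i z : ComplexGrassmann)) p.z = 0}

/-- `p` is an isolated singularity: `p ∈ Sing(V)`, and some ball about `𝔹(p)` contains no other
point of `𝔹(Sing(V))`. -/
def IsIsolatedSingularity (V : OddVectorField n U) (p : SuperPoint n) : Prop :=
  p ∈ V.singularSet ∧
    ∃ ε > 0, bodyBall p.body ε ∩ SuperPoint.body '' V.singularSet = {p.body}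

/-- The derivative `∂g_i/∂z_j`, with values in the even part of `ℂ_S`. -/
noncomputable def gDeriv (V : OddVectorField n U) (i j : Fin n) (z : BodySpace n) :
    ComplexGrassmann.evenPart :=
  ⟨dWirtinger j (fun w => (V.g i w : ComplexGrassmann)) z, by
    intro l hl
    have h : (fun w => (V.g i w : ComplexGrassmann) l) = fun _ => (0 : ℂ) :=
      funext fun w => (V.g i w).2 l hl
    simp [dWirtinger, h]⟩

/-- The function `det(JV)`, where `JV = (∂g_i/∂z_j)`. -/
noncomputable def detJ (V : OddVectorField n U) (z : BodySpace n) : ComplexGrassmann :=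
  ((Matrix.of fun i j => V.gDeriv i j z).det : ComplexGrassmann.evenPart)

/-- `p` is non-degenerate: `det(JV)(p)` is invertible in `ℂ_S`, i.e. its body is nonzero. -/
def IsNondegenerateAt (V : OddVectorField n U) (p : SuperPoint n) : Prop :=
  (superEval V.detJ p.z).body ≠ 0

/-- `ε` is the radius of a superball about `p` that isolates `p`: the closed ball lies in `U`, and
on it the body of `(g_1, …, g_n)` vanishes at `𝔹(p)` only. -/
def IsIsolatingRadius (V : OddVectorField n U) (p : SuperPoint n) (ε : ℝ) : Prop :=
  0 < ε ∧ bodyClosedBall p.body ε ⊆ U ∧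
    ∀ z ∈ bodyClosedBall p.body ε, (∀ i, (V.g i z : ComplexGrassmann).body = 0) → z = p.body

/-- `Res_p(V, η) = R`: the limit for `t → 0⁺` of the integral of `η · exp(-∂̄ω/t - i_V(ω)/t)` over
the superball `SB_ε(p)` exists and equals `R` (coefficient by coefficient), for every radius `ε`
that isolates `p`; and such radii exist. -/
def HasResidue (V : OddVectorField n U) (η : SuperForm n) (p : SuperPoint n)
    (R : ComplexGrassmann) : Prop :=
  (∃ ε, V.IsIsolatingRadius p ε) ∧
    ∀ ε, V.IsIsolatingRadius p ε → ∀ l : Finset ℕ,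
      Filter.Tendsto (fun t : ℝ => SuperForm.integral (bodyBall p.body ε) (V.localizedForm η t) l)
        (𝓝[>] 0) (𝓝 (R l))

end OddVectorField

/-! The component of the residue along β_l involves only the components of the data that are indexed
by subsets of l. So fix a finite set L and keep the subsets of L only. The even elements then become
a finite-dimensional commutative ℂ-algebra `TruncAlg L` in which the kernel of the body map is
nilpotent, and arbitrary elements, such as the coefficients of η, form a module `TruncSpace L` over
it. Over this algebra the theorem splits into an algebraic computation at each point of the body and
a Laplace type asymptotic for integrals.

Algebra. Let G_i and H_i be the truncations of g_i and of its conjugate. Then ∂̄ω + i_V(ω) = S + E +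
O + F, where S = ∑ G_i H_i is a scalar, E = ∑ (∂H_k/∂z̄_i) dz̄_i dz_k, O is the same sum with dξ_k
for dz_k, and F = ∑ H_j f_j. The form E is central. The form O + F has even degree and odd parity,
hence squares to zero, and (E + O + F)^m = E^m + m E^(m-1) (O + F). Moreover E^n is ± n! det(∂̄H)
times dz_1 ⋯ dz̄_n, while E^(n+1) = 0 and E^n O = 0. The localized form is therefore η exp(-S/t)
times a polynomial in 1/t of degree at most n + 1. Its term of weight n + 1 comes from E^n F and
meets only coefficients of η^{(0,0)|(n,n)} that the parity assumption removes
(`topPair_nilpotentPart_pow_succ`). The term of weight n gives det(∂̄H) times the sum of the two top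
coefficients of η, plus terms that contain a factor H_j (`topPair_nilpotentPart_pow`).

Analysis. The claim is that t⁻ⁿ ∫ exp(-S/t) ψ tends to πⁿ ψ(p) / (det ∂G det ∂̄H)(p), where the
value at the superpoint p is the Taylor expansion in its soul (`tendsto_setIntegral_bodyBall`).
Three facts prove it. - For the amplitude δ = det ∂G det ∂̄H the limit is πⁿ. When (G, H) moves
along the segment from its affine model, the integrand changes by a divergence, because the
cofactors of a Jacobian are divergence free. What remains lives where the cutoff is not constant;
there the body of S is bounded below, so it tends to zero (`norm_localInt_det_sub_le`). The affine
model is a Gaussian integral. - By Hadamard's lemma every smooth function is a constant plus a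
combination of the G_i and H_i plus nilpotent multiples of smooth functions. Integration by parts
turns a factor G_i or H_i into a factor t, while Taylor evaluation at p is multiplicative and kills
G_i and H_i. By induction on the order of nilpotency the integral of φ is Λ(t) φ(p) to leading
order, where Λ(t) is the integral of 1 (`norm_localInt_sub_le`). - The choice φ = δ determines the
limit of Λ.

In this way the soul of p enters through division only, and no change of variables by nilpotent
elements is made.

Conclusion. The terms of weight less than n carry a positive power of t and vanish in the limit. In
weight n the terms with a factor H_j evaluate to zero at p, the factor det ∂̄H cancels, and 1 /
det(JV)(p) remains. The signs and the powers of 2, i and π combine to (2π/i)^n. -/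

set_option linter.unusedSectionVars false

/-! ### Wirtinger derivatives of vector-valued functions -/

section Wirtinger

variable {n : ℕ} {A M M' : Type*} [NormedCommRing A] [NormedAlgebra ℂ A]
  [NormedAddCommGroup M] [NormedSpace ℂ M] [NormedAddCommGroup M'] [NormedSpace ℂ M']

/-- Smoothness and integration are taken over ℝ while the algebra and the module are complex; this
provides the compatibility of the real scalars with the action of the algebra. -/
theorem isScalarTower_real (A M : Type*) [NormedCommRing A] [NormedAlgebra ℂ A]
    [NormedAddCommGroup M] [NormedSpace ℂ M] [Module A M] [IsScalarTower ℂ A M] :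
    IsScalarTower ℝ A M := by
  constructor
  intro r a m
  exact smul_assoc (r : ℂ) a m

attribute [local instance] isScalarTower_real

/-- The operator `(∂/∂x_j + κ ∂/∂y_j)/2`: the Wirtinger derivative `∂/∂z_j` for `κ = -i` and
`∂/∂z̄_j` for `κ = i`. -/
noncomputable def wirt (κ : ℂ) (j : Fin n) (f : BodySpace n → M) (z : BodySpace n) : M :=
  (1 / 2 : ℂ) • (fderiv ℝ f z (Pi.single j 1) + κ • fderiv ℝ f z (Pi.single j Complex.I))

theorem wirt_congr {κ : ℂ} {j : Fin n} {f g : BodySpace n → M} {z : BodySpace n}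
    (h : f =ᶠ[𝓝 z] g) : wirt κ j f z = wirt κ j g z := by
  unfold wirt
  rw [h.fderiv_eq]

theorem wirt_const (κ : ℂ) (j : Fin n) (m : M) (z : BodySpace n) :
    wirt κ j (fun _ => m) z = 0 := by
  simp [wirt]

theorem wirt_eq_zero {κ : ℂ} {j : Fin n} {f : BodySpace n → M} {z : BodySpace n}
    (h : f =ᶠ[𝓝 z] 0) : wirt κ j f z = 0 := by
  rw [wirt_congr h]
  exact wirt_const κ j 0 z

theorem wirt_add {κ : ℂ} {j : Fin n} {f g : BodySpace n → M} {z : BodySpace n}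
    (hf : DifferentiableAt ℝ f z) (hg : DifferentiableAt ℝ g z) :
    wirt κ j (fun w => f w + g w) z = wirt κ j f z + wirt κ j g z := by
  unfold wirt
  rw [fderiv_fun_add hf hg]
  simp only [add_apply, smul_add]
  abel

theorem wirt_sum {ι : Type*} (s : Finset ι) {κ : ℂ} {j : Fin n} {f : ι → BodySpace n → M}
    {z : BodySpace n} (hf : ∀ i ∈ s, DifferentiableAt ℝ (f i) z) :
    wirt κ j (fun w => ∑ i ∈ s, f i w) z = ∑ i ∈ s, wirt κ j (f i) z := by
  unfold wirt
  rw [fderiv_fun_sum hf]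
  simp only [sum_apply, Finset.smul_sum, ← Finset.sum_add_distrib]

theorem wirt_clm (L : M →L[ℂ] M') {κ : ℂ} {j : Fin n} {f : BodySpace n → M} {z : BodySpace n}
    (hf : DifferentiableAt ℝ f z) : wirt κ j (fun w => L (f w)) z = L (wirt κ j f z) := by
  have h := ((L.restrictScalars ℝ).hasFDerivAt.comp z hf.hasFDerivAt).fderiv
  unfold wirt
  have h' : fderiv ℝ (fun w => L (f w)) z = (L.restrictScalars ℝ).comp (fderiv ℝ f z) := h
  rw [h']
  simp

theorem wirt_smul [Module A M] [IsBoundedSMul A M] [IsScalarTower ℂ A M] {κ : ℂ} {j : Fin n}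
    {a : BodySpace n → A} {f : BodySpace n → M} {z : BodySpace n}
    (ha : DifferentiableAt ℝ a z) (hf : DifferentiableAt ℝ f z) :
    wirt κ j (fun w => a w • f w) z = wirt κ j a z • f z + a z • wirt κ j f z := by
  have : SMulCommClass ℂ A M := ⟨fun c a m => by
    rw [← smul_assoc, ← algebraMap_smul A c m, smul_smul, mul_comm, ← Algebra.smul_def]⟩
  have h := (ha.hasFDerivAt.smul hf.hasFDerivAt).fderiv
  unfold wirt
  have h' : fderiv ℝ (fun w => a w • f w) z = a z • fderiv ℝ f z + (fderiv ℝ a z).smulRight (f z) :=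
    h
  rw [h']
  simp only [add_apply, smul_apply,
    ContinuousLinearMap.smulRight_apply, smul_add, add_smul, smul_assoc, smul_comm (a z)]
  abel

theorem wirt_mul {κ : ℂ} {j : Fin n} {a f : BodySpace n → A} {z : BodySpace n}
    (ha : DifferentiableAt ℝ a z) (hf : DifferentiableAt ℝ f z) :
    wirt κ j (fun w => a w * f w) z = wirt κ j a z * f z + a z * wirt κ j f z :=
  wirt_smul (M := A) ha hf

theorem wirt_exp [CompleteSpace A] {κ : ℂ} {j : Fin n} {f : BodySpace n → A} {z : BodySpace n}
    (hf : DifferentiableAt ℝ f z) :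
    wirt κ j (fun w => NormedSpace.exp (f w)) z = NormedSpace.exp (f z) * wirt κ j f z := by
  have h := ((hasFDerivAt_exp (𝕂 := ℝ) (x := f z)).comp z hf.hasFDerivAt).fderiv
  unfold wirt
  have h' : fderiv ℝ (fun w => NormedSpace.exp (f w)) z
      = (NormedSpace.exp (f z) • (1 : A →L[ℝ] A)).comp (fderiv ℝ f z) := h
  rw [h']
  simp [mul_add]

theorem ContDiffOn.wirt {U : Set (BodySpace n)} (hU : IsOpen U) {κ : ℂ} {j : Fin n}
    {f : BodySpace n → M} (hf : ContDiffOn ℝ ∞ f U) : ContDiffOn ℝ ∞ (wirt κ j f) U := by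
  have h : ContDiffOn ℝ ∞ (fderiv ℝ f) U := hf.fderiv_of_isOpen hU (by simp)
  have h1 (v : BodySpace n) : ContDiffOn ℝ ∞ (fun z => fderiv ℝ f z v) U :=
    h.clm_apply contDiffOn_const
  exact ((h1 _).add ((h1 _).const_smul κ)).const_smul (1 / 2 : ℂ)

theorem ContDiff.wirt {κ : ℂ} {j : Fin n} {f : BodySpace n → M} (hf : ContDiff ℝ ∞ f) :
    ContDiff ℝ ∞ (wirt κ j f) := by
  rw [← contDiffOn_univ] at hf ⊢
  exact hf.wirt isOpen_univ

theorem ContDiffOn.differentiableAt_of_isOpen {U : Set (BodySpace n)} (hU : IsOpen U)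
    {f : BodySpace n → M} (hf : ContDiffOn ℝ ∞ f U) {z : BodySpace n} (hz : z ∈ U) :
    DifferentiableAt ℝ f z :=
  (hf.differentiableOn (by simp)).differentiableAt (hU.mem_nhds hz)

/-- Both operators are combinations with constant coefficients of real directional derivatives, so
the symmetry of the second derivative suffices. -/
theorem wirt_comm {U : Set (BodySpace n)} (hU : IsOpen U) {κ κ' : ℂ} {i j : Fin n}
    {f : BodySpace n → M} (hf : ContDiffOn ℝ ∞ f U) {z : BodySpace n} (hz : z ∈ U) :
    wirt κ i (wirt κ' j f) z = wirt κ' j (wirt κ i f) z := by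
  have h : ContDiffOn ℝ ∞ (fderiv ℝ f) U := hf.fderiv_of_isOpen hU (by simp)
  have hd : DifferentiableAt ℝ (fderiv ℝ f) z :=
    (h.differentiableOn (by simp)).differentiableAt (hU.mem_nhds hz)
  have h1 (v w : BodySpace n) : fderiv ℝ (fun y => fderiv ℝ f y v) z w
      = fderiv ℝ (fderiv ℝ f) z w v := by
    rw [fderiv_clm_apply hd (differentiableAt_const v)]
    simp
  have h2 (v : BodySpace n) : DifferentiableAt ℝ (fun y => fderiv ℝ f y v) z :=
    hd.clm_apply (differentiableAt_const v)
  have key (μ : ℂ) (l : Fin n) (w : BodySpace n) : fderiv ℝ (wirt μ l f) z w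
      = (1 / 2 : ℂ) • (fderiv ℝ (fderiv ℝ f) z w (Pi.single l 1)
        + μ • fderiv ℝ (fderiv ℝ f) z w (Pi.single l Complex.I)) := by
    unfold wirt
    rw [fderiv_fun_const_smul ((h2 _).fun_add ((h2 _).fun_const_smul μ)),
      fderiv_fun_add (h2 _) ((h2 _).fun_const_smul μ), fderiv_fun_const_smul (h2 _)]
    simp only [add_apply, smul_apply, h1]
  have hs : IsSymmSndFDerivAt ℝ f z :=
    (hf.contDiffAt (hU.mem_nhds hz)).isSymmSndFDerivAt
      (by simpa using (WithTop.coe_le_coe.2 (le_top : (2 : ℕ∞) ≤ ⊤)))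
  rw [_root_.wirt.eq_def (f := wirt κ' j f), _root_.wirt.eq_def (f := wirt κ i f),
    key, key, key, key, hs.eq (Pi.single i 1), hs.eq (Pi.single i Complex.I),
    hs.eq (Pi.single i 1), hs.eq (Pi.single i Complex.I)]
  simp only [smul_add, smul_smul]
  rw [mul_comm κ, mul_comm κ']
  ring_nf
  abel

theorem fderiv_eq_sum_wirt (f : BodySpace n → M) (z v : BodySpace n) :
    fderiv ℝ f z v = ∑ j, (v j • wirt (-Complex.I) j f z
      + (starRingEnd ℂ (v j)) • wirt Complex.I j f z) := by
  have hv : v = ∑ j, ((v j).re • (Pi.single j 1 : BodySpace n)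
      + (v j).im • (Pi.single j Complex.I : BodySpace n)) := by
    conv_lhs => rw [← Finset.univ_sum_single v]
    refine Finset.sum_congr rfl fun j _ => ?_
    rw [← Pi.single_smul, ← Pi.single_smul, ← Pi.single_add]
    congr 1
    rw [Complex.real_smul, Complex.real_smul, mul_one, Complex.re_add_im]
  conv_lhs => rw [hv]
  rw [map_sum]
  refine Finset.sum_congr rfl fun j _ => ?_
  simp only [map_add, map_smul, wirt]
  set a := fderiv ℝ f z (Pi.single j 1)
  set c := fderiv ℝ f z (Pi.single j Complex.I)
  simp only [← Complex.coe_smul, smul_add, smul_smul]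
  have h1 := Complex.re_eq_add_conj (v j)
  have h2 := Complex.im_eq_sub_conj (v j)
  rw [h1, h2]
  -- The real and imaginary parts are written in terms of `v j` and its conjugate; their
  -- coefficients are those of the two Wirtinger operators.
  have e1 : ((v j + starRingEnd ℂ (v j)) / 2) = v j * (1 / 2) + starRingEnd ℂ (v j) * (1 / 2) := by
    ring
  have e2 : ((v j - starRingEnd ℂ (v j)) / (2 * Complex.I))
      = v j * (1 / 2 * -Complex.I) + starRingEnd ℂ (v j) * (1 / 2 * Complex.I) := by
    field_simp
    rw [Complex.I_sq]
    ring
  rw [e1, e2, add_smul, add_smul]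
  abel

open MeasureTheory in
-- Integration by parts against the constant function `1`.
theorem integral_fderiv_eq_zero {f : BodySpace n → M} (hf : ContDiff ℝ ∞ f)
    (hc : HasCompactSupport f) (v : BodySpace n) : ∫ z, fderiv ℝ f z v = 0 := by
  have hd : Continuous fun z => fderiv ℝ f z v :=
    (hf.continuous_fderiv (by simp)).clm_apply continuous_const
  have hdc : HasCompactSupport fun z => fderiv ℝ f z v := hc.fderiv_apply ℝ v
  have h := integral_smul_fderiv_eq_neg_fderiv_smul_of_integrable (μ := (volume : Measure (BodySpace n)))
    (f := fun _ : BodySpace n => (1 : ℝ)) (g := f) (v := v) (𝕜 := ℝ)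
    (by simp) (by simpa using hd.integrable_of_hasCompactSupport hdc)
    (by simpa using hf.continuous.integrable_of_hasCompactSupport hc)
    (fun x _ => differentiableAt_const _) (fun x _ => (hf.differentiable (by simp)) x)
  simpa using h

theorem integral_wirt_eq_zero {κ : ℂ} {j : Fin n} {f : BodySpace n → M} (hf : ContDiff ℝ ∞ f)
    (hc : HasCompactSupport f) : ∫ z, wirt κ j f z = 0 := by
  have hi (v : BodySpace n) : MeasureTheory.Integrable fun z => fderiv ℝ f z v :=
    ((hf.continuous_fderiv (by simp)).clm_apply continuous_const).integrable_of_hasCompactSupport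
      (hc.fderiv_apply ℝ v)
  unfold wirt
  rw [MeasureTheory.integral_smul, MeasureTheory.integral_add (hi _) ((hi _).fun_smul κ),
    MeasureTheory.integral_smul, integral_fderiv_eq_zero hf hc, integral_fderiv_eq_zero hf hc]
  simp

end Wirtinger

/-! ### Taylor evaluation along nilpotent directions -/

section SoulTaylor

variable {n : ℕ} {A M : Type*} [NormedCommRing A] [NormedAlgebra ℂ A]
  [NormedAddCommGroup M] [NormedSpace ℂ M] [Module A M] [IsBoundedSMul A M] [IsScalarTower ℂ A M]

attribute [local instance] isScalarTower_real

theorem smulCommClass_complex (A M : Type*) [NormedCommRing A] [NormedAlgebra ℂ A]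
    [NormedAddCommGroup M] [NormedSpace ℂ M] [Module A M] [IsScalarTower ℂ A M] :
    SMulCommClass ℂ A M :=
  ⟨fun c a m => by
    rw [← smul_assoc, ← algebraMap_smul A c m, smul_smul, mul_comm, ← Algebra.smul_def]⟩

attribute [local instance] smulCommClass_complex

/-- The derivation `∑_j (s_j ∂/∂z_j + s'_j ∂/∂z̄_j)`. -/
noncomputable def soulDer (s s' : Fin n → A) (f : BodySpace n → M) (z : BodySpace n) : M :=
  ∑ j, (s j • wirt (-Complex.I) j f z + s' j • wirt Complex.I j f z)

/-- The Taylor expansion `∑_{k < N} (s ∂ + s' ∂̄)^k f (p) / k!`. -/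
noncomputable def taylorEval (s s' : Fin n → A) (N : ℕ) (p : BodySpace n) (f : BodySpace n → M) :
    M :=
  ∑ k ∈ Finset.range N, (k.factorial : ℂ)⁻¹ • (soulDer s s')^[k] f p

variable (s s' : Fin n → A) {U : Set (BodySpace n)}

theorem ContDiffOn.soulDer (hU : IsOpen U) {f : BodySpace n → M} (hf : ContDiffOn ℝ ∞ f U) :
    ContDiffOn ℝ ∞ (soulDer s s' f) U := by
  unfold _root_.soulDer
  refine ContDiffOn.sum fun j _ => ?_
  exact (contDiffOn_const.smul (hf.wirt hU)).add (contDiffOn_const.smul (hf.wirt hU))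

theorem ContDiffOn.iterate_soulDer (hU : IsOpen U) {f : BodySpace n → M}
    (hf : ContDiffOn ℝ ∞ f U) (k : ℕ) : ContDiffOn ℝ ∞ ((_root_.soulDer s s')^[k] f) U := by
  induction k with
  | zero => exact hf
  | succ k ih =>
    rw [Function.iterate_succ_apply']
    exact ih.soulDer s s' hU

theorem soulDer_congr (hU : IsOpen U) {f g : BodySpace n → M} (h : Set.EqOn f g U) :
    Set.EqOn (soulDer s s' f) (soulDer s s' g) U := by
  intro z hz
  have : f =ᶠ[𝓝 z] g := h.eventuallyEq_of_mem (hU.mem_nhds hz)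
  simp only [soulDer, wirt_congr this]

theorem iterate_soulDer_congr (hU : IsOpen U) {f g : BodySpace n → M} (h : Set.EqOn f g U)
    (k : ℕ) : Set.EqOn ((soulDer s s')^[k] f) ((soulDer s s')^[k] g) U := by
  induction k with
  | zero => exact h
  | succ k ih =>
    rw [Function.iterate_succ_apply', Function.iterate_succ_apply']
    exact soulDer_congr s s' hU ih

theorem taylorEval_congr (hU : IsOpen U) {f g : BodySpace n → M} (h : Set.EqOn f g U) (N : ℕ)
    {p : BodySpace n} (hp : p ∈ U) : taylorEval s s' N p f = taylorEval s s' N p g := by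
  refine Finset.sum_congr rfl fun k _ => ?_
  rw [iterate_soulDer_congr s s' hU h k hp]

theorem soulDer_sum (hU : IsOpen U) {ι : Type*} (t : Finset ι) {f : ι → BodySpace n → M}
    (hf : ∀ i ∈ t, ContDiffOn ℝ ∞ (f i) U) {z : BodySpace n} (hz : z ∈ U) :
    soulDer s s' (fun w => ∑ i ∈ t, f i w) z = ∑ i ∈ t, soulDer s s' (f i) z := by
  have hd : ∀ i ∈ t, DifferentiableAt ℝ (f i) z := fun i hi =>
    (hf i hi).differentiableAt_of_isOpen hU hz
  unfold soulDer
  rw [Finset.sum_comm]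
  refine Finset.sum_congr rfl fun j _ => ?_
  rw [wirt_sum t hd, wirt_sum t hd, Finset.smul_sum, Finset.smul_sum, Finset.sum_add_distrib]

theorem iterate_soulDer_sum (hU : IsOpen U) {ι : Type*} (t : Finset ι) {f : ι → BodySpace n → M}
    (hf : ∀ i ∈ t, ContDiffOn ℝ ∞ (f i) U) (k : ℕ) {z : BodySpace n} (hz : z ∈ U) :
    (soulDer s s')^[k] (fun w => ∑ i ∈ t, f i w) z = ∑ i ∈ t, (soulDer s s')^[k] (f i) z := by
  induction k generalizing z with
  | zero => rfl
  | succ k ih =>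
    simp only [Function.iterate_succ_apply']
    rw [soulDer_congr s s' hU (fun w hw => ih hw) hz]
    exact soulDer_sum s s' hU t (fun i hi => (hf i hi).iterate_soulDer s s' hU k) hz

theorem taylorEval_sum (hU : IsOpen U) {ι : Type*} (t : Finset ι) {f : ι → BodySpace n → M}
    (hf : ∀ i ∈ t, ContDiffOn ℝ ∞ (f i) U) (N : ℕ) {p : BodySpace n} (hp : p ∈ U) :
    taylorEval s s' N p (fun w => ∑ i ∈ t, f i w) = ∑ i ∈ t, taylorEval s s' N p (f i) := by
  unfold taylorEval
  rw [Finset.sum_comm]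
  refine Finset.sum_congr rfl fun k _ => ?_
  rw [iterate_soulDer_sum s s' hU t hf k hp, Finset.smul_sum]

theorem taylorEval_add (hU : IsOpen U) {f g : BodySpace n → M} (hf : ContDiffOn ℝ ∞ f U)
    (hg : ContDiffOn ℝ ∞ g U) (N : ℕ) {p : BodySpace n} (hp : p ∈ U) :
    taylorEval s s' N p (fun w => f w + g w) = taylorEval s s' N p f + taylorEval s s' N p g := by
  have := taylorEval_sum s s' hU (Finset.univ : Finset Bool) (f := fun i => cond i f g)
    (by rintro (_ | _) _ <;> assumption) N hp
  simpa using this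

theorem soulDer_const (m : M) : soulDer s s' (fun _ : BodySpace n => m) = fun _ => 0 := by
  funext z
  simp [soulDer, wirt_const]

theorem iterate_soulDer_const (m : M) (k : ℕ) :
    (soulDer s s')^[k + 1] (fun _ : BodySpace n => m) = fun _ => 0 := by
  induction k with
  | zero => exact soulDer_const s s' m
  | succ k ih => rw [Function.iterate_succ_apply', ih, soulDer_const]

theorem taylorEval_const (m : M) {N : ℕ} (hN : 0 < N) (p : BodySpace n) :
    taylorEval s s' N p (fun _ => m) = m := by
  obtain ⟨N, rfl⟩ : ∃ k, N = k + 1 := ⟨N - 1, by omega⟩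
  rw [taylorEval, Finset.sum_range_succ']
  simp [iterate_soulDer_const]

theorem soulDer_smul (hU : IsOpen U) {a : BodySpace n → A} {f : BodySpace n → M}
    (ha : ContDiffOn ℝ ∞ a U) (hf : ContDiffOn ℝ ∞ f U) {z : BodySpace n} (hz : z ∈ U) :
    soulDer s s' (fun w => a w • f w) z = soulDer s s' a z • f z + a z • soulDer s s' f z := by
  have ha' := ha.differentiableAt_of_isOpen hU hz
  have hf' := hf.differentiableAt_of_isOpen hU hz
  unfold soulDer
  rw [Finset.sum_smul, Finset.smul_sum, ← Finset.sum_add_distrib]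
  refine Finset.sum_congr rfl fun j _ => ?_
  rw [wirt_smul ha' hf', wirt_smul ha' hf']
  simp only [smul_add, add_smul, smul_smul, smul_eq_mul, mul_comm (a z)]
  abel

theorem iterate_soulDer_smul (hU : IsOpen U) {a : BodySpace n → A} {f : BodySpace n → M}
    (ha : ContDiffOn ℝ ∞ a U) (hf : ContDiffOn ℝ ∞ f U) (k : ℕ) {z : BodySpace n} (hz : z ∈ U) :
    (soulDer s s')^[k] (fun w => a w • f w) z = ∑ ij ∈ Finset.HasAntidiagonal.antidiagonal k,
      k.choose ij.1 • ((soulDer s s')^[ij.1] a z • (soulDer s s')^[ij.2] f z) := by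
  induction k generalizing z with
  | zero => simp
  | succ k ih =>
    -- Pascal's rule: the sum for `k + 1` splits into two sums over the antidiagonal of `k`,
    -- according to the factor that receives the new derivative.
    rw [Finset.sum_antidiagonal_choose_succ_nsmul
      (fun i j => (soulDer s s')^[i] a z • (soulDer s s')^[j] f z), Function.iterate_succ_apply',
      soulDer_congr s s' hU (fun w hw => ih hw) hz, soulDer_sum s s' hU _ _ hz,
      ← Finset.sum_add_distrib]
    · refine Finset.sum_congr rfl fun ij hij => ?_
      have h1 := ha.iterate_soulDer s s' hU ij.1
      have h2 := hf.iterate_soulDer s s' hU ij.2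
      have h3 : soulDer s s' (fun w => k.choose ij.1 •
          ((soulDer s s')^[ij.1] a w • (soulDer s s')^[ij.2] f w)) z = k.choose ij.1 •
          soulDer s s' (fun w => (soulDer s s')^[ij.1] a w • (soulDer s s')^[ij.2] f w) z := by
        have := soulDer_sum s s' hU (Finset.range (k.choose ij.1)) (f := fun _ w =>
          (soulDer s s')^[ij.1] a w • (soulDer s s')^[ij.2] f w) (fun _ _ => h1.smul h2) hz
        simpa only [Finset.sum_const, Finset.card_range] using this
      rw [h3, soulDer_smul s s' hU h1 h2 hz, Function.iterate_succ_apply', Function.iterate_succ_apply', smul_add, add_comm,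
        Nat.choose_symm_of_eq_add (Finset.HasAntidiagonal.mem_antidiagonal.1 hij).symm]
    · intro ij _
      exact ((ha.iterate_soulDer s s' hU ij.1).smul (hf.iterate_soulDer s s' hU ij.2)).const_smul _

variable {s s'} {I : Ideal A}

/-- A subspace of a finite-dimensional space is cut out by linear functionals, and a functional that
vanishes on `f` throughout `U` also vanishes on its derivatives. -/
theorem wirt_mem [FiniteDimensional ℂ M] (hU : IsOpen U) (W : Submodule A M) {f : BodySpace n → M}
    (hf : ContDiffOn ℝ ∞ f U) (h : ∀ z ∈ U, f z ∈ W) (κ : ℂ) (j : Fin n) {z : BodySpace n}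
    (hz : z ∈ U) : wirt κ j f z ∈ W := by
  by_contra hne
  have hne' : wirt κ j f z ∉ W.restrictScalars ℂ := hne
  obtain ⟨l, hl, hle⟩ := Submodule.exists_le_ker_of_notMem hne'
  have h1 := wirt_clm (κ := κ) (j := j) (LinearMap.toContinuousLinearMap l)
    (hf.differentiableAt_of_isOpen hU hz)
  rw [wirt_eq_zero] at h1
  · exact hl h1.symm
  · filter_upwards [hU.mem_nhds hz] with w hw
    exact hle (h w hw)

/-- Differentiation keeps the values in `I ^ k • ⊤`, and each application of the derivation
multiplies by an `s j` or `s' j` in `I`. -/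
theorem iterate_soulDer_mem [FiniteDimensional ℂ M] (hU : IsOpen U) (hs : ∀ j, s j ∈ I)
    (hs' : ∀ j, s' j ∈ I) {f : BodySpace n → M} (hf : ContDiffOn ℝ ∞ f U) (k : ℕ)
    {z : BodySpace n} (hz : z ∈ U) :
    (soulDer s s')^[k] f z ∈ I ^ k • (⊤ : Submodule A M) := by
  induction k generalizing z with
  | zero => simp
  | succ k ih =>
    have hk := hf.iterate_soulDer s s' hU k
    rw [Function.iterate_succ_apply', pow_succ', mul_smul]
    refine Submodule.sum_mem _ fun j _ => Submodule.add_mem _ ?_ ?_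
    · exact Submodule.smul_mem_smul (hs j) (wirt_mem hU _ hk (fun w hw => ih hw) _ _ hz)
    · exact Submodule.smul_mem_smul (hs' j) (wirt_mem hU _ hk (fun w hw => ih hw) _ _ hz)

/-- The formal exponential of a derivation is multiplicative, and cutting the series at `N` does no
harm because `I ^ N = ⊥` kills every product of total order at least `N`. This is what makes
evaluation at a superpoint a ring homomorphism. -/
theorem taylorEval_smul [FiniteDimensional ℂ M] [FiniteDimensional ℂ A] (hU : IsOpen U)
    (hs : ∀ j, s j ∈ I) (hs' : ∀ j, s' j ∈ I) {N : ℕ} (hI : I ^ N = ⊥) {a : BodySpace n → A}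
    {f : BodySpace n → M} (ha : ContDiffOn ℝ ∞ a U) (hf : ContDiffOn ℝ ∞ f U) {p : BodySpace n}
    (hp : p ∈ U) : taylorEval s s' N p (fun w => a w • f w)
      = taylorEval s s' N p a • taylorEval s s' N p f := by
  have hzero (i j : ℕ) (hij : N ≤ i + j) :
      (soulDer s s')^[i] a p • (soulDer s s')^[j] f p = 0 := by
    have h1 := iterate_soulDer_mem hU hs hs' ha i hp
    have h2 := iterate_soulDer_mem hU hs hs' hf j hp
    rw [smul_eq_mul, Ideal.mul_top] at h1
    have h3 := Submodule.smul_mem_smul h1 h2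
    rw [← mul_smul, ← pow_add] at h3
    have h4 : I ^ (i + j) = ⊥ := le_bot_iff.1 (hI ▸ Ideal.pow_le_pow_right hij)
    rw [h4] at h3
    simpa using h3
  unfold taylorEval
  have h1 (k : ℕ) : (k.factorial : ℂ)⁻¹ • (soulDer s s')^[k] (fun w => a w • f w) p
      = ∑ ij ∈ Finset.HasAntidiagonal.antidiagonal k, ((ij.1.factorial : ℂ)⁻¹ • (soulDer s s')^[ij.1] a p) •
        ((ij.2.factorial : ℂ)⁻¹ • (soulDer s s')^[ij.2] f p) := by
    rw [iterate_soulDer_smul s s' hU ha hf k hp, Finset.smul_sum]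
    refine Finset.sum_congr rfl fun ij hij => ?_
    rw [smul_assoc, smul_comm _ ((ij.2.factorial : ℂ)⁻¹), smul_smul, ← Nat.cast_smul_eq_nsmul ℂ,
      smul_smul]
    congr 1
    rw [← Finset.HasAntidiagonal.mem_antidiagonal.1 hij]
    have := Nat.add_choose_mul_factorial_mul_factorial ij.1 ij.2
    have h2 : ((ij.1 + ij.2).factorial : ℂ) ≠ 0 := by exact_mod_cast Nat.factorial_ne_zero _
    have h3 : (ij.1.factorial : ℂ) ≠ 0 := by exact_mod_cast Nat.factorial_ne_zero _
    have h4 : (ij.2.factorial : ℂ) ≠ 0 := by exact_mod_cast Nat.factorial_ne_zero _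
    field_simp
    rw [← this, Nat.choose_symm_add]
    push_cast
    ring
  simp only [h1]
  rw [Finset.sum_smul_sum, ← Finset.sum_product', Finset.sum_sigma']
  symm
  -- The product of two truncated series is a sum over a square; the terms beyond its antidiagonal
  -- vanish by `hzero`, and the remaining triangle is the truncated series of the product.
  have h2 : ∑ x ∈ Finset.range N ×ˢ Finset.range N, ((x.1.factorial : ℂ)⁻¹ •
      (soulDer s s')^[x.1] a p) • ((x.2.factorial : ℂ)⁻¹ • (soulDer s s')^[x.2] f p)
      = ∑ x ∈ (Finset.range N ×ˢ Finset.range N).filter (fun x => x.1 + x.2 < N),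
        ((x.1.factorial : ℂ)⁻¹ • (soulDer s s')^[x.1] a p) •
        ((x.2.factorial : ℂ)⁻¹ • (soulDer s s')^[x.2] f p) := by
    symm
    refine Finset.sum_filter_of_ne fun x _ hx => ?_
    by_contra hlt
    refine hx ?_
    rw [smul_assoc, smul_comm _ ((x.2.factorial : ℂ)⁻¹), hzero _ _ (not_lt.1 hlt)]
    simp
  rw [h2]
  refine Finset.sum_bij' (fun x _ => ⟨x.1 + x.2, x⟩) (fun x _ => x.2) ?_ ?_ ?_ ?_ ?_
  · intro x hx
    simp only [Finset.mem_filter, Finset.mem_sigma, Finset.mem_range, Finset.HasAntidiagonal.mem_antidiagonal] at hx ⊢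
    exact ⟨hx.2, trivial⟩
  · rintro ⟨k, x⟩ hx
    simp only [Finset.mem_filter, Finset.mem_sigma, Finset.mem_range, Finset.HasAntidiagonal.mem_antidiagonal,
      Finset.mem_product] at hx ⊢
    omega
  · intro x _; rfl
  · rintro ⟨k, x⟩ hx
    simp only [Finset.mem_sigma, Finset.HasAntidiagonal.mem_antidiagonal] at hx
    obtain ⟨_, rfl⟩ := hx
    rfl
  · intro x _; rfl

theorem taylorEval_mul [FiniteDimensional ℂ A] (hU : IsOpen U)
    (hs : ∀ j, s j ∈ I) (hs' : ∀ j, s' j ∈ I) {N : ℕ} (hI : I ^ N = ⊥) {a f : BodySpace n → A}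
    (ha : ContDiffOn ℝ ∞ a U) (hf : ContDiffOn ℝ ∞ f U) {p : BodySpace n} (hp : p ∈ U) :
    taylorEval s s' N p (fun w => a w * f w)
      = taylorEval s s' N p a * taylorEval s s' N p f :=
  taylorEval_smul (M := A) hU hs hs' hI ha hf hp

/-- Each term of positive order carries a factor in `I`. When `I` is the kernel of the body map,
evaluation therefore does not change the body. -/
theorem taylorEval_sub_mem [FiniteDimensional ℂ A] (hU : IsOpen U)
    (hs : ∀ j, s j ∈ I) (hs' : ∀ j, s' j ∈ I) {N : ℕ} (hN : 0 < N) {f : BodySpace n → A}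
    (hf : ContDiffOn ℝ ∞ f U) {p : BodySpace n} (hp : p ∈ U) :
    taylorEval s s' N p f - f p ∈ I := by
  obtain ⟨N, rfl⟩ : ∃ k, N = k + 1 := ⟨N - 1, by omega⟩
  rw [taylorEval, Finset.sum_range_succ']
  simp only [Function.iterate_zero, id, Nat.factorial_zero, Nat.cast_one, inv_one, one_smul,
    add_sub_cancel_right]
  refine Ideal.sum_mem _ fun k _ => ?_
  have h1 := iterate_soulDer_mem hU hs hs' hf (k + 1) hp
  rw [smul_eq_mul, Ideal.mul_top] at h1
  rw [Algebra.smul_def]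
  exact Ideal.mul_mem_left _ _ (Ideal.pow_le_self (by omega) h1)

end SoulTaylor

/-! ### The kernel exp(-S/t): bounds and integration by parts -/

section Kernel

variable {n : ℕ} {A M : Type*} [NormedCommRing A] [NormedAlgebra ℂ A] [CompleteSpace A]
  [NormedAddCommGroup M] [NormedSpace ℂ M] [Module A M] [IsBoundedSMul A M] [IsScalarTower ℂ A M]

attribute [local instance] isScalarTower_real smulCommClass_complex

theorem norm_pow_le_norm_one_mul (x : A) (k : ℕ) : ‖x ^ k‖ ≤ ‖(1 : A)‖ * ‖x‖ ^ k := by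
  induction k with
  | zero => simp
  | succ k ih =>
    rw [pow_succ, pow_succ]
    calc ‖x ^ k * x‖ ≤ ‖x ^ k‖ * ‖x‖ := norm_mul_le _ _
      _ ≤ ‖(1 : A)‖ * ‖x‖ ^ k * ‖x‖ := by gcongr
      _ = _ := by ring

theorem exp_eq_sum_of_pow_eq_zero {x : A} {N : ℕ} (hx : x ^ N = 0) :
    NormedSpace.exp x = ∑ k ∈ Finset.range N, (k.factorial : ℂ)⁻¹ • x ^ k := by
  rw [NormedSpace.exp_eq_tsum ℂ]
  refine tsum_eq_sum fun k hk => ?_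
  rw [pow_eq_zero_of_le (by simpa using hk) hx, smul_zero]

/-- Split `a` into its body and a nilpotent remainder. The body contributes the scalar exponential,
and the exponential series of the remainder is a polynomial in `t⁻¹` of degree less than `N`. -/
theorem norm_exp_neg_inv_smul_le (b : A →ₐ[ℂ] ℂ) {N : ℕ} (hb : RingHom.ker b ^ N = ⊥)
    (hbc : Continuous b) (R : ℝ) : ∃ C : ℝ, 0 ≤ C ∧ ∀ a : A, ‖a‖ ≤ R → ∀ t : ℝ, 0 < t → t ≤ 1 →
      ‖NormedSpace.exp (-(t⁻¹ • a))‖ ≤ C * t⁻¹ ^ N * Real.exp (-(t⁻¹ * (b a).re)) := by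
  obtain ⟨c, hc0, hc⟩ : ∃ c : ℝ, 0 ≤ c ∧ ∀ a, ‖b a‖ ≤ c * ‖a‖ := by
    let B : A →L[ℂ] ℂ := ⟨b.toLinearMap, hbc⟩
    exact ⟨‖B‖, norm_nonneg _, fun a => B.le_opNorm a⟩
  -- The base of the power bounds the norm of `a` minus its body when `‖a‖ ≤ R`. The factors `‖1‖`
  -- appear because the norm is not assumed to be normalized, and `|R|` because `R` may be negative.
  refine ⟨‖(1 : A)‖ * ∑ k ∈ Finset.range N, ‖(1 : A)‖ * (|R| + c * |R| * ‖(1 : A)‖) ^ k,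
    by positivity, ?_⟩
  intro a ha t ht0 ht1
  set x : A := a - algebraMap ℂ A (b a) with hx
  have hxI : x ∈ RingHom.ker b := by
    rw [RingHom.mem_ker, hx, map_sub, AlgHom.commutes]
    simp
  have hxN : x ^ N = 0 := by
    have := Ideal.pow_mem_pow hxI N
    rwa [hb, Ideal.mem_bot] at this
  have ha' : ‖a‖ ≤ |R| := ha.trans (le_abs_self R)
  have hxn : ‖x‖ ≤ |R| + c * |R| * ‖(1 : A)‖ := by
    refine (norm_sub_le _ _).trans ?_
    rw [norm_algebraMap]
    have := hc a
    gcongr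
    exact this.trans (by gcongr)
  have e1 : -(t⁻¹ • a) = algebraMap ℂ A (-(t⁻¹ * b a)) + -(t⁻¹ • x) := by
    rw [hx, smul_sub, map_neg, map_mul, ← Complex.coe_smul t⁻¹ a, ← Complex.coe_smul t⁻¹ (algebraMap ℂ A _),
      Algebra.smul_def, Algebra.smul_def]
    push_cast
    ring
  have hy : (-(t⁻¹ • x)) ^ N = 0 := by
    rw [neg_pow, smul_pow, hxN, smul_zero, mul_zero]
  let _ : NormedAlgebra ℚ A := NormedAlgebra.restrictScalars ℚ ℂ A
  rw [e1, NormedSpace.exp_add, ← NormedSpace.algebraMap_exp_comm, exp_eq_sum_of_pow_eq_zero hy]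
  have hti : 1 ≤ t⁻¹ := (one_le_inv₀ ht0).2 ht1
  have h2 : ‖∑ k ∈ Finset.range N, (k.factorial : ℂ)⁻¹ • (-(t⁻¹ • x)) ^ k‖
      ≤ t⁻¹ ^ N * ∑ k ∈ Finset.range N, ‖(1 : A)‖ * (|R| + c * |R| * ‖(1 : A)‖) ^ k := by
    refine (norm_sum_le _ _).trans ?_
    rw [Finset.mul_sum]
    refine Finset.sum_le_sum fun k hk => ?_
    rw [norm_smul]
    have h3 : ‖((k.factorial : ℂ)⁻¹)‖ ≤ 1 := by
      rw [norm_inv, Complex.norm_natCast]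
      exact inv_le_one_of_one_le₀ (by exact_mod_cast Nat.one_le_iff_ne_zero.2 (Nat.factorial_ne_zero k))
    have h4 : ‖(-(t⁻¹ • x)) ^ k‖ ≤ t⁻¹ ^ N * (‖(1 : A)‖ * (|R| + c * |R| * ‖(1 : A)‖) ^ k) := by
      refine (norm_pow_le_norm_one_mul _ k).trans ?_
      rw [norm_neg, norm_smul, mul_pow, Real.norm_of_nonneg (by positivity)]
      have : t⁻¹ ^ k ≤ t⁻¹ ^ N := pow_le_pow_right₀ hti (Finset.mem_range.1 hk).le
      calc ‖(1 : A)‖ * (t⁻¹ ^ k * ‖x‖ ^ k) = t⁻¹ ^ k * (‖(1 : A)‖ * ‖x‖ ^ k) := by ring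
        _ ≤ _ := by gcongr
    calc _ ≤ 1 * _ := mul_le_mul h3 h4 (norm_nonneg _) zero_le_one
      _ = _ := one_mul _
  refine (norm_mul_le _ _).trans ?_
  rw [norm_algebraMap, ← Complex.exp_eq_exp_ℂ, Complex.norm_exp]
  have h5 : (-((t⁻¹ : ℝ) * b a) : ℂ).re = -(t⁻¹ * (b a).re) := by
    rw [Complex.neg_re, Complex.re_ofReal_mul]
  rw [h5]
  calc Real.exp (-(t⁻¹ * (b a).re)) * ‖(1 : A)‖ * _ ≤ Real.exp (-(t⁻¹ * (b a).re)) * ‖(1 : A)‖ *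
        (t⁻¹ ^ N * ∑ k ∈ Finset.range N, ‖(1 : A)‖ * (|R| + c * |R| * ‖(1 : A)‖) ^ k) := by gcongr
    _ = _ := by ring

theorem ContDiff.differentiableAt_infty {F : Type*} [NormedAddCommGroup F] [NormedSpace ℝ F]
    {g : BodySpace n → F} (hg : ContDiff ℝ ∞ g) (z : BodySpace n) : DifferentiableAt ℝ g z :=
  (hg.differentiable (by simp)) z

theorem ContDiff.normedSpace_exp {E : Type*} [NormedAddCommGroup E] [NormedSpace ℝ E] {f : E → A}
    {k : WithTop ℕ∞} (hf : ContDiff ℝ k f) : ContDiff ℝ k fun z => NormedSpace.exp (f z) := by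
  have h : ContDiff ℝ k (NormedSpace.exp : A → A) := by
    rw [contDiff_iff_contDiffAt]
    exact fun x => (NormedSpace.exp_analytic (𝕂 := ℝ) x).contDiffAt
  exact h.comp hf

/-- The localized oscillation-free integral `t⁻ⁿ ∫ χ exp(-S/t) f`. -/
noncomputable def localInt (χ : BodySpace n → ℂ) (S : BodySpace n → A) (t : ℝ)
    (f : BodySpace n → M) : M :=
  t⁻¹ ^ n • ∫ z, χ z • (NormedSpace.exp (-(t⁻¹ • S z)) • f z)

variable {χ : BodySpace n → ℂ} {S : BodySpace n → A} {f g : BodySpace n → M}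

theorem contDiff_kernel (hS : ContDiff ℝ ∞ S) (t : ℝ) :
    ContDiff ℝ ∞ fun z => NormedSpace.exp (-(t⁻¹ • S z)) :=
  ((hS.const_smul t⁻¹).neg).normedSpace_exp

theorem contDiff_localInt_integrand (hχ : ContDiff ℝ ∞ χ) (hS : ContDiff ℝ ∞ S)
    (hf : ContDiff ℝ ∞ f) (t : ℝ) :
    ContDiff ℝ ∞ fun z => χ z • (NormedSpace.exp (-(t⁻¹ • S z)) • f z) :=
  hχ.smul ((contDiff_kernel hS t).smul hf)

theorem integrable_localInt (hχ : ContDiff ℝ ∞ χ) (hc : HasCompactSupport χ) (hS : ContDiff ℝ ∞ S)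
    (hf : ContDiff ℝ ∞ f) (t : ℝ) :
    MeasureTheory.Integrable fun z => χ z • (NormedSpace.exp (-(t⁻¹ • S z)) • f z) :=
  (contDiff_localInt_integrand hχ hS hf t).continuous.integrable_of_hasCompactSupport
    hc.smul_right

theorem localInt_sum {ι : Type*} (T : Finset ι) {f : ι → BodySpace n → M} (hχ : ContDiff ℝ ∞ χ)
    (hc : HasCompactSupport χ) (hS : ContDiff ℝ ∞ S) (hf : ∀ i ∈ T, ContDiff ℝ ∞ (f i)) (t : ℝ) :
    localInt χ S t (fun z => ∑ i ∈ T, f i z) = ∑ i ∈ T, localInt χ S t (f i) := by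
  unfold localInt
  rw [← Finset.smul_sum, ← MeasureTheory.integral_finsetSum]
  · simp only [Finset.smul_sum]
  · exact fun i hi => integrable_localInt hχ hc hS (hf i hi) t

theorem localInt_add (hχ : ContDiff ℝ ∞ χ) (hc : HasCompactSupport χ) (hS : ContDiff ℝ ∞ S)
    (hf : ContDiff ℝ ∞ f) (hg : ContDiff ℝ ∞ g) (t : ℝ) :
    localInt χ S t (fun z => f z + g z) = localInt χ S t f + localInt χ S t g := by
  unfold localInt
  rw [← smul_add, ← MeasureTheory.integral_add (integrable_localInt hχ hc hS hf t)
    (integrable_localInt hχ hc hS hg t)]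
  simp only [smul_add]

theorem localInt_congr (h : ∀ z ∈ tsupport χ, f z = g z) (t : ℝ) :
    localInt χ S t f = localInt χ S t g := by
  unfold localInt
  congr 2
  funext z
  by_cases hz : z ∈ tsupport χ
  · rw [h z hz]
  · rw [image_eq_zero_of_notMem_tsupport hz, zero_smul, zero_smul]

theorem localInt_const_smul [FiniteDimensional ℂ M] (a : A) (hχ : ContDiff ℝ ∞ χ)
    (hc : HasCompactSupport χ) (hS : ContDiff ℝ ∞ S) (hf : ContDiff ℝ ∞ f) (t : ℝ) :
    localInt χ S t (fun z => a • f z) = a • localInt χ S t f := by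
  have : CompleteSpace M := FiniteDimensional.complete ℂ M
  let L : M →L[ℝ] M := ⟨⟨⟨fun m => a • m, smul_add a⟩, fun r m => smul_comm a r m⟩,
    continuous_const_smul a⟩
  unfold localInt
  have h := L.integral_comp_comm (integrable_localInt hχ hc hS hf t)
  rw [smul_comm a (t⁻¹ ^ n)]
  congr 1
  refine Eq.trans ?_ h
  congr 1
  funext z
  change _ = a • (χ z • (NormedSpace.exp (-(t⁻¹ • S z)) • f z))
  rw [smul_comm a (χ z), smul_comm a (NormedSpace.exp (-(t⁻¹ • S z)))]

theorem localInt_smul_const [FiniteDimensional ℂ M] [FiniteDimensional ℂ A] (m : M)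
    (hχ : ContDiff ℝ ∞ χ) (hc : HasCompactSupport χ) (hS : ContDiff ℝ ∞ S)
    {f : BodySpace n → A} (hf : ContDiff ℝ ∞ f) (t : ℝ) :
    localInt χ S t (fun z => f z • m) = localInt χ S t f • m := by
  have : CompleteSpace M := FiniteDimensional.complete ℂ M
  let L : A →L[ℝ] M := ⟨⟨⟨fun a => a • m, fun a c => add_smul a c m⟩, fun r a => smul_assoc r a m⟩,
    continuous_id.smul continuous_const⟩
  unfold localInt
  have h := L.integral_comp_comm (integrable_localInt hχ hc hS hf t)
  rw [smul_assoc]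
  congr 1
  refine Eq.trans ?_ h
  congr 1
  funext z
  change _ = (χ z • (NormedSpace.exp (-(t⁻¹ • S z)) • f z)) • m
  rw [smul_assoc, smul_assoc]

open MeasureTheory in
-- The nilpotent part of the phase costs a factor `t⁻¹ ^ N`. With `c = 0` this is the crude
-- polynomial bound from which the induction in `norm_localInt_sub_le` starts; with `c > 0` it is
-- exponential decay.
theorem norm_localInt_le [FiniteDimensional ℂ A] (b : A →ₐ[ℂ] ℂ) {N : ℕ}
    (hb : RingHom.ker b ^ N = ⊥) (hχ : ContDiff ℝ ∞ χ) (hc : HasCompactSupport χ)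
    (hS : ContDiff ℝ ∞ S) (hf : ContDiff ℝ ∞ f) (c : ℝ)
    (hpos : ∀ z ∈ tsupport χ, c ≤ (b (S z)).re) :
    ∃ C : ℝ, 0 ≤ C ∧ ∀ t : ℝ, 0 < t → t ≤ 1 →
      ‖localInt χ S t f‖ ≤ C * t⁻¹ ^ (n + N) * Real.exp (-(t⁻¹ * c)) := by
  obtain ⟨R, hR⟩ := hc.isCompact.exists_bound_of_continuousOn hS.continuous.continuousOn
  have hbc : Continuous b := b.toLinearMap.continuous_of_finiteDimensional
  obtain ⟨C, hC0, hC⟩ := norm_exp_neg_inv_smul_le b hb hbc R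
  have hi : Integrable fun z => ‖χ z • f z‖ :=
    ((hχ.continuous.smul hf.continuous).integrable_of_hasCompactSupport hc.smul_right).norm
  refine ⟨C * ∫ z, ‖χ z • f z‖, mul_nonneg hC0 (integral_nonneg fun z => norm_nonneg _), ?_⟩
  intro t ht0 ht1
  unfold localInt
  rw [norm_smul, Real.norm_of_nonneg (by positivity)]
  have h1 : ‖∫ z, χ z • (NormedSpace.exp (-(t⁻¹ • S z)) • f z)‖
      ≤ ∫ z, C * t⁻¹ ^ N * Real.exp (-(t⁻¹ * c)) * ‖χ z • f z‖ := by
    refine norm_integral_le_of_norm_le (hi.const_mul _) (Filter.Eventually.of_forall fun z => ?_)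
    by_cases hz : z ∈ tsupport χ
    · rw [smul_comm]
      refine (norm_smul_le _ _).trans ?_
      gcongr
      refine (hC _ (hR z hz) t ht0 ht1).trans ?_
      have := hpos z hz
      gcongr
    · rw [image_eq_zero_of_notMem_tsupport hz]
      simp
  rw [integral_const_mul] at h1
  calc _ ≤ t⁻¹ ^ n * _ := mul_le_mul_of_nonneg_left h1 (by positivity)
    _ = _ := by rw [pow_add]; ring

/-- This is `x ^ j / j! ≤ exp x` for `x = c / t` and `j = k + m`. -/
theorem exists_inv_pow_mul_exp_le {c : ℝ} (hc : 0 < c) (k m : ℕ) : ∃ C : ℝ, 0 ≤ C ∧ ∀ t : ℝ, 0 < t →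
    t⁻¹ ^ k * Real.exp (-(t⁻¹ * c)) ≤ C * t ^ m := by
  refine ⟨(k + m).factorial / c ^ (k + m), by positivity, fun t ht => ?_⟩
  have h := Real.pow_div_factorial_le_exp (t⁻¹ * c) (by positivity) (k + m)
  rw [Real.exp_neg, ← div_eq_mul_inv, div_le_iff₀ (Real.exp_pos _)]
  calc t⁻¹ ^ k = ((k + m).factorial / c ^ (k + m)) * t ^ m *
        ((t⁻¹ * c) ^ (k + m) / (k + m).factorial) := by
        have : ((k + m).factorial : ℝ) ≠ 0 := by positivity
        have h1 : t⁻¹ ^ m * t ^ m = 1 := by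
          rw [← mul_pow, inv_mul_cancel₀ ht.ne', one_pow]
        rw [mul_pow, pow_add t⁻¹]
        field_simp
        rw [one_div, mul_comm, h1]
    _ ≤ _ := by gcongr

theorem norm_localInt_le_pow [FiniteDimensional ℂ A] (b : A →ₐ[ℂ] ℂ) {N : ℕ}
    (hb : RingHom.ker b ^ N = ⊥) (hχ : ContDiff ℝ ∞ χ) (hc : HasCompactSupport χ)
    (hS : ContDiff ℝ ∞ S) (hf : ContDiff ℝ ∞ f) {c : ℝ} (hc0 : 0 < c)
    (hpos : ∀ z ∈ tsupport χ, c ≤ (b (S z)).re) (m : ℕ) :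
    ∃ C : ℝ, 0 ≤ C ∧ ∀ t : ℝ, 0 < t → t ≤ 1 → ‖localInt χ S t f‖ ≤ C * t ^ m := by
  obtain ⟨C, hC0, hC⟩ := norm_localInt_le b hb hχ hc hS hf c hpos
  obtain ⟨C', hC'0, hC'⟩ := exists_inv_pow_mul_exp_le hc0 (n + N) m
  refine ⟨C * C', by positivity, fun t ht0 ht1 => (hC t ht0 ht1).trans ?_⟩
  rw [mul_assoc, mul_assoc]
  exact mul_le_mul_of_nonneg_left (hC' t ht0) hC0

theorem HasCompactSupport.wirt (hc : HasCompactSupport χ) (κ : ℂ) (j : Fin n) :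
    HasCompactSupport (wirt κ j χ) := by
  refine hc.mono' ?_
  intro z hz
  by_contra hne
  refine hz (wirt_eq_zero ?_)
  exact notMem_tsupport_iff_eventuallyEq.1 hne

theorem tsupport_wirt_subset (χ : BodySpace n → ℂ) (κ : ℂ) (j : Fin n) :
    tsupport (wirt κ j χ) ⊆ tsupport χ := by
  refine closure_minimal ?_ (isClosed_tsupport χ)
  intro z hz
  by_contra hne
  exact hz (wirt_eq_zero (notMem_tsupport_iff_eventuallyEq.1 hne))

open MeasureTheory in
/-- Integration by parts along `∑_j X_j ∂_j` against the kernel `exp(-S/t)`. -/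
theorem localInt_smul_eq (hχ : ContDiff ℝ ∞ χ) (hc : HasCompactSupport χ)
    (hS : ContDiff ℝ ∞ S) (hf : ContDiff ℝ ∞ f) {κ : ℂ} {X : Fin n → BodySpace n → A}
    {T : BodySpace n → A} (hX : ∀ j, ContDiff ℝ ∞ (X j))
    (h : ∀ z ∈ tsupport χ, ∑ j, X j z * wirt κ j S z = T z) {t : ℝ} (ht : 0 < t) :
    localInt χ S t (fun z => T z • f z)
      = t • (localInt χ S t (fun z => ∑ j, wirt κ j (fun w => X j w • f w) z)
        + ∑ j, localInt (wirt κ j χ) S t (fun z => X j z • f z)) := by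
  have hXf (j : Fin n) : ContDiff ℝ ∞ fun w => X j w • f w := (hX j).smul hf
  have hK := contDiff_kernel hS t
  have hKX (j : Fin n) : ContDiff ℝ ∞
      fun w => NormedSpace.exp (-(t⁻¹ • S w)) • (X j w • f w) := hK.smul (hXf j)
  have hXS (j : Fin n) : ContDiff ℝ ∞ fun w => (X j w * wirt κ j S w) • f w :=
    ((hX j).mul (hS.wirt (κ := κ) (j := j))).smul hf
  -- The cutoff makes the product compactly supported, so the integral of its total derivative
  -- vanishes.
  have hzero (j : Fin n) : ∫ z, wirt κ j
      (fun w => χ w • (NormedSpace.exp (-(t⁻¹ • S w)) • (X j w • f w))) z = 0 :=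
    integral_wirt_eq_zero (contDiff_localInt_integrand hχ hS (hXf j) t) hc.smul_right
  have hwK (j : Fin n) (z : BodySpace n) : wirt κ j (fun w => NormedSpace.exp (-(t⁻¹ • S w))) z
      = NormedSpace.exp (-(t⁻¹ • S z)) * -(t⁻¹ • wirt κ j S z) := by
    rw [wirt_exp (ContDiff.differentiableAt_infty ((hS.const_smul t⁻¹).neg) z)]
    have e : (fun w => -(t⁻¹ • S w)) = fun w => (-((t⁻¹ : ℝ) : ℂ)) • S w := by
      funext w
      rw [neg_smul, Complex.coe_smul]
    have := wirt_clm (κ := κ) (j := j) ((-((t⁻¹ : ℝ) : ℂ)) • ContinuousLinearMap.id ℂ A) (ContDiff.differentiableAt_infty hS z)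
    rw [e]
    simp only [smul_apply, ContinuousLinearMap.id_apply] at this
    rw [this, neg_smul, Complex.coe_smul]
  -- The product rule gives three terms: the derivative falls on the cutoff, on the amplitude, or on
  -- the kernel. The last one produces `-t⁻¹ X_j ∂_j S`.
  have hexp (j : Fin n) (z : BodySpace n) : wirt κ j
      (fun w => χ w • (NormedSpace.exp (-(t⁻¹ • S w)) • (X j w • f w))) z
      = wirt κ j χ z • (NormedSpace.exp (-(t⁻¹ • S z)) • (X j z • f z))
        + χ z • (NormedSpace.exp (-(t⁻¹ • S z)) • wirt κ j (fun w => X j w • f w) z)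
        - t⁻¹ • (χ z • (NormedSpace.exp (-(t⁻¹ • S z)) • ((X j z * wirt κ j S z) • f z))) := by
    rw [wirt_smul (ContDiff.differentiableAt_infty hχ z) (ContDiff.differentiableAt_infty (hKX j) z), wirt_smul (ContDiff.differentiableAt_infty hK z) (ContDiff.differentiableAt_infty (hXf j) z), hwK,
      smul_add, mul_neg, neg_smul, smul_neg, mul_smul_comm, smul_assoc, smul_comm (χ z) t⁻¹,
      mul_smul (NormedSpace.exp _) (wirt κ j S z), smul_smul (wirt κ j S z),
      mul_comm (wirt κ j S z)]
    abel
  have hi1 (j : Fin n) := integrable_localInt (hχ.wirt (κ := κ) (j := j)) (hc.wirt κ j) hS (hXf j) t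
  have hi2 (j : Fin n) := integrable_localInt hχ hc hS ((hXf j).wirt (κ := κ) (j := j)) t
  have hi3 (j : Fin n) := integrable_localInt hχ hc hS (hXS j) t
  -- Solving for the term from the kernel; multiplication by `t` then yields the gain of one power.
  have hj (j : Fin n) : t⁻¹ • localInt χ S t (fun z => (X j z * wirt κ j S z) • f z)
      = localInt (wirt κ j χ) S t (fun z => X j z • f z)
        + localInt χ S t (fun z => wirt κ j (fun w => X j w • f w) z) := by
    have h0 := hzero j
    simp only [hexp] at h0
    rw [integral_sub ((hi1 j).fun_add (hi2 j)) ((hi3 j).fun_smul t⁻¹), integral_add (hi1 j) (hi2 j),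
      integral_smul, sub_eq_zero] at h0
    unfold localInt
    rw [smul_comm, ← smul_add, h0]
  have e1 : localInt χ S t (fun z => T z • f z)
      = ∑ j, localInt χ S t (fun z => (X j z * wirt κ j S z) • f z) := by
    rw [← localInt_sum _ hχ hc hS
      (fun j _ => hXS j)]
    refine localInt_congr (fun z hz => ?_) t
    rw [← h z hz, Finset.sum_smul]
  rw [e1, localInt_sum _ hχ hc hS (fun j _ => (hXf j).wirt), ← Finset.sum_add_distrib,
    Finset.smul_sum]
  refine Finset.sum_congr rfl fun j _ => ?_
  rw [add_comm, ← hj j, smul_smul, mul_inv_cancel₀ ht.ne', one_smul]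

end Kernel

/-! ### Derivatives of determinants and the Piola identity -/

section Determinant

variable {A : Type*} [NormedCommRing A] [NormedAlgebra ℂ A] {n : ℕ}

theorem det_updateRow_eq_sum_adjugate (B : Matrix (Fin n) (Fin n) A) (i : Fin n) (v : Fin n → A) :
    (B.updateRow i v).det = ∑ l, B.adjugate l i * v l := by
  rw [← Matrix.cramer_transpose_apply, Matrix.cramer_eq_adjugate_mulVec,
    ← Matrix.adjugate_transpose]
  rfl

/-- Jacobi's formula: the determinant is multilinear in the rows, so its derivative replaces one row
at a time, and Cramer's rule expresses the outcome through the adjugate. -/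
theorem hasFDerivAt_det {E : Type*} [NormedAddCommGroup E] [NormedSpace ℝ E]
    {J : E → Matrix (Fin n) (Fin n) A} {J' : Fin n → Fin n → E →L[ℝ] A} {z : E}
    (h : ∀ i l, HasFDerivAt (fun w => J w i l) (J' i l) z) :
    HasFDerivAt (fun w => (J w).det) (∑ i, ∑ l, (J z).adjugate l i • J' i l) z := by
  let D : ContinuousMultilinearMap ℝ (fun _ : Fin n => Fin n → A) A :=
    { (Matrix.detRowAlternating (n := Fin n) (R := A)).toMultilinearMap.restrictScalars ℝ with
      cont := by
        change Continuous fun v : Fin n → Fin n → A => Matrix.det (Matrix.of v)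
        exact Continuous.matrix_det continuous_id }
  have h1 : HasFDerivAt (fun w i l => J w i l)
      (ContinuousLinearMap.pi fun i => ContinuousLinearMap.pi fun l => J' i l) z :=
    hasFDerivAt_pi.2 fun i => hasFDerivAt_pi.2 fun l => h i l
  have h2 := (D.hasFDerivAt (fun i l => J z i l)).comp z h1
  refine h2.congr_fderiv ?_
  ext v
  simp only [ContinuousLinearMap.comp_apply, ContinuousMultilinearMap.linearDeriv_apply, sum_apply,
    smul_apply, ContinuousLinearMap.coe_pi']
  refine Finset.sum_congr rfl fun i _ => ?_
  exact det_updateRow_eq_sum_adjugate (J z) i fun l => J' i l v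

theorem wirt_det {κ : ℂ} {j : Fin n} {J : BodySpace n → Matrix (Fin n) (Fin n) A}
    {z : BodySpace n} (h : ∀ i l, DifferentiableAt ℝ (fun w => J w i l) z) :
    wirt κ j (fun w => (J w).det) z
      = ∑ i, ∑ l, (J z).adjugate l i * wirt κ j (fun w => J w i l) z := by
  have h1 := (hasFDerivAt_det fun i l => (h i l).hasFDerivAt).fderiv
  unfold wirt
  rw [h1]
  simp only [sum_apply, smul_apply, Finset.smul_sum, ← Finset.sum_add_distrib, smul_add,
    mul_add, smul_eq_mul, mul_smul_comm]

theorem hasDerivAt_det {J : ℝ → Matrix (Fin n) (Fin n) A} {J' : Matrix (Fin n) (Fin n) A} {s : ℝ}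
    (h : ∀ i l, HasDerivAt (fun w => J w i l) (J' i l) s) :
    HasDerivAt (fun w => (J w).det) (∑ i, ∑ l, (J s).adjugate l i * J' i l) s := by
  have h1 := hasFDerivAt_det fun i l => (h i l).hasFDerivAt
  have h2 := h1.hasDerivAt
  simpa using h2

theorem ContDiff.matrix_det {E : Type*} [NormedAddCommGroup E] [NormedSpace ℝ E]
    {J : E → Matrix (Fin n) (Fin n) A} {k : WithTop ℕ∞} (h : ∀ i l, ContDiff ℝ k fun w => J w i l) :
    ContDiff ℝ k fun w => (J w).det := by
  simp only [Matrix.det_apply]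
  refine ContDiff.sum fun σ _ => ?_
  have : ContDiff ℝ k fun w => ∏ i, J w (σ i) i := contDiff_prod fun i _ => h _ _
  rcases Int.units_eq_one_or (Equiv.Perm.sign σ) with h1 | h1
  · simpa [h1] using this
  · simpa [h1] using this.neg

theorem ContDiff.matrix_adjugate {E : Type*} [NormedAddCommGroup E] [NormedSpace ℝ E]
    {J : E → Matrix (Fin n) (Fin n) A} {k : WithTop ℕ∞} (h : ∀ i l, ContDiff ℝ k fun w => J w i l)
    (i j : Fin n) : ContDiff ℝ k fun w => (J w).adjugate i j := by
  simp only [Matrix.adjugate_apply]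
  refine ContDiff.matrix_det fun a l => ?_
  by_cases ha : a = j
  · subst ha
    simp only [Matrix.updateRow_self]
    exact contDiff_const
  · simpa only [Matrix.updateRow_ne ha] using h a l

theorem det_updateRow_updateRow_swap (B : Matrix (Fin n) (Fin n) A) {i k : Fin n} (hik : k ≠ i)
    (v w : Fin n → A) : ((B.updateRow i v).updateRow k w).det
      = -((B.updateRow i w).updateRow k v).det := by
  have h : (B.updateRow i v).updateRow k w
      = ((B.updateRow i w).updateRow k v).submatrix (Equiv.swap i k) id := by
    ext a l
    simp only [Matrix.submatrix_apply, id]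
    by_cases h1 : a = k
    · subst h1
      rw [Equiv.swap_apply_right, Matrix.updateRow_self, Matrix.updateRow_ne hik.symm,
        Matrix.updateRow_self]
    · by_cases h2 : a = i
      · subst h2
        rw [Equiv.swap_apply_left, Matrix.updateRow_self, Matrix.updateRow_ne h1,
          Matrix.updateRow_self]
      · rw [Equiv.swap_apply_of_ne_of_ne h2 h1, Matrix.updateRow_ne h1, Matrix.updateRow_ne h2,
          Matrix.updateRow_ne h1, Matrix.updateRow_ne h2]
  rw [h, Matrix.det_permute, Equiv.Perm.sign_swap hik.symm]
  simp

/-- The matrix of Wirtinger derivatives of a map. -/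
noncomputable def wirtJacobian (κ : ℂ) (G : Fin n → BodySpace n → A) (z : BodySpace n) :
    Matrix (Fin n) (Fin n) A :=
  Matrix.of fun i j => wirt κ j (G i) z

theorem contDiff_wirtJacobian {κ : ℂ} {G : Fin n → BodySpace n → A} (hG : ∀ i, ContDiff ℝ ∞ (G i))
    (i j : Fin n) : ContDiff ℝ ∞ fun z => wirtJacobian κ G z i j :=
  (hG i).wirt

/-- The Piola identity: the cofactor matrix of a Jacobian is divergence free. -/
theorem sum_wirt_adjugate_eq_zero {κ : ℂ} {G : Fin n → BodySpace n → A}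
    (hG : ∀ i, ContDiff ℝ ∞ (G i)) (i : Fin n) (z : BodySpace n) :
    ∑ j, wirt κ j (fun w => (wirtJacobian κ G w).adjugate j i) z = 0 := by
  -- A cofactor is the determinant with row `i` replaced by a basis vector. Differentiating the row
  -- `k = i` gives nothing because that row is now constant.
  have h1 (j : Fin n) : wirt κ j (fun w => (wirtJacobian κ G w).adjugate j i) z
      = ∑ k, ∑ l, if k = i then 0 else
        (((wirtJacobian κ G z).updateRow i (Pi.single j 1)).updateRow k (Pi.single l 1)).det *
          wirt κ j (wirt κ l (G k)) z := by
    simp only [Matrix.adjugate_apply]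
    have hd (a l : Fin n) : DifferentiableAt ℝ
        (fun w => (wirtJacobian κ G w).updateRow i (Pi.single j 1) a l) z := by
      by_cases ha : a = i
      · subst ha
        simp only [Matrix.updateRow_self]
        exact differentiableAt_const _
      · simp only [Matrix.updateRow_ne ha]
        exact ContDiff.differentiableAt_infty (contDiff_wirtJacobian hG a l) z
    rw [wirt_det hd]
    refine Finset.sum_congr rfl fun k _ => Finset.sum_congr rfl fun l _ => ?_
    split_ifs with hk
    · subst hk
      simp only [Matrix.updateRow_self]
      rw [wirt_const, mul_zero]
    · simp only [Matrix.updateRow_ne hk, Matrix.adjugate_apply]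
      rfl
  simp only [h1]
  have hzero (x : A) (hx : x = -x) : x = 0 := by
    have h2 : (2 : ℂ) • x = 0 := by
      rw [two_smul]
      nth_rewrite 1 [hx]
      exact neg_add_cancel x
    exact (smul_eq_zero_iff_right two_ne_zero).1 h2
  rw [Finset.sum_comm]
  refine Finset.sum_eq_zero fun k _ => ?_
  by_cases hk : k = i
  · simp [hk]
  simp only [hk, if_false]
  -- For fixed `k` the double sum over `j` and `l` pairs a determinant antisymmetric in `(j, l)`
  -- with a second derivative symmetric in `(j, l)`; it equals its own negative.
  apply hzero
  conv_lhs => rw [Finset.sum_comm]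
  rw [← Finset.sum_neg_distrib]
  refine Finset.sum_congr rfl fun j _ => ?_
  rw [← Finset.sum_neg_distrib]
  refine Finset.sum_congr rfl fun l _ => ?_
  rw [det_updateRow_updateRow_swap _ hk, neg_mul,
    wirt_comm isOpen_univ (hG k).contDiffOn (Set.mem_univ z)]

end Determinant

/-! ### Variation of the phase as a divergence -/

section Homotopy

variable {n : ℕ} {A : Type*} [NormedCommRing A] [NormedAlgebra ℂ A]

attribute [local instance] isScalarTower_real smulCommClass_complex

/-- The vector field `adj(∂G) ν`, along which integration by parts is used. -/
noncomputable def cofactorField (κ : ℂ) (G ν : Fin n → BodySpace n → A) (j : Fin n)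
    (z : BodySpace n) : A :=
  ∑ i, (wirtJacobian κ G z).adjugate j i * ν i z

theorem contDiff_cofactorField {κ : ℂ} {G ν : Fin n → BodySpace n → A}
    (hG : ∀ i, ContDiff ℝ ∞ (G i)) (hν : ∀ i, ContDiff ℝ ∞ (ν i)) (j : Fin n) :
    ContDiff ℝ ∞ (cofactorField κ G ν j) :=
  ContDiff.sum fun i _ => (ContDiff.matrix_adjugate (contDiff_wirtJacobian hG) j i).mul (hν i)

/-- The derivatives that fall on the cofactors cancel by the Piola identity. What remains is the
derivative of `det ∂G` in the direction `ν`. -/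
theorem sum_wirt_cofactorField {κ : ℂ} {G ν : Fin n → BodySpace n → A}
    (hG : ∀ i, ContDiff ℝ ∞ (G i)) (hν : ∀ i, ContDiff ℝ ∞ (ν i)) (z : BodySpace n) :
    ∑ j, wirt κ j (cofactorField κ G ν j) z
      = ∑ i, ∑ l, (wirtJacobian κ G z).adjugate l i * wirtJacobian κ ν z i l := by
  have ha (j i : Fin n) : ContDiff ℝ ∞ fun w => (wirtJacobian κ G w).adjugate j i :=
    ContDiff.matrix_adjugate (contDiff_wirtJacobian hG) j i
  have h1 (j : Fin n) : wirt κ j (cofactorField κ G ν j) z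
      = ∑ i, (wirt κ j (fun w => (wirtJacobian κ G w).adjugate j i) z * ν i z
        + (wirtJacobian κ G z).adjugate j i * wirt κ j (ν i) z) := by
    unfold cofactorField
    rw [wirt_sum]
    · refine Finset.sum_congr rfl fun i _ => ?_
      rw [wirt_mul (ContDiff.differentiableAt_infty (ha j i) z)
        (ContDiff.differentiableAt_infty (hν i) z)]
    · exact fun i _ => ContDiff.differentiableAt_infty ((ha j i).mul (hν i)) z
  simp only [h1]
  rw [Finset.sum_comm]
  refine Finset.sum_congr rfl fun i _ => ?_
  rw [Finset.sum_add_distrib, ← Finset.sum_mul, sum_wirt_adjugate_eq_zero hG, zero_mul, zero_add]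
  rfl

/-- Since `H` is annihilated by the operators at `z`, the gradient of the phase is `∂G` applied to
`H`, and a matrix times its adjugate is the determinant. -/
theorem sum_cofactorField_mul {κ : ℂ} {G ν H : Fin n → BodySpace n → A}
    (hG : ∀ i, ContDiff ℝ ∞ (G i)) (hH : ∀ i, ContDiff ℝ ∞ (H i)) {z : BodySpace n}
    (hz : ∀ i j, wirt κ j (H i) z = 0) :
    ∑ j, cofactorField κ G ν j z * wirt κ j (fun w => ∑ i, G i w * H i w) z
      = (∑ i, ν i z * H i z) * (wirtJacobian κ G z).det := by
  have h1 (j : Fin n) : wirt κ j (fun w => ∑ i, G i w * H i w) z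
      = ∑ k, wirtJacobian κ G z k j * H k z := by
    rw [wirt_sum]
    · refine Finset.sum_congr rfl fun k _ => ?_
      rw [wirt_mul (ContDiff.differentiableAt_infty (hG k) z)
        (ContDiff.differentiableAt_infty (hH k) z), hz, mul_zero, add_zero]
      rfl
    · exact fun k _ => ContDiff.differentiableAt_infty ((hG k).mul (hH k)) z
  have h2 (k i : Fin n) : ∑ j, wirtJacobian κ G z k j * (wirtJacobian κ G z).adjugate j i
      = if k = i then (wirtJacobian κ G z).det else 0 := by
    have := congrFun (congrFun (Matrix.mul_adjugate (wirtJacobian κ G z)) k) i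
    rw [Matrix.mul_apply] at this
    rw [this, Matrix.smul_apply, Matrix.one_apply, smul_eq_mul, mul_ite, mul_one, mul_zero]
  simp only [h1, cofactorField, Finset.sum_mul_sum]
  calc ∑ j, ∑ i, ∑ k, (wirtJacobian κ G z).adjugate j i * ν i z * (wirtJacobian κ G z k j * H k z)
      = ∑ i, ∑ k, (∑ j, wirtJacobian κ G z k j * (wirtJacobian κ G z).adjugate j i)
          * (ν i z * H k z) := by
        rw [Finset.sum_comm]
        refine Finset.sum_congr rfl fun i _ => ?_
        rw [Finset.sum_comm]
        refine Finset.sum_congr rfl fun k _ => ?_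
        rw [Finset.sum_mul]
        refine Finset.sum_congr rfl fun j _ => ?_
        ring
    _ = _ := by
        rw [Finset.sum_mul]
        refine Finset.sum_congr rfl fun i _ => ?_
        simp only [h2, ite_mul, zero_mul, Finset.sum_ite_eq', Finset.mem_univ, if_true]
        ring

/-- The amplitude on the left, multiplied by the kernel, is the derivative of `exp(-S/t) det(∂G) D`
when `G` moves in the direction `ν`. By the two preceding lemmas it is a divergence, so only terms
with a derivative of the cutoff are left. -/
theorem localInt_cofactorField [CompleteSpace A] {χ : BodySpace n → ℂ} (hχ : ContDiff ℝ ∞ χ)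
    (hc : HasCompactSupport χ) {κ : ℂ} {G ν H : Fin n → BodySpace n → A} {D : BodySpace n → A}
    (hG : ∀ i, ContDiff ℝ ∞ (G i)) (hν : ∀ i, ContDiff ℝ ∞ (ν i)) (hH : ∀ i, ContDiff ℝ ∞ (H i))
    (hD : ContDiff ℝ ∞ D) (hz : ∀ z ∈ tsupport χ, ∀ i j, wirt κ j (H i) z = 0)
    (hzD : ∀ z ∈ tsupport χ, ∀ j, wirt κ j D z = 0) {t : ℝ} (ht : 0 < t) :
    localInt χ (fun w => ∑ i, G i w * H i w) t (fun z =>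
        ((∑ i, ∑ l, (wirtJacobian κ G z).adjugate l i * wirtJacobian κ ν z i l) * D z)
        - t⁻¹ • ((∑ i, ν i z * H i z) * ((wirtJacobian κ G z).det * D z)))
      = -∑ j, localInt (wirt κ j χ) (fun w => ∑ i, G i w * H i w) t
          (fun z => cofactorField κ G ν j z * D z) := by
  have hS : ContDiff ℝ ∞ fun w => ∑ i, G i w * H i w :=
    ContDiff.sum fun i _ => (hG i).mul (hH i)
  have hX (j : Fin n) := contDiff_cofactorField (κ := κ) hG hν j
  have hdet : ContDiff ℝ ∞ fun z => (wirtJacobian κ G z).det :=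
    ContDiff.matrix_det (contDiff_wirtJacobian hG)
  have hT : ContDiff ℝ ∞ fun z => (∑ i, ν i z * H i z) * (wirtJacobian κ G z).det :=
    (ContDiff.sum fun i _ => (hν i).mul (hH i)).mul hdet
  have hTD : ContDiff ℝ ∞ fun z =>
      ((∑ i, ν i z * H i z) * (wirtJacobian κ G z).det) * D z := hT.mul hD
  have hW : ContDiff ℝ ∞ fun z =>
      (∑ i, ∑ l, (wirtJacobian κ G z).adjugate l i * wirtJacobian κ ν z i l) * D z :=
    (ContDiff.sum fun i _ => ContDiff.sum fun l _ =>
      (ContDiff.matrix_adjugate (contDiff_wirtJacobian hG) l i).mul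
        (contDiff_wirtJacobian hν i l)).mul hD
  have h := localInt_smul_eq (M := A) hχ hc hS hD (X := cofactorField κ G ν) (κ := κ) hX
    (fun z hzs => sum_cofactorField_mul hG hH (hz z hzs)) ht
  have h1 : localInt χ (fun w => ∑ i, G i w * H i w) t
      (fun z => ∑ j, wirt κ j (fun w => cofactorField κ G ν j w • D w) z)
      = localInt χ (fun w => ∑ i, G i w * H i w) t (fun z =>
        (∑ i, ∑ l, (wirtJacobian κ G z).adjugate l i * wirtJacobian κ ν z i l) * D z) := by
    refine localInt_congr (fun z hzs => ?_) t
    rw [← sum_wirt_cofactorField hG hν, Finset.sum_mul]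
    refine Finset.sum_congr rfl fun j _ => ?_
    rw [wirt_smul (M := A) (ContDiff.differentiableAt_infty (hX j) z)
      (ContDiff.differentiableAt_infty hD z), hzD z hzs]
    simp
  rw [h1] at h
  have h2 : (fun z =>
        ((∑ i, ∑ l, (wirtJacobian κ G z).adjugate l i * wirtJacobian κ ν z i l) * D z)
        - t⁻¹ • ((∑ i, ν i z * H i z) * ((wirtJacobian κ G z).det * D z)))
      = fun z => (∑ i, ∑ l, (wirtJacobian κ G z).adjugate l i * wirtJacobian κ ν z i l) * D z
        + (algebraMap ℂ A (-((t⁻¹ : ℝ) : ℂ))) •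
          (((∑ i, ν i z * H i z) * (wirtJacobian κ G z).det) * D z) := by
    funext z
    rw [algebraMap_smul, neg_smul, Complex.coe_smul, mul_assoc, sub_eq_add_neg]
  have hTc : ContDiff ℝ ∞ fun z => (algebraMap ℂ A (-((t⁻¹ : ℝ) : ℂ))) •
          (((∑ i, ν i z * H i z) * (wirtJacobian κ G z).det) * D z) :=
    (contDiff_const (c := algebraMap ℂ A (-((t⁻¹ : ℝ) : ℂ)))).mul hTD
  rw [h2, localInt_add hχ hc hS hW hTc]
  have h3 : localInt χ (fun w => ∑ i, G i w * H i w) t (fun z =>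
      (algebraMap ℂ A (-((t⁻¹ : ℝ) : ℂ))) •
          (((∑ i, ν i z * H i z) * (wirtJacobian κ G z).det) * D z))
      = -(t⁻¹ • localInt χ (fun w => ∑ i, G i w * H i w) t
        (fun z => ((∑ i, ν i z * H i z) * (wirtJacobian κ G z).det) • D z)) := by
    unfold localInt
    rw [smul_comm t⁻¹, ← smul_neg]
    congr 1
    rw [← MeasureTheory.integral_smul, ← MeasureTheory.integral_neg]
    congr 1
    funext z
    beta_reduce
    rw [algebraMap_smul, neg_smul, smul_neg, smul_neg, Complex.coe_smul,
      smul_comm _ t⁻¹, smul_comm _ t⁻¹]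
    rfl
  rw [h3, h, smul_smul, inv_mul_cancel₀ ht.ne', one_smul]
  simp only [smul_eq_mul]
  abel

end Homotopy

/-! ### Invariance of the integral along a segment of phases -/

section Homotopy

variable {n : ℕ} {A M : Type*} [NormedCommRing A] [NormedAlgebra ℂ A] [CompleteSpace A]
  [NormedAddCommGroup M] [NormedSpace ℂ M] [Module A M] [IsBoundedSMul A M] [IsScalarTower ℂ A M]

attribute [local instance] isScalarTower_real smulCommClass_complex

open MeasureTheory in
-- The constant depends on the phase and the amplitude only through `R`, `F` and `c`; this gives
-- estimates uniform in the parameter of the segment.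
theorem norm_localInt_le_of_bounds [FiniteDimensional ℂ A] (b : A →ₐ[ℂ] ℂ) {N : ℕ}
    (hb : RingHom.ker b ^ N = ⊥) {χ : BodySpace n → ℂ} (hχ : ContDiff ℝ ∞ χ)
    (hc : HasCompactSupport χ) (R F : ℝ) {c : ℝ} (hc0 : 0 < c) (m : ℕ) :
    ∃ C : ℝ, 0 ≤ C ∧ ∀ (S : BodySpace n → A) (f : BodySpace n → M),
      (∀ z ∈ tsupport χ, ‖S z‖ ≤ R) → (∀ z ∈ tsupport χ, ‖f z‖ ≤ F) →
      (∀ z ∈ tsupport χ, c ≤ (b (S z)).re) → ∀ t : ℝ, 0 < t → t ≤ 1 →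
      ‖localInt χ S t f‖ ≤ C * t ^ m := by
  have hbc : Continuous b := b.toLinearMap.continuous_of_finiteDimensional
  obtain ⟨C, hC0, hC⟩ := norm_exp_neg_inv_smul_le b hb hbc R
  obtain ⟨C', hC'0, hC'⟩ := exists_inv_pow_mul_exp_le hc0 (n + N) m
  have hi : Integrable fun z => ‖χ z‖ := (hχ.continuous.integrable_of_hasCompactSupport hc).norm
  have hI0 : 0 ≤ ∫ z, ‖χ z‖ := integral_nonneg fun z => norm_nonneg _
  refine ⟨C * |F| * (∫ z, ‖χ z‖) * C', by positivity, ?_⟩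
  intro S f hS hf hpos t ht0 ht1
  unfold localInt
  rw [norm_smul, Real.norm_of_nonneg (by positivity)]
  have h1 : ‖∫ z, χ z • (NormedSpace.exp (-(t⁻¹ • S z)) • f z)‖
      ≤ ∫ z, (C * t⁻¹ ^ N * Real.exp (-(t⁻¹ * c)) * |F|) * ‖χ z‖ := by
    refine norm_integral_le_of_norm_le (hi.const_mul _) (Filter.Eventually.of_forall fun z => ?_)
    by_cases hz : z ∈ tsupport χ
    · rw [norm_smul, mul_comm]
      gcongr
      refine (norm_smul_le _ _).trans ?_
      have h2 := hpos z hz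
      have h3 := (hf z hz).trans (le_abs_self F)
      gcongr
      refine (hC _ (hS z hz) t ht0 ht1).trans ?_
      gcongr
    · rw [image_eq_zero_of_notMem_tsupport hz]
      simp
  rw [integral_const_mul] at h1
  calc _ ≤ t⁻¹ ^ n * _ := mul_le_mul_of_nonneg_left h1 (by positivity)
    _ = C * |F| * (∫ z, ‖χ z‖) * (t⁻¹ ^ (n + N) * Real.exp (-(t⁻¹ * c))) := by rw [pow_add]; ring
    _ ≤ C * |F| * (∫ z, ‖χ z‖) * (C' * t ^ m) := by
        exact mul_le_mul_of_nonneg_left (hC' t ht0) (by positivity)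
    _ = _ := by ring

open MeasureTheory in
theorem hasDerivAt_localInt {χ : BodySpace n → ℂ} (hχ : Continuous χ) (hc : HasCompactSupport χ)
    {S S' : ℝ → BodySpace n → A} {f f' : ℝ → BodySpace n → M}
    (hS : Continuous fun q : ℝ × BodySpace n => S q.1 q.2)
    (hS' : Continuous fun q : ℝ × BodySpace n => S' q.1 q.2)
    (hf : Continuous fun q : ℝ × BodySpace n => f q.1 q.2)
    (hf' : Continuous fun q : ℝ × BodySpace n => f' q.1 q.2)
    (hdS : ∀ s z, HasDerivAt (fun r => S r z) (S' s z) s)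
    (hdf : ∀ s z, HasDerivAt (fun r => f r z) (f' s z) s) (t s : ℝ) :
    HasDerivAt (fun r => localInt χ (S r) t (f r))
      (localInt χ (S s) t fun z => f' s z - t⁻¹ • (S' s z • f s z)) s := by
  have hexp : Continuous (NormedSpace.exp : A → A) := by
    refine continuous_iff_continuousAt.2 fun x => ?_
    exact (NormedSpace.exp_analytic (𝕂 := ℂ) x).continuousAt
  have hK : Continuous fun q : ℝ × BodySpace n => NormedSpace.exp (-(t⁻¹ • S q.1 q.2)) :=
    hexp.comp (hS.const_smul t⁻¹).neg
  have hF : Continuous fun q : ℝ × BodySpace n =>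
      χ q.2 • (NormedSpace.exp (-(t⁻¹ • S q.1 q.2)) • f q.1 q.2) :=
    (hχ.comp continuous_snd).smul (hK.smul hf)
  have hF' : Continuous fun q : ℝ × BodySpace n => χ q.2 •
      (NormedSpace.exp (-(t⁻¹ • S q.1 q.2)) • (f' q.1 q.2 - t⁻¹ • (S' q.1 q.2 • f q.1 q.2))) :=
    (hχ.comp continuous_snd).smul (hK.smul (hf'.sub ((hS'.smul hf).const_smul t⁻¹)))
  -- Joint continuity bounds the derivative on a compact product, and outside the support of the
  -- cutoff it is zero; this is the dominating function.
  obtain ⟨B, hB⟩ := ((isCompact_closedBall s (1 : ℝ)).prod hc.isCompact).exists_bound_of_continuousOn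
    hF'.continuousOn
  have hslice (r : ℝ) : Continuous fun z : BodySpace n => (r, z) := by fun_prop
  have key := hasDerivAt_integral_of_dominated_loc_of_deriv_le (𝕜 := ℝ) (x₀ := s)
    (μ := (volume : Measure (BodySpace n))) (s := Metric.closedBall s 1)
    (F := fun r z => χ z • (NormedSpace.exp (-(t⁻¹ • S r z)) • f r z))
    (F' := fun r z => χ z •
      (NormedSpace.exp (-(t⁻¹ • S r z)) • (f' r z - t⁻¹ • (S' r z • f r z))))
    (bound := (tsupport χ).indicator fun _ => B)
    (Metric.closedBall_mem_nhds s one_pos)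
    (Filter.Eventually.of_forall fun r => (hF.comp (hslice r)).aestronglyMeasurable)
    ((hF.comp (hslice s)).integrable_of_hasCompactSupport (hc.smul_right))
    (hF'.comp (hslice s)).aestronglyMeasurable
    (Filter.Eventually.of_forall fun z r hr => ?_)
    ((integrable_indicator_iff (isClosed_tsupport χ).measurableSet).2
      (continuousOn_const.integrableOn_compact hc.isCompact))
    (Filter.Eventually.of_forall fun z r _ => ?_)
  · exact (key.2.const_smul (t⁻¹ ^ n))
  · by_cases hz : z ∈ tsupport χ
    · rw [Set.indicator_of_mem hz]
      exact hB (r, z) ⟨hr, hz⟩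
    · rw [Set.indicator_of_notMem hz, image_eq_zero_of_notMem_tsupport hz]
      simp
  · have h1 : HasDerivAt (fun r => NormedSpace.exp (-(t⁻¹ • S r z)))
        (NormedSpace.exp (-(t⁻¹ • S r z)) * -(t⁻¹ • S' r z)) r := by
      have := (hasFDerivAt_exp (𝕂 := ℝ) (x := -(t⁻¹ • S r z))).comp_hasDerivAt r
        (((hdS r z).const_smul t⁻¹).neg)
      exact this.congr_deriv (by simp)
    have h2 := (h1.smul (hdf r z)).const_smul (χ z)
    refine h2.congr_deriv ?_
    congr 1
    rw [smul_sub, mul_smul, neg_smul, smul_neg, smul_assoc t⁻¹]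
    abel

/-- The integral of `exp(-S/t) det(∂G) det(∂̄H)`, `S = ∑ G_i H_i`, does not change along a segment
of holomorphic `G` and antiholomorphic `H`, up to what comes from the region where `χ` is not
constant. -/
theorem norm_localInt_det_sub_le [FiniteDimensional ℂ A] (b : A →ₐ[ℂ] ℂ) {N : ℕ}
    (hb : RingHom.ker b ^ N = ⊥) {χ : BodySpace n → ℂ} (hχ : ContDiff ℝ ∞ χ)
    (hc : HasCompactSupport χ) {U : Set (BodySpace n)} (hU : IsOpen U) (hχU : tsupport χ ⊆ U)
    {G ν H μ : Fin n → BodySpace n → A} (hG : ∀ i, ContDiff ℝ ∞ (G i))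
    (hν : ∀ i, ContDiff ℝ ∞ (ν i)) (hH : ∀ i, ContDiff ℝ ∞ (H i)) (hμ : ∀ i, ContDiff ℝ ∞ (μ i))
    (hGz : ∀ z ∈ U, ∀ i j, wirt Complex.I j (G i) z = 0)
    (hνz : ∀ z ∈ U, ∀ i j, wirt Complex.I j (ν i) z = 0)
    (hHz : ∀ z ∈ U, ∀ i j, wirt (-Complex.I) j (H i) z = 0)
    (hμz : ∀ z ∈ U, ∀ i j, wirt (-Complex.I) j (μ i) z = 0) {c : ℝ} (hc0 : 0 < c)
    (hdec : ∀ s ∈ Set.Icc (0 : ℝ) 1, ∀ κ j, ∀ z ∈ tsupport (wirt κ j χ),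
      c ≤ (b (∑ i, (G i z + s • ν i z) * (H i z + s • μ i z))).re) :
    ∃ C : ℝ, 0 ≤ C ∧ ∀ t : ℝ, 0 < t → t ≤ 1 →
      ‖localInt χ (fun z => ∑ i, (G i z + ν i z) * (H i z + μ i z)) t (fun z =>
          (wirtJacobian (-Complex.I) (fun i z => G i z + ν i z) z).det *
            (wirtJacobian Complex.I (fun i z => H i z + μ i z) z).det)
        - localInt χ (fun z => ∑ i, G i z * H i z) t (fun z =>
          (wirtJacobian (-Complex.I) G z).det * (wirtJacobian Complex.I H z).det)‖ ≤ C * t := by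
  set Gs : ℝ → Fin n → BodySpace n → A := fun s i z => G i z + s • ν i z with hGs
  set Hs : ℝ → Fin n → BodySpace n → A := fun s i z => H i z + s • μ i z with hHs
  have hGsc (s : ℝ) (i : Fin n) : ContDiff ℝ ∞ (Gs s i) := (hG i).add ((hν i).const_smul s)
  have hHsc (s : ℝ) (i : Fin n) : ContDiff ℝ ∞ (Hs s i) := (hH i).add ((hμ i).const_smul s)
  have wline {κ : ℂ} {j : Fin n} {a d : BodySpace n → A} (ha : ContDiff ℝ ∞ a)
      (hd : ContDiff ℝ ∞ d) (s : ℝ) (z : BodySpace n) :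
      wirt κ j (fun z => a z + s • d z) z = wirt κ j a z + s • wirt κ j d z := by
    have e := wirt_clm (κ := κ) (j := j) ((s : ℂ) • ContinuousLinearMap.id ℂ A)
      (ContDiff.differentiableAt_infty hd z)
    simp only [smul_apply, ContinuousLinearMap.id_apply, Complex.coe_smul] at e
    have hsd : ContDiff ℝ ∞ fun z => s • d z := hd.const_smul s
    rw [wirt_add (ContDiff.differentiableAt_infty ha z)
      (ContDiff.differentiableAt_infty hsd z), e]
  have hGsz (s : ℝ) : ∀ z ∈ U, ∀ i j, wirt Complex.I j (Gs s i) z = 0 := fun z hz i j => by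
    rw [hGs, wline (hG i) (hν i), hGz z hz, hνz z hz, smul_zero, add_zero]
  have hHsz (s : ℝ) : ∀ z ∈ U, ∀ i j, wirt (-Complex.I) j (Hs s i) z = 0 := fun z hz i j => by
    rw [hHs, wline (hH i) (hμ i), hHz z hz, hμz z hz, smul_zero, add_zero]
  set S : ℝ → BodySpace n → A := fun s z => ∑ i, Gs s i z * Hs s i z with hS
  set S' : ℝ → BodySpace n → A := fun s z => ∑ i, (ν i z * Hs s i z + Gs s i z * μ i z) with hS'
  set JG : ℝ → BodySpace n → Matrix (Fin n) (Fin n) A := fun s => wirtJacobian (-Complex.I) (Gs s)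
  set JH : ℝ → BodySpace n → Matrix (Fin n) (Fin n) A := fun s => wirtJacobian Complex.I (Hs s)
  set dG : ℝ → BodySpace n → A := fun s z =>
    ∑ i, ∑ l, (JG s z).adjugate l i * wirtJacobian (-Complex.I) ν z i l
  set dH : ℝ → BodySpace n → A := fun s z =>
    ∑ i, ∑ l, (JH s z).adjugate l i * wirtJacobian Complex.I μ z i l
  have cJG : Continuous fun q : ℝ × BodySpace n => JG q.1 q.2 := by
    refine continuous_matrix fun i l => ?_
    have : (fun q : ℝ × BodySpace n => JG q.1 q.2 i l) = fun q =>
        wirt (-Complex.I) l (G i) q.2 + q.1 • wirt (-Complex.I) l (ν i) q.2 :=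
      funext fun q => wline (hG i) (hν i) q.1 q.2
    rw [this]
    exact ((hG i).wirt.continuous.comp continuous_snd).add
      (continuous_fst.smul ((hν i).wirt.continuous.comp continuous_snd))
  have cJH : Continuous fun q : ℝ × BodySpace n => JH q.1 q.2 := by
    refine continuous_matrix fun i l => ?_
    have : (fun q : ℝ × BodySpace n => JH q.1 q.2 i l) = fun q =>
        wirt Complex.I l (H i) q.2 + q.1 • wirt Complex.I l (μ i) q.2 :=
      funext fun q => wline (hH i) (hμ i) q.1 q.2
    rw [this]
    exact ((hH i).wirt.continuous.comp continuous_snd).add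
      (continuous_fst.smul ((hμ i).wirt.continuous.comp continuous_snd))
  have cGs (i : Fin n) : Continuous fun q : ℝ × BodySpace n => Gs q.1 i q.2 :=
    ((hG i).continuous.comp continuous_snd).add
      (continuous_fst.smul ((hν i).continuous.comp continuous_snd))
  have cHs (i : Fin n) : Continuous fun q : ℝ × BodySpace n => Hs q.1 i q.2 :=
    ((hH i).continuous.comp continuous_snd).add
      (continuous_fst.smul ((hμ i).continuous.comp continuous_snd))
  have cν (i : Fin n) : Continuous fun q : ℝ × BodySpace n => ν i q.2 :=
    (hν i).continuous.comp continuous_snd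
  have cμ (i : Fin n) : Continuous fun q : ℝ × BodySpace n => μ i q.2 :=
    (hμ i).continuous.comp continuous_snd
  have cS : Continuous fun q : ℝ × BodySpace n => S q.1 q.2 :=
    continuous_finsetSum _ fun i _ => (cGs i).mul (cHs i)
  have cS' : Continuous fun q : ℝ × BodySpace n => S' q.1 q.2 :=
    continuous_finsetSum _ fun i _ => ((cν i).mul (cHs i)).add ((cGs i).mul (cμ i))
  have cdetG : Continuous fun q : ℝ × BodySpace n => (JG q.1 q.2).det := cJG.matrix_det
  have cdetH : Continuous fun q : ℝ × BodySpace n => (JH q.1 q.2).det := cJH.matrix_det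
  have cadjG (l i : Fin n) : Continuous fun q : ℝ × BodySpace n => (JG q.1 q.2).adjugate l i :=
    cJG.matrix_adjugate.matrix_elem l i
  have cadjH (l i : Fin n) : Continuous fun q : ℝ × BodySpace n => (JH q.1 q.2).adjugate l i :=
    cJH.matrix_adjugate.matrix_elem l i
  have cdG : Continuous fun q : ℝ × BodySpace n => dG q.1 q.2 :=
    continuous_finsetSum _ fun i _ => continuous_finsetSum _ fun l _ =>
      (cadjG l i).mul ((hν i).wirt.continuous.comp continuous_snd)
  have cdH : Continuous fun q : ℝ × BodySpace n => dH q.1 q.2 :=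
    continuous_finsetSum _ fun i _ => continuous_finsetSum _ fun l _ =>
      (cadjH l i).mul ((hμ i).wirt.continuous.comp continuous_snd)
  have dGs (s : ℝ) (i : Fin n) (z : BodySpace n) : HasDerivAt (fun r => Gs r i z) (ν i z) s := by
    exact (((hasDerivAt_id s).smul_const (ν i z)).const_add (G i z)).congr_deriv
      (one_smul ℝ _)
  have dHs (s : ℝ) (i : Fin n) (z : BodySpace n) : HasDerivAt (fun r => Hs r i z) (μ i z) s := by
    exact (((hasDerivAt_id s).smul_const (μ i z)).const_add (H i z)).congr_deriv
      (one_smul ℝ _)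
  have hdS (s : ℝ) (z : BodySpace n) : HasDerivAt (fun r => S r z) (S' s z) s :=
    HasDerivAt.fun_sum fun i _ => (dGs s i z).mul (dHs s i z)
  have hdetG (s : ℝ) (z : BodySpace n) : HasDerivAt (fun r => (JG r z).det) (dG s z) s := by
    refine hasDerivAt_det fun i l => ?_
    have : (fun r => JG r z i l) = fun r =>
        wirt (-Complex.I) l (G i) z + r • wirt (-Complex.I) l (ν i) z :=
      funext fun r => wline (hG i) (hν i) r z
    rw [this]
    exact (((hasDerivAt_id s).smul_const (wirt (-Complex.I) l (ν i) z)).const_add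
      (wirt (-Complex.I) l (G i) z)).congr_deriv
      (one_smul ℝ _)
  have hdetH (s : ℝ) (z : BodySpace n) : HasDerivAt (fun r => (JH r z).det) (dH s z) s := by
    refine hasDerivAt_det fun i l => ?_
    have : (fun r => JH r z i l) = fun r =>
        wirt Complex.I l (H i) z + r • wirt Complex.I l (μ i) z :=
      funext fun r => wline (hH i) (hμ i) r z
    rw [this]
    exact (((hasDerivAt_id s).smul_const (wirt Complex.I l (μ i) z)).const_add
      (wirt Complex.I l (H i) z)).congr_deriv
      (one_smul ℝ _)
  have hder (t s : ℝ) := hasDerivAt_localInt (M := A) hχ.continuous hc cS cS' (cdetG.mul cdetH)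
    ((cdG.mul cdetH).add (cdetG.mul cdH)) hdS
    (fun s z => (hdetG s z).mul (hdetH s z)) t s
  have sS (s : ℝ) : ContDiff ℝ ∞ (S s) := ContDiff.sum fun i _ => (hGsc s i).mul (hHsc s i)
  have sdetG (s : ℝ) : ContDiff ℝ ∞ fun z => (JG s z).det :=
    ContDiff.matrix_det (contDiff_wirtJacobian (hGsc s))
  have sdetH (s : ℝ) : ContDiff ℝ ∞ fun z => (JH s z).det :=
    ContDiff.matrix_det (contDiff_wirtJacobian (hHsc s))
  -- The second derivatives commute, so the entries of the Jacobian of an antiholomorphic map are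
  -- again antiholomorphic; hence so is its determinant.
  have zdetH (s : ℝ) : ∀ z ∈ tsupport χ, ∀ j, wirt (-Complex.I) j (fun z => (JH s z).det) z = 0 := by
    intro z hz j
    rw [wirt_det fun i l => ContDiff.differentiableAt_infty (contDiff_wirtJacobian (hHsc s) i l) z]
    refine Finset.sum_eq_zero fun i _ => Finset.sum_eq_zero fun l _ => ?_
    have : wirt (-Complex.I) j (fun w => JH s w i l) z
        = wirt Complex.I l (wirt (-Complex.I) j (Hs s i)) z :=
      wirt_comm hU (hHsc s i).contDiffOn (hχU hz)
    rw [this, wirt_eq_zero, mul_zero]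
    filter_upwards [hU.mem_nhds (hχU hz)] with w hw using hHsz s w hw i j
  have zdetG (s : ℝ) : ∀ z ∈ tsupport χ, ∀ j, wirt Complex.I j (fun z => (JG s z).det) z = 0 := by
    intro z hz j
    rw [wirt_det fun i l => ContDiff.differentiableAt_infty (contDiff_wirtJacobian (hGsc s) i l) z]
    refine Finset.sum_eq_zero fun i _ => Finset.sum_eq_zero fun l _ => ?_
    have : wirt Complex.I j (fun w => JG s w i l) z
        = wirt (-Complex.I) l (wirt Complex.I j (Gs s i)) z :=
      wirt_comm hU (hGsc s i).contDiffOn (hχU hz)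
    rw [this, wirt_eq_zero, mul_zero]
    filter_upwards [hU.mem_nhds (hχU hz)] with w hw using hGsz s w hw i j
  -- The derivative in the parameter is a sum of two variations: that of `G` with `det ∂̄H` as a
  -- passive factor, and that of `H` with `det ∂G` as a passive factor. Each is a divergence by
  -- `localInt_cofactorField`.
  have hval (t s : ℝ) (ht : 0 < t) : localInt χ (S s) t (fun z =>
      (dG s z * (JH s z).det + (JG s z).det * dH s z)
        - t⁻¹ • (S' s z • ((JG s z).det * (JH s z).det)))
      = -(∑ j, localInt (wirt (-Complex.I) j χ) (S s) t
          (fun z => cofactorField (-Complex.I) (Gs s) ν j z * (JH s z).det))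
        - ∑ j, localInt (wirt Complex.I j χ) (S s) t
          (fun z => cofactorField Complex.I (Hs s) μ j z * (JG s z).det) := by
    have h1 := localInt_cofactorField hχ hc (κ := -Complex.I) (hGsc s) hν (hHsc s) (sdetH s)
      (fun z hz => hHsz s z (hχU hz)) (zdetH s) ht
    have h2 := localInt_cofactorField hχ hc (κ := Complex.I) (hHsc s) hμ (hGsc s) (sdetG s)
      (fun z hz => hGsz s z (hχU hz)) (zdetG s) ht
    have hcomm : (fun w => ∑ i, Hs s i w * Gs s i w) = S s := by
      funext w
      exact Finset.sum_congr rfl fun i _ => mul_comm _ _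
    rw [hcomm] at h2
    rw [sub_eq_add_neg, ← h1, ← h2, ← localInt_add hχ hc (sS s)]
    · congr 1
      funext z
      have e : S' s z • ((JG s z).det * (JH s z).det)
          = (∑ i, ν i z * Hs s i z) * ((JG s z).det * (JH s z).det)
            + (∑ i, μ i z * Gs s i z) * ((JH s z).det * (JG s z).det) := by
        simp only [hS', smul_eq_mul]
        rw [Finset.sum_add_distrib, add_mul]
        congr 1
        rw [mul_comm (JH s z).det]
        congr 1
        exact Finset.sum_congr rfl fun i _ => mul_comm _ _
      rw [e, smul_add, mul_comm (JG s z).det (dH s z)]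
      change dG s z * (JH s z).det + dH s z * (JG s z).det - _ = _
      abel
    · refine ContDiff.sub ?_ (ContDiff.const_smul _ ?_)
      · exact (ContDiff.sum fun i _ => ContDiff.sum fun l _ =>
          (ContDiff.matrix_adjugate (contDiff_wirtJacobian (hGsc s)) l i).mul
            (contDiff_wirtJacobian hν i l)).mul (sdetH s)
      · exact (ContDiff.sum fun i _ => (hν i).mul (hHsc s i)).mul ((sdetG s).mul (sdetH s))
    · refine ContDiff.sub ?_ (ContDiff.const_smul _ ?_)
      · exact (ContDiff.sum fun i _ => ContDiff.sum fun l _ =>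
          (ContDiff.matrix_adjugate (contDiff_wirtJacobian (hHsc s)) l i).mul
            (contDiff_wirtJacobian hμ i l)).mul (sdetG s)
      · exact (ContDiff.sum fun i _ => (hμ i).mul (hGsc s i)).mul ((sdetH s).mul (sdetG s))
  -- Compactness of `[0, 1]` times the support makes the bounds independent of `s`. Any power of `t`
  -- is available by exponential decay; the first power is enough.
  have hbound (κ : ℂ) (j : Fin n) (E : ℝ → BodySpace n → A)
      (hE : Continuous fun q : ℝ × BodySpace n => E q.1 q.2) :
      ∃ C : ℝ, 0 ≤ C ∧ ∀ s ∈ Set.Icc (0 : ℝ) 1, ∀ t : ℝ, 0 < t → t ≤ 1 →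
        ‖localInt (wirt κ j χ) (S s) t (E s)‖ ≤ C * t := by
    have hK := (isCompact_Icc (a := (0 : ℝ)) (b := 1)).prod (hc.wirt κ j).isCompact
    obtain ⟨R, hR⟩ := hK.exists_bound_of_continuousOn cS.continuousOn
    obtain ⟨F, hF⟩ := hK.exists_bound_of_continuousOn hE.continuousOn
    obtain ⟨C, hC0, hC⟩ := norm_localInt_le_of_bounds (M := A) b hb (hχ.wirt (κ := κ) (j := j))
      (hc.wirt κ j) R F hc0 1
    refine ⟨C, hC0, fun s hs t ht0 ht1 => ?_⟩
    have := hC (S s) (E s) (fun z hz => hR (s, z) ⟨hs, hz⟩) (fun z hz => hF (s, z) ⟨hs, hz⟩)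
      (fun z hz => hdec s hs κ j z hz) t ht0 ht1
    rwa [pow_one] at this
  have ccofG (j : Fin n) : Continuous fun q : ℝ × BodySpace n =>
      cofactorField (-Complex.I) (Gs q.1) ν j q.2 * (JH q.1 q.2).det :=
    (continuous_finsetSum _ fun i _ => (cadjG j i).mul (cν i)).mul cdetH
  have ccofH (j : Fin n) : Continuous fun q : ℝ × BodySpace n =>
      cofactorField Complex.I (Hs q.1) μ j q.2 * (JG q.1 q.2).det :=
    (continuous_finsetSum _ fun i _ => (cadjH j i).mul (cμ i)).mul cdetG
  choose C1 hC1 hC1' using fun j => hbound (-Complex.I) j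
    (fun s z => cofactorField (-Complex.I) (Gs s) ν j z * (JH s z).det) (ccofG j)
  choose C2 hC2 hC2' using fun j => hbound Complex.I j
    (fun s z => cofactorField Complex.I (Hs s) μ j z * (JG s z).det) (ccofH j)
  refine ⟨(∑ j, C1 j) + ∑ j, C2 j, add_nonneg (Finset.sum_nonneg fun j _ => hC1 j)
    (Finset.sum_nonneg fun j _ => hC2 j), fun t ht0 ht1 => ?_⟩
  -- The bound on the derivative along the segment passes to the difference of the endpoints.
  have hmv := norm_image_sub_le_of_norm_deriv_le_segment_01'
    (f := fun s => localInt χ (S s) t fun z => (JG s z).det * (JH s z).det)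
    (C := ((∑ j, C1 j) + ∑ j, C2 j) * t) (fun s _ => (hder t s).hasDerivWithinAt) ?_
  · have e0 : S 0 = fun z => ∑ i, G i z * H i z := by
      funext z
      simp [hS, hGs, hHs]
    have e1 : S 1 = fun z => ∑ i, (G i z + ν i z) * (H i z + μ i z) := by
      funext z
      simp [hS, hGs, hHs]
    have g0 : Gs 0 = G := by funext i z; simp [hGs]
    have g1 : Gs 1 = fun i z => G i z + ν i z := by funext i z; simp [hGs]
    have h0 : Hs 0 = H := by funext i z; simp [hHs]
    have h1 : Hs 1 = fun i z => H i z + μ i z := by funext i z; simp [hHs]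
    rw [← e0, ← e1]
    conv_lhs => rw [← g1, ← h1]
    have j0 : wirtJacobian (-Complex.I) G = JG 0 := by
      change _ = wirtJacobian (-Complex.I) (Gs 0)
      rw [g0]
    have k0 : wirtJacobian Complex.I H = JH 0 := by
      change _ = wirtJacobian Complex.I (Hs 0)
      rw [h0]
    rw [j0, k0]
    exact hmv
  · intro s hs
    have hs' : s ∈ Set.Icc (0 : ℝ) 1 := Set.Ico_subset_Icc_self hs
    have hv := hval t s ht0
    change ‖localInt χ (S s) t (fun z =>
      (dG s z * (JH s z).det + (JG s z).det * dH s z)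
        - t⁻¹ • (S' s z • ((JG s z).det * (JH s z).det)))‖ ≤ _
    rw [hv]
    refine (norm_sub_le _ _).trans ?_
    rw [norm_neg, add_mul, Finset.sum_mul, Finset.sum_mul]
    exact add_le_add (norm_sum_le_of_le _ fun j _ => hC1' j s hs' t ht0 ht1)
      (norm_sum_le_of_le _ fun j _ => hC2' j s hs' t ht0 ht1)

end Homotopy

/-! ### Gaussian integrals over ℂⁿ -/

section Gaussian

variable {n : ℕ}

open MeasureTheory

theorem integral_exp_neg_normSq_complex : ∫ w : ℂ, Real.exp (-Complex.normSq w) = Real.pi := by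
  have h := GaussianFourier.integral_rexp_neg_mul_sq_norm (V := ℂ) (b := 1) one_pos
  rw [Complex.finrank_real_complex] at h
  simp only [Complex.normSq_eq_norm_sq]
  simpa using h

theorem integrable_exp_neg_sum_normSq :
    Integrable fun w : BodySpace n => Real.exp (-∑ i, Complex.normSq (w i)) := by
  -- The integral of a function that is not integrable is `0` by convention, so the nonzero value
  -- `π` forces integrability.
  have h1 : Integrable fun w : ℂ => Real.exp (-Complex.normSq w) :=
    Integrable.of_integral_ne_zero (by
      rw [integral_exp_neg_normSq_complex]
      exact Real.pi_ne_zero)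
  have h2 := Integrable.fintype_prod (μ := fun _ : Fin n => (volume : Measure ℂ))
    (f := fun _ w => Real.exp (-Complex.normSq w)) (fun _ => h1)
  refine h2.congr (Filter.Eventually.of_forall fun w => ?_)
  simp only
  rw [← Real.exp_sum, Finset.sum_neg_distrib]

theorem integral_exp_neg_sum_normSq :
    ∫ w : BodySpace n, Real.exp (-∑ i, Complex.normSq (w i)) = Real.pi ^ n := by
  have h := integral_fintype_prod_volume_eq_pow (ι := Fin n) (fun w : ℂ => Real.exp (-Complex.normSq w))
  rw [integral_exp_neg_normSq_complex, Fintype.card_fin] at h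
  rw [← h]
  congr 1
  funext w
  rw [← Real.exp_sum, Finset.sum_neg_distrib]

theorem det_restrictScalars_toLin' (B : Matrix (Fin n) (Fin n) ℂ) :
    LinearMap.det ((Matrix.toLin' B).restrictScalars ℝ) = Complex.normSq B.det := by
  rw [LinearMap.det_restrictScalars, Algebra.norm_complex_apply, LinearMap.det_toLin']

/-- Substitute `z = p + √t J⁻¹ w`. As a real linear map, `√t J⁻¹` has determinant `tⁿ / |det J|²`,
and the factor `tⁿ` cancels the normalization `t⁻ⁿ`. -/
theorem integral_gaussian_rescale {χ : BodySpace n → ℂ} (hχ : Continuous χ)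
    {J : Matrix (Fin n) (Fin n) ℂ} (hJ : J.det ≠ 0) (p : BodySpace n) {t : ℝ} (ht : 0 < t) :
    (t⁻¹ ^ n : ℝ) • ∫ z, χ z * (Real.exp (-(t⁻¹ *
      ∑ i, Complex.normSq (∑ j, J i j * (z j - p j)))) : ℂ)
      = ((Complex.normSq J.det)⁻¹ : ℝ) • ∫ w : BodySpace n,
        χ (p + (Real.sqrt t : ℂ) • J⁻¹.mulVec w) *
          (Real.exp (-∑ i, Complex.normSq (w i)) : ℂ) := by
  set B : Matrix (Fin n) (Fin n) ℂ := (Real.sqrt t : ℂ) • J⁻¹ with hB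
  have hst : (Real.sqrt t : ℂ) ≠ 0 := by
    exact_mod_cast (Real.sqrt_pos.2 ht).ne'
  have hdetB : Complex.normSq B.det = t ^ n * (Complex.normSq J.det)⁻¹ := by
    rw [hB, Matrix.det_smul, map_mul, map_pow, Complex.normSq_ofReal, Real.mul_self_sqrt ht.le,
      Matrix.det_nonsing_inv, Ring.inverse_eq_inv', map_inv₀, Fintype.card_fin]
  have hJn : Complex.normSq J.det ≠ 0 := by simpa using hJ
  have hdet0 : LinearMap.det ((Matrix.toLin' B).restrictScalars ℝ) ≠ 0 := by
    rw [det_restrictScalars_toLin', hdetB]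
    have := ht.ne'
    positivity
  have hmap := Measure.map_linearMap_addHaar_eq_smul_addHaar
    (volume : Measure (BodySpace n)) hdet0
  rw [det_restrictScalars_toLin', hdetB] at hmap
  set g : BodySpace n → ℂ := fun z => χ (p + z) * (Real.exp (-(t⁻¹ *
      ∑ i, Complex.normSq (∑ j, J i j * z j))) : ℂ) with hg
  have hgc : Continuous g := by
    refine (hχ.comp (continuous_const.add continuous_id)).mul ?_
    refine Complex.continuous_ofReal.comp (Real.continuous_exp.comp ?_)
    refine (continuous_const.mul (continuous_finsetSum _ fun i _ => ?_)).neg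
    refine Complex.continuous_normSq.comp (continuous_finsetSum _ fun j _ => ?_)
    exact continuous_const.mul (continuous_apply j)
  have h1 : ∫ z, χ z * (Real.exp (-(t⁻¹ *
      ∑ i, Complex.normSq (∑ j, J i j * (z j - p j)))) : ℂ) = ∫ z, g z := by
    rw [← integral_add_left_eq_self _ p]
    congr 1
    funext z
    simp [hg]
  have hBc : Continuous ((Matrix.toLin' B).restrictScalars ℝ) :=
    LinearMap.continuous_of_finiteDimensional _
  have h2 := integral_map (μ := (volume : Measure (BodySpace n))) hBc.measurable.aemeasurable
    (f := g) hgc.aestronglyMeasurable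
  rw [hmap, integral_smul_measure] at h2
  have h3 (w : BodySpace n) : g ((Matrix.toLin' B).restrictScalars ℝ w)
      = χ (p + (Real.sqrt t : ℂ) • J⁻¹.mulVec w) *
          (Real.exp (-∑ i, Complex.normSq (w i)) : ℂ) := by
    have e1 : (Matrix.toLin' B).restrictScalars ℝ w = (Real.sqrt t : ℂ) • J⁻¹.mulVec w := by
      rw [LinearMap.restrictScalars_apply, Matrix.toLin'_apply, hB, Matrix.smul_mulVec]
    rw [e1, hg]
    simp only
    congr 3
    congr 1
    rw [Finset.mul_sum]
    refine Finset.sum_congr rfl fun i _ => ?_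
    have e2 : ∑ j, J i j * ((Real.sqrt t : ℂ) • J⁻¹.mulVec w) j = (Real.sqrt t : ℂ) * w i := by
      have : J.mulVec ((Real.sqrt t : ℂ) • J⁻¹.mulVec w) = (Real.sqrt t : ℂ) • w := by
        rw [Matrix.mulVec_smul, Matrix.mulVec_mulVec,
          Matrix.mul_nonsing_inv _ (isUnit_iff_ne_zero.2 hJ), Matrix.one_mulVec]
      exact congrFun this i
    rw [e2, map_mul, Complex.normSq_ofReal, Real.mul_self_sqrt ht.le, ← mul_assoc,
      inv_mul_cancel₀ ht.ne', one_mul]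
  simp only [h3] at h2
  rw [h1, ← h2, smul_smul, ENNReal.toReal_ofReal (abs_nonneg _), abs_of_nonneg]
  · congr 1
    rw [mul_inv, inv_inv, ← mul_assoc, mul_comm _ (t ^ n)⁻¹, mul_assoc, inv_mul_cancel₀ hJn, mul_one,
      inv_pow]
  · have := Complex.normSq_nonneg J.det
    positivity

/-- Dominated convergence: a bound for the cutoff times the density `ρ` dominates. -/
theorem tendsto_integral_dilation {χ : BodySpace n → ℂ} (hχ : Continuous χ)
    (hc : HasCompactSupport χ) {ρ : BodySpace n → ℝ} (hρ : Continuous ρ) (hρ0 : ∀ w, 0 ≤ ρ w)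
    (hρi : Integrable ρ) {L : BodySpace n → BodySpace n} (hL : Continuous L) (p : BodySpace n) :
    Filter.Tendsto (fun t : ℝ => ∫ w : BodySpace n, χ (p + (Real.sqrt t : ℂ) • L w) * (ρ w : ℂ))
      (𝓝[>] 0) (𝓝 (∫ w : BodySpace n, χ p * (ρ w : ℂ))) := by
  obtain ⟨B, hB⟩ := hχ.bounded_above_of_compact_support hc
  have hρc : Continuous fun w => (ρ w : ℂ) := Complex.continuous_ofReal.comp hρ
  have hmeas (t : ℝ) : Continuous fun w => χ (p + (Real.sqrt t : ℂ) • L w) * (ρ w : ℂ) := by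
    have h1 : Continuous fun w => p + (Real.sqrt t : ℂ) • L w := by fun_prop
    have h2 : Continuous fun w => χ (p + (Real.sqrt t : ℂ) • L w) := hχ.comp h1
    exact h2.mul hρc
  have hbound (t : ℝ) (w : BodySpace n) :
      ‖χ (p + (Real.sqrt t : ℂ) • L w) * (ρ w : ℂ)‖ ≤ B * ρ w := by
    rw [norm_mul, Complex.norm_real, Real.norm_of_nonneg (hρ0 w)]
    exact mul_le_mul_of_nonneg_right (hB _) (hρ0 w)
  have hlim (w : BodySpace n) : Filter.Tendsto
      (fun t : ℝ => χ (p + (Real.sqrt t : ℂ) • L w) * (ρ w : ℂ)) (𝓝[>] 0)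
      (𝓝 (χ p * (ρ w : ℂ))) := by
    refine Filter.Tendsto.mul_const _ ?_
    have h1 : Continuous fun t : ℝ => χ (p + (Real.sqrt t : ℂ) • L w) := by
      refine hχ.comp (continuous_const.add ?_)
      exact (Complex.continuous_ofReal.comp Real.continuous_sqrt).smul continuous_const
    have h2 := (h1.tendsto 0).mono_left (nhdsWithin_le_nhds (s := Set.Ioi 0))
    simpa using h2
  exact tendsto_integral_filter_of_dominated_convergence (fun w => B * ρ w)
    (Filter.Eventually.of_forall fun t => (hmeas t).aestronglyMeasurable)
    (Filter.Eventually.of_forall fun t => Filter.Eventually.of_forall fun w => hbound t w)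
    (hρi.const_mul B) (Filter.Eventually.of_forall hlim)

theorem tendsto_gaussian {χ : BodySpace n → ℂ} (hχ : Continuous χ) (hc : HasCompactSupport χ)
    {J : Matrix (Fin n) (Fin n) ℂ} (hJ : J.det ≠ 0) (p : BodySpace n) :
    Filter.Tendsto (fun t : ℝ => (t⁻¹ ^ n : ℝ) • ∫ z, χ z * (Real.exp (-(t⁻¹ *
      ∑ i, Complex.normSq (∑ j, J i j * (z j - p j)))) : ℂ)) (𝓝[>] 0)
      (𝓝 (((Complex.normSq J.det)⁻¹ : ℝ) • (χ p * (Real.pi : ℂ) ^ n))) := by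
  have hρ : Continuous fun w : BodySpace n => Real.exp (-∑ i, Complex.normSq (w i)) :=
    Real.continuous_exp.comp (continuous_finsetSum _ fun i _ =>
      Complex.continuous_normSq.comp (continuous_apply i)).neg
  have hmv : Continuous fun w : BodySpace n => J⁻¹.mulVec w :=
    continuous_const.matrix_mulVec continuous_id
  have h := (tendsto_integral_dilation hχ hc hρ (fun w => (Real.exp_pos _).le)
    integrable_exp_neg_sum_normSq hmv p).const_smul ((Complex.normSq J.det)⁻¹ : ℝ)
  rw [integral_const_mul, integral_complex_ofReal, integral_exp_neg_sum_normSq,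
    Complex.ofReal_pow] at h
  refine h.congr' ?_
  filter_upwards [self_mem_nhdsWithin] with t ht
  exact (integral_gaussian_rescale hχ hJ p ht).symm

theorem contDiff_coord (l : Fin n) : ContDiff ℝ ∞ fun z : BodySpace n => z l :=
  contDiff_apply ℝ ℂ l

theorem fderiv_coord (l : Fin n) (z v : BodySpace n) :
    fderiv ℝ (fun w : BodySpace n => w l) z v = v l := by
  rw [(hasFDerivAt_apply (𝕜 := ℝ) l z).fderiv]
  rfl

theorem wirt_coord (l j : Fin n) (z : BodySpace n) :
    wirt (-Complex.I) j (fun w : BodySpace n => w l) z = if l = j then 1 else 0 := by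
  unfold wirt
  rw [fderiv_coord, fderiv_coord, Pi.single_apply, Pi.single_apply]
  split_ifs <;> (simp; try norm_num)

theorem wirt_bar_coord (l j : Fin n) (z : BodySpace n) :
    wirt Complex.I j (fun w : BodySpace n => w l) z = 0 := by
  unfold wirt
  rw [fderiv_coord, fderiv_coord, Pi.single_apply, Pi.single_apply]
  split_ifs <;> simp

theorem wirt_conj {κ : ℂ} {j : Fin n} {f : BodySpace n → ℂ} {z : BodySpace n}
    (hf : DifferentiableAt ℝ f z) :
    wirt κ j (fun w => starRingEnd ℂ (f w)) z
      = starRingEnd ℂ (wirt (starRingEnd ℂ κ) j f z) := by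
  have h : fderiv ℝ (fun w => starRingEnd ℂ (f w)) z
      = (Complex.conjCLE : ℂ →L[ℝ] ℂ).comp (fderiv ℝ f z) :=
    (Complex.conjCLE.hasFDerivAt.comp z hf.hasFDerivAt).fderiv
  unfold wirt
  rw [h]
  simp [Complex.conj_ofNat]

end Gaussian

/-! ### The affine model of the phase -/

section LinearModel

variable {n : ℕ} {A : Type*} [NormedCommRing A] [NormedAlgebra ℂ A]

/-- The affine map `z ↦ J (z - p)`. -/
noncomputable def affineForm (J : Matrix (Fin n) (Fin n) ℂ) (p : BodySpace n) (i : Fin n)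
    (z : BodySpace n) : ℂ :=
  ∑ j, J i j * (z j - p j)

theorem contDiff_affineForm (J : Matrix (Fin n) (Fin n) ℂ) (p : BodySpace n) (i : Fin n) :
    ContDiff ℝ ∞ (affineForm J p i) :=
  ContDiff.sum fun j _ => contDiff_const.mul ((contDiff_coord j).sub contDiff_const)

theorem wirt_affineForm (κ : ℂ) (J : Matrix (Fin n) (Fin n) ℂ) (p : BodySpace n) (i l : Fin n)
    (z : BodySpace n) : wirt κ l (affineForm J p i) z
      = ∑ j, J i j * wirt κ l (fun w : BodySpace n => w j) z := by
  unfold affineForm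
  have hs (j : Fin n) : ContDiff ℝ ∞ fun w : BodySpace n => w j + -p j :=
    (contDiff_coord j).add contDiff_const
  simp only [sub_eq_add_neg]
  rw [wirt_sum]
  · refine Finset.sum_congr rfl fun j _ => ?_
    rw [wirt_mul (differentiableAt_const _) (ContDiff.differentiableAt_infty (hs j) z), wirt_const,
      zero_mul, zero_add, wirt_add (ContDiff.differentiableAt_infty (contDiff_coord j) z)
        (differentiableAt_const _), wirt_const, add_zero]
  · exact fun j _ => ContDiff.differentiableAt_infty (contDiff_const.mul (hs j)) z

theorem wirt_hol_affineForm (J : Matrix (Fin n) (Fin n) ℂ) (p : BodySpace n) (i l : Fin n)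
    (z : BodySpace n) : wirt (-Complex.I) l (affineForm J p i) z = J i l := by
  rw [wirt_affineForm]
  simp [wirt_coord]

theorem wirt_bar_affineForm (J : Matrix (Fin n) (Fin n) ℂ) (p : BodySpace n) (i l : Fin n)
    (z : BodySpace n) : wirt Complex.I l (affineForm J p i) z = 0 := by
  rw [wirt_affineForm]
  simp [wirt_bar_coord]

theorem wirt_algebraMap {κ : ℂ} {j : Fin n} {f : BodySpace n → ℂ} {z : BodySpace n}
    (hf : DifferentiableAt ℝ f z) :
    wirt κ j (fun w => algebraMap ℂ A (f w)) z = algebraMap ℂ A (wirt κ j f z) :=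
  wirt_clm (algebraMapCLM ℂ A) hf

theorem contDiff_algebraMap_comp {f : BodySpace n → ℂ} (hf : ContDiff ℝ ∞ f) :
    ContDiff ℝ ∞ fun w => algebraMap ℂ A (f w) :=
  (((algebraMapCLM ℂ A).restrictScalars ℝ).contDiff).comp hf

theorem contDiff_conj_comp {f : BodySpace n → ℂ} (hf : ContDiff ℝ ∞ f) :
    ContDiff ℝ ∞ fun w => starRingEnd ℂ (f w) :=
  Complex.conjCLE.contDiff.comp hf

open MeasureTheory in
-- The amplitude is the constant `|det J|²`, which cancels the Jacobian of the rescaling; so the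
-- limit does not depend on `J`.
theorem tendsto_localInt_affineForm [FiniteDimensional ℂ A] {χ : BodySpace n → ℂ}
    (hχ : ContDiff ℝ ∞ χ) (hc : HasCompactSupport χ) {J : Matrix (Fin n) (Fin n) ℂ}
    (hJ : J.det ≠ 0) (p : BodySpace n) :
    Filter.Tendsto (fun t : ℝ => localInt χ
      (fun z => ∑ i, algebraMap ℂ A (affineForm J p i z) *
        algebraMap ℂ A (starRingEnd ℂ (affineForm J p i z))) t
      (fun z => (wirtJacobian (-Complex.I) (fun i z => algebraMap ℂ A (affineForm J p i z)) z).det *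
        (wirtJacobian Complex.I
          (fun i z => algebraMap ℂ A (starRingEnd ℂ (affineForm J p i z))) z).det))
      (𝓝[>] 0) (𝓝 (algebraMap ℂ A (χ p * (Real.pi : ℂ) ^ n))) := by
  have hd (i : Fin n) (z : BodySpace n) :=
    ContDiff.differentiableAt_infty (contDiff_affineForm J p i) z
  have hdc (i : Fin n) (z : BodySpace n) :=
    ContDiff.differentiableAt_infty (contDiff_conj_comp (contDiff_affineForm J p i)) z
  have e1 (z : BodySpace n) : (wirtJacobian (-Complex.I)
      (fun i z => algebraMap ℂ A (affineForm J p i z)) z).det = algebraMap ℂ A J.det := by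
    rw [RingHom.map_det]
    congr 1
    ext i l
    change wirt (-Complex.I) l (fun z => algebraMap ℂ A (affineForm J p i z)) z
      = algebraMap ℂ A (J i l)
    rw [wirt_algebraMap (hd i z), wirt_hol_affineForm]
  have e2 (z : BodySpace n) : (wirtJacobian Complex.I
      (fun i z => algebraMap ℂ A (starRingEnd ℂ (affineForm J p i z))) z).det
      = algebraMap ℂ A (starRingEnd ℂ J.det) := by
    rw [RingHom.map_det, RingHom.map_det]
    congr 1
    ext i l
    change wirt Complex.I l (fun z => algebraMap ℂ A (starRingEnd ℂ (affineForm J p i z))) z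
      = algebraMap ℂ A (starRingEnd ℂ (J i l))
    rw [wirt_algebraMap (hdc i z), wirt_conj (hd i z), Complex.conj_I, wirt_hol_affineForm]
  have e3 (t : ℝ) (z : BodySpace n) : NormedSpace.exp (-(t⁻¹ •
      ∑ i, algebraMap ℂ A (affineForm J p i z) *
        algebraMap ℂ A (starRingEnd ℂ (affineForm J p i z))))
      = algebraMap ℂ A (Real.exp (-(t⁻¹ *
        ∑ i, Complex.normSq (∑ j, J i j * (z j - p j)))) : ℂ) := by
    rw [Complex.ofReal_exp, Complex.exp_eq_exp_ℂ, NormedSpace.algebraMap_exp_comm]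
    congr 1
    simp only [← map_mul, Complex.mul_conj]
    rw [← map_sum, ← Complex.coe_smul, Algebra.smul_def, ← map_mul, ← map_neg]
    congr 1
    push_cast
    rfl
  have h := tendsto_gaussian hχ.continuous hc hJ p
  have h2 := ((algebraMapCLM ℂ A).continuous.tendsto _).comp (h.const_mul (J.det * starRingEnd ℂ J.det))
  have hJn : (Complex.normSq J.det : ℂ) ≠ 0 := by
    simpa using hJ
  convert h2 using 2
  · rename_i t
    unfold localInt
    simp only [e1, e2, e3, Function.comp]
    rw [mul_smul_comm, ← integral_const_mul]
    have e4 : (algebraMapCLM ℂ A) (t⁻¹ ^ n • ∫ z, J.det * starRingEnd ℂ J.det * (χ z *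
        (Real.exp (-(t⁻¹ * ∑ i, Complex.normSq (∑ j, J i j * (z j - p j)))) : ℂ)))
        = t⁻¹ ^ n • (algebraMapCLM ℂ A) (∫ z, J.det * starRingEnd ℂ J.det * (χ z *
        (Real.exp (-(t⁻¹ * ∑ i, Complex.normSq (∑ j, J i j * (z j - p j)))) : ℂ))) :=
      ((algebraMapCLM ℂ A).restrictScalars ℝ).map_smul _ _
    rw [e4, ← ContinuousLinearMap.integral_comp_comm]
    · congr 2
      funext z
      rw [smul_eq_mul, Algebra.smul_def, algebraMapCLM_apply, map_mul, map_mul, map_mul]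
      generalize algebraMap ℂ A (χ z) = a
      generalize algebraMap ℂ A (_ : ℂ) = b
      ring
    · refine Continuous.integrable_of_hasCompactSupport ?_ ?_
      · refine continuous_const.mul (hχ.continuous.mul (Complex.continuous_ofReal.comp
          (Real.continuous_exp.comp (continuous_const.mul (continuous_finsetSum _ fun i _ =>
            Complex.continuous_normSq.comp (contDiff_affineForm J p i).continuous)).neg)))
      · exact (hc.mul_right).mul_left
  · rw [algebraMapCLM_apply]
    congr 1
    rw [Complex.mul_conj, ← Complex.coe_smul, smul_eq_mul, ← mul_assoc]
    push_cast
    rw [mul_inv_cancel₀ hJn, one_mul]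

end LinearModel

/-! ### Hadamard's lemma and smooth extension -/

section Hadamard

variable {n : ℕ}

open MeasureTheory

/-- The mean of `f` over the segment from `p` to `z`. -/
noncomputable def segmentMean (f : BodySpace n → ℂ) (p z : BodySpace n) : ℂ :=
  ∫ s in (0 : ℝ)..1, f (p + s • (z - p))

/-- Smooth dependence on `z` is obtained by reading the mean as a convolution, with parameter `z`,
of the indicator of `(0, 1]` with a smooth compactly supported function, evaluated at `0`. -/
theorem contDiff_segmentMean {f : BodySpace n → ℂ} (hf : ContDiff ℝ ∞ f) (p : BodySpace n) :
    ContDiff ℝ ∞ (segmentMean f p) := by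
  let θ : ContDiffBump (0 : ℝ) := ⟨1, 2, one_pos, by norm_num⟩
  -- A convolution at `0` evaluates `g` at `-t`, hence the sign in front of `u`. The bump function
  -- is `1` on `[-1, 1]`, so it supplies compact support without affecting the relevant values.
  let g : BodySpace n → ℝ → ℂ := fun z u => θ u • f (p + (-u) • (z - p))
  have hg : ContDiff ℝ ∞ (Function.uncurry g) := by
    refine (θ.contDiff.comp contDiff_snd).smul (hf.comp ?_)
    exact contDiff_const.add (contDiff_snd.neg.smul (contDiff_fst.sub contDiff_const))
  have h := contDiffOn_convolution_right_with_param_comp (𝕜 := ℝ) (n := ⊤) (μ := volume)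
    (ContinuousLinearMap.lsmul ℝ ℝ (E := ℂ)) (s := Set.univ)
    (v := fun _ : BodySpace n => (0 : ℝ)) contDiff_const.contDiffOn
    (f := (Set.Ioc (0 : ℝ) 1).indicator fun _ => (1 : ℝ)) (g := g) (k := Metric.closedBall 0 2)
    isOpen_univ (isCompact_closedBall 0 2)
    (fun z u _ hu => by
      have : θ u = 0 := θ.zero_of_le_dist (not_le.1 hu).le
      simp [g, this])
    ((integrable_indicator_iff measurableSet_Ioc).2
      (integrableOn_const (by simp))).locallyIntegrable hg.contDiffOn
  rw [contDiffOn_univ] at h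
  convert h using 1
  funext z
  rw [convolution_def, segmentMean, intervalIntegral.integral_of_le zero_le_one,
    ← integral_indicator measurableSet_Ioc]
  congr 1
  funext t
  by_cases ht : t ∈ Set.Ioc (0 : ℝ) 1
  · have h1 : θ (-t) = 1 := θ.one_of_mem_closedBall (by
      simp only [Metric.mem_closedBall, dist_zero_right, norm_neg, Real.norm_eq_abs]
      rw [abs_of_pos ht.1]
      exact ht.2)
    simp [ht, g, h1]
  · simp [ht]

theorem segmentMean_self (f : BodySpace n → ℂ) (p : BodySpace n) : segmentMean f p p = f p := by
  simp [segmentMean]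

theorem segmentMean_eq_zero {f : BodySpace n → ℂ} {p z : BodySpace n}
    (h : ∀ s ∈ Set.Icc (0 : ℝ) 1, f (p + s • (z - p)) = 0) : segmentMean f p z = 0 := by
  unfold segmentMean
  rw [intervalIntegral.integral_congr (g := fun _ => 0)]
  · simp
  · intro s hs
    rw [Set.uIcc_of_le zero_le_one] at hs
    exact h s hs

/-- Hadamard's lemma: the fundamental theorem of calculus on the segment from `p` to `z`, with the
differential written in Wirtinger derivatives. -/
theorem eq_add_sum_segmentMean {f : BodySpace n → ℂ} (hf : ContDiff ℝ ∞ f) (p z : BodySpace n) :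
    f z = f p + ∑ j, ((z j - p j) * segmentMean (wirt (-Complex.I) j f) p z
      + starRingEnd ℂ (z j - p j) * segmentMean (wirt Complex.I j f) p z) := by
  have hline (s : ℝ) : HasDerivAt (fun s : ℝ => p + s • (z - p)) (z - p) s := by
    simpa using ((hasDerivAt_id s).smul_const (z - p)).const_add p
  have hd (s : ℝ) : HasDerivAt (fun s : ℝ => f (p + s • (z - p)))
      (fderiv ℝ f (p + s • (z - p)) (z - p)) s :=
    ((ContDiff.differentiableAt_infty hf _).hasFDerivAt).comp_hasDerivAt s (hline s)
  have hlc : Continuous fun s : ℝ => p + s • (z - p) := by fun_prop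
  have hw (κ : ℂ) (j : Fin n) : Continuous fun s : ℝ => wirt κ j f (p + s • (z - p)) :=
    hf.wirt.continuous.comp hlc
  have hs (c κ : ℂ) (j : Fin n) : Continuous fun s : ℝ => c • wirt κ j f (p + s • (z - p)) :=
    (continuous_const_smul c).comp (hw κ j)
  have hi := intervalIntegral.integral_eq_sub_of_hasDerivAt (a := 0) (b := 1) (fun s _ => hd s)
    (by
      refine Continuous.intervalIntegrable ?_ _ _
      simp only [fderiv_eq_sum_wirt]
      refine continuous_finsetSum _ fun j _ => ?_
      exact (hs _ _ j).add (hs _ _ j))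
  simp only [fderiv_eq_sum_wirt, one_smul, zero_smul, add_zero, add_sub_cancel] at hi
  rw [intervalIntegral.integral_finsetSum] at hi
  · rw [← sub_eq_iff_eq_add', ← hi]
    refine Finset.sum_congr rfl fun j _ => ?_
    rw [intervalIntegral.integral_add, intervalIntegral.integral_smul,
      intervalIntegral.integral_smul]
    · simp [segmentMean]
    · exact (hs _ _ j).intervalIntegrable _ _
    · exact (hs _ _ j).intervalIntegrable _ _
  · exact fun j _ => ((hs _ _ j).add (hs _ _ j)).intervalIntegrable _ _

/-- Multiplication by a bump function. The integrals with a cutoff are treated for globally smooth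
data, whereas the given data are smooth on `U` only. -/
theorem exists_contDiff_eqOn_ball {M : Type*} [NormedAddCommGroup M] [NormedSpace ℝ M]
    {f : BodySpace n → M} {p : BodySpace n} {r R : ℝ} (hr : 0 < r) (hrR : r < R)
    (hf : ContDiffOn ℝ ∞ f (Metric.ball p R)) :
    ∃ g : BodySpace n → M, ContDiff ℝ ∞ g ∧ ∀ z ∈ Metric.closedBall p r, g z = f z := by
  let χ : ContDiffBump p := ⟨r, (r + R) / 2, hr, by linarith⟩
  refine ⟨fun z => χ z • f z, ?_, fun z hz => by
    change χ z • f z = f z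
    rw [χ.one_of_mem_closedBall hz, one_smul]⟩
  rw [contDiff_iff_contDiffAt]
  intro z
  by_cases hz : z ∈ Metric.ball p R
  · exact χ.contDiff.contDiffAt.smul (hf.contDiffAt (Metric.isOpen_ball.mem_nhds hz))
  · have hz' : z ∉ tsupport χ := by
      rw [χ.tsupport_eq]
      intro h
      refine hz (Metric.closedBall_subset_ball ?_ h)
      change (r + R) / 2 < R
      linarith
    refine (contDiffAt_const (c := (0 : M))).congr_of_eventuallyEq ?_
    filter_upwards [notMem_tsupport_iff_eventuallyEq.1 hz'] with w hw
    rw [hw, Pi.zero_apply, zero_smul]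

end Hadamard

/-! ### Lower bound for the phase and division by the components of g -/

section Gap

variable {n : ℕ}

theorem wirt_eq_of_hasFDerivAt {M : Type*} [NormedAddCommGroup M] [NormedSpace ℂ M]
    {f : BodySpace n → M} (z v : BodySpace n) (h : ∀ j, wirt Complex.I j f z = 0) :
    fderiv ℝ f z v = ∑ j, v j • wirt (-Complex.I) j f z := by
  rw [fderiv_eq_sum_wirt]
  simp [h]

/-- The invertible linear part grows at least linearly, and the remainder of `g` is at most half of
that near `p`. So the bound survives on the whole segment between the affine model and `g`. -/
theorem exists_sum_normSq_ge {g : Fin n → BodySpace n → ℂ} {p : BodySpace n}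
    (hd : ∀ i, DifferentiableAt ℝ (g i) p) (hz : ∀ i j, wirt Complex.I j (g i) p = 0)
    (h0 : ∀ i, g i p = 0) {J : Matrix (Fin n) (Fin n) ℂ}
    (hJ : ∀ i j, J i j = wirt (-Complex.I) j (g i) p) (hdet : J.det ≠ 0) :
    ∃ c > 0, ∃ r > 0, ∀ z, ‖z - p‖ < r → ∀ s ∈ Set.Icc (0 : ℝ) 1, c * ‖z - p‖ ^ 2 ≤
      ∑ i, Complex.normSq (affineForm J p i z + s * (g i z - affineForm J p i z)) := by
  obtain ⟨K, hK0, hK⟩ : ∃ K > 0, ∀ v : BodySpace n, ‖v‖ ≤ K * ‖J.mulVec v‖ := by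
    let L : BodySpace n →L[ℂ] BodySpace n := LinearMap.toContinuousLinearMap (Matrix.toLin' J⁻¹)
    refine ⟨‖L‖ + 1, by positivity, fun v => ?_⟩
    have h1 : L (J.mulVec v) = v := by
      change Matrix.toLin' J⁻¹ (J.mulVec v) = v
      rw [Matrix.toLin'_apply, Matrix.mulVec_mulVec,
        Matrix.nonsing_inv_mul _ (isUnit_iff_ne_zero.2 hdet), Matrix.one_mulVec]
    calc ‖v‖ = ‖L (J.mulVec v)‖ := by rw [h1]
      _ ≤ ‖L‖ * ‖J.mulVec v‖ := L.le_opNorm _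
      _ ≤ _ := by gcongr; linarith
  -- `(2 * K)⁻¹` is half of the constant `K⁻¹` in the lower bound for `J`; the other half remains
  -- and its square is the constant `c`.
  have hsmall : ∀ᶠ z in 𝓝 p, ∀ i, ‖g i z - affineForm J p i z‖ ≤ (2 * K)⁻¹ * ‖z - p‖ := by
    rw [Filter.eventually_all]
    intro i
    have h1 := (hd i).hasFDerivAt.isLittleO
    rw [Asymptotics.isLittleO_iff] at h1
    filter_upwards [h1 (c := (2 * K)⁻¹) (by positivity)] with z hz1
    rw [h0, sub_zero, wirt_eq_of_hasFDerivAt _ _ (hz i)] at hz1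
    have e : affineForm J p i z = ∑ j, (z - p) j • wirt (-Complex.I) j (g i) p :=
      Finset.sum_congr rfl fun j _ => by rw [hJ, smul_eq_mul, mul_comm, Pi.sub_apply]
    rw [e]
    exact hz1
  obtain ⟨r, hr, hball⟩ := Metric.eventually_nhds_iff_ball.1 hsmall
  refine ⟨((2 * K)⁻¹) ^ 2, by positivity, r, hr, fun z hzr s hs => ?_⟩
  have h2 := hball z (by rwa [Metric.mem_ball, dist_eq_norm])
  set w : BodySpace n := fun i => affineForm J p i z + s * (g i z - affineForm J p i z) with hw
  have h3 : ‖J.mulVec (z - p)‖ ≤ ‖w‖ + (2 * K)⁻¹ * ‖z - p‖ := by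
    refine (pi_norm_le_iff_of_nonneg (by positivity)).2 fun i => ?_
    have e : (J.mulVec (z - p)) i = w i - s * (g i z - affineForm J p i z) := by
      simp only [hw, add_sub_cancel_right]
      rfl
    rw [e]
    refine (norm_sub_le _ _).trans (add_le_add (norm_le_pi_norm w i) ?_)
    rw [norm_mul, Complex.norm_real, Real.norm_of_nonneg hs.1]
    calc s * ‖g i z - affineForm J p i z‖ ≤ 1 * ‖g i z - affineForm J p i z‖ := by
          gcongr
          exact hs.2
      _ ≤ _ := by rw [one_mul]; exact h2 i
  have h4 : (2 * K)⁻¹ * ‖z - p‖ ≤ ‖w‖ := by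
    have h5 := hK (z - p)
    have h6 : K⁻¹ * ‖z - p‖ ≤ ‖J.mulVec (z - p)‖ := by
      rw [inv_mul_le_iff₀ hK0]
      exact h5
    have h7 : (2 * K)⁻¹ = K⁻¹ / 2 := by
      rw [mul_inv]
      ring
    rw [h7] at h3 ⊢
    linarith
  have h8 : ‖w‖ ^ 2 ≤ ∑ i, Complex.normSq (w i) := by
    have h9 : ‖w‖ ≤ Real.sqrt (∑ i, Complex.normSq (w i)) := by
      refine (pi_norm_le_iff_of_nonneg (Real.sqrt_nonneg _)).2 fun i => ?_
      refine Real.le_sqrt_of_sq_le ?_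
      rw [← Complex.normSq_eq_norm_sq]
      exact Finset.single_le_sum (f := fun i => Complex.normSq (w i))
        (fun i _ => Complex.normSq_nonneg _) (Finset.mem_univ i)
    calc ‖w‖ ^ 2 ≤ Real.sqrt (∑ i, Complex.normSq (w i)) ^ 2 := by gcongr
      _ = _ := Real.sq_sqrt (Finset.sum_nonneg fun i _ => Complex.normSq_nonneg _)
  calc _ = ((2 * K)⁻¹ * ‖z - p‖) ^ 2 := by ring
    _ ≤ ‖w‖ ^ 2 := by gcongr
    _ ≤ _ := h8

/-- Smooth functions are combinations of a constant and the `g i` and their conjugates. -/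
theorem exists_ball_division {g : Fin n → BodySpace n → ℂ} (hg : ∀ i, ContDiff ℝ ∞ (g i))
    {p : BodySpace n} {R : ℝ} (hR : 0 < R)
    (hz : ∀ z ∈ Metric.ball p R, ∀ i j, wirt Complex.I j (g i) z = 0)
    (h0 : ∀ i, g i p = 0) (hdet : (wirtJacobian (-Complex.I) g p).det ≠ 0) :
    ∃ r > 0, ∀ φ : BodySpace n → ℂ, ContDiff ℝ ∞ φ → ∃ ψ ψ' : Fin n → BodySpace n → ℂ,
      (∀ i, ContDiff ℝ ∞ (ψ i)) ∧ (∀ i, ContDiff ℝ ∞ (ψ' i)) ∧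
      ∀ z ∈ Metric.ball p r, φ z = φ p
        + ∑ i, (g i z * ψ i z + starRingEnd ℂ (g i z) * ψ' i z) := by
  -- Since `g` is holomorphic on the ball, Hadamard's lemma reads `g z = a(z) (z - p)`, and `a(p)`
  -- is the Jacobian.
  let a : BodySpace n → Matrix (Fin n) (Fin n) ℂ := fun z =>
    Matrix.of fun i j => segmentMean (wirt (-Complex.I) j (g i)) p z
  have ha (i j : Fin n) : ContDiff ℝ ∞ fun z => a z i j := contDiff_segmentMean (hg i).wirt p
  have hga (z : BodySpace n) (hzR : z ∈ Metric.ball p R) (i : Fin n) :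
      g i z = ((a z).mulVec (z - p)) i := by
    rw [eq_add_sum_segmentMean (hg i) p z, h0, zero_add]
    refine Finset.sum_congr rfl fun j _ => ?_
    have e : segmentMean (wirt Complex.I j (g i)) p z = 0 := segmentMean_eq_zero fun s hs =>
      hz _ ((convex_ball p R).add_smul_sub_mem (Metric.mem_ball_self hR) hzR hs) i j
    rw [e, mul_zero, add_zero, mul_comm]
    rfl
  have hap : a p = wirtJacobian (-Complex.I) g p := by
    ext i j
    exact segmentMean_self _ _
  have hdc : ContDiff ℝ ∞ fun z => (a z).det := ContDiff.matrix_det ha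
  have hnz : ∀ᶠ z in 𝓝 p, (a z).det ≠ 0 := by
    refine hdc.continuous.continuousAt.eventually_ne ?_
    rwa [hap]
  obtain ⟨r₀, hr₀, hball⟩ := Metric.eventually_nhds_iff_ball.1 hnz
  set r₁ := min r₀ R with hr₁
  have hr₁0 : 0 < r₁ := lt_min hr₀ hR
  have hinv : ContDiffOn ℝ ∞ (fun z => ((a z).det)⁻¹) (Metric.ball p r₁) := fun z hz1 =>
    (hdc.contDiffAt.inv (hball z (Metric.ball_subset_ball (min_le_left _ _) hz1))).contDiffWithinAt
  -- `d` is a globally smooth function that equals `1 / det a` near `p`, and `B = d · adj a` is then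
  -- the inverse of `a` there.
  obtain ⟨d, hd, hdeq⟩ := exists_contDiff_eqOn_ball (half_pos hr₁0) (half_lt_self hr₁0) hinv
  let B : Fin n → Fin n → BodySpace n → ℂ := fun j i z => d z * (a z).adjugate j i
  have hB (j i : Fin n) : ContDiff ℝ ∞ (B j i) := hd.mul (ContDiff.matrix_adjugate ha j i)
  refine ⟨r₁ / 2, half_pos hr₁0, fun φ hφ => ?_⟩
  refine ⟨fun i z => ∑ j, B j i z * segmentMean (wirt (-Complex.I) j φ) p z,
    fun i z => ∑ j, starRingEnd ℂ (B j i z) * segmentMean (wirt Complex.I j φ) p z,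
    fun i => ContDiff.sum fun j _ => (hB j i).mul (contDiff_segmentMean hφ.wirt p),
    fun i => ContDiff.sum fun j _ =>
      (contDiff_conj_comp (hB j i)).mul (contDiff_segmentMean hφ.wirt p), fun z hzr => ?_⟩
  have hz1 : z ∈ Metric.ball p r₁ := Metric.ball_subset_ball (by linarith) hzr
  have hzR : z ∈ Metric.ball p R := Metric.ball_subset_ball (min_le_right _ _) hz1
  have hdet1 : (a z).det ≠ 0 := hball z (Metric.ball_subset_ball (min_le_left _ _) hz1)
  -- The coordinates are combinations of the `g i`, and their conjugates are combinations of the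
  -- conjugates. Substituting both into Hadamard's lemma for `φ` gives the division.
  have hy (j : Fin n) : z j - p j = ∑ i, B j i z * g i z := by
    have h1 : (a z).adjugate.mulVec ((a z).mulVec (z - p)) = (a z).det • (z - p) := by
      rw [Matrix.mulVec_mulVec, Matrix.adjugate_mul, Matrix.smul_mulVec, Matrix.one_mulVec]
    have h2 := congrFun h1 j
    simp only [B, mul_assoc]
    rw [← Finset.mul_sum, hdeq z (Metric.ball_subset_closedBall hzr), eq_inv_mul_iff_mul_eq₀ hdet1]
    rw [Pi.smul_apply, smul_eq_mul, Pi.sub_apply] at h2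
    rw [← h2, Matrix.mulVec, dotProduct]
    refine Finset.sum_congr rfl fun i _ => ?_
    rw [hga z hzR i]
  rw [eq_add_sum_segmentMean hφ p z, Finset.sum_add_distrib, Finset.sum_add_distrib]
  congr 1
  congr 1
  · simp only [hy, Finset.sum_mul, Finset.mul_sum]
    rw [Finset.sum_comm]
    exact Finset.sum_congr rfl fun i _ => Finset.sum_congr rfl fun j _ => by ring
  · simp only [hy, map_sum, map_mul, Finset.sum_mul, Finset.mul_sum]
    rw [Finset.sum_comm]
    exact Finset.sum_congr rfl fun i _ => Finset.sum_congr rfl fun j _ => by ring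

end Gap

/-! ### Algebras with a body map whose kernel is nilpotent -/

section LocalAlgebra

variable {A : Type*} [NormedCommRing A] [NormedAlgebra ℂ A]

/-- A nonzero scalar plus a nilpotent element is a unit. -/
theorem isUnit_of_body_ne_zero (b : A →ₐ[ℂ] ℂ) {N : ℕ} (hb : RingHom.ker b ^ N = ⊥) {a : A}
    (ha : b a ≠ 0) : IsUnit a := by
  have h1 : IsNilpotent (a - algebraMap ℂ A (b a)) := by
    refine ⟨N, ?_⟩
    have : a - algebraMap ℂ A (b a) ∈ RingHom.ker b := by
      rw [RingHom.mem_ker, map_sub, AlgHom.commutes]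
      exact sub_self _
    have h2 := Ideal.pow_mem_pow this N
    rwa [hb, Ideal.mem_bot] at h2
  have h2 : IsUnit (algebraMap ℂ A (b a)) := (isUnit_iff_ne_zero.2 ha).map _
  have h3 := h1.isUnit_add_left_of_commute h2 (mul_comm _ _)
  rwa [add_sub_cancel] at h3

/-- Every element is its body plus a combination of nilpotent elements. -/
theorem exists_body_decomposition [FiniteDimensional ℂ A] (b : A →ₐ[ℂ] ℂ) :
    ∃ (q : ℕ) (β : Fin q → A) (c : Fin q → A →L[ℂ] ℂ), (∀ m, β m ∈ RingHom.ker b) ∧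
      ∀ a, a = algebraMap ℂ A (b a) + ∑ m, β m * algebraMap ℂ A (c m a) := by
  let e := Module.finBasis ℂ A
  -- The souls of the vectors of a basis, with the coordinate functionals as coefficients.
  refine ⟨_, fun m => e m - algebraMap ℂ A (b (e m)),
    fun m => LinearMap.toContinuousLinearMap (e.coord m), fun m => ?_, fun a => ?_⟩
  · rw [RingHom.mem_ker, map_sub, AlgHom.commutes]
    exact sub_self _
  · have h1 := e.sum_repr a
    have h2 : b a = ∑ m, e.repr a m * b (e m) := by
      conv_lhs => rw [← h1]
      rw [map_sum]
      exact Finset.sum_congr rfl fun m _ => by rw [map_smul, smul_eq_mul]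
    have h3 (m) : (e m - algebraMap ℂ A (b (e m))) * algebraMap ℂ A (e.coord m a)
        = e.repr a m • e m - algebraMap ℂ A (e.repr a m * b (e m)) := by
      rw [Algebra.smul_def, map_mul, Module.Basis.coord_apply]
      ring
    have h4 (m) : (e m - algebraMap ℂ A (b (e m))) *
        algebraMap ℂ A ((LinearMap.toContinuousLinearMap (e.coord m)) a)
        = e.repr a m • e m - algebraMap ℂ A (e.repr a m * b (e m)) := h3 m
    simp only [h4, Finset.sum_sub_distrib, h1]
    rw [h2, map_sum]
    ring

end LocalAlgebra

/-! ### Holomorphic G and antiholomorphic H near a nondegenerate zero -/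

section CriticalPair

variable {n : ℕ} {A : Type*} [NormedCommRing A] [NormedAlgebra ℂ A] [FiniteDimensional ℂ A]
  [CompleteSpace A]

attribute [local instance] isScalarTower_real smulCommClass_complex

theorem wirt_body (b : A →ₐ[ℂ] ℂ) {κ : ℂ} {j : Fin n} {f : BodySpace n → A} {z : BodySpace n}
    (hf : DifferentiableAt ℝ f z) : wirt κ j (fun w => b (f w)) z = b (wirt κ j f z) :=
  wirt_clm (LinearMap.toContinuousLinearMap b.toLinearMap) hf

theorem contDiff_body_comp (b : A →ₐ[ℂ] ℂ) {f : BodySpace n → A} (hf : ContDiff ℝ ∞ f) :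
    ContDiff ℝ ∞ fun w => b (f w) :=
  (((LinearMap.toContinuousLinearMap b.toLinearMap).restrictScalars ℝ).contDiff).comp hf

theorem continuous_body (b : A →ₐ[ℂ] ℂ) : Continuous b :=
  (LinearMap.toContinuousLinearMap b.toLinearMap).continuous

theorem body_det_wirtJacobian (b : A →ₐ[ℂ] ℂ) {κ : ℂ} {G : Fin n → BodySpace n → A}
    (hG : ∀ i, ContDiff ℝ ∞ (G i)) (z : BodySpace n) :
    b (wirtJacobian κ G z).det = (wirtJacobian κ (fun i z => b (G i z)) z).det := by
  rw [AlgHom.map_det]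
  congr 1
  ext i j
  exact (wirt_body b (ContDiff.differentiableAt_infty (hG i) z)).symm

theorem tsupport_wirt_subset_of_eq_one {χ : BodySpace n → ℂ} {p : BodySpace n} {ρ : ℝ}
    (hρ : ∀ z ∈ Metric.ball p ρ, χ z = 1) (κ : ℂ) (j : Fin n) {z : BodySpace n}
    (hz : z ∈ tsupport (wirt κ j χ)) : ρ ≤ ‖z - p‖ := by
  by_contra! h
  refine (notMem_tsupport_iff_eventuallyEq.2 ?_) hz
  have hzb : z ∈ Metric.ball p ρ := by rwa [Metric.mem_ball, dist_eq_norm]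
  filter_upwards [Metric.isOpen_ball.mem_nhds hzb] with w hw
  rw [wirt_congr (g := fun _ => (1 : ℂ)), wirt_const, Pi.zero_apply]
  filter_upwards [Metric.isOpen_ball.mem_nhds hw] with v hv
  exact hρ v hv

/-- `G` is holomorphic and `H` antiholomorphic near `p`, their bodies are conjugate, and `p` is a
nondegenerate zero of the body of `G`. -/
structure IsCriticalPair (b : A →ₐ[ℂ] ℂ) (p : BodySpace n) (R : ℝ)
    (G H : Fin n → BodySpace n → A) : Prop where
  pos : 0 < R
  contDiff_left : ∀ i, ContDiff ℝ ∞ (G i)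
  contDiff_right : ∀ i, ContDiff ℝ ∞ (H i)
  wirt_left : ∀ z ∈ Metric.ball p R, ∀ i j, wirt Complex.I j (G i) z = 0
  wirt_right : ∀ z ∈ Metric.ball p R, ∀ i j, wirt (-Complex.I) j (H i) z = 0
  body_right : ∀ z ∈ Metric.ball p R, ∀ i, b (H i z) = starRingEnd ℂ (b (G i z))
  body_left : ∀ i, b (G i p) = 0
  det_ne_zero : b (wirtJacobian (-Complex.I) G p).det ≠ 0

/-- A smooth cutoff function, equal to `1` near `p`. -/
structure IsCutoff (χ : BodySpace n → ℂ) (p : BodySpace n) (r : ℝ) : Prop where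
  contDiff : ContDiff ℝ ∞ χ
  hasCompactSupport : HasCompactSupport χ
  tsupport_subset : tsupport χ ⊆ Metric.ball p r
  eq_one : ∃ ρ > 0, ∀ z ∈ Metric.ball p ρ, χ z = 1

theorem exists_isCutoff (p : BodySpace n) {r : ℝ} (hr : 0 < r) : ∃ χ, IsCutoff χ p r := by
  let f : ContDiffBump p := ⟨r / 3, r / 2, by positivity, by linarith⟩
  have h : tsupport (fun z => (f z : ℂ)) ⊆ Metric.closedBall p (r / 2) := by
    refine closure_minimal (fun z hz => ?_) Metric.isClosed_closedBall
    by_contra h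
    refine hz ?_
    change (f z : ℂ) = 0
    rw [f.zero_of_le_dist (not_le.1 h).le, Complex.ofReal_zero]
  refine ⟨fun z => (f z : ℂ), Complex.ofRealCLM.contDiff.comp f.contDiff, ?_, ?_, r / 3,
    by positivity, fun z hz => ?_⟩
  · exact (isCompact_closedBall p (r / 2)).of_isClosed_subset (isClosed_tsupport _) h
  · exact h.trans (Metric.closedBall_subset_ball (by linarith))
  · rw [f.one_of_mem_closedBall (Metric.ball_subset_closedBall hz), Complex.ofReal_one]

theorem IsCutoff.mono {χ : BodySpace n → ℂ} {p : BodySpace n} {r r' : ℝ} (h : IsCutoff χ p r)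
    (hr : r ≤ r') : IsCutoff χ p r' :=
  ⟨h.1, h.2, h.3.trans (Metric.ball_subset_ball hr), h.4⟩

variable {b : A →ₐ[ℂ] ℂ} {p : BodySpace n} {R : ℝ} {G H : Fin n → BodySpace n → A}

namespace IsCriticalPair

theorem wirt_body_left (h : IsCriticalPair b p R G H) {z : BodySpace n}
    (hz : z ∈ Metric.ball p R) (i j : Fin n) : wirt Complex.I j (fun w => b (G i w)) z = 0 := by
  rw [wirt_body b (ContDiff.differentiableAt_infty (h.contDiff_left i) z), h.wirt_left z hz,
    map_zero]

theorem det_body_ne_zero (h : IsCriticalPair b p R G H) :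
    (wirtJacobian (-Complex.I) (fun i z => b (G i z)) p).det ≠ 0 := by
  rw [← body_det_wirtJacobian b h.contDiff_left]
  exact h.det_ne_zero

theorem body_sum_mul (h : IsCriticalPair b p R G H) {z : BodySpace n}
    (hz : z ∈ Metric.ball p R) :
    b (∑ i, G i z * H i z) = ((∑ i, Complex.normSq (b (G i z)) : ℝ) : ℂ) := by
  rw [map_sum, Complex.ofReal_sum]
  exact Finset.sum_congr rfl fun i _ => by rw [map_mul, h.body_right z hz, Complex.mul_conj]

theorem exists_gap (h : IsCriticalPair b p R G H) : ∃ c > 0, ∃ r > 0, r ≤ R ∧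
    ∀ z ∈ Metric.ball p r, ∀ s ∈ Set.Icc (0 : ℝ) 1, c * ‖z - p‖ ^ 2 ≤
      ∑ i, Complex.normSq (affineForm (wirtJacobian (-Complex.I) (fun i z => b (G i z)) p) p i z
        + s * (b (G i z)
          - affineForm (wirtJacobian (-Complex.I) (fun i z => b (G i z)) p) p i z)) := by
  obtain ⟨c, hc, r, hr, hgap⟩ := exists_sum_normSq_ge (g := fun i z => b (G i z)) (p := p)
    (fun i => ContDiff.differentiableAt_infty (contDiff_body_comp b (h.contDiff_left i)) p)
    (fun i j => h.wirt_body_left (Metric.mem_ball_self h.pos) i j) h.body_left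
    (J := wirtJacobian (-Complex.I) (fun i z => b (G i z)) p) (fun _ _ => rfl) h.det_body_ne_zero
  refine ⟨c, hc, min r R, lt_min hr h.pos, min_le_right _ _, fun z hz => hgap z ?_⟩
  rw [← dist_eq_norm]
  exact lt_of_lt_of_le hz (min_le_left _ _)

theorem exists_body_ge (h : IsCriticalPair b p R G H) : ∃ c > 0, ∃ r > 0, r ≤ R ∧
    ∀ z ∈ Metric.ball p r, c * ‖z - p‖ ^ 2 ≤ (b (∑ i, G i z * H i z)).re := by
  obtain ⟨c, hc, r, hr, hrR, hgap⟩ := h.exists_gap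
  refine ⟨c, hc, r, hr, hrR, fun z hz => ?_⟩
  rw [h.body_sum_mul (Metric.ball_subset_ball hrR hz), Complex.ofReal_re]
  simpa using hgap z hz 1 (by simp)

/-- Deform the affine model of the body into `(G, H)`; the souls of `G` and `H` are switched on
along the same segment. The body of the phase is a sum of squared moduli at each stage, so the gap
keeps it positive where the cutoff is not constant. -/
theorem tendsto_localInt_det (h : IsCriticalPair b p R G H) {N : ℕ}
    (hb : RingHom.ker b ^ N = ⊥) : ∃ r > 0, ∀ χ, IsCutoff χ p r →
      Filter.Tendsto (fun t : ℝ => localInt χ (fun z => ∑ i, G i z * H i z) t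
        (fun z => (wirtJacobian (-Complex.I) G z).det * (wirtJacobian Complex.I H z).det))
        (𝓝[>] 0) (𝓝 (algebraMap ℂ A ((Real.pi : ℂ) ^ n))) := by
  obtain ⟨c, hc, r, hr, hrR, hgap⟩ := h.exists_gap
  set J := wirtJacobian (-Complex.I) (fun i z => b (G i z)) p with hJ
  refine ⟨r, hr, fun χ hχ => ?_⟩
  obtain ⟨ρ, hρ, hρ1⟩ := hχ.eq_one
  have hl (i : Fin n) := contDiff_affineForm J p i
  have hG0 (i : Fin n) : ContDiff ℝ ∞ fun z => algebraMap ℂ A (affineForm J p i z) :=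
    contDiff_algebraMap_comp (hl i)
  have hH0 (i : Fin n) :
      ContDiff ℝ ∞ fun z => algebraMap ℂ A (starRingEnd ℂ (affineForm J p i z)) :=
    contDiff_algebraMap_comp (contDiff_conj_comp (hl i))
  have hG0z (z : BodySpace n) (i j : Fin n) :
      wirt Complex.I j (fun z => algebraMap ℂ A (affineForm J p i z)) z = 0 := by
    rw [wirt_algebraMap (ContDiff.differentiableAt_infty (hl i) z), wirt_bar_affineForm, map_zero]
  have hH0z (z : BodySpace n) (i j : Fin n) : wirt (-Complex.I) j
      (fun z => algebraMap ℂ A (starRingEnd ℂ (affineForm J p i z))) z = 0 := by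
    rw [wirt_algebraMap (ContDiff.differentiableAt_infty (contDiff_conj_comp (hl i)) z),
      wirt_conj (ContDiff.differentiableAt_infty (hl i) z), map_neg, Complex.conj_I, neg_neg,
      wirt_bar_affineForm, map_zero, map_zero]
  have hsub {κ : ℂ} {j : Fin n} {f g : BodySpace n → A} {z : BodySpace n} (hf : ContDiff ℝ ∞ f)
      (hg : ContDiff ℝ ∞ g) (hfz : wirt κ j f z = 0) (hgz : wirt κ j g z = 0) :
      wirt κ j (fun w => f w - g w) z = 0 := by
    have hg' : ContDiff ℝ ∞ fun w => (-1 : A) * g w := contDiff_const.mul hg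
    have e : (fun w => f w - g w) = fun w => f w + (-1 : A) * g w := by
      funext w
      ring
    rw [e, wirt_add (ContDiff.differentiableAt_infty hf z) (ContDiff.differentiableAt_infty hg' z),
      wirt_mul (differentiableAt_const _) (ContDiff.differentiableAt_infty hg z), wirt_const, hfz,
      hgz]
    ring
  obtain ⟨C, hC, hbd⟩ := norm_localInt_det_sub_le b hb hχ.contDiff hχ.hasCompactSupport
    (U := Metric.ball p R) Metric.isOpen_ball
    (hχ.tsupport_subset.trans (Metric.ball_subset_ball hrR)) hG0
    (ν := fun i z => G i z - algebraMap ℂ A (affineForm J p i z))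
    (fun i => (h.contDiff_left i).sub (hG0 i)) hH0
    (μ := fun i z => H i z - algebraMap ℂ A (starRingEnd ℂ (affineForm J p i z)))
    (fun i => (h.contDiff_right i).sub (hH0 i)) (fun z _ i j => hG0z z i j)
    (fun z hz i j => hsub (h.contDiff_left i) (hG0 i) (h.wirt_left z hz i j) (hG0z z i j))
    (fun z _ i j => hH0z z i j)
    (fun z hz i j => hsub (h.contDiff_right i) (hH0 i) (h.wirt_right z hz i j) (hH0z z i j))
    -- The derivatives of the cutoff live at distance at least `ρ` from `p`, where the quadratic
    -- lower bound is at least `c * ρ ^ 2`.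
    (c := c * ρ ^ 2) (by positivity) (by
      intro s hs κ j z hz
      have hzr := hχ.tsupport_subset (tsupport_wirt_subset χ κ j hz)
      have hzρ := tsupport_wirt_subset_of_eq_one hρ1 κ j hz
      have e : b (∑ i, (algebraMap ℂ A (affineForm J p i z)
          + s • (G i z - algebraMap ℂ A (affineForm J p i z))) *
          (algebraMap ℂ A (starRingEnd ℂ (affineForm J p i z))
          + s • (H i z - algebraMap ℂ A (starRingEnd ℂ (affineForm J p i z)))))
          = ((∑ i, Complex.normSq (affineForm J p i z
            + s * (b (G i z) - affineForm J p i z)) : ℝ) : ℂ) := by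
        rw [map_sum, Complex.ofReal_sum]
        refine Finset.sum_congr rfl fun i _ => ?_
        rw [← Complex.mul_conj, map_mul, map_add, map_add, ← Complex.coe_smul, ← Complex.coe_smul,
          map_smul, map_smul, map_sub, map_sub, AlgHom.commutes, AlgHom.commutes,
          h.body_right z (Metric.ball_subset_ball hrR hzr)]
        simp
      rw [e, Complex.ofReal_re]
      refine le_trans ?_ (hgap z hzr s hs)
      gcongr)
  simp only [add_sub_cancel] at hbd
  have h1 := tendsto_localInt_affineForm (A := A) hχ.contDiff hχ.hasCompactSupport
    (J := J) h.det_body_ne_zero p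
  rw [hρ1 p (Metric.mem_ball_self hρ), one_mul] at h1
  have h2 : Filter.Tendsto (fun t : ℝ =>
      localInt χ (fun z => ∑ i, G i z * H i z) t
        (fun z => (wirtJacobian (-Complex.I) G z).det * (wirtJacobian Complex.I H z).det)
      - localInt χ (fun z => ∑ i, algebraMap ℂ A (affineForm J p i z) *
          algebraMap ℂ A (starRingEnd ℂ (affineForm J p i z))) t
        (fun z => (wirtJacobian (-Complex.I)
            (fun i z => algebraMap ℂ A (affineForm J p i z)) z).det *
          (wirtJacobian Complex.I
            (fun i z => algebraMap ℂ A (starRingEnd ℂ (affineForm J p i z))) z).det))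
      (𝓝[>] 0) (𝓝 0) := by
    refine squeeze_zero_norm' (a := fun t : ℝ => C * t) ?_ ?_
    · filter_upwards [Ioc_mem_nhdsGT (zero_lt_one' ℝ)] with t ht
      exact hbd t ht.1 ht.2
    · have : Filter.Tendsto (fun t : ℝ => C * t) (𝓝 0) (𝓝 (C * 0)) :=
        Filter.tendsto_id.const_mul C
      rw [mul_zero] at this
      exact this.mono_left nhdsWithin_le_nhds
  have h3 := h2.add h1
  simpa using h3

end IsCriticalPair

/-- Integration by parts: multiplying the amplitude by a component of the gradient of the phase
gains a factor `t`. -/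
theorem exists_norm_localInt_mul_sub_le {N : ℕ} (hb : RingHom.ker b ^ N = ⊥) {κ : ℂ}
    {F K : Fin n → BodySpace n → A} (hF : ∀ i, ContDiff ℝ ∞ (F i)) (hK : ∀ i, ContDiff ℝ ∞ (K i))
    {r : ℝ} (hr : 0 < r) (hKz : ∀ z ∈ Metric.ball p r, ∀ i j, wirt κ j (K i) z = 0)
    (hdet : ∀ z ∈ Metric.ball p r, b (wirtJacobian κ F z).det ≠ 0) {χ : BodySpace n → ℂ}
    (hχ : IsCutoff χ p (r / 2)) {c : ℝ} (hc : 0 < c)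
    (hdec : ∀ j, ∀ z ∈ tsupport (wirt κ j χ), c ≤ (b (∑ i, F i z * K i z)).re)
    (i : Fin n) {ψ : BodySpace n → A} (hψ : ContDiff ℝ ∞ ψ) :
    ∃ D : BodySpace n → A, ContDiff ℝ ∞ D ∧ ∃ C : ℝ, 0 ≤ C ∧ ∀ t : ℝ, 0 < t → t ≤ 1 →
      ‖localInt χ (fun z => ∑ k, F k z * K k z) t (fun z => K i z * ψ z)
        - t • localInt χ (fun z => ∑ k, F k z * K k z) t D‖ ≤ C * t := by
  have hJ := contDiff_wirtJacobian (κ := κ) hF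
  have hS : ContDiff ℝ ∞ fun z => ∑ k, F k z * K k z :=
    ContDiff.sum fun k _ => (hF k).mul (hK k)
  have hdc : ContDiff ℝ ∞ fun z => (wirtJacobian κ F z).det := ContDiff.matrix_det hJ
  have hinv : ContDiffOn ℝ ∞ (fun z => Ring.inverse (wirtJacobian κ F z).det)
      (Metric.ball p r) := fun z hz => by
    obtain ⟨u, hu⟩ := isUnit_of_body_ne_zero b hb (hdet z hz)
    have h1 := contDiffAt_ringInverse ℝ (n := ∞) u
    rw [hu] at h1
    exact (h1.comp z hdc.contDiffAt).contDiffWithinAt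
  obtain ⟨Q, hQ, hQeq⟩ := exists_contDiff_eqOn_ball (half_pos hr) (half_lt_self hr) hinv
  -- The column `i` of the inverse of `∂F`. As `K` is annihilated by the operators, the gradient of
  -- the phase is `∂F` applied to `K`, and pairing it with `X` isolates `K i`.
  let X : Fin n → BodySpace n → A := fun j z => Q z * (wirtJacobian κ F z).adjugate j i
  have hX (j : Fin n) : ContDiff ℝ ∞ (X j) := hQ.mul (ContDiff.matrix_adjugate hJ j i)
  have hXS : ∀ z ∈ tsupport χ, ∑ j, X j z * wirt κ j (fun z => ∑ k, F k z * K k z) z = K i z := by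
    intro z hz
    have hz2 := hχ.tsupport_subset hz
    have hzr : z ∈ Metric.ball p r := Metric.ball_subset_ball (by linarith) hz2
    have e1 (j : Fin n) : wirt κ j (fun z => ∑ k, F k z * K k z) z
        = ∑ k, wirtJacobian κ F z k j * K k z := by
      rw [wirt_sum _ fun k _ => ContDiff.differentiableAt_infty ((hF k).mul (hK k)) z]
      refine Finset.sum_congr rfl fun k _ => ?_
      rw [wirt_mul (ContDiff.differentiableAt_infty (hF k) z)
        (ContDiff.differentiableAt_infty (hK k) z), hKz z hzr, mul_zero, add_zero]
      rfl
    have e2 (k : Fin n) : ∑ j, wirtJacobian κ F z k j * (wirtJacobian κ F z).adjugate j i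
        = (wirtJacobian κ F z).det * (1 : Matrix (Fin n) (Fin n) A) k i := by
      have := congrFun (congrFun (Matrix.mul_adjugate (wirtJacobian κ F z)) k) i
      rwa [Matrix.mul_apply, Matrix.smul_apply, smul_eq_mul] at this
    calc _ = ∑ k, Q z * (∑ j, wirtJacobian κ F z k j * (wirtJacobian κ F z).adjugate j i)
          * K k z := by
          simp only [e1, X, Finset.mul_sum, Finset.sum_mul]
          rw [Finset.sum_comm]
          exact Finset.sum_congr rfl fun k _ => Finset.sum_congr rfl fun j _ => by ring
      _ = K i z := by
          simp only [e2]
          rw [Finset.sum_eq_single i]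
          · rw [Matrix.one_apply_eq, mul_one, hQeq z (Metric.ball_subset_closedBall hz2),
              Ring.inverse_mul_cancel _ (isUnit_of_body_ne_zero b hb (hdet z hzr)), one_mul]
          · intro k _ hk
            rw [Matrix.one_apply_ne hk, mul_zero, mul_zero, zero_mul]
          · simp
  -- For the terms with a derivative of the cutoff boundedness is enough, hence the exponent `0`:
  -- integration by parts already supplies the factor `t`.
  have hbd (j : Fin n) := norm_localInt_le_pow (M := A) b hb (hχ.contDiff.wirt (κ := κ) (j := j))
    (hχ.hasCompactSupport.wirt κ j) hS ((hX j).mul hψ) hc (hdec j) 0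
  choose C hC hbd using hbd
  -- The new amplitude is the divergence of `ψ` times the field `X`.
  refine ⟨fun z => ∑ j, wirt κ j (fun w => X j w * ψ w) z,
    ContDiff.sum fun j _ => ((hX j).mul hψ).wirt, ∑ j, C j, Finset.sum_nonneg fun j _ => hC j,
    fun t ht ht1 => ?_⟩
  have h1 := localInt_smul_eq (M := A) hχ.contDiff hχ.hasCompactSupport hS hψ hX hXS ht
  simp only [smul_eq_mul] at h1
  rw [h1, smul_add, add_sub_cancel_left, norm_smul, Real.norm_of_nonneg ht.le, mul_comm]
  refine mul_le_mul_of_nonneg_right ((norm_sum_le _ _).trans (Finset.sum_le_sum fun j _ => ?_))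
    ht.le
  have h2 := hbd j t ht ht1
  rwa [pow_zero, mul_one] at h2

end CriticalPair

/-! ### Reduction of all amplitudes to the constant amplitude -/

section Asymptotics

variable {n : ℕ} {A : Type*} [NormedCommRing A] [NormedAlgebra ℂ A] [FiniteDimensional ℂ A]
  [CompleteSpace A]

attribute [local instance] isScalarTower_real smulCommClass_complex

variable {b : A →ₐ[ℂ] ℂ} {p : BodySpace n} {R : ℝ} {G H : Fin n → BodySpace n → A}

/-- Modulo nilpotent elements, every smooth function is a constant plus a combination of the `G i`
and the `H i`. -/
theorem IsCriticalPair.exists_division (h : IsCriticalPair b p R G H) :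
    ∃ r > 0, r ≤ R ∧ ∃ (q : ℕ) (β : Fin q → A), (∀ m, β m ∈ RingHom.ker b) ∧
      ∀ φ : BodySpace n → A, ContDiff ℝ ∞ φ → ∃ (a : A) (ψ ψ' : Fin n → BodySpace n → A)
        (ρ : Fin q → BodySpace n → A), (∀ i, ContDiff ℝ ∞ (ψ i)) ∧ (∀ i, ContDiff ℝ ∞ (ψ' i)) ∧
        (∀ m, ContDiff ℝ ∞ (ρ m)) ∧ ∀ z ∈ Metric.ball p r,
          φ z = a + ∑ i, G i z * ψ i z + ∑ i, H i z * ψ' i z + ∑ m, β m * ρ m z := by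
  obtain ⟨r, hr, hdiv⟩ := exists_ball_division
    (fun i => contDiff_body_comp b (h.contDiff_left i)) h.pos
    (fun z hz i j => h.wirt_body_left hz i j) h.body_left h.det_body_ne_zero
  obtain ⟨q, β, c, hβ, hc⟩ := exists_body_decomposition b
  have hcs (m : Fin q) {f : BodySpace n → A} (hf : ContDiff ℝ ∞ f) :
      ContDiff ℝ ∞ fun z => algebraMap ℂ A (c m (f z)) :=
    contDiff_algebraMap_comp (((c m).restrictScalars ℝ).contDiff.comp hf)
  refine ⟨min r R, lt_min hr h.pos, min_le_right _ _, q, β, hβ, fun φ hφ => ?_⟩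
  obtain ⟨ψ, ψ', hψ, hψ', heq⟩ := hdiv _ (contDiff_body_comp b hφ)
  refine ⟨algebraMap ℂ A (b (φ p)), fun i z => algebraMap ℂ A (ψ i z),
    fun i z => algebraMap ℂ A (ψ' i z),
    -- Division is available for the bodies only. Replacing the body of `G i` or `H i` by the
    -- element itself creates an error with nilpotent coefficients, which is moved into the
    -- functions multiplying the `β m`.
    fun m z => algebraMap ℂ A (c m (φ z)) - ∑ i, (algebraMap ℂ A (c m (G i z)) *
      algebraMap ℂ A (ψ i z) + algebraMap ℂ A (c m (H i z)) * algebraMap ℂ A (ψ' i z)),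
    fun i => contDiff_algebraMap_comp (hψ i), fun i => contDiff_algebraMap_comp (hψ' i),
    fun m => (hcs m hφ).sub (ContDiff.sum fun i _ =>
      ((hcs m (h.contDiff_left i)).mul (contDiff_algebraMap_comp (hψ i))).add
      ((hcs m (h.contDiff_right i)).mul (contDiff_algebraMap_comp (hψ' i)))), fun z hz => ?_⟩
  have hzr := Metric.ball_subset_ball (min_le_left _ _) hz
  have hzR := Metric.ball_subset_ball (min_le_right _ _) hz
  have hG (i : Fin n) : algebraMap ℂ A (b (G i z))
      = G i z - ∑ m, β m * algebraMap ℂ A (c m (G i z)) := eq_sub_of_add_eq (hc (G i z)).symm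
  have hH (i : Fin n) : algebraMap ℂ A (starRingEnd ℂ (b (G i z)))
      = H i z - ∑ m, β m * algebraMap ℂ A (c m (H i z)) := by
    rw [← h.body_right z hzR]
    exact eq_sub_of_add_eq (hc (H i z)).symm
  conv_lhs => rw [hc (φ z), heq z hzr]
  rw [map_add, map_sum]
  simp only [map_add, map_mul, hG, hH, mul_sub, sub_mul, Finset.sum_sub_distrib,
    Finset.sum_add_distrib, mul_add, Finset.mul_sum, Finset.sum_mul]
  rw [Finset.sum_comm (s := (Finset.univ : Finset (Fin q))),
    Finset.sum_comm (s := (Finset.univ : Finset (Fin q)))]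
  simp only [mul_assoc]
  ring

variable {χ : BodySpace n → ℂ} {S : BodySpace n → A}

/-- If every smooth function is, up to a constant and nilpotent multiples, a combination of
functions `F k` that are killed by Taylor evaluation and gain a factor `t` in the integral, then the
integral is, to leading order, a multiple of Taylor evaluation. -/
theorem norm_localInt_sub_le {N : ℕ} (hb : RingHom.ker b ^ N = ⊥) (hN : 0 < N)
    (hχ : IsCutoff χ p R) (hR : 0 < R) (hS : ContDiff ℝ ∞ S)
    (hpos : ∀ z ∈ tsupport χ, 0 ≤ (b (S z)).re)
    {s s' : Fin n → A} (hs : ∀ j, s j ∈ RingHom.ker b) (hs' : ∀ j, s' j ∈ RingHom.ker b)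
    {ι : Type*} [Fintype ι] {F : ι → BodySpace n → A} (hF : ∀ k, ContDiff ℝ ∞ (F k))
    (hF0 : ∀ k, taylorEval s s' N p (F k) = 0)
    (hibp : ∀ k, ∀ ψ : BodySpace n → A, ContDiff ℝ ∞ ψ → ∃ D : BodySpace n → A, ContDiff ℝ ∞ D ∧
      ∃ C : ℝ, 0 ≤ C ∧ ∀ t : ℝ, 0 < t → t ≤ 1 →
        ‖localInt χ S t (fun z => F k z * ψ z) - t • localInt χ S t D‖ ≤ C * t)
    {q : ℕ} {β : Fin q → A} (hβ : ∀ m, β m ∈ RingHom.ker b)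
    (hdiv : ∀ φ : BodySpace n → A, ContDiff ℝ ∞ φ → ∃ (a : A) (ψ : ι → BodySpace n → A)
      (ρ : Fin q → BodySpace n → A), (∀ k, ContDiff ℝ ∞ (ψ k)) ∧ (∀ m, ContDiff ℝ ∞ (ρ m)) ∧
      ∀ z ∈ Metric.ball p R, φ z = a + ∑ k, F k z * ψ k z + ∑ m, β m * ρ m z)
    {φ : BodySpace n → A} (hφ : ContDiff ℝ ∞ φ) :
    ∃ C : ℝ, 0 ≤ C ∧ ∀ t : ℝ, 0 < t → t ≤ 1 →
      ‖localInt χ S t φ - localInt χ S t (fun _ => 1) * taylorEval s s' N p φ‖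
        ≤ C * t * (1 + ‖localInt χ S t (fun _ => (1 : A))‖) := by
  set L : ℝ → (BodySpace n → A) → A := fun t f => localInt χ S t f with hL
  set ev : (BodySpace n → A) → A := fun f => taylorEval s s' N p f with hev
  have hpb : p ∈ Metric.ball p R := Metric.mem_ball_self hR
  have evmul {f g : BodySpace n → A} (hf : ContDiff ℝ ∞ f) (hg : ContDiff ℝ ∞ g) :
      ev (fun z => f z * g z) = ev f * ev g :=
    taylorEval_mul isOpen_univ hs hs' hb hf.contDiffOn hg.contDiffOn (Set.mem_univ p)
  have evadd {f g : BodySpace n → A} (hf : ContDiff ℝ ∞ f) (hg : ContDiff ℝ ∞ g) :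
      ev (fun z => f z + g z) = ev f + ev g :=
    taylorEval_add s s' isOpen_univ hf.contDiffOn hg.contDiffOn N (Set.mem_univ p)
  have evconst (a : A) : ev (fun _ => a) = a := taylorEval_const s s' a hN p
  have Ladd (t : ℝ) {f g : BodySpace n → A} (hf : ContDiff ℝ ∞ f) (hg : ContDiff ℝ ∞ g) :
      L t (fun z => f z + g z) = L t f + L t g :=
    localInt_add hχ.contDiff hχ.hasCompactSupport hS hf hg t
  have Lmul (t : ℝ) (a : A) {f : BodySpace n → A} (hf : ContDiff ℝ ∞ f) :
      L t (fun z => a * f z) = a * L t f :=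
    localInt_const_smul a hχ.contDiff hχ.hasCompactSupport hS hf t
  set K := n + N with hK
  -- Double induction. The multiplier `a` has nilpotency order at least `N - d`, so for `d = 0` it
  -- is zero. The index `m` counts the powers of `t` gained against the crude loss `t⁻¹ ^ K`.
  -- Dividing `φ` leaves terms with a factor `F k`, which are `t` times a case with `m` lowered, and
  -- terms with a factor `β l`, which are absorbed into `a` and lower `d`. The factor `1 + ‖L t 1‖`
  -- stays in the estimate because the integral of `1` is not yet known to be bounded.
  have key : ∀ (d m : ℕ), ∀ a ∈ RingHom.ker b ^ (N - d), ∀ φ : BodySpace n → A,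
      ContDiff ℝ ∞ φ → ∃ C : ℝ, 0 ≤ C ∧ ∀ t : ℝ, 0 < t → t ≤ 1 →
        ‖a * (L t φ - L t (fun _ => 1) * ev φ)‖
          ≤ C * (t + t⁻¹ ^ K * t ^ m) * (1 + ‖L t fun _ => 1‖) := by
    intro d
    induction d with
    | zero =>
      intro m a ha φ _
      rw [Nat.sub_zero, hb, Ideal.mem_bot] at ha
      refine ⟨0, le_rfl, fun t _ _ => ?_⟩
      rw [ha, zero_mul, norm_zero, zero_mul, zero_mul]
    | succ d ihd =>
      intro m
      induction m with
      | zero =>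
        intro a _ φ hφ
        obtain ⟨C, hC, hbd⟩ := norm_localInt_le b hb hχ.contDiff hχ.hasCompactSupport hS hφ 0 hpos
        refine ⟨‖a‖ * (C + ‖ev φ‖), by positivity, fun t ht ht1 => ?_⟩
        have h1 := hbd t ht ht1
        rw [mul_zero, neg_zero, Real.exp_zero, mul_one] at h1
        have ht' : 1 ≤ t⁻¹ ^ K := one_le_pow₀ ((one_le_inv₀ ht).2 ht1)
        have hl : 0 ≤ ‖L t fun _ => 1‖ := norm_nonneg _
        have h2 : ‖L t φ - L t (fun _ => 1) * ev φ‖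
            ≤ (C + ‖ev φ‖) * t⁻¹ ^ K * (1 + ‖L t fun _ => 1‖) := by
          calc _ ≤ C * t⁻¹ ^ K + ‖L t fun _ => 1‖ * ‖ev φ‖ :=
                (norm_sub_le _ _).trans (add_le_add h1 (norm_mul_le _ _))
            _ ≤ C * t⁻¹ ^ K * (1 + ‖L t fun _ => 1‖)
                + (‖ev φ‖ * t⁻¹ ^ K) * (1 + ‖L t fun _ => 1‖) := by
                refine add_le_add (le_mul_of_one_le_right (by positivity) (by linarith)) ?_
                rw [mul_comm]
                refine mul_le_mul (le_mul_of_one_le_right (norm_nonneg _) ht') (by linarith) hl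
                  (by positivity)
            _ = _ := by ring
        calc _ ≤ ‖a‖ * ‖L t φ - L t (fun _ => 1) * ev φ‖ := norm_mul_le _ _
          _ ≤ ‖a‖ * ((C + ‖ev φ‖) * t⁻¹ ^ K * (1 + ‖L t fun _ => 1‖)) := by gcongr
          _ ≤ _ := by
            rw [pow_zero, mul_one]
            have : (C + ‖ev φ‖) * t⁻¹ ^ K ≤ (C + ‖ev φ‖) * (t + t⁻¹ ^ K) := by
              gcongr
              linarith
            calc _ ≤ ‖a‖ * ((C + ‖ev φ‖) * (t + t⁻¹ ^ K) * (1 + ‖L t fun _ => 1‖)) := by gcongr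
              _ = _ := by ring
      | succ m ihm =>
        intro a ha φ hφ
        obtain ⟨a₀, ψ, ρ, hψ, hρ, heq⟩ := hdiv φ hφ
        have hFψ (k : ι) : ContDiff ℝ ∞ fun z => F k z * ψ k z := (hF k).mul (hψ k)
        have hβρ (l : Fin q) : ContDiff ℝ ∞ fun z => β l * ρ l z := contDiff_const.mul (hρ l)
        have hsF : ContDiff ℝ ∞ fun z => ∑ k, F k z * ψ k z := ContDiff.sum fun k _ => hFψ k
        have hsβ : ContDiff ℝ ∞ fun z => ∑ l, β l * ρ l z := ContDiff.sum fun l _ => hβρ l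
        choose D hD C hC hbd using fun k => hibp k (ψ k) (hψ k)
        choose C₁ hC₁ hbd₁ using fun k => ihm a ha (D k) (hD k)
        -- The multiplication by `β l` raises the order by one. The subtraction is truncated, but `N
        -- - d ≤ N - (d + 1) + 1` holds in every case.
        have haβ (l : Fin q) : a * β l ∈ RingHom.ker b ^ (N - d) := by
          have h1 : a * β l ∈ RingHom.ker b ^ (N - (d + 1) + 1) := by
            rw [pow_succ]
            exact Ideal.mul_mem_mul ha (hβ l)
          exact Ideal.pow_le_pow_right (by omega) h1
        choose C₂ hC₂ hbd₂ using fun l => ihd (m + 1) (a * β l) (haβ l) (ρ l) (hρ l)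
        have hLφ (t : ℝ) : L t φ = a₀ * L t (fun _ => 1) + ∑ k, L t (fun z => F k z * ψ k z)
            + ∑ l, β l * L t (ρ l) := by
          have e1 : L t φ = L t fun z => a₀ * 1 + ∑ k, F k z * ψ k z + ∑ l, β l * ρ l z :=
            localInt_congr (fun z hz => by rw [mul_one, heq z (hχ.tsupport_subset hz)]) t
          have e2 : L t (fun z => ∑ k, F k z * ψ k z) = ∑ k, L t (fun z => F k z * ψ k z) :=
            localInt_sum _ hχ.contDiff hχ.hasCompactSupport hS (fun k _ => hFψ k) t
          have e3 : L t (fun z => ∑ l, β l * ρ l z) = ∑ l, L t (fun z => β l * ρ l z) :=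
            localInt_sum _ hχ.contDiff hχ.hasCompactSupport hS (fun l _ => hβρ l) t
          rw [e1, Ladd t ((contDiff_const (c := a₀ * 1)).add hsF) hsβ,
            Ladd t (contDiff_const (c := a₀ * 1)) hsF, e2, e3,
            Lmul t a₀ (contDiff_const (c := (1 : A)))]
          congr 1
          exact Finset.sum_congr rfl fun l _ => Lmul t (β l) (hρ l)
        have heφ : ev φ = a₀ + ∑ l, β l * ev (ρ l) := by
          -- Taylor evaluation at `p` depends only on the function near `p`, so the division on the
          -- ball may be inserted.
          have e1 : ev φ = ev fun z => a₀ + ∑ k, F k z * ψ k z + ∑ l, β l * ρ l z :=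
            taylorEval_congr s s' Metric.isOpen_ball (fun z hz => heq z hz) N hpb
          have e4 : ev (fun z => ∑ k, F k z * ψ k z) = ∑ k, ev (fun z => F k z * ψ k z) :=
            taylorEval_sum s s' isOpen_univ _ (fun k _ => (hFψ k).contDiffOn) N (Set.mem_univ p)
          have e5 : ev (fun z => ∑ l, β l * ρ l z) = ∑ l, ev (fun z => β l * ρ l z) :=
            taylorEval_sum s s' isOpen_univ _ (fun l _ => (hβρ l).contDiffOn) N (Set.mem_univ p)
          rw [e1, evadd ((contDiff_const (c := a₀)).add hsF) hsβ,
            evadd (contDiff_const (c := a₀)) hsF, e4, e5, evconst]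
          have e2 (k : ι) : ev (fun z => F k z * ψ k z) = 0 := by
            rw [evmul (hF k) (hψ k)]
            change taylorEval s s' N p (F k) * _ = 0
            rw [hF0, zero_mul]
          have e3 (l : Fin q) : ev (fun z => β l * ρ l z) = β l * ev (ρ l) := by
            rw [evmul contDiff_const (hρ l), evconst]
          simp [e2, e3]
        refine ⟨∑ k, (‖a‖ * C k + C₁ k + ‖a‖ * ‖ev (D k)‖) + ∑ l, C₂ l,
          add_nonneg (Finset.sum_nonneg fun k _ => by have := hC k; have := hC₁ k; positivity)
            (Finset.sum_nonneg fun l _ => hC₂ l), fun t ht ht1 => ?_⟩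
        set Λ := L t (fun _ => 1) with hΛ
        have hΛ0 : 0 ≤ ‖Λ‖ := norm_nonneg _
        set T := t + t⁻¹ ^ K * t ^ (m + 1) with hT
        have htT : t ≤ T := by
          have : 0 ≤ t⁻¹ ^ K * t ^ (m + 1) := by positivity
          linarith
        have e : a * (L t φ - Λ * ev φ) = ∑ k, a * L t (fun z => F k z * ψ k z)
            + ∑ l, a * β l * (L t (ρ l) - Λ * ev (ρ l)) := by
          rw [hLφ, heφ, mul_add Λ, Finset.mul_sum (a := Λ)]
          simp only [mul_sub, Finset.sum_sub_distrib, mul_add, Finset.mul_sum]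
          have : ∑ l, a * (Λ * (β l * ev (ρ l))) = ∑ l, a * β l * (Λ * ev (ρ l)) :=
            Finset.sum_congr rfl fun l _ => by ring
          rw [this]
          simp only [mul_assoc]
          ring
        have b1 (k : ι) : ‖a * L t (fun z => F k z * ψ k z)‖
            ≤ (‖a‖ * C k + C₁ k + ‖a‖ * ‖ev (D k)‖) * T * (1 + ‖Λ‖) := by
          have e2 : a * L t (fun z => F k z * ψ k z)
              = a * (L t (fun z => F k z * ψ k z) - t • L t (D k))
                + t • (a * (L t (D k) - Λ * ev (D k))) + t • (a * (Λ * ev (D k))) := by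
            rw [add_assoc, ← smul_add, ← mul_add, sub_add_cancel, mul_sub, mul_smul_comm, sub_add_cancel]
          rw [e2]
          have n1 : ‖a * (L t (fun z => F k z * ψ k z) - t • L t (D k))‖
              ≤ ‖a‖ * C k * T * (1 + ‖Λ‖) := by
            calc _ ≤ ‖a‖ * (C k * t) := (norm_mul_le _ _).trans
                  (mul_le_mul_of_nonneg_left (hbd k t ht ht1) (norm_nonneg _))
              _ ≤ ‖a‖ * (C k * T) := by
                  have := hC k
                  gcongr
              _ = ‖a‖ * C k * T * 1 := by ring
              _ ≤ _ := by
                  have := hC k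
                  have : 0 ≤ T := ht.le.trans htT
                  gcongr
                  linarith
          have n2 : ‖t • (a * (L t (D k) - Λ * ev (D k)))‖ ≤ C₁ k * T * (1 + ‖Λ‖) := by
            rw [norm_smul, Real.norm_of_nonneg ht.le]
            have h3 := hbd₁ k t ht ht1
            have h4 : t * (t + t⁻¹ ^ K * t ^ m) ≤ T := by
              have : t * t ≤ t := mul_le_of_le_one_left ht.le ht1
              calc t * (t + t⁻¹ ^ K * t ^ m) = t * t + t⁻¹ ^ K * t ^ (m + 1) := by ring
                _ ≤ _ := by rw [hT]; gcongr
            calc _ ≤ t * (C₁ k * (t + t⁻¹ ^ K * t ^ m) * (1 + ‖Λ‖)) := by gcongr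
              _ = C₁ k * (t * (t + t⁻¹ ^ K * t ^ m)) * (1 + ‖Λ‖) := by ring
              _ ≤ _ := by
                have := hC₁ k
                gcongr
          have n3 : ‖t • (a * (Λ * ev (D k)))‖ ≤ ‖a‖ * ‖ev (D k)‖ * T * (1 + ‖Λ‖) := by
            rw [norm_smul, Real.norm_of_nonneg ht.le]
            calc _ ≤ t * (‖a‖ * (‖Λ‖ * ‖ev (D k)‖)) := by
                  refine mul_le_mul_of_nonneg_left ((norm_mul_le _ _).trans ?_) ht.le
                  exact mul_le_mul_of_nonneg_left (norm_mul_le _ _) (norm_nonneg _)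
              _ ≤ T * (‖a‖ * ((1 + ‖Λ‖) * ‖ev (D k)‖)) := by
                  have : 0 ≤ T := ht.le.trans htT
                  gcongr
                  linarith
              _ = _ := by ring
          refine (norm_add₃_le).trans ?_
          calc _ ≤ _ := add_le_add (add_le_add n1 n2) n3
            _ = _ := by ring
        rw [e]
        calc _ ≤ ∑ k, (‖a‖ * C k + C₁ k + ‖a‖ * ‖ev (D k)‖) * T * (1 + ‖Λ‖)
              + ∑ l, C₂ l * T * (1 + ‖Λ‖) := by
              refine (norm_add_le _ _).trans (add_le_add ?_ ?_)
              · exact (norm_sum_le _ _).trans (Finset.sum_le_sum fun k _ => b1 k)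
              · exact (norm_sum_le _ _).trans (Finset.sum_le_sum fun l _ => hbd₂ l t ht ht1)
          _ = _ := by
              rw [← Finset.sum_mul, ← Finset.sum_mul, ← Finset.sum_mul, ← Finset.sum_mul]
              ring
  -- For `d = N` the condition on the multiplier is empty, so `a = 1` is allowed; `m = K + 1` turns
  -- `t⁻¹ ^ K * t ^ m` into `t`.
  obtain ⟨C, hC, hbd⟩ := key N (K + 1) 1 (by simp) φ hφ
  refine ⟨C * 2, by positivity, fun t ht ht1 => ?_⟩
  have h1 := hbd t ht ht1
  rw [one_mul, pow_succ, ← mul_assoc, ← mul_pow, inv_mul_cancel₀ ht.ne', one_pow, one_mul,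
    ← two_mul] at h1
  calc _ ≤ _ := h1
    _ = _ := by ring

end Asymptotics

/-! ### The limit of the integrals with cutoff -/

section Limit

variable {n : ℕ} {A M : Type*} [NormedCommRing A] [NormedAlgebra ℂ A] [FiniteDimensional ℂ A]
  [CompleteSpace A] [NormedAddCommGroup M] [NormedSpace ℂ M] [Module A M] [IsBoundedSMul A M]
  [IsScalarTower ℂ A M] [FiniteDimensional ℂ M]

attribute [local instance] isScalarTower_real smulCommClass_complex

variable {b : A →ₐ[ℂ] ℂ} {p : BodySpace n} {R : ℝ} {G H : Fin n → BodySpace n → A}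

theorem IsCriticalPair.det_right_ne_zero (h : IsCriticalPair b p R G H) :
    b (wirtJacobian Complex.I H p).det ≠ 0 := by
  rw [body_det_wirtJacobian b h.contDiff_right]
  have e : wirtJacobian Complex.I (fun i z => b (H i z)) p
      = (wirtJacobian (-Complex.I) (fun i z => b (G i z)) p).map (starRingEnd ℂ) := by
    ext i j
    change wirt Complex.I j (fun z => b (H i z)) p
      = starRingEnd ℂ (wirt (-Complex.I) j (fun z => b (G i z)) p)
    rw [wirt_congr (g := fun z => starRingEnd ℂ (b (G i z))),
      wirt_conj (ContDiff.differentiableAt_infty (contDiff_body_comp b (h.contDiff_left i)) p),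
      Complex.conj_I]
    filter_upwards [Metric.isOpen_ball.mem_nhds (Metric.mem_ball_self h.pos)] with z hz
    exact h.body_right z hz i
  rw [e, ← RingHom.mapMatrix_apply, ← RingHom.map_det]
  simpa using h.det_body_ne_zero

theorem IsCriticalPair.contDiff_det (h : IsCriticalPair b p R G H) : ContDiff ℝ ∞
    fun z => (wirtJacobian (-Complex.I) G z).det * (wirtJacobian Complex.I H z).det :=
  (ContDiff.matrix_det (contDiff_wirtJacobian h.contDiff_left)).mul
    (ContDiff.matrix_det (contDiff_wirtJacobian h.contDiff_right))

/-- Evaluation changes a value by an element of the kernel of the body map only, so a nonzero body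
at `p` persists. -/
theorem isUnit_taylorEval {N : ℕ} (hb : RingHom.ker b ^ N = ⊥) (hN : 0 < N) {s s' : Fin n → A}
    (hs : ∀ j, s j ∈ RingHom.ker b) (hs' : ∀ j, s' j ∈ RingHom.ker b) {f : BodySpace n → A}
    (hf : ContDiff ℝ ∞ f) (hfp : b (f p) ≠ 0) : IsUnit (taylorEval s s' N p f) := by
  refine isUnit_of_body_ne_zero b hb ?_
  have h1 := taylorEval_sub_mem isOpen_univ hs hs' hN hf.contDiffOn (Set.mem_univ p)
  rw [RingHom.mem_ker, map_sub, sub_eq_zero] at h1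
  rwa [h1]

/-- Localization of the integral at the zero of `G`. -/
theorem IsCriticalPair.exists_tendsto_localInt_algebra (h : IsCriticalPair b p R G H) {N : ℕ}
    (hb : RingHom.ker b ^ N = ⊥) (hN : 0 < N) {s s' : Fin n → A}
    (hs : ∀ j, s j ∈ RingHom.ker b) (hs' : ∀ j, s' j ∈ RingHom.ker b)
    (hG0 : ∀ i, taylorEval s s' N p (G i) = 0) (hH0 : ∀ i, taylorEval s s' N p (H i) = 0) :
    ∃ r > 0, ∀ χ, IsCutoff χ p r → ∀ φ : BodySpace n → A, ContDiff ℝ ∞ φ →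
      Filter.Tendsto (fun t : ℝ => localInt χ (fun z => ∑ i, G i z * H i z) t φ) (𝓝[>] 0)
        (𝓝 (algebraMap ℂ A ((Real.pi : ℂ) ^ n) * Ring.inverse (taylorEval s s' N p fun z =>
          (wirtJacobian (-Complex.I) G z).det * (wirtJacobian Complex.I H z).det)
          * taylorEval s s' N p φ)) := by
  obtain ⟨c, hc, r₁, hr₁, hr₁R, hge⟩ := h.exists_body_ge
  obtain ⟨r₂, hr₂, hdet⟩ := h.tendsto_localInt_det hb
  have hcl := body_det_wirtJacobian b (κ := -Complex.I) h.contDiff_left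
  have hcr := body_det_wirtJacobian b (κ := Complex.I) h.contDiff_right
  have hev : ∀ᶠ z in 𝓝 p, b (wirtJacobian (-Complex.I) G z).det ≠ 0 ∧
      b (wirtJacobian Complex.I H z).det ≠ 0 := by
    refine Filter.Eventually.and ?_ ?_
    · exact ((continuous_body b).comp (ContDiff.matrix_det
        (contDiff_wirtJacobian h.contDiff_left)).continuous).continuousAt.eventually_ne
        h.det_ne_zero
    · exact ((continuous_body b).comp (ContDiff.matrix_det
        (contDiff_wirtJacobian h.contDiff_right)).continuous).continuousAt.eventually_ne
        h.det_right_ne_zero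
  obtain ⟨r₃, hr₃, hunit⟩ := Metric.eventually_nhds_iff_ball.1 hev
  obtain ⟨r₄, hr₄, hr₄R, q, β, hβ, hdiv⟩ := h.exists_division
  set r₅ := min r₃ R with hr₅
  have hr₅0 : 0 < r₅ := lt_min hr₃ h.pos
  refine ⟨min (min r₁ r₂) (min (r₅ / 2) r₄), by positivity, fun χ hχ => ?_⟩
  have hχ1 : IsCutoff χ p r₁ := hχ.mono ((min_le_left _ _).trans (min_le_left _ _))
  have hχ2 : IsCutoff χ p r₂ := hχ.mono ((min_le_left _ _).trans (min_le_right _ _))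
  have hχ5 : IsCutoff χ p (r₅ / 2) := hχ.mono ((min_le_right _ _).trans (min_le_left _ _))
  have hχ4 : IsCutoff χ p r₄ := hχ.mono ((min_le_right _ _).trans (min_le_right _ _))
  obtain ⟨ρ, hρ, hρ1⟩ := hχ.eq_one
  set S : BodySpace n → A := fun z => ∑ i, G i z * H i z with hS
  have hSc : ContDiff ℝ ∞ S :=
    ContDiff.sum fun i _ => (h.contDiff_left i).mul (h.contDiff_right i)
  have hS' : S = fun z => ∑ i, H i z * G i z := by
    funext z
    exact Finset.sum_congr rfl fun i _ => mul_comm _ _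
  have hdec (κ : ℂ) (j : Fin n) : ∀ z ∈ tsupport (wirt κ j χ), c * ρ ^ 2 ≤ (b (S z)).re := by
    intro z hz
    have hzρ := tsupport_wirt_subset_of_eq_one hρ1 κ j hz
    refine le_trans ?_ (hge z (hχ1.tsupport_subset (tsupport_wirt_subset χ κ j hz)))
    gcongr
  have hR5 : Metric.ball p r₅ ⊆ Metric.ball p R := Metric.ball_subset_ball (min_le_right _ _)
  have h35 : Metric.ball p r₅ ⊆ Metric.ball p r₃ := Metric.ball_subset_ball (min_le_left _ _)
  have hibpH (i : Fin n) (ψ : BodySpace n → A) (hψ : ContDiff ℝ ∞ ψ) :=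
    exists_norm_localInt_mul_sub_le hb h.contDiff_left h.contDiff_right hr₅0
      (fun z hz => h.wirt_right z (hR5 hz)) (fun z hz => (hunit z (h35 hz)).1) hχ5
      (c := c * ρ ^ 2) (by positivity) (hdec _) i hψ
  have hibpG (i : Fin n) (ψ : BodySpace n → A) (hψ : ContDiff ℝ ∞ ψ) :=
    exists_norm_localInt_mul_sub_le hb h.contDiff_right h.contDiff_left hr₅0
      (fun z hz => h.wirt_left z (hR5 hz)) (fun z hz => (hunit z (h35 hz)).2) hχ5
      (c := c * ρ ^ 2) (by positivity) (fun j z hz => by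
        have h1 := hdec _ j z hz
        rwa [hS'] at h1) i hψ
  rw [← hS'] at hibpG
  -- The functions to divide by are the `G i` and the `H i` together: the first gain a factor `t`
  -- through the `∂̄`-derivatives, the second through the `∂`-derivatives.
  have main {φ : BodySpace n → A} (hφ : ContDiff ℝ ∞ φ) := norm_localInt_sub_le
    (ι := Fin n ⊕ Fin n) hb hN hχ4 hr₄ hSc
    (fun z hz => le_trans (by positivity) (hge z (hχ1.tsupport_subset hz))) hs hs'
    (F := Sum.elim G H) (by rintro (i | i); exacts [h.contDiff_left i, h.contDiff_right i])
    (by rintro (i | i); exacts [hG0 i, hH0 i])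
    (by rintro (i | i); exacts [hibpG i, hibpH i]) hβ
    (fun φ hφ => by
      obtain ⟨a, ψ, ψ', ρ, hψ, hψ', hρ, heq⟩ := hdiv φ hφ
      refine ⟨a, Sum.elim ψ ψ', ρ, by rintro (i | i); exacts [hψ i, hψ' i], hρ, fun z hz => ?_⟩
      rw [heq z hz, Fintype.sum_sum_type, ← add_assoc]
      rfl) hφ
  set δ : BodySpace n → A := fun z =>
    (wirtJacobian (-Complex.I) G z).det * (wirtJacobian Complex.I H z).det with hδ
  have hu : IsUnit (taylorEval s s' N p δ) := by
    refine isUnit_taylorEval hb hN hs hs' h.contDiff_det ?_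
    rw [map_mul]
    exact mul_ne_zero h.det_ne_zero h.det_right_ne_zero
  set v := Ring.inverse (taylorEval s s' N p δ) with hv
  have huv : taylorEval s s' N p δ * v = 1 := Ring.mul_inverse_cancel _ hu
  have hlim := hdet χ hχ2
  set Λ : ℝ → A := fun t => localInt χ S t (fun _ => 1) with hΛ
  -- An absorption argument. The amplitude `δ` has a convergent integral and an invertible value at
  -- `p`, so `Λ t` is bounded by a constant plus `C ‖v‖ t (1 + ‖Λ t‖)`; for small `t` that
  -- coefficient is below `1 / 2` and the term moves to the left.
  have hbounded : ∃ B : ℝ, ∀ᶠ t in 𝓝[>] (0 : ℝ), 1 + ‖Λ t‖ ≤ B := by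
    obtain ⟨C, hC, hbd⟩ := main h.contDiff_det
    have e1 : ∀ᶠ t in 𝓝[>] (0 : ℝ), ‖localInt χ S t δ‖
        < ‖algebraMap ℂ A ((Real.pi : ℂ) ^ n)‖ + 1 :=
      hlim.norm.eventually_lt_const (lt_add_one _)
    have e2 : ∀ᶠ t in 𝓝[>] (0 : ℝ), C * ‖v‖ * t < 1 / 2 := by
      have : Filter.Tendsto (fun t : ℝ => C * ‖v‖ * t) (𝓝 0) (𝓝 (C * ‖v‖ * 0)) :=
        Filter.tendsto_id.const_mul _
      rw [mul_zero] at this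
      exact (this.mono_left nhdsWithin_le_nhds).eventually_lt_const (by norm_num)
    refine ⟨1 + 2 * ((‖algebraMap ℂ A ((Real.pi : ℂ) ^ n)‖ + 1) * ‖v‖ + 1 / 2), ?_⟩
    filter_upwards [e1, e2, Ioc_mem_nhdsGT (zero_lt_one' ℝ)] with t h1 h2 ht
    have h3 := hbd t ht.1 ht.2
    have e3 : Λ t = localInt χ S t δ * v
        - (localInt χ S t δ - Λ t * taylorEval s s' N p δ) * v := by
      rw [sub_mul, sub_sub_cancel, mul_assoc, huv, mul_one]
    have h4 : ‖Λ t‖ ≤ (‖algebraMap ℂ A ((Real.pi : ℂ) ^ n)‖ + 1) * ‖v‖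
        + C * t * (1 + ‖Λ t‖) * ‖v‖ := by
      conv_lhs => rw [e3]
      refine (norm_sub_le _ _).trans (add_le_add ?_ ?_)
      · exact (norm_mul_le _ _).trans (by gcongr)
      · exact (norm_mul_le _ _).trans (by gcongr)
    have h5 : C * t * (1 + ‖Λ t‖) * ‖v‖ ≤ 1 / 2 * (1 + ‖Λ t‖) := by
      calc _ = C * ‖v‖ * t * (1 + ‖Λ t‖) := by ring
        _ ≤ _ := by gcongr
    linarith
  obtain ⟨B, hB⟩ := hbounded
  have hdiff {φ : BodySpace n → A} (hφ : ContDiff ℝ ∞ φ) : Filter.Tendsto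
      (fun t : ℝ => localInt χ S t φ - Λ t * taylorEval s s' N p φ) (𝓝[>] 0) (𝓝 0) := by
    obtain ⟨C, hC, hbd⟩ := main hφ
    refine squeeze_zero_norm' (a := fun t : ℝ => C * B * t) ?_ ?_
    · filter_upwards [hB, Ioc_mem_nhdsGT (zero_lt_one' ℝ)] with t h1 ht
      have := ht.1
      calc _ ≤ C * t * (1 + ‖Λ t‖) := hbd t ht.1 ht.2
        _ ≤ C * t * B := by gcongr
        _ = _ := by ring
    · have : Filter.Tendsto (fun t : ℝ => C * B * t) (𝓝 0) (𝓝 (C * B * 0)) :=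
        Filter.tendsto_id.const_mul _
      rw [mul_zero] at this
      exact this.mono_left nhdsWithin_le_nhds
  have hΛlim : Filter.Tendsto Λ (𝓝[>] 0) (𝓝 (algebraMap ℂ A ((Real.pi : ℂ) ^ n) * v)) := by
    have h1 := (hlim.sub (hdiff h.contDiff_det)).mul_const v
    rw [sub_zero] at h1
    refine h1.congr fun t => ?_
    rw [sub_sub_cancel, mul_assoc, huv, mul_one]
  intro φ hφ
  have h1 := (hdiff hφ).add (hΛlim.mul_const (taylorEval s s' N p φ))
  rw [zero_add] at h1
  refine h1.congr fun t => ?_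
  rw [sub_add_cancel]

/-- Coordinates in a basis of `M` over ℂ reduce this to amplitudes with values in `A`. Modules are
needed since the coefficients of a superform need not be even and so do not lie in the commutative
algebra. -/
theorem IsCriticalPair.exists_tendsto_localInt (h : IsCriticalPair b p R G H) {N : ℕ}
    (hb : RingHom.ker b ^ N = ⊥) (hN : 0 < N) {s s' : Fin n → A}
    (hs : ∀ j, s j ∈ RingHom.ker b) (hs' : ∀ j, s' j ∈ RingHom.ker b)
    (hG0 : ∀ i, taylorEval s s' N p (G i) = 0) (hH0 : ∀ i, taylorEval s s' N p (H i) = 0) :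
    ∃ r > 0, ∀ χ, IsCutoff χ p r → ∀ ψ : BodySpace n → M, ContDiff ℝ ∞ ψ →
      Filter.Tendsto (fun t : ℝ => localInt χ (fun z => ∑ i, G i z * H i z) t ψ) (𝓝[>] 0)
        (𝓝 ((algebraMap ℂ A ((Real.pi : ℂ) ^ n) * Ring.inverse (taylorEval s s' N p fun z =>
          (wirtJacobian (-Complex.I) G z).det * (wirtJacobian Complex.I H z).det))
          • taylorEval s s' N p ψ)) := by
  obtain ⟨r, hr, hlim⟩ := h.exists_tendsto_localInt_algebra hb hN hs hs' hG0 hH0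
  refine ⟨r, hr, fun χ hχ ψ hψ => ?_⟩
  set a := algebraMap ℂ A ((Real.pi : ℂ) ^ n) * Ring.inverse (taylorEval s s' N p fun z =>
    (wirtJacobian (-Complex.I) G z).det * (wirtJacobian Complex.I H z).det)
  let e := Module.finBasis ℂ M
  let φ : Fin (Module.finrank ℂ M) → BodySpace n → A := fun m z =>
    algebraMap ℂ A (LinearMap.toContinuousLinearMap (e.coord m) (ψ z))
  have hφ (m) : ContDiff ℝ ∞ (φ m) := contDiff_algebraMap_comp
    (((LinearMap.toContinuousLinearMap (e.coord m)).restrictScalars ℝ).contDiff.comp hψ)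
  have hψe : ψ = fun z => ∑ m, φ m z • e m := by
    funext z
    conv_lhs => rw [← e.sum_repr (ψ z)]
    refine Finset.sum_congr rfl fun m _ => ?_
    rw [algebraMap_smul]
    rfl
  have hφe (m) : ContDiff ℝ ∞ fun z => φ m z • e m := (hφ m).smul contDiff_const
  have hSc : ContDiff ℝ ∞ fun z => ∑ i, G i z * H i z :=
    ContDiff.sum fun i _ => (h.contDiff_left i).mul (h.contDiff_right i)
  have h1 : taylorEval s s' N p ψ = ∑ m, taylorEval s s' N p (φ m) • e m := by
    rw [hψe, taylorEval_sum s s' isOpen_univ _ (fun m _ => (hφe m).contDiffOn) N (Set.mem_univ p)]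
    refine Finset.sum_congr rfl fun m _ => ?_
    rw [taylorEval_smul isOpen_univ hs hs' hb (hφ m).contDiffOn contDiffOn_const (Set.mem_univ p),
      taylorEval_const s s' _ hN]
  have h2 (t : ℝ) : localInt χ (fun z => ∑ i, G i z * H i z) t ψ
      = ∑ m, localInt χ (fun z => ∑ i, G i z * H i z) t (φ m) • e m := by
    rw [hψe, localInt_sum _ hχ.contDiff hχ.hasCompactSupport hSc (fun m _ => hφe m)]
    exact Finset.sum_congr rfl fun m _ =>
      localInt_smul_const (e m) hχ.contDiff hχ.hasCompactSupport hSc (hφ m) t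
  simp only [h2]
  rw [h1, Finset.smul_sum]
  refine tendsto_finsetSum _ fun m _ => ?_
  rw [smul_smul]
  exact (hlim χ hχ (φ m) (hφ m)).smul_const (e m)

end Limit

/-! ### From a cutoff to the ball of integration -/

section Ball

variable {n : ℕ}

open MeasureTheory

theorem continuous_sum_norm_sub_sq (p : BodySpace n) :
    Continuous fun z : BodySpace n => ∑ i, ‖z i - p i‖ ^ 2 :=
  continuous_finsetSum _ fun i _ => by fun_prop

theorem isOpen_bodyBall (p : BodySpace n) (ε : ℝ) : IsOpen (bodyBall p ε) :=
  isOpen_lt (continuous_sum_norm_sub_sq p) continuous_const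

theorem bodyBall_subset_bodyClosedBall (p : BodySpace n) (ε : ℝ) :
    bodyBall p ε ⊆ bodyClosedBall p ε := fun _ hz => le_of_lt (Set.mem_ofPred.1 hz)

theorem mem_bodyBall_self (p : BodySpace n) {ε : ℝ} (hε : 0 < ε) : p ∈ bodyBall p ε := by
  simp only [bodyBall, Set.mem_ofPred_eq, sub_self, norm_zero]
  simpa using pow_pos hε 2

theorem bodyClosedBall_subset_closedBall (p : BodySpace n) {ε : ℝ} (hε : 0 < ε) :
    bodyClosedBall p ε ⊆ Metric.closedBall p ε := by
  intro z hz
  rw [mem_closedBall_iff_norm, pi_norm_le_iff_of_nonneg hε.le]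
  intro i
  refine le_of_sq_le_sq ?_ hε.le
  refine le_trans ?_ hz
  exact Finset.single_le_sum (f := fun i => ‖z i - p i‖ ^ 2) (fun i _ => by positivity)
    (Finset.mem_univ i)

theorem isCompact_bodyClosedBall (p : BodySpace n) {ε : ℝ} (hε : 0 < ε) :
    IsCompact (bodyClosedBall p ε) :=
  (isCompact_closedBall p ε).of_isClosed_subset
    (isClosed_le (continuous_sum_norm_sub_sq p) continuous_const)
    (bodyClosedBall_subset_closedBall p hε)

variable {A M : Type*} [NormedCommRing A] [NormedAlgebra ℂ A] [FiniteDimensional ℂ A]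
  [CompleteSpace A] [NormedAddCommGroup M] [NormedSpace ℂ M] [Module A M] [IsBoundedSMul A M]
  [IsScalarTower ℂ A M] [FiniteDimensional ℂ M]

attribute [local instance] isScalarTower_real smulCommClass_complex

variable {b : A →ₐ[ℂ] ℂ} {p : BodySpace n} {G H : Fin n → BodySpace n → A}

/-- Away from the zeros of the phase the integral over a compact set is negligible. -/
theorem tendsto_setIntegral_of_pos {N : ℕ} (hb : RingHom.ker b ^ N = ⊥) {B K : Set (BodySpace n)}
    (hK : IsCompact K) (hBK : B ⊆ K) {S : BodySpace n → A}
    (hS : ContinuousOn S K) {f : BodySpace n → M} (hf : ContinuousOn f K) {c : ℝ} (hc : 0 < c)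
    (hpos : ∀ z ∈ K, f z ≠ 0 → c ≤ (b (S z)).re) :
    Filter.Tendsto (fun t : ℝ => t⁻¹ ^ n • ∫ z in B, NormedSpace.exp (-(t⁻¹ • S z)) • f z)
      (𝓝[>] 0) (𝓝 0) := by
  obtain ⟨R, hR⟩ := hK.exists_bound_of_continuousOn hS
  obtain ⟨F, hF⟩ := hK.exists_bound_of_continuousOn hf
  obtain ⟨C, hC, hexp⟩ := norm_exp_neg_inv_smul_le b hb (continuous_body b) R
  obtain ⟨C', hC', hpow⟩ : ∃ C' : ℝ, 0 ≤ C' ∧ ∀ t : ℝ, 0 < t →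
      t⁻¹ ^ (n + N) * Real.exp (-(t⁻¹ * c)) ≤ C' * t := by
    obtain ⟨C', h1, h2⟩ := exists_inv_pow_mul_exp_le hc (n + N) 1
    exact ⟨C', h1, fun t ht => by simpa using h2 t ht⟩
  have hvol : volume B < ⊤ := lt_of_le_of_lt (measure_mono hBK) hK.measure_lt_top
  refine squeeze_zero_norm' (a := fun t : ℝ => C * |F| * (volume B).toReal * C' * t) ?_ ?_
  · filter_upwards [Ioc_mem_nhdsGT (zero_lt_one' ℝ)] with t ht
    have ht0 := ht.1
    have h1 : ∀ z ∈ B, ‖NormedSpace.exp (-(t⁻¹ • S z)) • f z‖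
        ≤ C * t⁻¹ ^ N * Real.exp (-(t⁻¹ * c)) * |F| := by
      intro z hz
      by_cases hfz : f z = 0
      · rw [hfz, smul_zero, norm_zero]
        positivity
      refine (norm_smul_le _ _).trans ?_
      have h2 : ‖NormedSpace.exp (-(t⁻¹ • S z))‖ ≤ C * t⁻¹ ^ N * Real.exp (-(t⁻¹ * c)) := by
        refine (hexp (S z) (hR z (hBK hz)) t ht.1 ht.2).trans ?_
        gcongr
        exact hpos z (hBK hz) hfz
      gcongr
      exact (hF z (hBK hz)).trans (le_abs_self F)
    have h2 := norm_setIntegral_le_of_norm_le_const hvol h1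
    rw [norm_smul, norm_pow, norm_inv, Real.norm_of_nonneg ht.1.le]
    calc _ ≤ t⁻¹ ^ n * (C * t⁻¹ ^ N * Real.exp (-(t⁻¹ * c)) * |F| * (volume B).toReal) := by
          gcongr
          exact h2
      _ = C * |F| * (volume B).toReal * (t⁻¹ ^ (n + N) * Real.exp (-(t⁻¹ * c))) := by
          rw [pow_add]
          ring
      _ ≤ C * |F| * (volume B).toReal * (C' * t) := by
          exact mul_le_mul_of_nonneg_left (hpow t ht.1) (by positivity)
      _ = _ := by ring
  · have : Filter.Tendsto (fun t : ℝ => C * |F| * (volume B).toReal * C' * t) (𝓝 0)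
        (𝓝 (C * |F| * (volume B).toReal * C' * 0)) := Filter.tendsto_id.const_mul _
    rw [mul_zero] at this
    exact this.mono_left nhdsWithin_le_nhds

/-- The asymptotics of Gaussian type integrals over a ball on which the phase has a single,
nondegenerate zero. -/
theorem tendsto_setIntegral_bodyBall {N : ℕ} (hb : RingHom.ker b ^ N = ⊥) (hN : 0 < N)
    {U : Set (BodySpace n)} (hU : IsOpen U) (hG : ∀ i, ContDiffOn ℝ ∞ (G i) U)
    (hH : ∀ i, ContDiffOn ℝ ∞ (H i) U) (hGz : ∀ z ∈ U, ∀ i j, wirt Complex.I j (G i) z = 0)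
    (hHz : ∀ z ∈ U, ∀ i j, wirt (-Complex.I) j (H i) z = 0)
    (hconj : ∀ z ∈ U, ∀ i, b (H i z) = starRingEnd ℂ (b (G i z)))
    {ε : ℝ} (hε : 0 < ε) (hεU : bodyClosedBall p ε ⊆ U)
    (hzero : ∀ z ∈ bodyClosedBall p ε, (∀ i, b (G i z) = 0) → z = p)
    {s s' : Fin n → A} (hs : ∀ j, s j ∈ RingHom.ker b) (hs' : ∀ j, s' j ∈ RingHom.ker b)
    (hG0 : ∀ i, taylorEval s s' N p (G i) = 0) (hH0 : ∀ i, taylorEval s s' N p (H i) = 0)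
    (hdet : b (wirtJacobian (-Complex.I) G p).det ≠ 0) {ψ : BodySpace n → M}
    (hψ : ContDiffOn ℝ ∞ ψ U) :
    Filter.Tendsto (fun t : ℝ => t⁻¹ ^ n • ∫ z in bodyBall p ε,
        NormedSpace.exp (-(t⁻¹ • ∑ i, G i z * H i z)) • ψ z) (𝓝[>] 0)
      (𝓝 ((algebraMap ℂ A ((Real.pi : ℂ) ^ n) * Ring.inverse (taylorEval s s' N p fun z =>
          (wirtJacobian (-Complex.I) G z).det * (wirtJacobian Complex.I H z).det))
          • taylorEval s s' N p ψ)) := by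
  have hpB : p ∈ bodyBall p ε := mem_bodyBall_self p hε
  have hBU : bodyBall p ε ⊆ U := (bodyBall_subset_bodyClosedBall p ε).trans hεU
  obtain ⟨R₂, hR₂, hR₂B⟩ := Metric.isOpen_iff.1 (isOpen_bodyBall p ε) p hpB
  have hR : 0 < R₂ / 2 := half_pos hR₂
  have hsub : Metric.ball p R₂ ⊆ U := hR₂B.trans hBU
  -- Globally smooth replacements that agree with the given data near `p`. They change neither the
  -- derivatives on the smaller ball nor the Taylor evaluation at `p`.
  choose Gt hGt hGeq using fun i => exists_contDiff_eqOn_ball hR (half_lt_self hR₂)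
    ((hG i).mono hsub)
  choose Ht hHt hHeq using fun i => exists_contDiff_eqOn_ball hR (half_lt_self hR₂)
    ((hH i).mono hsub)
  obtain ⟨ψt, hψt, hψeq⟩ := exists_contDiff_eqOn_ball hR (half_lt_self hR₂) (hψ.mono hsub)
  have hbU : Metric.ball p (R₂ / 2) ⊆ U := (Metric.ball_subset_ball (by linarith)).trans hsub
  have hpR : p ∈ Metric.ball p (R₂ / 2) := Metric.mem_ball_self hR
  have ev_eq {M' : Type _} [NormedAddCommGroup M'] [NormedSpace ℂ M'] {f g : BodySpace n → M'}
      (h : ∀ z ∈ Metric.closedBall p (R₂ / 2), f z = g z) :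
      ∀ z ∈ Metric.ball p (R₂ / 2), f =ᶠ[𝓝 z] g := fun z hz => by
    filter_upwards [Metric.isOpen_ball.mem_nhds hz] with w hw
    exact h w (Metric.ball_subset_closedBall hw)
  have hwG (κ : ℂ) : ∀ z ∈ Metric.ball p (R₂ / 2), wirtJacobian κ Gt z = wirtJacobian κ G z :=
    fun z hz => by
      ext i j
      exact wirt_congr (ev_eq (hGeq i) z hz)
  have hwH (κ : ℂ) : ∀ z ∈ Metric.ball p (R₂ / 2), wirtJacobian κ Ht z = wirtJacobian κ H z :=
    fun z hz => by
      ext i j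
      exact wirt_congr (ev_eq (hHeq i) z hz)
  have hcrit : IsCriticalPair b p (R₂ / 2) Gt Ht := by
    refine ⟨hR, hGt, hHt, fun z hz i j => ?_, fun z hz i j => ?_, fun z hz i => ?_, fun i => ?_, ?_⟩
    · rw [wirt_congr (ev_eq (hGeq i) z hz), hGz z (hbU hz)]
    · rw [wirt_congr (ev_eq (hHeq i) z hz), hHz z (hbU hz)]
    · rw [hHeq i z (Metric.ball_subset_closedBall hz), hGeq i z (Metric.ball_subset_closedBall hz),
        hconj z (hbU hz)]
    · rw [hGeq i p (Metric.ball_subset_closedBall hpR)]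
      have h1 := taylorEval_sub_mem hU hs hs' hN (hG i) (hbU hpR)
      rw [hG0, zero_sub, neg_mem_iff, RingHom.mem_ker] at h1
      exact h1
    · rwa [hwG _ p hpR]
  obtain ⟨r, hr, hlim⟩ := hcrit.exists_tendsto_localInt (M := M) hb hN hs hs'
    (fun i => by
      rw [taylorEval_congr s s' Metric.isOpen_ball
        (fun z hz => hGeq i z (Metric.ball_subset_closedBall hz)) N hpR, hG0])
    (fun i => by
      rw [taylorEval_congr s s' Metric.isOpen_ball
        (fun z hz => hHeq i z (Metric.ball_subset_closedBall hz)) N hpR, hH0])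
  obtain ⟨χ, hχ⟩ := exists_isCutoff p (lt_min hr hR)
  have h1 := hlim χ (hχ.mono (min_le_left _ _)) ψt hψt
  have hχR : tsupport χ ⊆ Metric.ball p (R₂ / 2) :=
    hχ.tsupport_subset.trans (Metric.ball_subset_ball (min_le_right _ _))
  rw [taylorEval_congr s s' Metric.isOpen_ball
      (fun z hz => hψeq z (Metric.ball_subset_closedBall hz)) N hpR,
    taylorEval_congr s s' Metric.isOpen_ball (g := fun z =>
      (wirtJacobian (-Complex.I) G z).det * (wirtJacobian Complex.I H z).det)
      (fun z hz => by simp only [hwG _ z hz, hwH _ z hz]) N hpR] at h1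
  obtain ⟨ρ, hρ, hρ1⟩ := hχ.eq_one
  set S : BodySpace n → A := fun z => ∑ i, G i z * H i z with hS
  have hK := isCompact_bodyClosedBall p hε
  have hSU : ContDiffOn ℝ ∞ S U := ContDiffOn.sum fun i _ => (hG i).mul (hH i)
  have hSc : ContinuousOn S (bodyClosedBall p ε) := hSU.continuousOn.mono hεU
  have hψc : ContinuousOn ψ (bodyClosedBall p ε) := hψ.continuousOn.mono hεU
  have hχc : Continuous χ := hχ.contDiff.continuous
  have hSre (z : BodySpace n) (hz : z ∈ U) :
      (b (S z)).re = ∑ i, Complex.normSq (b (G i z)) := by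
    have : b (S z) = ((∑ i, Complex.normSq (b (G i z)) : ℝ) : ℂ) := by
      rw [map_sum, Complex.ofReal_sum]
      exact Finset.sum_congr rfl fun i _ => by rw [map_mul, hconj z hz, Complex.mul_conj]
    rw [this, Complex.ofReal_re]
  -- On the compact complement of a neighbourhood of `p` the body of the phase is a continuous sum
  -- of squares without zeros, hence bounded below. This is where the isolating property of `ε`
  -- enters.
  obtain ⟨c, hc, hcpos⟩ : ∃ c > 0, ∀ z ∈ bodyClosedBall p ε \ Metric.ball p ρ,
      c ≤ (b (S z)).re := by
    have hK' : IsCompact (bodyClosedBall p ε \ Metric.ball p ρ) := hK.diff Metric.isOpen_ball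
    have hcont : ContinuousOn (fun z => (b (S z)).re) (bodyClosedBall p ε \ Metric.ball p ρ) :=
      Complex.continuous_re.comp_continuousOn
        ((continuous_body b).comp_continuousOn (hSc.mono Set.sdiff_subset))
    rcases (bodyClosedBall p ε \ Metric.ball p ρ).eq_empty_or_nonempty with he | hne
    · exact ⟨1, one_pos, fun z hz => by simp [he] at hz⟩
    obtain ⟨w, hw, hmin⟩ := hK'.exists_isMinOn hne hcont
    refine ⟨_, ?_, fun z hz => hmin hz⟩
    change 0 < (b (S w)).re
    rw [hSre w (hεU hw.1)]
    refine lt_of_le_of_ne (Finset.sum_nonneg fun i _ => Complex.normSq_nonneg _) fun h0 => ?_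
    have h3 := (Finset.sum_eq_zero_iff_of_nonneg fun i _ => Complex.normSq_nonneg _).1 h0.symm
    have h4 := hzero w hw.1 fun i => Complex.normSq_eq_zero.1 (h3 i (Finset.mem_univ i))
    refine hw.2 ?_
    rw [h4]
    exact Metric.mem_ball_self hρ
  let _ : NormedAlgebra ℚ A := NormedAlgebra.restrictScalars ℚ ℂ A
  have hexpc (t : ℝ) : ContinuousOn (fun z => NormedSpace.exp (-(t⁻¹ • S z)))
      (bodyClosedBall p ε) :=
    NormedSpace.exp_continuous.comp_continuousOn (continuousOn_const.smul hSc).neg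
  -- The amplitude is split with the cutoff. The part with `1 - χ` vanishes near `p` and is
  -- negligible; the part with `χ` is the integral over the whole space treated above.
  have h2 := tendsto_setIntegral_of_pos (M := M) hb hK (bodyBall_subset_bodyClosedBall p ε) hSc (f := fun z => (1 - χ z) • ψ z)
    ((continuousOn_const.sub hχc.continuousOn).smul hψc) hc
    (fun z hz hne => hcpos z ⟨hz, fun hzρ => hne (by
      rw [hρ1 z hzρ, sub_self, zero_smul])⟩)
  have h3 := h2.add h1
  rw [zero_add] at h3
  refine h3.congr fun t => ?_
  have hint {f : BodySpace n → M} (hf : ContinuousOn f (bodyClosedBall p ε)) :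
      IntegrableOn f (bodyBall p ε) :=
    (hf.integrableOn_compact hK).mono_set (bodyBall_subset_bodyClosedBall p ε)
  have e1 : localInt χ (fun z => ∑ i, Gt i z * Ht i z) t ψt
      = t⁻¹ ^ n • ∫ z in bodyBall p ε, NormedSpace.exp (-(t⁻¹ • S z)) • (χ z • ψ z) := by
    unfold localInt
    congr 1
    rw [setIntegral_eq_integral_of_forall_compl_eq_zero]
    · congr 1
      funext z
      by_cases hz : z ∈ tsupport χ
      · have hz' := Metric.ball_subset_closedBall (hχR hz)
        simp only [hS]
        rw [hψeq z hz', smul_comm]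
        simp only [hGeq _ z hz', hHeq _ z hz']
      · rw [image_eq_zero_of_notMem_tsupport hz, zero_smul, zero_smul, smul_zero]
    · intro z hz
      have : χ z = 0 := by
        by_contra h
        exact hz (hR₂B (Metric.ball_subset_ball (by linarith) (hχR (subset_tsupport χ h))))
      rw [this, zero_smul, smul_zero]
  rw [e1, ← smul_add, ← integral_add]
  · congr 2
    funext z
    rw [← smul_add, ← add_smul, sub_add_cancel, one_smul]
  · exact hint ((hexpc t).smul ((continuousOn_const.sub hχc.continuousOn).smul hψc))
  · exact hint ((hexpc t).smul (hχc.continuousOn.smul hψc))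

end Ball

/-! ### Signs of products of monomials -/

/-- For disjoint sets each pair of the product is counted on exactly one side, so the two exponents
add up to the number of all pairs. -/
theorem shuffleSign_comm {α : Type*} [LinearOrder α] {s t : Finset α} (h : Disjoint s t) :
    shuffleSign s t = (-1) ^ (s.card * t.card) * shuffleSign t s := by
  have h1 : ((t ×ˢ s).filter fun q => q.2 < q.1).card
      = ((s ×ˢ t).filter fun q => ¬ q.2 < q.1).card := by
    refine Finset.card_bij' (fun q _ => (q.2, q.1)) (fun q _ => (q.2, q.1)) ?_ ?_ ?_ ?_
    · intro q hq
      simp only [Finset.mem_filter, Finset.mem_product] at hq ⊢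
      exact ⟨⟨hq.1.2, hq.1.1⟩, not_lt.2 hq.2.le⟩
    · intro q hq
      simp only [Finset.mem_filter, Finset.mem_product] at hq ⊢
      refine ⟨⟨hq.1.2, hq.1.1⟩, lt_of_le_of_ne (not_lt.1 hq.2) fun he => ?_⟩
      exact (Finset.disjoint_left.1 h hq.1.1) (he ▸ hq.1.2)
    · intro q _; rfl
    · intro q _; rfl
  have h2 := Finset.card_filter_add_card_filter_not (s := s ×ˢ t) (fun q => q.2 < q.1)
  rw [Finset.card_product] at h2
  unfold shuffleSign
  rw [h1, ← h2, pow_add, mul_assoc, ← mul_pow]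
  simp

theorem shuffleSign_empty_left {α : Type*} [LinearOrder α] (t : Finset α) :
    shuffleSign ∅ t = 1 := by simp [shuffleSign]

theorem shuffleSign_empty_right {α : Type*} [LinearOrder α] (t : Finset α) :
    shuffleSign t ∅ = 1 := by simp [shuffleSign]

/-- The union inside a monomial may be formed with another decision procedure for equality than the
one of the linear order. -/
theorem shuffleSign_union_left_of_decidableEq {α : Type*} [LinearOrder α] [DecidableEq α]
    {s t u : Finset α} (h : Disjoint s t) :
    shuffleSign (s ∪ t) u = shuffleSign s u * shuffleSign t u := by
  rw [← shuffleSign_union_left h]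
  congr!

theorem shuffleSign_union_right_of_decidableEq {α : Type*} [LinearOrder α] [DecidableEq α]
    {s t u : Finset α} (h : Disjoint t u) :
    shuffleSign s (t ∪ u) = shuffleSign s t * shuffleSign s u := by
  rw [← shuffleSign_union_right h]
  congr!

/-! ### The partial monoid of supermonomials -/

namespace SuperMonomial

variable {n : ℕ}

/-- The exponents of a product of monomials. -/
def mul (I J : SuperMonomial n) : SuperMonomial n := ⟨I.A ∪ J.A, I.m + J.m, I.Q ∪ J.Q⟩

/-- The product of two monomials is not forced to vanish. -/
def Compat (I J : SuperMonomial n) : Prop := Disjoint I.A J.A ∧ Disjoint I.Q J.Q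

/-- The complementary factor of `I` in `K`. -/
def div (K I : SuperMonomial n) : SuperMonomial n := ⟨K.A \ I.A, K.m - I.m, K.Q \ I.Q⟩

/-- The empty monomial. -/
def unit (n : ℕ) : SuperMonomial n := ⟨∅, 0, ∅⟩

/-- The factorizations of `K`. -/
noncomputable def antidiagonal (K : SuperMonomial n) :
    Finset (SuperMonomial n × SuperMonomial n) :=
  (K.A.powerset ×ˢ Finset.Iic K.m ×ˢ K.Q.powerset).map
    ⟨fun q => (⟨q.1, q.2.1, q.2.2⟩, K.div ⟨q.1, q.2.1, q.2.2⟩), fun q q' h => by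
      simp only [Prod.mk.injEq, SuperMonomial.mk.injEq] at h
      exact Prod.ext h.1.1 (Prod.ext h.1.2.1 h.1.2.2)⟩

theorem mem_antidiagonal {K : SuperMonomial n} {q : SuperMonomial n × SuperMonomial n} :
    q ∈ K.antidiagonal ↔ q.1.Compat q.2 ∧ q.1.mul q.2 = K := by
  obtain ⟨I, J⟩ := q
  simp only [antidiagonal, Finset.mem_map, Finset.mem_product, Finset.mem_powerset,
    Finset.mem_Iic, Prod.exists]
  constructor
  · rintro ⟨A, m, Q, ⟨h1, h2, h3⟩, h⟩
    cases h
    refine ⟨⟨Finset.disjoint_sdiff, Finset.disjoint_sdiff⟩, ?_⟩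
    ext1
    · exact Finset.union_sdiff_of_subset h1
    · exact add_tsub_cancel_of_le h2
    · exact Finset.union_sdiff_of_subset h3
  · rintro ⟨⟨h1, h2⟩, rfl⟩
    refine ⟨I.A, I.m, I.Q, ⟨Finset.subset_union_left, le_self_add, Finset.subset_union_left⟩,
      Prod.ext rfl ?_⟩
    apply SuperMonomial.ext
    · exact Finset.union_sdiff_cancel_left h1
    · exact add_tsub_cancel_left _ _
    · exact Finset.union_sdiff_cancel_left h2

theorem mk_mem_antidiagonal {I J : SuperMonomial n} (h : I.Compat J) :
    (I, J) ∈ (I.mul J).antidiagonal := by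
  rw [mem_antidiagonal]
  exact ⟨h, rfl⟩

theorem sum_antidiagonal {X : Type*} [AddCommMonoid X] (K : SuperMonomial n)
    (f : SuperMonomial n → SuperMonomial n → X) : ∑ q ∈ K.antidiagonal, f q.1 q.2
      = ∑ A ∈ K.A.powerset, ∑ m ∈ Finset.Iic K.m, ∑ Q ∈ K.Q.powerset,
        f ⟨A, m, Q⟩ ⟨K.A \ A, K.m - m, K.Q \ Q⟩ := by
  rw [antidiagonal, Finset.sum_map, Finset.sum_product]
  refine Finset.sum_congr rfl fun A _ => ?_
  rw [Finset.sum_product]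
  rfl

theorem compat_mul_left {I J K : SuperMonomial n} :
    (I.mul J).Compat K ↔ I.Compat K ∧ J.Compat K := by
  simp only [Compat, mul, Finset.disjoint_union_left]
  tauto

theorem compat_mul_right {I J K : SuperMonomial n} :
    I.Compat (J.mul K) ↔ I.Compat J ∧ I.Compat K := by
  simp only [Compat, mul, Finset.disjoint_union_right]
  tauto

theorem compat_symm {I J : SuperMonomial n} (h : I.Compat J) : J.Compat I := ⟨h.1.symm, h.2.symm⟩

theorem mul_assoc (I J K : SuperMonomial n) : (I.mul J).mul K = I.mul (J.mul K) := by
  simp only [mul, Finset.union_assoc, add_assoc]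

theorem mul_comm (I J : SuperMonomial n) : I.mul J = J.mul I := by
  simp only [mul, Finset.union_comm, add_comm]

theorem unit_mul (I : SuperMonomial n) : (unit n).mul I = I := by
  ext1 <;> simp [mul, unit]

theorem mul_unit (I : SuperMonomial n) : I.mul (unit n) = I := by
  rw [mul_comm, unit_mul]

theorem compat_unit (I : SuperMonomial n) : I.Compat (unit n) := by
  simp [Compat, unit]

theorem sign_unit_left (I : SuperMonomial n) : sign (unit n) I = 1 := by
  simp [sign, unit, shuffleSign_empty_left]

theorem sign_unit_right (I : SuperMonomial n) : sign I (unit n) = 1 := by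
  simp [sign, unit, shuffleSign_empty_right]

theorem mul_left_cancel {I J J' : SuperMonomial n} (h : I.Compat J) (h' : I.Compat J')
    (he : I.mul J = I.mul J') : J = J' := by
  have h1 := congrArg SuperMonomial.A he
  have h2 := congrArg SuperMonomial.m he
  have h3 := congrArg SuperMonomial.Q he
  simp only [mul] at h1 h2 h3
  ext1
  · rw [← Finset.union_sdiff_cancel_left h.1, h1, Finset.union_sdiff_cancel_left h'.1]
  · exact add_left_cancel h2
  · rw [← Finset.union_sdiff_cancel_left h.2, h3, Finset.union_sdiff_cancel_left h'.2]

/-- With `sign_mul_right` the sign is multiplicative in each argument; this cocycle property is what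
associativity of the wedge product needs. -/
theorem sign_mul_left {I J K : SuperMonomial n} (h : I.Compat J) :
    sign (I.mul J) K = sign I K * sign J K := by
  simp only [sign, mul]
  rw [shuffleSign_union_left_of_decidableEq h.1, shuffleSign_union_left_of_decidableEq h.2,
    Finset.card_union_of_disjoint h.2]
  simp only [Pi.add_apply, Finset.sum_add_distrib]
  ring

theorem sign_mul_right {I J K : SuperMonomial n} (h : J.Compat K) :
    sign I (J.mul K) = sign I J * sign I K := by
  simp only [sign, mul]
  rw [shuffleSign_union_right_of_decidableEq h.1, shuffleSign_union_right_of_decidableEq h.2,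
    Finset.card_union_of_disjoint h.1]
  simp only [Pi.add_apply, Finset.sum_add_distrib]
  ring

/-- The degree of a monomial. -/
def degree (I : SuperMonomial n) : ℕ := I.A.card + ∑ c, I.m c

/-- The parity of a monomial, as a natural number. -/
def parity (I : SuperMonomial n) : ℕ := I.Q.card + ∑ c, I.m c

/-- Expanding the exponent, the product of the numbers of odd 1-forms occurs twice, once from the
degrees and once from the parities, and cancels: the odd 1-forms commute with each other. The
remaining terms are the swaps of the two ordered products and the mixed terms in the definition of
`sign`. -/
theorem sign_comm {I J : SuperMonomial n} (h : I.Compat J) :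
    sign I J = (-1) ^ (I.degree * J.degree + I.parity * J.parity) * sign J I := by
  have e (k : ℕ) : ((-1 : ℤ) ^ k) * (-1) ^ k = 1 := by
    rw [← mul_pow]
    simp
  unfold sign degree parity
  rw [shuffleSign_comm h.1, shuffleSign_comm h.2]
  set a := I.A.card
  set a' := J.A.card
  set q := I.Q.card
  set q' := J.Q.card
  set m := ∑ c, I.m c
  set m' := ∑ c, J.m c
  have e1 : (a + m) * (a' + m') + (q + m) * (q' + m')
      = (a * a' + q * q' + (m * a' + q * m')) + ((m' * a + q' * m) + (m * m' + m * m')) := by ring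
  rw [e1, pow_add _ _ ((m' * a + q' * m) + (m * m' + m * m')), pow_add _ (m' * a + q' * m),
    pow_add _ (m * m'), e (m * m'), mul_one]
  have e2 := e (m' * a + q' * m)
  have e3 : ((-1 : ℤ) ^ (a * a' + q * q' + (m * a' + q * m')))
      = (-1) ^ (a * a') * (-1) ^ (q * q') * (-1) ^ (m * a' + q * m') := by
    rw [pow_add, pow_add]
  rw [e3]
  linear_combination (-((-1) ^ (a * a') * (-1) ^ (q * q') * (-1) ^ (m * a' + q * m')
    * shuffleSign J.A I.A * shuffleSign J.Q I.Q)) * e2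

theorem degree_mul {I J : SuperMonomial n} (h : I.Compat J) :
    (I.mul J).degree = I.degree + J.degree := by
  unfold degree mul
  rw [Finset.card_union_of_disjoint h.1]
  simp only [Pi.add_apply, Finset.sum_add_distrib]
  ring

end SuperMonomial

/-! ### The algebra of superforms at a point -/

/-- The algebra of superforms at a point, with coefficients in a commutative ring `R`. -/
def FormAlg (n : ℕ) (R : Type*) : Type _ := SuperMonomial n → R

namespace FormAlg

variable {n : ℕ} {R : Type*} [CommRing R]

instance : AddCommGroup (FormAlg n R) := inferInstanceAs (AddCommGroup (SuperMonomial n → R))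

instance : Module R (FormAlg n R) := inferInstanceAs (Module R (SuperMonomial n → R))

open Classical in
/-- The monomial `I` with coefficient `r`. -/
noncomputable def single (I : SuperMonomial n) (r : R) : FormAlg n R := Pi.single I r

noncomputable instance : One (FormAlg n R) := ⟨single (SuperMonomial.unit n) 1⟩

noncomputable instance : Mul (FormAlg n R) :=
  ⟨fun x y K => ∑ q ∈ K.antidiagonal, SuperMonomial.sign q.1 q.2 • (x q.1 * y q.2)⟩

theorem mul_apply (x y : FormAlg n R) (K : SuperMonomial n) : (x * y) K
    = ∑ q ∈ K.antidiagonal, SuperMonomial.sign q.1 q.2 • (x q.1 * y q.2) := rfl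

theorem add_apply (x y : FormAlg n R) (K : SuperMonomial n) : (x + y) K = x K + y K := rfl

theorem neg_apply (x : FormAlg n R) (K : SuperMonomial n) : (-x) K = -x K := rfl

theorem zero_apply (K : SuperMonomial n) : (0 : FormAlg n R) K = 0 := rfl

theorem smul_apply (r : R) (x : FormAlg n R) (K : SuperMonomial n) : (r • x) K = r * x K := rfl

theorem sum_apply {ι : Type*} (s : Finset ι) (x : ι → FormAlg n R) (K : SuperMonomial n) :
    (∑ i ∈ s, x i) K = ∑ i ∈ s, x i K := Finset.sum_apply K s x

@[simp] theorem single_same (I : SuperMonomial n) (r : R) : single I r I = r := by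
  simp [single]

theorem single_of_ne {I K : SuperMonomial n} (h : K ≠ I) (r : R) : single I r K = 0 := by
  simp [single, h]

theorem one_def : (1 : FormAlg n R) = single (SuperMonomial.unit n) 1 := rfl

theorem single_mul_apply (I J : SuperMonomial n) (h : I.Compat J) (r : R) (y : FormAlg n R) :
    (single I r * y) (I.mul J) = SuperMonomial.sign I J • (r * y J) := by
  rw [mul_apply, Finset.sum_eq_single (I, J)]
  · rw [single_same]
  · rintro ⟨I', J'⟩ hq hne
    rw [SuperMonomial.mem_antidiagonal] at hq
    by_cases hI : I' = I
    · subst hI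
      exact absurd (SuperMonomial.mul_left_cancel hq.1 h hq.2) fun hJ => hne (Prod.ext rfl hJ)
    · rw [single_of_ne hI, zero_mul, smul_zero]
  · intro hq
    exact absurd (SuperMonomial.mk_mem_antidiagonal h) hq

theorem mul_single_apply (I J : SuperMonomial n) (h : I.Compat J) (r : R) (x : FormAlg n R) :
    (x * single J r) (I.mul J) = SuperMonomial.sign I J • (x I * r) := by
  rw [mul_apply, Finset.sum_eq_single (I, J)]
  · rw [single_same]
  · rintro ⟨I', J'⟩ hq hne
    rw [SuperMonomial.mem_antidiagonal] at hq
    by_cases hJ : J' = J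
    · subst hJ
      have h0 : J'.Compat I' := SuperMonomial.compat_symm hq.1
      have h1 : J'.mul I' = J'.mul I := by
        rw [SuperMonomial.mul_comm, SuperMonomial.mul_comm J' I]
        exact hq.2
      exact absurd (SuperMonomial.mul_left_cancel h0 (SuperMonomial.compat_symm h) h1)
        fun hI => hne (Prod.ext hI rfl)
    · rw [single_of_ne hJ, mul_zero, smul_zero]
  · intro hq
    exact absurd (SuperMonomial.mk_mem_antidiagonal h) hq

protected theorem one_mul' (x : FormAlg n R) : 1 * x = x := by
  funext K
  have h := single_mul_apply (SuperMonomial.unit n) K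
    (SuperMonomial.compat_symm (SuperMonomial.compat_unit K)) (1 : R) x
  rw [SuperMonomial.unit_mul, SuperMonomial.sign_unit_left, one_smul, one_mul] at h
  exact h

protected theorem mul_one' (x : FormAlg n R) : x * 1 = x := by
  funext K
  have h := mul_single_apply K (SuperMonomial.unit n) (SuperMonomial.compat_unit K) (1 : R) x
  rw [SuperMonomial.mul_unit, SuperMonomial.sign_unit_right, one_smul, mul_one] at h
  exact h

protected theorem mul_assoc' (x y z : FormAlg n R) : x * y * z = x * (y * z) := by
  funext K
  simp only [mul_apply, Finset.mul_sum, Finset.sum_mul, Finset.smul_sum]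
  rw [Finset.sum_sigma', Finset.sum_sigma']
  -- Both sides run over the factorizations of `K` into three monomials; the bijection rebrackets
  -- them.
  refine Finset.sum_bij' (fun q _ => ⟨(q.2.1, q.2.2.mul q.1.2), (q.2.2, q.1.2)⟩)
    (fun q _ => ⟨(q.1.1.mul q.2.1, q.2.2), (q.1.1, q.2.1)⟩) ?_ ?_ ?_ ?_ ?_
  · rintro ⟨⟨a, d⟩, ⟨u, v⟩⟩ h
    simp only [Finset.mem_sigma, SuperMonomial.mem_antidiagonal] at h ⊢
    obtain ⟨⟨h1, h2⟩, h3, rfl⟩ := h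
    rw [SuperMonomial.compat_mul_left] at h1
    rw [SuperMonomial.compat_mul_right, ← SuperMonomial.mul_assoc]
    exact ⟨⟨⟨h3, h1.1⟩, h2⟩, h1.2, trivial⟩
  · rintro ⟨⟨a, d⟩, ⟨u, v⟩⟩ h
    simp only [Finset.mem_sigma, SuperMonomial.mem_antidiagonal] at h ⊢
    obtain ⟨⟨h1, h2⟩, h3, rfl⟩ := h
    rw [SuperMonomial.compat_mul_right] at h1
    rw [SuperMonomial.compat_mul_left, SuperMonomial.mul_assoc]
    exact ⟨⟨⟨h1.2, h3⟩, h2⟩, h1.1, trivial⟩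
  · rintro ⟨⟨a, d⟩, ⟨u, v⟩⟩ h
    simp only [Finset.mem_sigma, SuperMonomial.mem_antidiagonal] at h
    obtain ⟨⟨h1, h2⟩, h3, rfl⟩ := h
    rfl
  · rintro ⟨⟨a, d⟩, ⟨u, v⟩⟩ h
    simp only [Finset.mem_sigma, SuperMonomial.mem_antidiagonal] at h
    obtain ⟨⟨h1, h2⟩, h3, rfl⟩ := h
    rfl
  · rintro ⟨⟨a, d⟩, ⟨u, v⟩⟩ h
    simp only [Finset.mem_sigma, SuperMonomial.mem_antidiagonal] at h
    obtain ⟨⟨h1, h2⟩, h3, rfl⟩ := h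
    rw [SuperMonomial.compat_mul_left] at h1
    simp only [SuperMonomial.sign_mul_left h3, SuperMonomial.sign_mul_right h1.2, zsmul_eq_mul]
    push_cast
    ring

noncomputable instance : Ring (FormAlg n R) :=
  { (inferInstance : AddCommGroup (FormAlg n R)) with
    one := 1
    mul := (· * ·)
    one_mul := FormAlg.one_mul'
    mul_one := FormAlg.mul_one'
    mul_assoc := FormAlg.mul_assoc'
    zero_mul := by
      intro x
      funext K
      simp [mul_apply, zero_apply]
    mul_zero := by
      intro x
      funext K
      simp [mul_apply, zero_apply]
    left_distrib := by
      intro x y z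
      funext K
      simp only [mul_apply, add_apply, mul_add, smul_add, Finset.sum_add_distrib]
    right_distrib := by
      intro x y z
      funext K
      simp only [mul_apply, add_apply, add_mul, smul_add, Finset.sum_add_distrib] }

noncomputable instance : Algebra R (FormAlg n R) :=
  Algebra.ofModule
    (fun r x y => by
      funext K
      simp only [mul_apply, smul_apply, Finset.mul_sum, mul_assoc, mul_smul_comm])
    (fun r x y => by
      funext K
      simp only [mul_apply, smul_apply, Finset.mul_sum, mul_smul_comm, mul_left_comm])

theorem single_mul_single {I J : SuperMonomial n} (h : I.Compat J) (r s : R) :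
    single I r * single J s = single (I.mul J) (SuperMonomial.sign I J • (r * s)) := by
  funext K
  by_cases hK : K = I.mul J
  · rw [hK, single_mul_apply I J h, single_same, single_same]
  · rw [single_of_ne hK, mul_apply]
    refine Finset.sum_eq_zero fun q hq => ?_
    rw [SuperMonomial.mem_antidiagonal] at hq
    by_cases h1 : q.1 = I
    · by_cases h2 : q.2 = J
      · exact absurd (by rw [← hq.2, h1, h2]) hK
      · rw [single_of_ne h2, mul_zero, smul_zero]
    · rw [single_of_ne h1, zero_mul, smul_zero]

theorem single_mul_single_of_not {I J : SuperMonomial n} (h : ¬ I.Compat J) (r s : R) :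
    single I r * single J s = 0 := by
  funext K
  rw [mul_apply]
  refine Finset.sum_eq_zero fun q hq => ?_
  rw [SuperMonomial.mem_antidiagonal] at hq
  by_cases h1 : q.1 = I
  · by_cases h2 : q.2 = J
    · exact absurd (h1 ▸ h2 ▸ hq.1) h
    · rw [single_of_ne h2, mul_zero, smul_zero]
  · rw [single_of_ne h1, zero_mul, smul_zero]

/-- `x` is a combination of monomials satisfying `p`. -/
def SupportedOn (p : SuperMonomial n → Prop) (x : FormAlg n R) : Prop := ∀ I, x I ≠ 0 → p I

theorem SupportedOn.mul {p p' p'' : SuperMonomial n → Prop} {x y : FormAlg n R}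
    (hx : x.SupportedOn p) (hy : y.SupportedOn p')
    (h : ∀ I J, I.Compat J → p I → p' J → p'' (I.mul J)) : (x * y).SupportedOn p'' := by
  intro K hK
  rw [mul_apply] at hK
  obtain ⟨q, hq, hne⟩ := Finset.exists_ne_zero_of_sum_ne_zero hK
  rw [SuperMonomial.mem_antidiagonal] at hq
  rw [← hq.2]
  refine h _ _ hq.1 (hx _ fun h0 => hne ?_) (hy _ fun h0 => hne ?_)
  · rw [h0, zero_mul, smul_zero]
  · rw [h0, mul_zero, smul_zero]

theorem SupportedOn.sum {p : SuperMonomial n → Prop} {ι : Type*} {s : Finset ι}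
    {x : ι → FormAlg n R} (h : ∀ i ∈ s, (x i).SupportedOn p) : (∑ i ∈ s, x i).SupportedOn p := by
  intro K hK
  rw [sum_apply] at hK
  obtain ⟨i, hi, hne⟩ := Finset.exists_ne_zero_of_sum_ne_zero hK
  exact h i hi K hne

theorem SupportedOn.add {p : SuperMonomial n → Prop} {x y : FormAlg n R} (hx : x.SupportedOn p)
    (hy : y.SupportedOn p) : (x + y).SupportedOn p := by
  intro K hK
  rw [add_apply] at hK
  by_cases h : x K = 0
  · refine hy K fun h' => hK ?_
    rw [h, h', add_zero]
  · exact hx K h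

theorem supportedOn_single {p : SuperMonomial n → Prop} {I : SuperMonomial n} (h : p I) (r : R) :
    (single I r).SupportedOn p := by
  intro K hK
  by_cases hKI : K = I
  · rwa [hKI]
  · exact absurd (single_of_ne hKI r) hK

theorem SupportedOn.pow {x : FormAlg n R} (f : SuperMonomial n → ℕ)
    (hf : ∀ I J, I.Compat J → f (I.mul J) = f I + f J) (h0 : f (SuperMonomial.unit n) = 0) {d : ℕ}
    (hx : x.SupportedOn fun I => f I = d) (k : ℕ) : (x ^ k).SupportedOn fun I => f I = k * d := by
  induction k with
  | zero =>
    rw [pow_zero, zero_mul]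
    exact supportedOn_single h0 1
  | succ k ih =>
    rw [pow_succ]
    refine ih.mul hx fun I J hIJ h1 h2 => ?_
    rw [hf I J hIJ, h1, h2]
    ring

/-- The supercommutation rule. -/
theorem mul_eq_of_supportedOn {x y : FormAlg n R} {p p' : SuperMonomial n → Prop}
    (hx : x.SupportedOn p) (hy : y.SupportedOn p') {s : ℤ}
    (h : ∀ I J, p I → p' J → (-1 : ℤ) ^ (I.degree * J.degree + I.parity * J.parity) = s) :
    x * y = s • (y * x) := by
  funext K
  change (x * y) K = s • ((y * x) K)
  rw [mul_apply, mul_apply, Finset.smul_sum]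
  refine Finset.sum_bij' (fun q _ => (q.2, q.1)) (fun q _ => (q.2, q.1)) ?_ ?_ ?_ ?_ ?_
  · intro q hq
    rw [SuperMonomial.mem_antidiagonal] at hq ⊢
    exact ⟨SuperMonomial.compat_symm hq.1, by rw [← hq.2, SuperMonomial.mul_comm]⟩
  · intro q hq
    rw [SuperMonomial.mem_antidiagonal] at hq ⊢
    exact ⟨SuperMonomial.compat_symm hq.1, by rw [← hq.2, SuperMonomial.mul_comm]⟩
  · intro q _
    rfl
  · intro q _
    rfl
  · intro q hq
    rw [SuperMonomial.mem_antidiagonal] at hq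
    by_cases hx0 : x q.1 = 0
    · rw [hx0, zero_mul, mul_zero, smul_zero, smul_zero, smul_zero]
    by_cases hy0 : y q.2 = 0
    · rw [hy0, zero_mul, mul_zero, smul_zero, smul_zero, smul_zero]
    rw [SuperMonomial.sign_comm hq.1, h _ _ (hx _ hx0) (hy _ hy0), smul_smul, mul_comm (y q.2)]

end FormAlg

/-! ### Order and cardinality of the coordinate indices -/

section CoordIndex

variable {n : ℕ}

theorem hol_injective : Function.Injective (hol : Fin n → CoordIndex n) := fun i j h => by
  simpa [hol] using h

theorem anti_injective : Function.Injective (anti : Fin n → CoordIndex n) := fun i j h => by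
  simpa [anti] using h

theorem hol_ne_anti (i j : Fin n) : hol i ≠ anti j := by simp [hol, anti]

theorem hol_lt_hol {i j : Fin n} : hol i < hol j ↔ i < j := by simp [hol]

theorem anti_lt_anti {i j : Fin n} : anti i < anti j ↔ i < j := by simp [anti]

theorem hol_lt_anti (i j : Fin n) : hol i < anti j := by simp [hol, anti]

theorem coordIndex_cases (c : CoordIndex n) : (∃ i, c = hol i) ∨ ∃ i, c = anti i := by
  rcases h : ofLex c with i | i
  · exact Or.inl ⟨i, ofLex.injective h⟩
  · exact Or.inr ⟨i, ofLex.injective h⟩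

theorem card_coordIndex : Fintype.card (CoordIndex n) = 2 * n := by
  rw [two_mul]
  exact (Fintype.card_sum (α := Fin n) (β := Fin n)).trans (by simp)

theorem shuffleSign_singleton_right {α : Type*} [LinearOrder α] (s : Finset α) (a : α) :
    shuffleSign s {a} = (-1) ^ (s.filter fun c => a < c).card := by
  unfold shuffleSign
  congr 1
  refine Finset.card_bij' (fun q _ => q.1) (fun c _ => (c, a)) ?_ ?_ ?_ ?_
  · intro q hq
    simp only [Finset.mem_filter, Finset.mem_product, Finset.mem_singleton] at hq ⊢
    exact ⟨hq.1.1, hq.1.2 ▸ hq.2⟩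
  · intro c hc
    simp only [Finset.mem_filter, Finset.mem_product, Finset.mem_singleton] at hc ⊢
    exact ⟨⟨hc.1, trivial⟩, hc.2⟩
  · intro q hq
    simp only [Finset.mem_filter, Finset.mem_product, Finset.mem_singleton] at hq
    rw [← hq.1.2]
  · intro c _
    rfl

end CoordIndex

/-! ### Products of the 2-forms dz̄ dz and the determinant -/

namespace FormAlg

variable {n : ℕ} {R : Type*} [CommRing R]

/-- `dz̄_i`. -/
noncomputable def dzbar (i : Fin n) : FormAlg n R := single ⟨{anti i}, 0, ∅⟩ 1

/-- `dz_i`. -/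
noncomputable def dz (i : Fin n) : FormAlg n R := single ⟨{hol i}, 0, ∅⟩ 1

/-- `dξ_i`. -/
noncomputable def dxi (i : Fin n) : FormAlg n R := single ⟨∅, Pi.single (hol i) 1, ∅⟩ 1

/-- The monomial `dZ_A`. -/
def ofA (A : Finset (CoordIndex n)) : SuperMonomial n := ⟨A, 0, ∅⟩

/-- `∑_i v_i dz̄_i`. -/
noncomputable def theta (v : Fin n → R) : FormAlg n R := ∑ i, v i • dzbar i

theorem smul_single (r : R) (I : SuperMonomial n) (s : R) :
    r • single I s = single I (r * s) := by
  funext K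
  rw [smul_apply]
  by_cases h : K = I
  · rw [h, single_same, single_same]
  · rw [single_of_ne h, single_of_ne h, mul_zero]

theorem SupportedOn.smul {p : SuperMonomial n → Prop} {x : FormAlg n R} (hx : x.SupportedOn p)
    (r : R) : (r • x).SupportedOn p := fun I hI => hx I fun h => hI (by rw [smul_apply, h, mul_zero])

/-- Monomials with the given degree and parity modulo two. -/
def HasType (d e : ℕ) (I : SuperMonomial n) : Prop := I.degree % 2 = d ∧ I.parity % 2 = e

theorem HasType.mul {d e d' e' : ℕ} {I J : SuperMonomial n} (h : I.Compat J) (hI : HasType d e I)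
    (hJ : HasType d' e' J) : HasType ((d + d') % 2) ((e + e') % 2) (I.mul J) := by
  refine ⟨?_, ?_⟩
  · rw [SuperMonomial.degree_mul h, Nat.add_mod, hI.1, hJ.1]
  · have : (I.mul J).parity = I.parity + J.parity := by
      unfold SuperMonomial.parity SuperMonomial.mul
      rw [Finset.card_union_of_disjoint h.2]
      simp only [Pi.add_apply, Finset.sum_add_distrib]
      ring
    rw [this, Nat.add_mod, hI.2, hJ.2]

theorem neg_one_pow_of_hasType {d e d' e' : ℕ} {I J : SuperMonomial n} (hI : HasType d e I)
    (hJ : HasType d' e' J) :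
    (-1 : ℤ) ^ (I.degree * J.degree + I.parity * J.parity) = (-1) ^ (d * d' + e * e') := by
  rw [neg_one_pow_eq_pow_mod_two, Nat.add_mod, Nat.mul_mod, Nat.mul_mod I.parity, hI.1, hI.2, hJ.1,
    hJ.2, ← Nat.add_mod, ← neg_one_pow_eq_pow_mod_two]

theorem mul_eq_of_hasType {x y : FormAlg n R} {d e d' e' : ℕ} (hx : x.SupportedOn (HasType d e))
    (hy : y.SupportedOn (HasType d' e')) : x * y = ((-1 : ℤ) ^ (d * d' + e * e')) • (y * x) :=
  mul_eq_of_supportedOn hx hy fun _ _ hI hJ => neg_one_pow_of_hasType hI hJ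

theorem mul_comm_of_even {x : FormAlg n R} (hx : x.SupportedOn (HasType 0 0)) (y : FormAlg n R) :
    x * y = y * x := by
  have h := mul_eq_of_supportedOn hx (fun I _ => trivial : y.SupportedOn fun _ => True) (s := 1)
    fun I J hI _ => by
      rw [neg_one_pow_eq_pow_mod_two, Nat.add_mod, Nat.mul_mod, Nat.mul_mod I.parity, hI.1, hI.2]
      simp
  rwa [one_smul] at h

theorem eq_zero_of_eq_neg [Algebra ℂ R] {x : FormAlg n R} (h : x = -x) : x = 0 := by
  funext K
  have h1 : x K = -x K := congrFun h K
  have h2 : (2 : ℂ) • x K = 0 := by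
    rw [two_smul]
    nth_rw 1 [h1]
    exact neg_add_cancel _
  change x K = 0
  rw [← one_smul ℂ (x K), show (1 : ℂ) = 2⁻¹ * 2 by norm_num, mul_smul, h2, smul_zero]

theorem mul_self_eq_zero_of_hasType [Algebra ℂ R] {x : FormAlg n R} {d e : ℕ}
    (hx : x.SupportedOn (HasType d e)) (h : Odd (d * d + e * e)) : x * x = 0 := by
  refine eq_zero_of_eq_neg ?_
  have := mul_eq_of_hasType hx hx
  rwa [h.neg_one_pow, neg_smul, one_smul] at this

theorem hasType_dzbar (i : Fin n) : (dzbar i : FormAlg n R).SupportedOn (HasType 1 0) :=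
  supportedOn_single (by simp [HasType, SuperMonomial.degree, SuperMonomial.parity]) 1

theorem hasType_dz (i : Fin n) : (dz i : FormAlg n R).SupportedOn (HasType 1 0) :=
  supportedOn_single (by simp [HasType, SuperMonomial.degree, SuperMonomial.parity]) 1

theorem hasType_dxi (i : Fin n) : (dxi i : FormAlg n R).SupportedOn (HasType 1 1) :=
  supportedOn_single (by simp [HasType, SuperMonomial.degree, SuperMonomial.parity]) 1

theorem hasType_theta (v : Fin n → R) : (theta v).SupportedOn (HasType 1 0) :=
  SupportedOn.sum fun i _ => (hasType_dzbar i).smul _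

theorem hasType_theta_mul_dz (v : Fin n → R) (k : Fin n) :
    (theta v * dz k).SupportedOn (HasType 0 0) :=
  (hasType_theta v).mul (hasType_dz k) fun _ _ h hI hJ => HasType.mul h hI hJ

theorem hasType_theta_mul_dxi (v : Fin n → R) (k : Fin n) :
    (theta v * dxi k).SupportedOn (HasType 0 1) :=
  (hasType_theta v).mul (hasType_dxi k) fun _ _ h hI hJ => HasType.mul h hI hJ

/-- The linear map `v ↦ (∑_i v_i dz̄_i) dz_k` into the center. -/
noncomputable def thetaDz (k : Fin n) : (Fin n → R) →ₗ[R] Subalgebra.center R (FormAlg n R) where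
  toFun v := ⟨theta v * dz k, Subalgebra.mem_center_iff.2 fun y =>
    (mul_comm_of_even (hasType_theta_mul_dz v k) y).symm⟩
  map_add' v w := by
    apply Subtype.ext
    change theta (v + w) * dz k = theta v * dz k + theta w * dz k
    rw [← add_mul]
    congr 1
    simp only [theta, Pi.add_apply, add_smul, Finset.sum_add_distrib]
  map_smul' r v := by
    apply Subtype.ext
    change theta (r • v) * dz k = r • (theta v * dz k)
    rw [← smul_mul_assoc]
    congr 1
    simp only [theta, Pi.smul_apply, smul_eq_mul, Finset.smul_sum, smul_smul]

theorem coe_thetaDz (k : Fin n) (v : Fin n → R) :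
    (thetaDz k v : FormAlg n R) = theta v * dz k := rfl

section Square

variable [Algebra ℂ R]

theorem theta_mul_self (v : Fin n → R) : theta v * theta v = 0 :=
  mul_self_eq_zero_of_hasType (hasType_theta v) (by decide)

theorem dz_mul_self (k : Fin n) : (dz k * dz k : FormAlg n R) = 0 :=
  mul_self_eq_zero_of_hasType (hasType_dz k) (by decide)

theorem thetaDz_mul_theta (k : Fin n) (v : Fin n → R) :
    (thetaDz k v : FormAlg n R) * theta v = 0 := by
  rw [coe_thetaDz, mul_comm_of_even (hasType_theta_mul_dz v k), ← mul_assoc, theta_mul_self,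
    zero_mul]

theorem thetaDz_mul_thetaDz (k l : Fin n) (v : Fin n → R) : thetaDz k v * thetaDz l v = 0 := by
  apply Subtype.ext
  change (thetaDz k v : FormAlg n R) * (theta v * dz l) = 0
  rw [← mul_assoc, thetaDz_mul_theta, zero_mul]

/-- The product of the `(∑_i v_{k,i} dz̄_i) dz_k`, as an alternating function of `v`. -/
noncomputable def thetaProd :
    (Fin n → R) [⋀^Fin n]→ₗ[R] Subalgebra.center R (FormAlg n R) :=
  { (MultilinearMap.mkPiAlgebra R (Fin n) (Subalgebra.center R (FormAlg n R))).compLinearMap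
      thetaDz with
    -- If two arguments agree, two factors contain the same 1-form in the dz̄, whose square is zero.
    map_eq_zero_of_eq' := by
      intro v i j hv hij
      change ∏ k, thetaDz k (v k) = 0
      rw [← Finset.mul_prod_erase _ _ (Finset.mem_univ i),
        ← Finset.mul_prod_erase _ _ (Finset.mem_erase.2 ⟨hij.symm, Finset.mem_univ j⟩),
        ← mul_assoc, hv, thetaDz_mul_thetaDz, zero_mul] }

end Square

theorem theta_single (i : Fin n) : theta (Pi.single i (1 : R)) = dzbar i := by
  unfold theta
  rw [Finset.sum_eq_single i]
  · rw [Pi.single_eq_same, one_smul]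
  · intro j _ hj
    rw [Pi.single_eq_of_ne hj, zero_smul]
  · simp

theorem ofA_mul (A B : Finset (CoordIndex n)) : (ofA A).mul (ofA B) = ofA (A ∪ B) := by
  simp [ofA, SuperMonomial.mul]

theorem sign_ofA (A B : Finset (CoordIndex n)) :
    SuperMonomial.sign (ofA A) (ofA B) = shuffleSign A B := by
  simp [ofA, SuperMonomial.sign, shuffleSign_empty_left]

theorem compat_ofA {A B : Finset (CoordIndex n)} : (ofA A).Compat (ofA B) ↔ Disjoint A B := by
  simp [ofA, SuperMonomial.Compat]

/-- The sign in `∏_k dz̄_k dz_k = ± dz_1 ⋯ dz_n dz̄_1 ⋯ dz̄_n`. -/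
def orientationSign (m : ℕ) : ℤ := (-1) ^ (m * (m + 1) / 2)

theorem orientationSign_succ (m : ℕ) :
    orientationSign (m + 1) = (-1) ^ (m + 1) * orientationSign m := by
  unfold orientationSign
  rw [← pow_add]
  congr 1
  have h : (m + 1) * (m + 1 + 1) = m * (m + 1) + (m + 1) * 2 := by ring
  rw [h, Nat.add_mul_div_right _ _ two_pos]
  ring

/-- Induction by adding a largest index `a`. Reordering `dz̄_a dz_a` costs one sign, and moving
`dz_a` to the left of the dz̄ already present costs one sign for each of them; this is the recursion
`orientationSign_succ`. -/
theorem prod_thetaDz_single (s : Finset (Fin n)) :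
    ((∏ k ∈ s, thetaDz k (Pi.single k (1 : R)) : Subalgebra.center R (FormAlg n R)) : FormAlg n R)
      = single (ofA (s.image hol ∪ s.image anti)) (orientationSign s.card : R) := by
  induction s using Finset.induction_on_max with
  | empty => simp [orientationSign, one_def, ofA, SuperMonomial.unit]
  | insert a s ha ih =>
    have has : a ∉ s := fun h => lt_irrefl _ (ha a h)
    rw [Finset.prod_insert has, mul_comm, Finset.card_insert_of_notMem has]
    have e1 : ((∏ k ∈ s, thetaDz k (Pi.single k (1 : R))) * thetaDz a (Pi.single a 1) :
        Subalgebra.center R (FormAlg n R)) = (((∏ k ∈ s, thetaDz k (Pi.single k (1 : R)) :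
        Subalgebra.center R (FormAlg n R)) : FormAlg n R) * (dzbar a * dz a) : FormAlg n R) := by
      rw [← theta_single a]
      rfl
    rw [e1, ih]
    have d1 : Disjoint ({anti a} : Finset (CoordIndex n)) {hol a} := by
      simpa using (hol_ne_anti a a).symm
    have hs1 : shuffleSign ({anti a} : Finset (CoordIndex n)) {hol a} = -1 := by
      rw [shuffleSign_singleton_right, Finset.filter_singleton, if_pos (hol_lt_anti a a)]
      simp
    have e2 : (dzbar a * dz a : FormAlg n R) = single (ofA ({anti a} ∪ {hol a})) (-1 : R) := by
      change single (ofA {anti a}) 1 * single (ofA {hol a}) 1 = _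
      rw [single_mul_single (compat_ofA.2 d1), ofA_mul, sign_ofA, hs1]
      simp
    have d2 : Disjoint (s.image hol ∪ s.image anti) ({anti a} ∪ {hol a}) := by
      rw [Finset.disjoint_left]
      intro c hc hc'
      simp only [Finset.mem_union, Finset.mem_image, Finset.mem_singleton] at hc hc'
      rcases hc with ⟨i, hi, rfl⟩ | ⟨i, hi, rfl⟩ <;> rcases hc' with h | h
      · exact hol_ne_anti _ _ h
      · exact has (hol_injective h ▸ hi)
      · exact has (anti_injective h ▸ hi)
      · exact hol_ne_anti _ _ h.symm
    have hs2 : shuffleSign (s.image hol ∪ s.image anti) ({anti a} ∪ {hol a}) = (-1) ^ s.card := by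
      rw [shuffleSign_union_right_of_decidableEq d1, shuffleSign_singleton_right,
        shuffleSign_singleton_right]
      have f1 : (s.image hol ∪ s.image anti).filter (fun c => anti a < c) = ∅ := by
        rw [Finset.filter_eq_empty_iff]
        intro c hc
        simp only [Finset.mem_union, Finset.mem_image] at hc
        rcases hc with ⟨i, hi, rfl⟩ | ⟨i, hi, rfl⟩
        · exact (hol_lt_anti i a).not_gt
        · exact (anti_lt_anti.2 (ha i hi)).not_gt
      have f2 : (s.image hol ∪ s.image anti).filter (fun c => hol a < c) = s.image anti := by
        ext c
        simp only [Finset.mem_filter, Finset.mem_union, Finset.mem_image]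
        constructor
        · rintro ⟨⟨i, hi, rfl⟩ | h, hc⟩
          · exact absurd (hol_lt_hol.2 (ha i hi)) hc.not_gt
          · exact h
        · rintro ⟨i, hi, rfl⟩
          exact ⟨Or.inr ⟨i, hi, rfl⟩, hol_lt_anti a i⟩
      rw [f1, f2, Finset.card_image_of_injective _ anti_injective]
      simp
    rw [e2, single_mul_single (compat_ofA.2 d2), ofA_mul, sign_ofA, hs2, orientationSign_succ]
    congr 1
    · congr 1
      ext c
      simp only [Finset.mem_union, Finset.mem_image, Finset.mem_insert, Finset.mem_singleton]
      constructor
      · rintro ((⟨i, hi, rfl⟩ | ⟨i, hi, rfl⟩) | (rfl | rfl))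
        · exact Or.inl ⟨i, Or.inr hi, rfl⟩
        · exact Or.inr ⟨i, Or.inr hi, rfl⟩
        · exact Or.inr ⟨a, Or.inl rfl, rfl⟩
        · exact Or.inl ⟨a, Or.inl rfl, rfl⟩
      · rintro (⟨i, rfl | hi, rfl⟩ | ⟨i, rfl | hi, rfl⟩)
        · exact Or.inr (Or.inr rfl)
        · exact Or.inl (Or.inl ⟨i, hi, rfl⟩)
        · exact Or.inr (Or.inl rfl)
        · exact Or.inl (Or.inr ⟨i, hi, rfl⟩)
    · rw [zsmul_eq_mul]
      push_cast
      ring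

theorem image_hol_union_image_anti :
    (Finset.univ : Finset (Fin n)).image hol ∪ Finset.univ.image anti = Finset.univ := by
  ext c
  simp only [Finset.mem_union, Finset.mem_image, Finset.mem_univ, true_and, iff_true]
  rcases coordIndex_cases c with ⟨i, rfl⟩ | ⟨i, rfl⟩
  · exact Or.inl ⟨i, rfl⟩
  · exact Or.inr ⟨i, rfl⟩

/-- An alternating form of `n` vectors in `Rⁿ` is the determinant times its value on the standard
basis, which `prod_thetaDz_single` provides. -/
theorem coe_thetaProd [Algebra ℂ R] (M : Matrix (Fin n) (Fin n) R) :
    ((thetaProd fun k i => M i k : Subalgebra.center R (FormAlg n R)) : FormAlg n R)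
      = single (ofA Finset.univ) (orientationSign n * M.det) := by
  funext K
  let ev : Subalgebra.center R (FormAlg n R) →ₗ[R] R :=
    (LinearMap.proj K : (SuperMonomial n → R) →ₗ[R] R) ∘ₗ
      (Subalgebra.center R (FormAlg n R)).val.toLinearMap
  have h := (ev.compAlternatingMap thetaProd).eq_smul_basis_det (Pi.basisFun R (Fin n))
  have h1 := congrArg (fun f => f fun k i => M i k) h
  rw [Pi.basisFun_det] at h1
  have h2 : Matrix.detRowAlternating (R := R) (fun k i => M i k) = M.det := M.det_transpose
  have h3 : (ev.compAlternatingMap thetaProd) (Pi.basisFun R (Fin n))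
      = single (ofA Finset.univ) (orientationSign n : R) K := by
    have := congrFun (prod_thetaDz_single (n := n) (R := R) Finset.univ) K
    rw [image_hol_union_image_anti, Finset.card_univ, Fintype.card_fin] at this
    rw [← this]
    change ((thetaProd _ : Subalgebra.center R (FormAlg n R)) : FormAlg n R) K = _
    have e : (⇑(Pi.basisFun R (Fin n))) = fun k => Pi.single k (1 : R) :=
      funext fun k => Pi.basisFun_apply R (Fin n) k
    rw [e]
    rfl
  change ((thetaProd _ : Subalgebra.center R (FormAlg n R)) : FormAlg n R) K
    = (_ * Matrix.detRowAlternating (R := R) (fun k i => M i k)) at h1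
  rw [h1, h2, h3, mul_comm, ← smul_apply, smul_single, mul_comm]

end FormAlg

/-! ### Powers of sums of elements of square zero -/

section SquareZero

theorem add_pow_succ_of_mul_self_eq_zero {Z : Type*} [Ring Z] {x y : Z} (hxy : x * y = y * x)
    (hy : y * y = 0) (m : ℕ) : (x + y) ^ m = x ^ m + m • (x ^ (m - 1) * y) := by
  induction m with
  | zero => simp
  | succ m ih =>
    rw [pow_succ, ih, Nat.add_sub_cancel, mul_add, add_mul, add_mul, smul_mul_assoc,
      smul_mul_assoc, mul_assoc _ y y, hy, mul_zero, smul_zero, add_zero, mul_assoc _ y x, ← hxy,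
      ← mul_assoc]
    rcases m with _ | m
    · simp
    · rw [Nat.add_sub_cancel, ← pow_succ, ← pow_succ]
      rw [succ_nsmul (x ^ (m + 1) * y) (m + 1)]
      abel

variable {Z : Type*} [CommRing Z] {ι : Type*} [DecidableEq ι] {x : ι → Z}

/-- Only squarefree products survive in the expansion, and the product of all the elements arises
once for each ordering. -/
theorem sum_pow_card_of_mul_self_eq_zero (hx : ∀ k, x k * x k = 0) (s : Finset ι) :
    (∑ k ∈ s, x k) ^ s.card = s.card.factorial • ∏ k ∈ s, x k ∧
      (∑ k ∈ s, x k) ^ (s.card + 1) = 0 := by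
  induction s using Finset.induction_on with
  | empty => simp
  | insert a s ha ih =>
    have h1 : (∑ k ∈ s, x k) ^ (s.card + 1 + 1) = 0 := by rw [pow_succ, ih.2, zero_mul]
    rw [Finset.card_insert_of_notMem ha, Finset.sum_insert ha, Finset.prod_insert ha, add_comm,
      add_pow_succ_of_mul_self_eq_zero (mul_comm _ _) (hx a),
      add_pow_succ_of_mul_self_eq_zero (mul_comm _ _) (hx a), ih.2, h1]
    simp only [Nat.add_sub_cancel]
    rw [ih.1, ih.2]
    refine ⟨?_, by simp⟩
    rw [Nat.factorial_succ, zero_add, mul_comm (x a), smul_mul_assoc, smul_smul]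

theorem mul_sum_pow_eq [Fintype ι] {T : Z} (s : Finset ι) (h : ∀ k ∉ s, T * x k = 0) (m : ℕ) :
    T * (∑ k, x k) ^ m = T * (∑ k ∈ s, x k) ^ m := by
  induction m with
  | zero => simp
  | succ m ih =>
    have h1 : T * ∑ k, x k = T * ∑ k ∈ s, x k := by
      rw [Finset.mul_sum, Finset.mul_sum]
      exact (Finset.sum_subset (Finset.subset_univ s) fun k _ hk => h k hk).symm
    calc T * (∑ k, x k) ^ (m + 1) = (T * (∑ k, x k) ^ m) * ∑ k, x k := by ring
      _ = (T * ∑ k, x k) * (∑ k ∈ s, x k) ^ m := by rw [ih]; ring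
      _ = _ := by rw [h1]; ring

end SquareZero

theorem SuperMonomial.sign_mul_self {n : ℕ} (I J : SuperMonomial n) :
    SuperMonomial.sign I J * SuperMonomial.sign I J = 1 := by
  have e (k : ℕ) : ((-1 : ℤ) ^ k) * (-1) ^ k = 1 := by
    rw [← mul_pow]
    simp
  unfold SuperMonomial.sign shuffleSign
  rw [← pow_add, ← pow_add]
  exact e _

/-! ### Powers of the nilpotent part and its top coefficient -/

namespace FormAlg

variable {n : ℕ} {R : Type*} [CommRing R] [Algebra ℂ R]

/-- `∑_{i,k} M_{ik} dz̄_i dz_k`. -/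
noncomputable def evenTwoForm (M : Matrix (Fin n) (Fin n) R) : FormAlg n R :=
  ∑ k, theta (fun i => M i k) * dz k

/-- `∑_{i,k} M_{ik} dz̄_i dξ_k`. -/
noncomputable def oddTwoForm (M : Matrix (Fin n) (Fin n) R) : FormAlg n R :=
  ∑ k, theta (fun i => M i k) * dxi k

theorem coe_sum_thetaDz_pow (M : Matrix (Fin n) (Fin n) R) (m : ℕ) :
    (((∑ k, thetaDz k fun i => M i k) ^ m : Subalgebra.center R (FormAlg n R)) : FormAlg n R)
      = evenTwoForm M ^ m := by
  rw [SubmonoidClass.coe_pow]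
  congr 1
  exact AddSubmonoidClass.coe_finsetSum _ _

theorem evenTwoForm_pow (M : Matrix (Fin n) (Fin n) R) : evenTwoForm M ^ n
    = single (ofA Finset.univ) (n.factorial * (orientationSign n * M.det)) := by
  have h := (sum_pow_card_of_mul_self_eq_zero (x := fun k => thetaDz k fun i => M i k)
    (fun k => thetaDz_mul_thetaDz k k _) Finset.univ).1
  rw [Finset.card_univ, Fintype.card_fin] at h
  rw [← coe_sum_thetaDz_pow, h]
  change n.factorial • ((thetaProd fun k i => M i k : Subalgebra.center R (FormAlg n R)) :
    FormAlg n R) = _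
  rw [coe_thetaProd, ← Nat.cast_smul_eq_nsmul R, smul_single]

theorem evenTwoForm_pow_succ (M : Matrix (Fin n) (Fin n) R) : evenTwoForm M ^ (n + 1) = 0 := by
  have h := (sum_pow_card_of_mul_self_eq_zero (x := fun k => thetaDz k fun i => M i k)
    (fun k => thetaDz_mul_thetaDz k k _) Finset.univ).2
  rw [Finset.card_univ, Fintype.card_fin] at h
  rw [← coe_sum_thetaDz_pow, h]
  rfl

theorem theta_mul_dz_mul_theta_mul_dz_self (u v : Fin n → R) (j : Fin n) :
    theta u * dz j * (theta v * dz j) = 0 := by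
  have h : (dz j * theta v : FormAlg n R) = -(theta v * dz j) := by
    rw [mul_eq_of_hasType (hasType_dz j) (hasType_theta v)]
    simp
  rw [← mul_assoc, mul_assoc _ (dz j), h, mul_neg, neg_mul, ← mul_assoc, mul_assoc _ (dz j),
    dz_mul_self, mul_zero, neg_zero]

/-- The factor kills every summand of the 2-form that shares its 1-form in the dz̄ or its `dz_i`.
For `k = i` one summand is lost and the other `n - 1` complete the product; for `k ≠ i` two are
lost, and the power `n - 1` of the remaining `n - 2` vanishes. -/
theorem evenTwoForm_pow_mul_theta_mul_dz (M : Matrix (Fin n) (Fin n) R) (k i : Fin n) :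
    evenTwoForm M ^ (n - 1) * (theta (fun l => M l k) * dz i)
      = if k = i then single (ofA Finset.univ)
        ((n - 1).factorial * (orientationSign n * M.det)) else 0 := by
  set x : Fin n → Subalgebra.center R (FormAlg n R) := fun k => thetaDz k fun i => M i k with hx
  have hxx (k) : x k * x k = 0 := thetaDz_mul_thetaDz k k _
  have h0 : evenTwoForm M ^ (n - 1) * (theta (fun l => M l k) * dz i)
      = ((thetaDz i (fun l => M l k) * (∑ k, x k) ^ (n - 1) :
        Subalgebra.center R (FormAlg n R)) : FormAlg n R) := by
    rw [mul_comm]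
    change _ = (((∑ k, x k) ^ (n - 1) : Subalgebra.center R (FormAlg n R)) : FormAlg n R) * _
    rw [coe_sum_thetaDz_pow, coe_thetaDz]
  rw [h0]
  split_ifs with hki
  · subst hki
    have hc : (Finset.univ.erase k).card = n - 1 := by
      rw [Finset.card_erase_of_mem (Finset.mem_univ k), Finset.card_univ, Fintype.card_fin]
    have h1 := (sum_pow_card_of_mul_self_eq_zero hxx (Finset.univ.erase k)).1
    rw [hc] at h1
    rw [mul_sum_pow_eq (Finset.univ.erase k) (x := x), h1, mul_smul_comm]
    · have h2 := Finset.mul_prod_erase Finset.univ x (Finset.mem_univ k)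
      have h3 : thetaDz k (fun l => M l k) * ∏ k ∈ Finset.univ.erase k, x k
          = thetaProd fun k i => M i k := h2
      rw [h3]
      change (n - 1).factorial • ((thetaProd fun k i => M i k :
        Subalgebra.center R (FormAlg n R)) : FormAlg n R) = _
      rw [coe_thetaProd, ← Nat.cast_smul_eq_nsmul R, smul_single]
    · intro j hj
      rw [Finset.mem_erase, not_and_or, not_not] at hj
      rcases hj with rfl | hj
      · exact hxx j
      · exact absurd (Finset.mem_univ j) hj
  · have hc : ((Finset.univ.erase k).erase i).card + 1 = n - 1 := by
      have h1 : i ∈ Finset.univ.erase k := Finset.mem_erase.2 ⟨Ne.symm hki, Finset.mem_univ i⟩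
      have h2 : (Finset.univ.erase k).card = n - 1 := by
        rw [Finset.card_erase_of_mem (Finset.mem_univ k), Finset.card_univ, Fintype.card_fin]
      rw [Finset.card_erase_of_mem h1, h2]
      have : 0 < (Finset.univ.erase k).card := Finset.card_pos.2 ⟨i, h1⟩
      omega
    rw [mul_sum_pow_eq ((Finset.univ.erase k).erase i) (x := x), ← hc,
      (sum_pow_card_of_mul_self_eq_zero hxx _).2, mul_zero]
    · rfl
    · intro j hj
      rw [Finset.mem_erase, Finset.mem_erase, not_and_or, not_and_or, not_not, not_not] at hj
      rcases hj with rfl | rfl | hj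
      · apply Subtype.ext
        exact theta_mul_dz_mul_theta_mul_dz_self _ _ _
      · exact thetaDz_mul_thetaDz i j _
      · exact absurd (Finset.mem_univ j) hj

theorem hasType_evenTwoForm (M : Matrix (Fin n) (Fin n) R) :
    (evenTwoForm M).SupportedOn (HasType 0 0) :=
  SupportedOn.sum fun k _ => hasType_theta_mul_dz _ k

theorem hasType_oddTwoForm (M : Matrix (Fin n) (Fin n) R) :
    (oddTwoForm M).SupportedOn (HasType 0 1) :=
  SupportedOn.sum fun k _ => hasType_theta_mul_dxi _ k

/-- The power already contains each `dz̄_i`, and each term on the right brings another one. -/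
theorem evenTwoForm_pow_mul_oddTwoForm (M : Matrix (Fin n) (Fin n) R) :
    evenTwoForm M ^ n * oddTwoForm M = 0 := by
  rw [evenTwoForm_pow]
  unfold oddTwoForm theta
  rw [Finset.mul_sum]
  refine Finset.sum_eq_zero fun k _ => ?_
  rw [Finset.sum_mul, Finset.mul_sum]
  refine Finset.sum_eq_zero fun i _ => ?_
  rw [← mul_assoc, mul_smul_comm, dzbar, single_mul_single_of_not, smul_zero, zero_mul]
  simp [ofA, SuperMonomial.Compat]

/-- After the multiplication by `dz_i` the 1-forms in the dz̄ stand next to `dz_i`, and the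
preceding computation leaves the summand `k = i` alone. The sign is that of the exchange of `dξ_i`
and `dz_i`. The product with `dz_i` is used because it determines the coefficients of all monomials
without `dz_i`. -/
theorem evenTwoForm_pow_mul_oddTwoForm_mul_dz (M : Matrix (Fin n) (Fin n) R) (i : Fin n) :
    evenTwoForm M ^ (n - 1) * oddTwoForm M * dz i
      = -single ⟨Finset.univ, Pi.single (hol i) 1, ∅⟩
        ((n - 1).factorial * (orientationSign n * M.det)) := by
  unfold oddTwoForm
  rw [Finset.mul_sum, Finset.sum_mul]
  have h1 (k : Fin n) : evenTwoForm M ^ (n - 1) * (theta (fun l => M l k) * dxi k) * dz i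
      = -(evenTwoForm M ^ (n - 1) * (theta (fun l => M l k) * dz i) * dxi k) := by
    have h2 : (dxi k * dz i : FormAlg n R) = -(dz i * dxi k) := by
      rw [mul_eq_of_hasType (hasType_dxi k) (hasType_dz i)]
      simp
    simp only [mul_assoc, h2, mul_neg]
  simp only [h1, evenTwoForm_pow_mul_theta_mul_dz]
  rw [Finset.sum_eq_single i]
  · rw [if_pos rfl, dxi, single_mul_single]
    · congr 2
      · simp [ofA, SuperMonomial.mul]
      · simp [ofA, SuperMonomial.sign, shuffleSign_empty_right]
    · simp [ofA, SuperMonomial.Compat]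
  · intro k _ hk
    rw [if_neg hk, zero_mul, neg_zero]
  · simp

/-- The number of factors `dz_i` of a monomial. -/
def holDegree (I : SuperMonomial n) : ℕ := (I.A.filter fun c => ∃ i, c = hol i).card

theorem holDegree_mul {I J : SuperMonomial n} (h : I.Compat J) :
    holDegree (I.mul J) = holDegree I + holDegree J := by
  unfold holDegree SuperMonomial.mul
  rw [Finset.filter_union, Finset.card_union_of_disjoint]
  exact Finset.disjoint_filter_filter h.1

theorem holDegree_evenTwoForm (M : Matrix (Fin n) (Fin n) R) :
    (evenTwoForm M).SupportedOn fun I => holDegree I = 1 := by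
  refine SupportedOn.sum fun k _ => ?_
  have h1 : (theta fun i => M i k).SupportedOn fun I => holDegree I = 0 :=
    SupportedOn.sum fun i _ => (supportedOn_single (by
      simp only [holDegree, Finset.card_eq_zero, Finset.filter_eq_empty_iff,
        Finset.mem_singleton]
      rintro c rfl ⟨j, hj⟩
      exact hol_ne_anti _ _ hj.symm) 1).smul _
  have h2 : (dz k : FormAlg n R).SupportedOn fun I => holDegree I = 1 :=
    supportedOn_single (by
      unfold holDegree
      rw [Finset.filter_singleton, if_pos ⟨k, rfl⟩, Finset.card_singleton]) 1
  refine h1.mul h2 fun I J h hI hJ => ?_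
  rw [holDegree_mul h, hI, hJ]

theorem holDegree_oddTwoForm (M : Matrix (Fin n) (Fin n) R) :
    (oddTwoForm M).SupportedOn fun I => holDegree I = 0 := by
  refine SupportedOn.sum fun k _ => ?_
  have h1 : (theta fun i => M i k).SupportedOn fun I => holDegree I = 0 :=
    SupportedOn.sum fun i _ => (supportedOn_single (by
      simp only [holDegree, Finset.card_eq_zero, Finset.filter_eq_empty_iff,
        Finset.mem_singleton]
      rintro c rfl ⟨j, hj⟩
      exact hol_ne_anti _ _ hj.symm) 1).smul _
  have h2 : (dxi k : FormAlg n R).SupportedOn fun I => holDegree I = 0 :=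
    supportedOn_single (by simp [holDegree]) 1
  refine h1.mul h2 fun I J h hI hJ => ?_
  rw [holDegree_mul h, hI, hJ]

/-- The monomial of `dZ dΞ` complementary to `dz_i ∏_{k ≠ i} dξ_k ∏ dξ̄_k ξ_1 ⋯ ξ̄_n`. -/
def starMonomial (i : Fin n) : SuperMonomial n :=
  ⟨Finset.univ.erase (hol i), Pi.single (hol i) 1, ∅⟩

theorem starMonomial_compat (i : Fin n) : (starMonomial i).Compat ⟨{hol i}, 0, ∅⟩ := by
  simp [starMonomial, SuperMonomial.Compat]

theorem starMonomial_mul (i : Fin n) : (starMonomial i).mul ⟨{hol i}, 0, ∅⟩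
    = ⟨Finset.univ, Pi.single (hol i) 1, ∅⟩ := by
  ext1
  · ext c
    simp [starMonomial, SuperMonomial.mul]
  · simp [starMonomial, SuperMonomial.mul]
  · simp [starMonomial, SuperMonomial.mul]

/-- Each monomial has `n - 1` factors among the dz, so some `dz_i` is missing. Multiplication by
that `dz_i` is injective on such monomials and lands in the single monomial found above. -/
theorem supportedOn_evenTwoForm_pow_mul_oddTwoForm (M : Matrix (Fin n) (Fin n) R) :
    (evenTwoForm M ^ (n - 1) * oddTwoForm M).SupportedOn fun K => ∃ i, K = starMonomial i := by
  intro K hK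
  rcases Nat.eq_zero_or_pos n with rfl | hn
  · simp [oddTwoForm, zero_apply] at hK
  have hdeg : holDegree K = n - 1 := by
    have h1 := ((holDegree_evenTwoForm M).pow holDegree (fun I J h => holDegree_mul h)
      (by simp [holDegree, SuperMonomial.unit]) (n - 1)).mul (holDegree_oddTwoForm M)
      (p'' := fun I => holDegree I = n - 1) fun I J h hI hJ => by
        rw [holDegree_mul h, hI, hJ]
        ring
    exact h1 K hK
  obtain ⟨i, hi⟩ : ∃ i : Fin n, hol i ∉ K.A := by
    by_contra! h
    have h1 : Finset.univ.image hol ⊆ K.A.filter fun c => ∃ i, c = hol i := by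
      intro c hc
      obtain ⟨i, _, rfl⟩ := Finset.mem_image.1 hc
      exact Finset.mem_filter.2 ⟨h i, i, rfl⟩
    have h2 := Finset.card_le_card h1
    rw [Finset.card_image_of_injective _ hol_injective, Finset.card_univ, Fintype.card_fin] at h2
    unfold holDegree at hdeg
    omega
  have hc : K.Compat ⟨{hol i}, 0, ∅⟩ := by
    simpa [SuperMonomial.Compat] using hi
  have h1 := mul_single_apply K ⟨{hol i}, 0, ∅⟩ hc (1 : R) (evenTwoForm M ^ (n - 1) * oddTwoForm M)
  have h2 := congrFun (evenTwoForm_pow_mul_oddTwoForm_mul_dz M i) (K.mul ⟨{hol i}, 0, ∅⟩)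
  rw [dz, h1] at h2
  refine ⟨i, ?_⟩
  by_contra hne
  have h3 : K.mul ⟨{hol i}, 0, ∅⟩ ≠ ⟨Finset.univ, Pi.single (hol i) 1, ∅⟩ := by
    rw [← starMonomial_mul i, SuperMonomial.mul_comm, SuperMonomial.mul_comm (starMonomial i)]
    exact fun h => hne (SuperMonomial.mul_left_cancel (SuperMonomial.compat_symm hc)
      (SuperMonomial.compat_symm (starMonomial_compat i)) h)
  rw [neg_apply, single_of_ne h3, neg_zero, mul_one] at h2
  have h4 := congrArg (fun r => SuperMonomial.sign K ⟨{hol i}, 0, ∅⟩ • r) h2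
  simp only [smul_smul, SuperMonomial.sign_mul_self, one_smul, smul_zero] at h4
  exact hK h4

/-- The monomial `dz_i ∏_{k ≠ i} dξ_k ∏ dξ̄_k ξ_1 ⋯ ξ̄_n`. -/
def starCofactor (i : Fin n) : SuperMonomial n :=
  ⟨{hol i}, Function.update 1 (hol i) 0, Finset.univ⟩

theorem starCofactor_compat (i : Fin n) : (starCofactor i).Compat (starMonomial i) := by
  simp [starCofactor, starMonomial, SuperMonomial.Compat]

theorem starCofactor_mul (i : Fin n) :
    (starCofactor i).mul (starMonomial i) = ⟨Finset.univ, 1, Finset.univ⟩ := by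
  ext1
  · ext c
    simp [starCofactor, starMonomial, SuperMonomial.mul]
  · funext c
    by_cases h : c = hol i
    · subst h
      simp [starCofactor, starMonomial, SuperMonomial.mul]
    · simp [starCofactor, starMonomial, SuperMonomial.mul, h]
  · simp [starCofactor, starMonomial, SuperMonomial.mul]

/-- This sign cancels the one in `evenTwoForm_pow_mul_oddTwoForm_mul_dz`. Therefore the coefficients
of η with one `dz_j` enter with the same sign as the coefficient without any. -/
theorem sign_starCofactor (i : Fin n) : SuperMonomial.sign (starCofactor i) (starMonomial i)
    = -SuperMonomial.sign (starMonomial i) ⟨{hol i}, 0, ∅⟩ := by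
  have hn : 0 < n := i.pos
  have e1 : ∑ c : CoordIndex n, Function.update (1 : CoordIndex n → ℕ) (hol i) 0 c = 2 * n - 1 := by
    have h1 := Finset.sum_update_of_mem (Finset.mem_univ (hol i)) (1 : CoordIndex n → ℕ) 0
    rw [h1, zero_add]
    simp only [Pi.one_apply, Finset.sum_const, smul_eq_mul, mul_one]
    rw [Finset.card_sdiff_of_subset (Finset.subset_univ _), Finset.card_univ, card_coordIndex,
      Finset.card_singleton]
  have e2 : ((Finset.univ : Finset (CoordIndex n)).erase (hol i)).card = 2 * n - 1 := by
    rw [Finset.card_erase_of_mem (Finset.mem_univ _), Finset.card_univ, card_coordIndex]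
  have e3 : ∑ c : CoordIndex n, Pi.single (M := fun _ => ℕ) (hol i) 1 c = 1 := by
    rw [Finset.sum_pi_single']
    simp
  have hodd : Odd (2 * n - 1) := ⟨n - 1, by omega⟩
  have hd : Disjoint ({hol i} : Finset (CoordIndex n)) (Finset.univ.erase (hol i)) := by simp
  unfold SuperMonomial.sign starCofactor starMonomial
  simp only
  rw [e1, e2, e3, shuffleSign_empty_right, shuffleSign_comm hd, e2, Finset.card_singleton, one_mul,
    hodd.neg_one_pow, Finset.card_univ, card_coordIndex, pow_add, (hodd.mul hodd).neg_one_pow,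
    shuffleSign_empty_left]
  simp

theorem sign_smul_evenTwoForm_pow_mul_oddTwoForm (M : Matrix (Fin n) (Fin n) R) (i : Fin n) :
    SuperMonomial.sign (starCofactor i) (starMonomial i) •
      (evenTwoForm M ^ (n - 1) * oddTwoForm M) (starMonomial i)
      = (n - 1).factorial * (orientationSign n * M.det) := by
  have h1 := mul_single_apply (starMonomial i) ⟨{hol i}, 0, ∅⟩ (starMonomial_compat i) (1 : R)
    (evenTwoForm M ^ (n - 1) * oddTwoForm M)
  have h2 := congrFun (evenTwoForm_pow_mul_oddTwoForm_mul_dz M i)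
    ((starMonomial i).mul ⟨{hol i}, 0, ∅⟩)
  rw [dz, h1, neg_apply, starMonomial_mul, single_same, mul_one] at h2
  rw [sign_starCofactor, neg_smul, h2, neg_neg]

variable {N : Type*} [AddCommGroup N] [Module R N]

/-- The top coefficient of the product of `η` and `x`. -/
noncomputable def topPair (η : SuperMonomial n → N) : FormAlg n R →ₗ[R] N where
  toFun x := ∑ q ∈ (⟨Finset.univ, 1, Finset.univ⟩ : SuperMonomial n).antidiagonal,
    SuperMonomial.sign q.1 q.2 • (x q.2 • η q.1)
  map_add' x y := by
    rw [← Finset.sum_add_distrib]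
    refine Finset.sum_congr rfl fun q _ => ?_
    rw [← smul_add, ← add_smul]
    rfl
  map_smul' r x := by
    rw [RingHom.id_apply, Finset.smul_sum]
    refine Finset.sum_congr rfl fun q _ => ?_
    rw [smul_comm r, smul_smul]
    rfl

theorem topPair_apply (η : SuperMonomial n → N) (x : FormAlg n R) : topPair η x
    = ∑ q ∈ (⟨Finset.univ, 1, Finset.univ⟩ : SuperMonomial n).antidiagonal,
      SuperMonomial.sign q.1 q.2 • (x q.2 • η q.1) := rfl

theorem topPair_single_univ (η : SuperMonomial n → N) (r : R) :
    topPair η (single (ofA Finset.univ) r) = r • η ⟨∅, 1, Finset.univ⟩ := by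
  have hc : (⟨∅, 1, Finset.univ⟩ : SuperMonomial n).Compat (ofA Finset.univ) := by
    simp [ofA, SuperMonomial.Compat]
  have hm : (⟨∅, 1, Finset.univ⟩ : SuperMonomial n).mul (ofA Finset.univ)
      = ⟨Finset.univ, 1, Finset.univ⟩ := by
    simp [ofA, SuperMonomial.mul]
  -- The `2n` odd 1-forms pass `2n` even 1-forms, an even number of exchanges.
  have hs : SuperMonomial.sign (⟨∅, 1, Finset.univ⟩ : SuperMonomial n) (ofA Finset.univ) = 1 := by
    have e : Even (2 * n * (2 * n)) := ⟨2 * n * n, by ring⟩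
    simp [SuperMonomial.sign, ofA, shuffleSign_empty_left, shuffleSign_empty_right, e.neg_one_pow,
      ← two_mul]
  rw [topPair_apply, Finset.sum_eq_single (⟨∅, 1, Finset.univ⟩, ofA Finset.univ)]
  · simp only
    rw [single_same, hs, one_smul]
  · rintro ⟨I, J⟩ hq hne
    simp only
    rw [SuperMonomial.mem_antidiagonal] at hq
    by_cases hJ : J = ofA Finset.univ
    · subst hJ
      refine absurd ?_ hne
      refine Prod.ext ?_ rfl
      have h2 := hq.2.trans hm.symm
      simp only at h2
      rw [SuperMonomial.mul_comm, SuperMonomial.mul_comm (⟨∅, 1, Finset.univ⟩)] at h2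
      exact SuperMonomial.mul_left_cancel (SuperMonomial.compat_symm hq.1)
        (SuperMonomial.compat_symm hc) h2
    · rw [single_of_ne hJ, zero_smul, smul_zero]
  · intro h
    exact absurd (hm ▸ SuperMonomial.mk_mem_antidiagonal hc) h

theorem topPair_evenTwoForm_pow_mul_oddTwoForm (η : SuperMonomial n → N)
    (M : Matrix (Fin n) (Fin n) R) : topPair η (evenTwoForm M ^ (n - 1) * oddTwoForm M)
      = ((n - 1).factorial * (orientationSign n * M.det)) • ∑ i, η (starCofactor i) := by
  have hinj : Function.Injective fun i : Fin n => (starCofactor i, starMonomial i) := by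
    intro i j h
    have h1 := congrArg (fun q : SuperMonomial n × SuperMonomial n => q.1.A) h
    exact hol_injective (Finset.singleton_injective h1)
  classical
  rw [topPair_apply, ← Finset.sum_subset (s₁ := Finset.univ.image fun i : Fin n =>
    (starCofactor i, starMonomial i)), Finset.sum_image fun i _ j _ h => hinj h, Finset.smul_sum]
  · refine Finset.sum_congr rfl fun i _ => ?_
    rw [← smul_assoc, sign_smul_evenTwoForm_pow_mul_oddTwoForm]
  · intro q hq
    obtain ⟨i, _, rfl⟩ := Finset.mem_image.1 hq
    rw [← starCofactor_mul i]
    exact SuperMonomial.mk_mem_antidiagonal (starCofactor_compat i)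
  · rintro ⟨I, J⟩ hq hne
    simp only
    rw [SuperMonomial.mem_antidiagonal] at hq
    by_cases h0 : (evenTwoForm M ^ (n - 1) * oddTwoForm M) J = 0
    · rw [h0, zero_smul, smul_zero]
    obtain ⟨i, rfl⟩ := supportedOn_evenTwoForm_pow_mul_oddTwoForm M J h0
    refine hne.elim (Finset.mem_image.2 ⟨i, Finset.mem_univ i, Prod.ext ?_ rfl⟩)
    have h2 := (starCofactor_mul i).trans hq.2.symm
    simp only at h2
    rw [SuperMonomial.mul_comm, SuperMonomial.mul_comm I] at h2
    exact SuperMonomial.mul_left_cancel (SuperMonomial.compat_symm (starCofactor_compat i))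
      (SuperMonomial.compat_symm hq.1) h2

/-- The power uses up all even 1-forms, so the partner taken from `η` has none, has all the odd
1-forms once, and has exactly the odd coordinates missing in `F`. -/
theorem topPair_evenTwoForm_pow_mul_eq_zero (η : SuperMonomial n → N)
    (M : Matrix (Fin n) (Fin n) R) {F : FormAlg n R}
    (hF : F.SupportedOn fun I => I.A = ∅ ∧ I.m = 0 ∧ η ⟨∅, 1, Finset.univ \ I.Q⟩ = 0) :
    topPair η (evenTwoForm M ^ n * F) = 0 := by
  rw [evenTwoForm_pow, topPair_apply]
  refine Finset.sum_eq_zero ?_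
  rintro ⟨I, J⟩ hq
  simp only
  rw [SuperMonomial.mem_antidiagonal] at hq
  obtain ⟨hq1, hq2⟩ := hq
  by_cases h0 : (single (ofA Finset.univ) ((n.factorial : R) * (orientationSign n * M.det)) * F :
      FormAlg n R) J = 0
  · rw [h0, zero_smul, smul_zero]
  have h1 := (supportedOn_single (p := fun I => I = ofA Finset.univ) rfl
    ((n.factorial : R) * (orientationSign n * M.det))).mul hF
    (p'' := fun K => K.A = Finset.univ ∧ K.m = 0 ∧ η ⟨∅, 1, Finset.univ \ K.Q⟩ = 0) (by
      rintro I K hc rfl ⟨hA, hm, hη⟩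
      simp only [SuperMonomial.mul, ofA, hA, hm, Finset.union_empty, Finset.empty_union, add_zero]
      exact ⟨trivial, trivial, hη⟩) J h0
  have hI : I = ⟨∅, 1, Finset.univ \ J.Q⟩ := by
    have a1 := congrArg SuperMonomial.m hq2
    have a2 := congrArg SuperMonomial.Q hq2
    simp only [SuperMonomial.mul, h1.2.1, add_zero] at a1 a2
    ext1
    · have := hq1.1
      simp only at this
      rw [h1.1, ← Finset.top_eq_univ, disjoint_top] at this
      exact this
    · exact a1
    · rw [← a2]
      exact (Finset.union_sdiff_cancel_right hq1.2).symm
  rw [hI, h1.2.2, smul_zero, smul_zero]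

section Total

variable (M : Matrix (Fin n) (Fin n) R) {F : FormAlg n R}

/-- The even 2-form is central, and the rest has even degree and odd parity, so it anticommutes with
itself and its square is zero. -/
theorem total_pow (hF : F.SupportedOn (HasType 0 1)) (m : ℕ) :
    (evenTwoForm M + (oddTwoForm M + F)) ^ m
      = evenTwoForm M ^ m + m • (evenTwoForm M ^ (m - 1) * (oddTwoForm M + F)) :=
  add_pow_succ_of_mul_self_eq_zero (mul_comm_of_even (hasType_evenTwoForm M) _)
    (mul_self_eq_zero_of_hasType ((hasType_oddTwoForm M).add hF) (by decide)) m

theorem total_pow_eq_zero (hF : F.SupportedOn (HasType 0 1)) :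
    (evenTwoForm M + (oddTwoForm M + F)) ^ (n + 2) = 0 := by
  rw [total_pow M hF, show n + 2 - 1 = n + 1 from rfl, evenTwoForm_pow_succ, zero_mul, smul_zero,
    pow_succ, evenTwoForm_pow_succ, zero_mul, add_zero]

/-- Of the power `n + 1` only the product of the `n`-th power of the even 2-form with `F` is left,
since that `n`-th power annihilates the odd 2-form. -/
theorem topPair_total_pow_succ (hF : F.SupportedOn (HasType 0 1)) (η : SuperMonomial n → N)
    (hFη : F.SupportedOn fun I => I.A = ∅ ∧ I.m = 0 ∧ η ⟨∅, 1, Finset.univ \ I.Q⟩ = 0) :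
    topPair η ((evenTwoForm M + (oddTwoForm M + F)) ^ (n + 1)) = 0 := by
  rw [total_pow M hF, evenTwoForm_pow_succ, zero_add, Nat.add_sub_cancel, mul_add,
    evenTwoForm_pow_mul_oddTwoForm, zero_add, map_nsmul,
    topPair_evenTwoForm_pow_mul_eq_zero η M hFη, smul_zero]

/-- The two contributions come with the weights `n!` and `n · (n - 1)!`; their equality is the
reason why the coefficients of `η` are simply added. -/
theorem topPair_total_pow (hF : F.SupportedOn (HasType 0 1)) (η : SuperMonomial n → N) :
    topPair η ((evenTwoForm M + (oddTwoForm M + F)) ^ n)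
      = (n.factorial * (orientationSign n * M.det)) •
          (η ⟨∅, 1, Finset.univ⟩ + ∑ i, η (starCofactor i))
        + n • topPair η (evenTwoForm M ^ (n - 1) * F) := by
  rw [total_pow M hF, map_add, map_nsmul, evenTwoForm_pow, topPair_single_univ, mul_add, map_add,
    topPair_evenTwoForm_pow_mul_oddTwoForm, smul_add, smul_add, ← add_assoc]
  congr 2
  rcases Nat.eq_zero_or_pos n with rfl | hn
  · simp
  · rw [← Nat.cast_smul_eq_nsmul R, smul_smul, ← mul_assoc, ← Nat.cast_mul,
      Nat.mul_factorial_pred hn.ne']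

end Total

end FormAlg

/-! ### The Grassmann algebra and its finite truncations -/

namespace ComplexGrassmann

/-! ### Order, inverses and conjugation -/

theorem smul_apply (c : ℂ) (x : ComplexGrassmann) (l : Finset ℕ) : (c • x) l = c * x l := rfl

theorem sub_apply (x y : ComplexGrassmann) (l : Finset ℕ) : (x - y) l = x l - y l := rfl

theorem sum_apply {ι : Type*} (s : Finset ι) (x : ι → ComplexGrassmann) (l : Finset ℕ) :
    (∑ i ∈ s, x i) l = ∑ i ∈ s, x i l := Finset.sum_apply l s x

theorem smul_mul (c : ℂ) (x y : ComplexGrassmann) : c • x * y = c • (x * y) := by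
  funext l
  simp only [mul_apply, smul_apply, Finset.mul_sum]
  exact Finset.sum_congr rfl fun m _ => by ring

theorem mul_smul' (c : ℂ) (x y : ComplexGrassmann) : x * c • y = c • (x * y) := by
  funext l
  simp only [mul_apply, smul_apply, Finset.mul_sum]
  exact Finset.sum_congr rfl fun m _ => by ring

theorem smul_mem_evenPart (c : ℂ) {x : ComplexGrassmann} (hx : x ∈ evenPart) :
    c • x ∈ evenPart := fun l hl => by rw [smul_apply, hx l hl, mul_zero]

theorem mul_comm_of_mem_evenPart {x : ComplexGrassmann} (hx : x ∈ evenPart)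
    (y : ComplexGrassmann) : x * y = y * x := by
  funext l
  rw [mul_apply, mul_apply]
  refine Finset.sum_bij' (fun m _ => l \ m) (fun m _ => l \ m) ?_ ?_ ?_ ?_ ?_
  · intro m _; simp
  · intro m _; simp
  · intro m hm
    exact Finset.sdiff_sdiff_eq_self (Finset.mem_powerset.1 hm)
  · intro m hm
    exact Finset.sdiff_sdiff_eq_self (Finset.mem_powerset.1 hm)
  · intro m hm
    rw [Finset.sdiff_sdiff_eq_self (Finset.mem_powerset.1 hm)]
    rcases Nat.even_or_odd m.card with he | ho
    · rw [shuffleSign_swap Finset.disjoint_sdiff (he.mul_right _)]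
      ring
    · rw [hx m ho]; simp

/-- `x` has no components in degrees less than `k`. -/
def HasOrder (k : ℕ) (x : ComplexGrassmann) : Prop := ∀ l : Finset ℕ, l.card < k → x l = 0

theorem HasOrder.mul {i j : ℕ} {x y : ComplexGrassmann} (hx : HasOrder i x) (hy : HasOrder j y) :
    HasOrder (i + j) (x * y) := by
  intro l hl
  rw [mul_apply]
  refine Finset.sum_eq_zero fun m hm => ?_
  have hc := Finset.card_sdiff_add_card_eq_card (Finset.mem_powerset.1 hm)
  by_cases hm : m.card < i
  · rw [hx m hm]; simp
  · rw [hy (l \ m) (by omega)]; simp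

theorem hasOrder_one_iff {x : ComplexGrassmann} : HasOrder 1 x ↔ x.body = 0 := by
  refine ⟨fun h => h ∅ (by simp), fun h l hl => ?_⟩
  rw [Nat.lt_one_iff, Finset.card_eq_zero] at hl
  rw [hl]
  exact h

theorem body_mul (x y : ComplexGrassmann) : (x * y).body = x.body * y.body := by
  unfold body
  rw [mul_apply]
  simp [shuffleSign]

theorem body_soul (x : ComplexGrassmann) : x.soul.body = 0 := by
  simp [body, soul, sub_apply, smul_apply, one_apply]

theorem hasOrder_soul (x : ComplexGrassmann) : HasOrder 1 x.soul := hasOrder_one_iff.2 (body_soul x)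

theorem soul_mem_evenPart {x : ComplexGrassmann} (hx : x ∈ evenPart) : x.soul ∈ evenPart :=
  sub_mem hx (smul_mem_evenPart _ (one_mem _))

theorem HasOrder.pow {x : ComplexGrassmann} (hx : x.body = 0) (k : ℕ) : HasOrder k (x ^ k) := by
  induction k with
  | zero => exact fun l hl => absurd hl (Nat.not_lt_zero _)
  | succ k ih =>
    rw [pow_succ]
    exact ih.mul (hasOrder_one_iff.2 hx)

/-- A component of a product depends only on the components indexed by its subsets; truncation to
the subsets of `L` rests on this. -/
theorem mul_apply_congr {a x y : ComplexGrassmann} {l : Finset ℕ} (h : ∀ m ⊆ l, x m = y m) :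
    (a * x) l = (a * y) l := by
  rw [mul_apply, mul_apply]
  exact Finset.sum_congr rfl fun m _ => by rw [h _ Finset.sdiff_subset]

/-- The geometric series for one minus a soul. It is infinite, but in each component only finitely
many terms are nonzero. -/
theorem exists_mul_eq_one (x : evenPart) (hx : (x : ComplexGrassmann).body ≠ 0) :
    ∃ y : evenPart, x * y = 1 := by
  set c := (x : ComplexGrassmann).body with hc
  set s : ComplexGrassmann := 1 - c⁻¹ • (x : ComplexGrassmann) with hs
  have hse : s ∈ evenPart := sub_mem (one_mem _) (smul_mem_evenPart _ x.2)
  have hsb : s.body = 0 := by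
    change (1 : ComplexGrassmann) ∅ - c⁻¹ * c = 0
    rw [one_apply, if_pos rfl, inv_mul_cancel₀ hx, sub_self]
  have hxs : (x : ComplexGrassmann) = c • (1 - s) := by
    rw [hs, sub_sub_cancel, smul_smul, mul_inv_cancel₀ hx, one_smul]
  let g (k : ℕ) : ComplexGrassmann := ∑ i ∈ Finset.range k, s ^ i
  have hge (k : ℕ) : g k ∈ evenPart := sum_mem fun i _ => pow_mem hse i
  have hgk (k : ℕ) (m : Finset ℕ) (hm : m.card < k) : g k m = g (m.card + 1) m := by
    simp only [g]
    rw [sum_apply, sum_apply]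
    refine (Finset.sum_subset (Finset.range_mono hm) fun i _ hi => ?_).symm
    exact HasOrder.pow hsb i m (by simpa using hi)
  -- The component `m` of the partial sums is constant from `m.card + 1` terms on, because the power
  -- `s ^ i` has order `i`.
  let w : ComplexGrassmann := fun m => g (m.card + 1) m
  let y : ComplexGrassmann := c⁻¹ • w
  have hye : y ∈ evenPart := smul_mem_evenPart _ fun m hm => hge (m.card + 1) m hm
  refine ⟨⟨y, hye⟩, Subtype.ext ?_⟩
  change (x : ComplexGrassmann) * y = 1
  have h1 : (x : ComplexGrassmann) * y = (1 - s) * w := by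
    rw [hxs, smul_mul, mul_smul', smul_smul, mul_inv_cancel₀ hx, one_smul]
  rw [h1]
  funext l
  rw [mul_apply_congr (y := g (l.card + 1)) fun m hm =>
    (hgk _ m (Nat.lt_succ_of_le (Finset.card_le_card hm))).symm, mul_neg_geom_sum, sub_apply,
    HasOrder.pow hsb _ l (Nat.lt_succ_self _), sub_zero]

theorem isUnit_of_mem_evenPart (x : evenPart) (hx : (x : ComplexGrassmann).body ≠ 0) : IsUnit x :=
  let ⟨y, hy⟩ := exists_mul_eq_one x hx
  IsUnit.of_mul_eq_one y hy

theorem conj_apply (x : ComplexGrassmann) (l : Finset ℕ) : x.conj l = starRingEnd ℂ (x l) := rfl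

theorem conj_conj (x : ComplexGrassmann) : x.conj.conj = x :=
  funext fun l => Complex.conj_conj (x l)

theorem conj_mul (x y : ComplexGrassmann) : (x * y).conj = x.conj * y.conj := by
  funext l
  rw [conj_apply, mul_apply, mul_apply, map_sum]
  refine Finset.sum_congr rfl fun m _ => ?_
  rw [map_mul, map_mul, conj_apply, conj_apply, map_intCast]

theorem conj_add (x y : ComplexGrassmann) : (x + y).conj = x.conj + y.conj :=
  funext fun l => map_add (starRingEnd ℂ) (x l) (y l)

theorem conj_sum {ι : Type*} (s : Finset ι) (x : ι → ComplexGrassmann) :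
    (∑ i ∈ s, x i).conj = ∑ i ∈ s, (x i).conj := by
  funext l
  rw [conj_apply, sum_apply, sum_apply, map_sum]
  rfl

theorem conj_mem_evenPart {x : ComplexGrassmann} (hx : x ∈ evenPart) : x.conj ∈ evenPart :=
  fun l hl => by rw [conj_apply, hx l hl, map_zero]

/-! ### Truncation -/

/-- The components of elements of `ℂ_S` indexed by the subsets of `L`. -/
abbrev TruncSpace (L : Finset ℕ) : Type := L.powerset → ℂ

variable {L : Finset ℕ}

/-- The components indexed by the subsets of `L`. -/
def res (L : Finset ℕ) : ComplexGrassmann →ₗ[ℂ] TruncSpace L where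
  toFun x m := x m
  map_add' _ _ := rfl
  map_smul' _ _ := rfl

/-- Extension by zero. -/
noncomputable def extend (L : Finset ℕ) : TruncSpace L →ₗ[ℂ] ComplexGrassmann where
  toFun v m := if h : m ∈ L.powerset then v ⟨m, h⟩ else 0
  map_add' v w := by
    funext m
    change _ = (if h : m ∈ L.powerset then v ⟨m, h⟩ else 0)
      + if h : m ∈ L.powerset then w ⟨m, h⟩ else 0
    split_ifs
    · rfl
    · rw [add_zero]
  map_smul' c v := by
    funext m
    change _ = c * if h : m ∈ L.powerset then v ⟨m, h⟩ else 0
    split_ifs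
    · rfl
    · rw [mul_zero]

theorem res_apply (x : ComplexGrassmann) (m : L.powerset) : res L x m = x m := rfl

theorem res_extend (v : TruncSpace L) : res L (extend L v) = v := by
  funext m
  rw [res_apply]
  exact dif_pos m.2

theorem extend_res_apply (x : ComplexGrassmann) {m : Finset ℕ} (hm : m ⊆ L) :
    extend L (res L x) m = x m :=
  dif_pos (Finset.mem_powerset.2 hm)

theorem res_mul_extend_res (a x : ComplexGrassmann) :
    res L (a * extend L (res L x)) = res L (a * x) := by
  funext m
  exact mul_apply_congr fun k hk => extend_res_apply x (hk.trans (Finset.mem_powerset.1 m.2))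

theorem res_mul_congr {a b : ComplexGrassmann} (h : res L a = res L b) (x : ComplexGrassmann) :
    res L (a * x) = res L (b * x) := by
  funext m
  rw [res_apply, res_apply, mul_apply, mul_apply]
  refine Finset.sum_congr rfl fun k hk => ?_
  have := congrFun h ⟨k, Finset.mem_powerset.2
    ((Finset.mem_powerset.1 hk).trans (Finset.mem_powerset.1 m.2))⟩
  rw [res_apply, res_apply] at this
  rw [this]

/-- Multiplication by an even element, on the truncated algebra. -/
noncomputable def mulLeft (L : Finset ℕ) :
    evenPart →+* (TruncSpace L →L[ℂ] TruncSpace L) where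
  toFun a := LinearMap.toContinuousLinearMap
    { toFun := fun v => res L ((a : ComplexGrassmann) * extend L v)
      map_add' := fun v w => by rw [map_add, mul_add, map_add]
      map_smul' := fun c v => by rw [map_smul, mul_smul', map_smul, RingHom.id_apply] }
  map_one' := by
    ext1 v
    change res L (1 * extend L v) = v
    rw [one_mul, res_extend]
  map_mul' a b := by
    ext1 v
    change res L ((a : ComplexGrassmann) * b * extend L v)
      = res L (a * extend L (res L (b * extend L v)))
    rw [res_mul_extend_res, mul_assoc]
  map_zero' := by
    ext1 v
    change res L (0 * extend L v) = 0
    rw [zero_mul, map_zero]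
  map_add' a b := by
    ext1 v
    change res L (((a : ComplexGrassmann) + b) * extend L v)
      = res L (a * extend L v) + res L (b * extend L v)
    rw [add_mul, map_add]

theorem mulLeft_smul (c : ℂ) (a : evenPart) :
    mulLeft L ⟨c • (a : ComplexGrassmann), smul_mem_evenPart c a.2⟩ = c • mulLeft L a := by
  ext1 v
  change res L (c • (a : ComplexGrassmann) * extend L v) = c • res L (a * extend L v)
  rw [smul_mul, map_smul]

/-- The algebra of multiplications by even elements on the truncated algebra. -/
noncomputable def truncSubalgebra (L : Finset ℕ) :
    Subalgebra ℂ (TruncSpace L →L[ℂ] TruncSpace L) where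
  __ := (mulLeft L).range
  algebraMap_mem' c := by
    refine ⟨⟨c • ((1 : evenPart) : ComplexGrassmann), smul_mem_evenPart c (1 : evenPart).2⟩, ?_⟩
    rw [mulLeft_smul, map_one, Algebra.algebraMap_eq_smul_one]

/-- The even part of the truncated algebra, with the operator norm. -/
def TruncAlg (L : Finset ℕ) : Type := truncSubalgebra L

namespace TruncAlg

/-- Realizing the truncation by operators on a finite-dimensional space provides a submultiplicative
norm, for which the exponential series is available. -/
noncomputable instance : NormedRing (TruncAlg L) := inferInstanceAs (NormedRing (truncSubalgebra L))

noncomputable instance : NormedCommRing (TruncAlg L) :=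
  { (inferInstance : NormedRing (TruncAlg L)) with
    mul_comm := by
      rintro ⟨_, a, rfl⟩ ⟨_, b, rfl⟩
      apply Subtype.ext
      change mulLeft L a * mulLeft L b = mulLeft L b * mulLeft L a
      rw [← map_mul, mul_comm, map_mul] }

noncomputable instance : NormedAlgebra ℂ (TruncAlg L) :=
  inferInstanceAs (NormedAlgebra ℂ (truncSubalgebra L))

instance : FiniteDimensional ℂ (TruncAlg L) :=
  inferInstanceAs (FiniteDimensional ℂ (Subalgebra.toSubmodule (truncSubalgebra L)))

instance : CompleteSpace (TruncAlg L) := FiniteDimensional.complete ℂ (TruncAlg L)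

noncomputable instance : Module (TruncAlg L) (TruncSpace L) :=
  inferInstanceAs (Module (truncSubalgebra L) (TruncSpace L))

instance : IsBoundedSMul (TruncAlg L) (TruncSpace L) :=
  IsBoundedSMul.of_norm_smul_le fun a v => a.1.le_opNorm v

instance : IsScalarTower ℂ (TruncAlg L) (TruncSpace L) := ⟨fun _ _ _ => rfl⟩

end TruncAlg

/-- The truncation of even elements. -/
noncomputable def trunc (L : Finset ℕ) : evenPart →+* TruncAlg L := (mulLeft L).rangeRestrict

theorem trunc_surjective : Function.Surjective (trunc L) := (mulLeft L).rangeRestrict_surjective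

theorem trunc_smul_res (a : evenPart) (x : ComplexGrassmann) :
    trunc L a • res L x = res L ((a : ComplexGrassmann) * x) :=
  res_mul_extend_res (a : ComplexGrassmann) x

theorem trunc_smul_res_one (a : evenPart) : trunc L a • res L 1 = res L (a : ComplexGrassmann) := by
  rw [trunc_smul_res, mul_one]

theorem trunc_smul (c : ℂ) (a : evenPart) :
    trunc L ⟨c • (a : ComplexGrassmann), smul_mem_evenPart c a.2⟩ = c • trunc L a :=
  Subtype.ext (mulLeft_smul c a)

theorem trunc_eq_of_res_eq {a b : evenPart}
    (h : res L (a : ComplexGrassmann) = res L (b : ComplexGrassmann)) : trunc L a = trunc L b := by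
  apply Subtype.ext
  ext1 v
  exact res_mul_congr h _

theorem eq_of_smul_res_one {a b : TruncAlg L} (h : a • res L 1 = b • res L 1) : a = b := by
  obtain ⟨a, rfl⟩ := trunc_surjective a
  obtain ⟨b, rfl⟩ := trunc_surjective b
  rw [trunc_smul_res_one, trunc_smul_res_one] at h
  exact trunc_eq_of_res_eq h

/-- The components of an element of the truncated algebra. -/
noncomputable def truncCoeff (L : Finset ℕ) : TruncAlg L →L[ℂ] TruncSpace L :=
  LinearMap.toContinuousLinearMap
    { toFun := fun a => a • res L 1
      map_add' := fun a b => add_smul a b _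
      map_smul' := fun c a => smul_assoc c a _ }

theorem truncCoeff_trunc (a : evenPart) : truncCoeff L (trunc L a) = res L (a : ComplexGrassmann) :=
  trunc_smul_res_one a

/-- The body of an element of the truncated algebra. -/
noncomputable def truncBody (L : Finset ℕ) : TruncAlg L →ₐ[ℂ] ℂ :=
  AlgHom.ofLinearMap
    ((LinearMap.proj ⟨∅, Finset.empty_mem_powerset L⟩) ∘ₗ (truncCoeff L).toLinearMap)
    (by
      change ((1 : TruncAlg L) • res L 1) ⟨∅, Finset.empty_mem_powerset L⟩ = 1
      rw [one_smul]
      rw [res_apply, one_apply, if_pos rfl])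
    (by
      intro a b
      obtain ⟨a, rfl⟩ := trunc_surjective a
      obtain ⟨b, rfl⟩ := trunc_surjective b
      rw [← map_mul]
      simp only [LinearMap.coe_comp, Function.comp_apply, ContinuousLinearMap.coe_coe,
        truncCoeff_trunc]
      exact body_mul _ _)

theorem truncBody_trunc (a : evenPart) :
    truncBody L (trunc L a) = (a : ComplexGrassmann).body := by
  change truncCoeff L (trunc L a) ⟨∅, Finset.empty_mem_powerset L⟩ = _
  rw [truncCoeff_trunc]
  rfl

/-- A product of `k` elements without body has a representative of order at least `k`, and order
`L.card + 1` leaves no component on the subsets of `L`. -/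
theorem ker_truncBody_pow : RingHom.ker (truncBody L) ^ (L.card + 1) = ⊥ := by
  let J (k : ℕ) : Ideal (TruncAlg L) :=
    { carrier := {a | ∃ x : evenPart, HasOrder k (x : ComplexGrassmann) ∧ trunc L x = a}
      add_mem' := by
        rintro _ _ ⟨x, hx, rfl⟩ ⟨y, hy, rfl⟩
        refine ⟨x + y, fun l hl => ?_, map_add _ _ _⟩
        change (x : ComplexGrassmann) l + (y : ComplexGrassmann) l = 0
        rw [hx l hl, hy l hl, add_zero]
      zero_mem' := ⟨0, fun _ _ => rfl, map_zero _⟩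
      smul_mem' := by
        rintro c _ ⟨x, hx, rfl⟩
        obtain ⟨c, rfl⟩ := trunc_surjective c
        refine ⟨c * x, ?_, map_mul _ _ _⟩
        have h0 : HasOrder 0 (c : ComplexGrassmann) := fun l hl => absurd hl (Nat.not_lt_zero _)
        have := h0.mul hx
        rwa [zero_add] at this }
  have h1 (k : ℕ) : RingHom.ker (truncBody L) ^ k ≤ J k := by
    induction k with
    | zero =>
      intro a _
      obtain ⟨a, rfl⟩ := trunc_surjective a
      exact ⟨a, fun l hl => absurd hl (Nat.not_lt_zero _), rfl⟩
    | succ k ih =>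
      rw [pow_succ, Ideal.mul_le]
      intro a ha b hb
      obtain ⟨x, hx, rfl⟩ := ih ha
      obtain ⟨y, rfl⟩ := trunc_surjective b
      rw [RingHom.mem_ker, truncBody_trunc] at hb
      exact ⟨x * y, hx.mul (hasOrder_one_iff.2 hb), map_mul _ _ _⟩
  rw [eq_bot_iff]
  intro a ha
  obtain ⟨x, hx, rfl⟩ := h1 _ ha
  rw [Ideal.mem_bot, ← map_zero (trunc L)]
  refine trunc_eq_of_res_eq (funext fun m => ?_)
  exact hx m (Nat.lt_succ_of_le (Finset.card_le_card (Finset.mem_powerset.1 m.2)))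

/-- An even element with given even components indexed by the subsets of `L`. -/
noncomputable def truncOfCoeff (L : Finset ℕ) : TruncSpace L →L[ℂ] TruncAlg L :=
  LinearMap.toContinuousLinearMap
    { toFun := fun v => trunc L ⟨fun m => if Odd m.card then 0 else extend L v m,
        fun _ hm => if_pos hm⟩
      map_add' := fun v w => by
        rw [← map_add]
        congr 2
        funext m
        change _ = (if Odd m.card then 0 else extend L v m) + if Odd m.card then 0 else extend L w m
        split_ifs
        · rw [add_zero]
        · rw [map_add, add_apply]
      map_smul' := fun c v => by
        rw [RingHom.id_apply, ← trunc_smul]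
        congr 2
        funext m
        change _ = c * if Odd m.card then 0 else extend L v m
        split_ifs
        · rw [mul_zero]
        · rw [map_smul, smul_apply] }

/-- The truncation is thus a fixed ℂ-linear function of the components, so smoothness and
derivatives pass from the components to truncations. -/
theorem truncOfCoeff_res (a : evenPart) : truncOfCoeff L (res L (a : ComplexGrassmann)) = trunc L a := by
  refine trunc_eq_of_res_eq (funext fun m => ?_)
  change (if Odd (m : Finset ℕ).card then 0 else extend L (res L (a : ComplexGrassmann)) m)
    = (a : ComplexGrassmann) m
  split_ifs with h
  · exact (a.2 m h).symm
  · exact extend_res_apply _ (Finset.mem_powerset.1 m.2)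

end ComplexGrassmann

/-! ### Smoothness of holomorphic functions of several variables -/

section SeveralComplexVariables

variable {E : Type*} [NormedAddCommGroup E] [NormedSpace ℂ E] [FiniteDimensional ℂ E]

/-- The directional derivatives of a holomorphic function are holomorphic. -/
theorem DifferentiableOn.fderiv_apply_of_isOpen {U : Set E} (hU : IsOpen U) {f : E → ℂ}
    (hf : DifferentiableOn ℂ f U) (v : E) : DifferentiableOn ℂ (fun z => fderiv ℂ f z v) U := by
  have : ProperSpace E := FiniteDimensional.proper ℂ E
  intro z₀ hz₀
  apply DifferentiableAt.differentiableWithinAt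
  obtain ⟨R₀, hR₀, hball⟩ := Metric.isOpen_iff.1 hU z₀ hz₀
  -- The base point moves within `R`, the discs of integration stay within `2 * R`, and Cauchy's
  -- estimate needs another `R`; all of this fits into a compact ball of radius `3 * R` inside `U`.
  set R := R₀ / 4 with hRdef
  have hR : 0 < R := by positivity
  have hball3 : Metric.closedBall z₀ (3 * R) ⊆ U :=
    (Metric.closedBall_subset_ball (by linarith)).trans hball
  obtain ⟨C, hC⟩ := (isCompact_closedBall z₀ (3 * R)).exists_bound_of_continuousOn
    (hf.continuousOn.mono hball3)
  have hderiv (w : E) (hw : w ∈ Metric.ball z₀ (2 * R)) : ‖fderiv ℂ f w‖ ≤ (C + C) / R := by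
    have hsub : Metric.ball w R ⊆ Metric.closedBall z₀ (3 * R) := by
      intro x hx
      rw [Metric.mem_ball] at hx hw
      rw [Metric.mem_closedBall]
      linarith [dist_triangle x w z₀]
    refine Complex.norm_fderiv_le_div_of_mapsTo_ball (hf.mono (hsub.trans hball3)) ?_ hR
    intro x hx
    rw [mem_closedBall_iff_norm]
    exact (norm_sub_le _ _).trans
      (add_le_add (hC x (hsub hx)) (hC w (hsub (Metric.mem_ball_self hR))))
  set r := R / (‖v‖ + 1) with hrdef
  have hr : 0 < r := by positivity
  have hrv : r * ‖v‖ < R := by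
    rw [hrdef, div_mul_eq_mul_div, div_lt_iff₀ (by positivity)]
    nlinarith
  have hmem (z : E) (hz : z ∈ Metric.ball z₀ R) (ζ : ℂ) (hζ : ‖ζ‖ ≤ r) :
      z + ζ • v ∈ Metric.ball z₀ (2 * R) := by
    rw [mem_ball_iff_norm] at hz ⊢
    have h1 : ‖ζ • v‖ ≤ r * ‖v‖ := by
      rw [norm_smul]
      exact mul_le_mul_of_nonneg_right hζ (norm_nonneg v)
    calc ‖z + ζ • v - z₀‖ = ‖(z - z₀) + ζ • v‖ := by congr 1; abel
      _ ≤ ‖z - z₀‖ + ‖ζ • v‖ := norm_add_le _ _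
      _ < 2 * R := by linarith
  have h23 : Metric.ball z₀ (2 * R) ⊆ U :=
    (Metric.ball_subset_closedBall.trans
      (Metric.closedBall_subset_closedBall (by linarith))).trans hball3
  have hcm (θ : ℝ) : ‖circleMap 0 r θ‖ ≤ r := by
    rw [norm_circleMap_zero, abs_of_pos hr]
  have hfd (z : E) (hz : z ∈ Metric.ball z₀ R) (ζ : ℂ) (hζ : ‖ζ‖ ≤ r) :
      DifferentiableAt ℂ f (z + ζ • v) :=
    hf.differentiableAt (hU.mem_nhds (h23 (hmem z hz ζ hζ)))
  have hline (z : E) (ζ : ℂ) : HasDerivAt (fun ζ : ℂ => z + ζ • v) v ζ := by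
    have := ((hasDerivAt_id ζ).smul_const v).const_add z
    rwa [one_smul] at this
  let k : ℝ → ℂ := fun θ => _root_.deriv (circleMap 0 r) θ * (1 / (circleMap 0 r θ - 0) ^ 2)
  have hk : Continuous k := by
    have h1 : Continuous (circleMap 0 r) := continuous_circleMap 0 r
    refine Continuous.mul ?_ (continuous_const.div (by fun_prop) fun θ => ?_)
    · have h2 : _root_.deriv (circleMap 0 r) = fun θ => circleMap 0 r θ * Complex.I :=
        funext fun θ => deriv_circleMap 0 r θ
      rw [h2]
      fun_prop
    · exact pow_ne_zero 2 (sub_ne_zero.2 (circleMap_ne_center hr.ne'))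
  -- Cauchy's formula on a disc in the direction `v`, whose radius `r` is so small that the disc
  -- moves the point by less than `R`.
  have hcauchy (z : E) (hz : z ∈ Metric.ball z₀ R) :
      fderiv ℂ f z v = (2 * Real.pi * Complex.I : ℂ)⁻¹ •
        ∫ θ in (0 : ℝ)..2 * Real.pi, k θ • f (z + circleMap 0 r θ • v) := by
    have h1 : DifferentiableOn ℂ (fun ζ : ℂ => f (z + ζ • v)) (Metric.closedBall 0 r) := by
      intro ζ hζ
      exact ((hfd z hz ζ (by simpa using hζ)).comp ζ
        (hline z ζ).differentiableAt).differentiableWithinAt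
    have h2 := h1.deriv_eq_smul_circleIntegral hr
    have h3 : _root_.deriv (fun ζ : ℂ => f (z + ζ • v)) 0 = fderiv ℂ f z v := by
      have h4 := hfd z hz 0 (by simpa using hr.le)
      have h5 := h4.hasFDerivAt.comp_hasDerivAt (0 : ℂ) (hline z 0)
      rw [zero_smul, add_zero] at h5
      exact h5.deriv
    rw [h3, circleIntegral] at h2
    rw [eq_inv_smul_iff₀ Complex.two_pi_I_ne_zero, ← h2]
    refine intervalIntegral.integral_congr fun θ _ => ?_
    simp only [k, smul_eq_mul]
    ring
  have hcont (z : E) (hz : z ∈ Metric.ball z₀ R) :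
      Continuous fun θ => k θ • f (z + circleMap 0 r θ • v) := by
    refine hk.smul (continuous_iff_continuousAt.2 fun θ => ?_)
    exact ContinuousAt.comp (f := fun θ => z + circleMap 0 r θ • v)
      (hfd z hz _ (hcm θ)).continuousAt
      (continuous_const.add ((continuous_circleMap 0 r).smul continuous_const)).continuousAt
  -- The Cauchy integral is differentiated under the integral sign. Cauchy's estimate dominates the
  -- derivative of `f`, and measurability of that derivative suffices, its continuity not being
  -- known yet.
  have hint := intervalIntegral.hasFDerivAt_integral_of_dominated_of_fderiv_le (𝕜 := ℂ)
    (μ := MeasureTheory.volume) (a := 0) (b := 2 * Real.pi) (s := Metric.ball z₀ R) (x₀ := z₀)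
    (F := fun z θ => k θ • f (z + circleMap 0 r θ • v))
    (F' := fun z θ => k θ • fderiv ℂ f (z + circleMap 0 r θ • v))
    (bound := fun θ => ‖k θ‖ * ((C + C) / R)) (Metric.ball_mem_nhds z₀ hR)
    (by
      filter_upwards [Metric.ball_mem_nhds z₀ hR] with z hz
      exact (hcont z hz).aestronglyMeasurable)
    ((hcont z₀ (Metric.mem_ball_self hR)).intervalIntegrable _ _)
    (by
      borelize E
      refine (hk.measurable.smul ((measurable_fderiv ℂ f).comp ?_)).aestronglyMeasurable
      exact (continuous_const.add ((continuous_circleMap 0 r).smul continuous_const)).measurable)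
    (by
      refine Filter.Eventually.of_forall fun θ _ z hz => ?_
      rw [norm_smul]
      exact mul_le_mul_of_nonneg_left (hderiv _ (hmem z hz _ (hcm θ))) (norm_nonneg _))
    ((hk.norm.mul continuous_const).intervalIntegrable _ _)
    (by
      refine Filter.Eventually.of_forall fun θ _ z hz => ?_
      have h1 := ((hfd z hz _ (hcm θ)).hasFDerivAt.comp z
        ((hasFDerivAt_id z).add_const (circleMap 0 r θ • v))).const_smul (k θ)
      rw [ContinuousLinearMap.comp_id] at h1
      exact h1)
  refine (hint.differentiableAt.const_smul (2 * Real.pi * Complex.I : ℂ)⁻¹).congr_of_eventuallyEq ?_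
  filter_upwards [Metric.ball_mem_nhds z₀ hR] with z hz
  exact hcauchy z hz

/-- Holomorphic functions of several variables are smooth. -/
theorem DifferentiableOn.contDiffOn_of_isOpen {U : Set E} (hU : IsOpen U) {f : E → ℂ}
    (hf : DifferentiableOn ℂ f U) : ContDiffOn ℂ ∞ f U := by
  rw [contDiffOn_infty]
  intro k
  induction k generalizing f with
  | zero => exact contDiffOn_zero.2 hf.continuousOn
  | succ k ih =>
    push_cast
    rw [contDiffOn_succ_iff_fderiv_of_isOpen hU]
    refine ⟨hf, fun h => absurd h (by simp), contDiffOn_clm_apply.2 fun v => ?_⟩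
    exact ih (hf.fderiv_apply_of_isOpen hU v)

end SeveralComplexVariables

open ComplexGrassmann

/-! ### Evaluation at superpoints and its truncation -/

section Evaluation

attribute [local instance] isScalarTower_real smulCommClass_complex

variable {n : ℕ} {U : Set (BodySpace n)} {L : Finset ℕ}

/-! ### Smoothness and derivatives of truncations -/

theorem GrassmannHolomorphicOn.smoothOn (hU : IsOpen U) {h : BodySpace n → ComplexGrassmann}
    (hh : GrassmannHolomorphicOn h U) : GrassmannSmoothOn h U := fun l =>
  ((hh l).contDiffOn_of_isOpen hU).restrict_scalars ℝ

theorem GrassmannSmoothOn.conj {h : BodySpace n → ComplexGrassmann} (hh : GrassmannSmoothOn h U) :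
    GrassmannSmoothOn (fun z => (h z).conj) U := fun l =>
  (Complex.conjCLE.contDiff (n := ∞)).comp_contDiffOn (hh l)

theorem GrassmannSmoothOn.mul {h k : BodySpace n → ComplexGrassmann} (hh : GrassmannSmoothOn h U)
    (hk : GrassmannSmoothOn k U) : GrassmannSmoothOn (fun z => h z * k z) U := fun _ =>
  ContDiffOn.sum fun m _ => contDiffOn_const.mul ((hh m).mul (hk _))

theorem grassmannSmoothOn_const (x : ComplexGrassmann) :
    GrassmannSmoothOn (fun _ : BodySpace n => x) U := fun _ => contDiffOn_const

theorem GrassmannSmoothOn.add {h k : BodySpace n → ComplexGrassmann} (hh : GrassmannSmoothOn h U)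
    (hk : GrassmannSmoothOn k U) : GrassmannSmoothOn (fun z => h z + k z) U := fun l =>
  (hh l).add (hk l)

theorem GrassmannSmoothOn.sum {ι : Type*} {s : Finset ι} {h : ι → BodySpace n → ComplexGrassmann}
    (hh : ∀ i ∈ s, GrassmannSmoothOn (h i) U) : GrassmannSmoothOn (fun z => ∑ i ∈ s, h i z) U := by
  intro l
  simp only [ComplexGrassmann.sum_apply]
  exact ContDiffOn.sum fun i hi => hh i hi l

theorem dWirtinger_apply (j : Fin n) (h : BodySpace n → ComplexGrassmann) (z : BodySpace n)
    (l : Finset ℕ) : dWirtinger j h z l = wirt (-Complex.I) j (fun w => h w l) z := by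
  simp only [dWirtinger, wirt, smul_eq_mul]
  ring

theorem dbarWirtinger_apply (j : Fin n) (h : BodySpace n → ComplexGrassmann) (z : BodySpace n)
    (l : Finset ℕ) : dbarWirtinger j h z l = wirt Complex.I j (fun w => h w l) z := by
  simp only [dbarWirtinger, wirt, smul_eq_mul]
  ring

theorem GrassmannSmoothOn.dWirtinger (hU : IsOpen U) {h : BodySpace n → ComplexGrassmann}
    (hh : GrassmannSmoothOn h U) (j : Fin n) : GrassmannSmoothOn (dWirtinger j h) U := by
  intro l
  simp only [dWirtinger_apply]
  exact (hh l).wirt hU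

theorem GrassmannSmoothOn.dbarWirtinger (hU : IsOpen U) {h : BodySpace n → ComplexGrassmann}
    (hh : GrassmannSmoothOn h U) (j : Fin n) : GrassmannSmoothOn (dbarWirtinger j h) U := by
  intro l
  simp only [dbarWirtinger_apply]
  exact (hh l).wirt hU

theorem GrassmannSmoothOn.res {h : BodySpace n → ComplexGrassmann} (hh : GrassmannSmoothOn h U)
    (L : Finset ℕ) : ContDiffOn ℝ ∞ (fun z => res L (h z)) U :=
  contDiffOn_pi.2 fun m => hh m

theorem wirt_res (hU : IsOpen U) {h : BodySpace n → ComplexGrassmann} (hh : GrassmannSmoothOn h U)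
    {κ : ℂ} {j : Fin n} {z : BodySpace n} (hz : z ∈ U) (m : L.powerset) :
    wirt κ j (fun w => res L (h w)) z m = wirt κ j (fun w => h w m) z :=
  (wirt_clm (ContinuousLinearMap.proj (R := ℂ) (φ := fun _ : L.powerset => ℂ) m)
    ((hh.res L).differentiableAt_of_isOpen hU hz)).symm

theorem wirt_res_eq_dWirtinger (hU : IsOpen U) {h : BodySpace n → ComplexGrassmann}
    (hh : GrassmannSmoothOn h U) (j : Fin n) {z : BodySpace n} (hz : z ∈ U) :
    wirt (-Complex.I) j (fun w => res L (h w)) z = res L (dWirtinger j h z) :=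
  funext fun m => (wirt_res hU hh hz m).trans (dWirtinger_apply j h z m).symm

theorem wirt_res_eq_dbarWirtinger (hU : IsOpen U) {h : BodySpace n → ComplexGrassmann}
    (hh : GrassmannSmoothOn h U) (j : Fin n) {z : BodySpace n} (hz : z ∈ U) :
    wirt Complex.I j (fun w => res L (h w)) z = res L (dbarWirtinger j h z) :=
  funext fun m => (wirt_res hU hh hz m).trans (dbarWirtinger_apply j h z m).symm

theorem trunc_eq_truncOfCoeff (h : BodySpace n → evenPart) :
    (fun z => trunc L (h z)) = fun z => truncOfCoeff L (res L (h z : ComplexGrassmann)) :=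
  funext fun z => (truncOfCoeff_res (h z)).symm

theorem GrassmannSmoothOn.trunc {h : BodySpace n → evenPart}
    (hh : GrassmannSmoothOn (fun z => (h z : ComplexGrassmann)) U) (L : Finset ℕ) :
    ContDiffOn ℝ ∞ (fun z => trunc L (h z)) U := by
  rw [trunc_eq_truncOfCoeff]
  exact ((truncOfCoeff L).restrictScalars ℝ).contDiff.comp_contDiffOn (hh.res L)

theorem wirt_trunc (hU : IsOpen U) {h : BodySpace n → evenPart}
    (hh : GrassmannSmoothOn (fun z => (h z : ComplexGrassmann)) U) {κ : ℂ} {j : Fin n}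
    {z : BodySpace n} (hz : z ∈ U) : wirt κ j (fun w => trunc L (h w)) z
      = truncOfCoeff L (wirt κ j (fun w => res L (h w : ComplexGrassmann)) z) := by
  rw [trunc_eq_truncOfCoeff]
  exact wirt_clm (truncOfCoeff L) ((hh.res L).differentiableAt_of_isOpen hU hz)

/-! ### Evaluation at a point with even coordinates -/

theorem hasOrder_conj {k : ℕ} {x : ComplexGrassmann} (hx : HasOrder k x) : HasOrder k x.conj :=
  fun l hl => by rw [conj_apply, hx l hl, map_zero]

theorem HasOrder.soulDerivative {s : Fin n → ComplexGrassmann} (hs : ∀ j, HasOrder 1 (s j)) {k : ℕ}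
    {h : BodySpace n → ComplexGrassmann} (hh : ∀ z, HasOrder k (h z)) (z : BodySpace n) :
    HasOrder (k + 1) (soulDerivative s h z) := by
  have hd (κ : ℂ) (j : Fin n) (l : Finset ℕ) (hl : l.card < k) :
      wirt κ j (fun w => h w l) z = 0 := by
    have : (fun w => h w l) = fun _ => 0 := funext fun w => hh w l hl
    rw [this, wirt_const]
  intro l hl
  unfold _root_.soulDerivative
  rw [ComplexGrassmann.sum_apply]
  refine Finset.sum_eq_zero fun j _ => ?_
  rw [add_comm] at hl
  have h1 : HasOrder k (dWirtinger j h z) := fun l hl => by rw [dWirtinger_apply, hd _ j l hl]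
  have h2 : HasOrder k (dbarWirtinger j h z) := fun l hl => by rw [dbarWirtinger_apply, hd _ j l hl]
  rw [ComplexGrassmann.add_apply, (hs j).mul h1 l hl, (hasOrder_conj (hs j)).mul h2 l hl, add_zero]

/-- Each step multiplies by a soul or its conjugate, and derivatives do not lower the order. Order
one of the souls is enough for the Taylor series to be finite in each component. -/
theorem hasOrder_iterate_soulDerivative {s : Fin n → ComplexGrassmann} (hs : ∀ j, HasOrder 1 (s j))
    (h : BodySpace n → ComplexGrassmann) (k : ℕ) (z : BodySpace n) :
    HasOrder k ((soulDerivative s)^[k] h z) := by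
  induction k generalizing z with
  | zero => exact fun l hl => absurd hl (Nat.not_lt_zero _)
  | succ k ih =>
    rw [Function.iterate_succ_apply']
    exact HasOrder.soulDerivative hs ih z

theorem GrassmannSmoothOn.soulDerivative (hU : IsOpen U) (s : Fin n → ComplexGrassmann)
    {h : BodySpace n → ComplexGrassmann} (hh : GrassmannSmoothOn h U) :
    GrassmannSmoothOn (soulDerivative s h) U :=
  GrassmannSmoothOn.sum fun j _ => ((grassmannSmoothOn_const (s j)).mul (hh.dWirtinger hU j)).add
    ((grassmannSmoothOn_const (s j).conj).mul (hh.dbarWirtinger hU j))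

theorem GrassmannSmoothOn.iterate_soulDerivative (hU : IsOpen U) (s : Fin n → ComplexGrassmann)
    {h : BodySpace n → ComplexGrassmann} (hh : GrassmannSmoothOn h U) (k : ℕ) :
    GrassmannSmoothOn ((_root_.soulDerivative s)^[k] h) U := by
  induction k with
  | zero => exact hh
  | succ k ih =>
    rw [Function.iterate_succ_apply']
    exact ih.soulDerivative hU s

/-- The truncations of the conjugates of even elements. -/
noncomputable def truncConj (L : Finset ℕ) (a : evenPart) : TruncAlg L :=
  trunc L ⟨(a : ComplexGrassmann).conj, conj_mem_evenPart a.2⟩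

theorem res_soulDerivative (hU : IsOpen U) (s : Fin n → evenPart)
    {h : BodySpace n → ComplexGrassmann} (hh : GrassmannSmoothOn h U) {z : BodySpace n}
    (hz : z ∈ U) : res L (soulDerivative (fun j => (s j : ComplexGrassmann)) h z)
      = soulDer (fun j => trunc L (s j)) (fun j => truncConj L (s j)) (fun w => res L (h w)) z := by
  unfold soulDerivative soulDer truncConj
  rw [map_sum]
  refine Finset.sum_congr rfl fun j _ => ?_
  rw [map_add, wirt_res_eq_dWirtinger hU hh j hz, wirt_res_eq_dbarWirtinger hU hh j hz,
    trunc_smul_res, trunc_smul_res]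

theorem res_iterate_soulDerivative (hU : IsOpen U) (s : Fin n → evenPart)
    {h : BodySpace n → ComplexGrassmann} (hh : GrassmannSmoothOn h U) (k : ℕ) {z : BodySpace n}
    (hz : z ∈ U) : res L ((soulDerivative fun j => (s j : ComplexGrassmann))^[k] h z)
      = (soulDer (fun j => trunc L (s j)) fun j => truncConj L (s j))^[k]
        (fun w => res L (h w)) z := by
  induction k generalizing z with
  | zero => rfl
  | succ k ih =>
    rw [Function.iterate_succ_apply', Function.iterate_succ_apply',
      res_soulDerivative hU s (hh.iterate_soulDerivative hU _ k) hz]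
    exact soulDer_congr _ _ hU (fun w hw => ih hw) hz

/-- The soul of an even element. -/
noncomputable def evenSoul (a : evenPart) : evenPart :=
  ⟨(a : ComplexGrassmann).soul, soul_mem_evenPart a.2⟩

/-- The Taylor expansion at a point with even coordinates, in the truncated algebra. -/
noncomputable def truncEval (L : Finset ℕ) {M : Type*} [NormedAddCommGroup M] [NormedSpace ℂ M]
    [Module (TruncAlg L) M] (x : Fin n → evenPart) (f : BodySpace n → M) : M :=
  taylorEval (fun j => trunc L (evenSoul (x j))) (fun j => truncConj L (evenSoul (x j)))
    (L.card + 1) (fun j => (x j : ComplexGrassmann).body) f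

theorem truncBody_trunc_evenSoul (a : evenPart) :
    trunc L (evenSoul a) ∈ RingHom.ker (truncBody L) := by
  rw [RingHom.mem_ker, truncBody_trunc]
  exact body_soul _

theorem truncBody_truncConj_evenSoul (a : evenPart) :
    truncConj L (evenSoul a) ∈ RingHom.ker (truncBody L) := by
  rw [RingHom.mem_ker, truncConj, truncBody_trunc]
  change starRingEnd ℂ (a : ComplexGrassmann).soul.body = 0
  rw [body_soul, map_zero]

/-- In `superEval` the number of terms depends on the component, in `truncEval` it is the same for
all. The additional terms vanish by `hasOrder_iterate_soulDerivative`. -/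
theorem res_superEval (hU : IsOpen U) {h : BodySpace n → ComplexGrassmann}
    (hh : GrassmannSmoothOn h U) (x : Fin n → evenPart)
    (hx : (fun j => (x j : ComplexGrassmann).body) ∈ U) :
    res L (superEval h x) = truncEval L x fun z => res L (h z) := by
  have h1 : truncEval L x (fun z => res L (h z)) = ∑ k ∈ Finset.range (L.card + 1),
      (k.factorial : ℂ)⁻¹ • res L ((soulDerivative fun j => (evenSoul (x j) : ComplexGrassmann))^[k] h
        fun j => (x j : ComplexGrassmann).body) := by
    unfold truncEval taylorEval
    refine Finset.sum_congr rfl fun k _ => ?_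
    rw [res_iterate_soulDerivative hU (fun j => evenSoul (x j)) hh k hx]
  rw [h1]
  funext m
  rw [Finset.sum_apply, res_apply]
  unfold superEval
  refine Finset.sum_subset (Finset.range_mono (Nat.succ_le_succ (Finset.card_le_card
    (Finset.mem_powerset.1 m.2)))) fun k _ hk => ?_
  rw [Finset.mem_range, not_lt] at hk
  rw [hasOrder_iterate_soulDerivative (fun j => hasOrder_soul _) h k _ _ hk, mul_zero]

theorem soulDerivative_mem_evenPart {s : Fin n → ComplexGrassmann} (hs : ∀ j, s j ∈ evenPart)
    {h : BodySpace n → ComplexGrassmann} (hh : ∀ z, h z ∈ evenPart) (z : BodySpace n) :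
    soulDerivative s h z ∈ evenPart := by
  have hd (κ : ℂ) (j : Fin n) (l : Finset ℕ) (hl : Odd l.card) :
      wirt κ j (fun w => h w l) z = 0 := by
    have : (fun w => h w l) = fun _ => 0 := funext fun w => hh w l hl
    rw [this, wirt_const]
  refine sum_mem fun j _ => add_mem (mul_mem (hs j) fun l hl => ?_)
    (mul_mem (conj_mem_evenPart (hs j)) fun l hl => ?_)
  · rw [dWirtinger_apply, hd _ j l hl]
  · rw [dbarWirtinger_apply, hd _ j l hl]

theorem superEval_mem_evenPart {h : BodySpace n → ComplexGrassmann} (hh : ∀ z, h z ∈ evenPart)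
    (x : Fin n → evenPart) : superEval h x ∈ evenPart := by
  have h1 (k : ℕ) : ∀ z, (soulDerivative fun j => (x j : ComplexGrassmann).soul)^[k] h z
      ∈ evenPart := by
    induction k with
    | zero => exact hh
    | succ k ih =>
      intro z
      rw [Function.iterate_succ_apply']
      exact soulDerivative_mem_evenPart (fun j => soul_mem_evenPart (x j).2) ih z
  intro l hl
  exact Finset.sum_eq_zero fun k _ => by rw [h1 k _ l hl, mul_zero]

/-- Compare the actions on the truncated unit: evaluation is multiplicative and fixes constants,
which reduces the claim to the components. -/
theorem trunc_superEval (hU : IsOpen U) {h : BodySpace n → evenPart}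
    (hh : GrassmannSmoothOn (fun z => (h z : ComplexGrassmann)) U) (x : Fin n → evenPart)
    (hx : (fun j => (x j : ComplexGrassmann).body) ∈ U) :
    trunc L ⟨superEval (fun z => (h z : ComplexGrassmann)) x,
        superEval_mem_evenPart (fun z => (h z).2) x⟩
      = truncEval L x fun z => trunc L (h z) := by
  apply eq_of_smul_res_one
  rw [trunc_smul_res_one, res_superEval hU hh x hx]
  have h1 := taylorEval_smul (M := TruncSpace L) (I := RingHom.ker (truncBody L)) hU
    (fun j => truncBody_trunc_evenSoul (x j)) (fun j => truncBody_truncConj_evenSoul (x j))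
    ker_truncBody_pow (hh.trunc L) (contDiffOn_const (c := res L 1)) hx
  rw [taylorEval_const _ _ _ (Nat.succ_pos _)] at h1
  simp only [trunc_smul_res_one] at h1
  exact h1

theorem soulDerivative_congr (hU : IsOpen U) (s : Fin n → ComplexGrassmann)
    {h k : BodySpace n → ComplexGrassmann} (hk : Set.EqOn h k U) :
    Set.EqOn (soulDerivative s h) (soulDerivative s k) U := by
  intro z hz
  have h1 (l : Finset ℕ) : (fun w => h w l) =ᶠ[𝓝 z] fun w => k w l :=
    Set.EqOn.eventuallyEq_of_mem (fun w hw => congrFun (hk hw) l) (hU.mem_nhds hz)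
  have h2 (j : Fin n) : dWirtinger j h z = dWirtinger j k z :=
    funext fun l => by rw [dWirtinger_apply, dWirtinger_apply, wirt_congr (h1 l)]
  have h3 (j : Fin n) : dbarWirtinger j h z = dbarWirtinger j k z :=
    funext fun l => by rw [dbarWirtinger_apply, dbarWirtinger_apply, wirt_congr (h1 l)]
  simp only [soulDerivative, h2, h3]

theorem dWirtinger_conj (hU : IsOpen U) {h : BodySpace n → ComplexGrassmann}
    (hh : GrassmannSmoothOn h U) (j : Fin n) {z : BodySpace n} (hz : z ∈ U) :
    dWirtinger j (fun w => (h w).conj) z = (dbarWirtinger j h z).conj := by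
  funext l
  rw [dWirtinger_apply, conj_apply, dbarWirtinger_apply]
  have := wirt_conj (κ := -Complex.I) (j := j) ((hh l).differentiableAt_of_isOpen hU hz)
  rwa [map_neg, Complex.conj_I, neg_neg] at this

theorem dbarWirtinger_conj (hU : IsOpen U) {h : BodySpace n → ComplexGrassmann}
    (hh : GrassmannSmoothOn h U) (j : Fin n) {z : BodySpace n} (hz : z ∈ U) :
    dbarWirtinger j (fun w => (h w).conj) z = (dWirtinger j h z).conj := by
  funext l
  rw [dbarWirtinger_apply, conj_apply, dWirtinger_apply]
  have := wirt_conj (κ := Complex.I) (j := j) ((hh l).differentiableAt_of_isOpen hU hz)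
  rwa [Complex.conj_I] at this

theorem soulDerivative_conj (hU : IsOpen U) (s : Fin n → ComplexGrassmann)
    {h : BodySpace n → ComplexGrassmann} (hh : GrassmannSmoothOn h U) {z : BodySpace n}
    (hz : z ∈ U) : soulDerivative s (fun w => (h w).conj) z = (soulDerivative s h z).conj := by
  unfold soulDerivative
  rw [conj_sum]
  refine Finset.sum_congr rfl fun j _ => ?_
  rw [conj_add, conj_mul, conj_mul, conj_conj, dWirtinger_conj hU hh j hz,
    dbarWirtinger_conj hU hh j hz, add_comm]

/-- The derivation along the soul is real, being the sum of an operator and its conjugate, so it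
commutes with conjugation. Hence the conjugates of the `g_i` vanish at a superpoint where the `g_i`
do. -/
theorem superEval_conj (hU : IsOpen U) {h : BodySpace n → ComplexGrassmann}
    (hh : GrassmannSmoothOn h U) (x : Fin n → evenPart)
    (hx : (fun j => (x j : ComplexGrassmann).body) ∈ U) :
    superEval (fun w => (h w).conj) x = (superEval h x).conj := by
  have h1 (k : ℕ) : ∀ z ∈ U, (soulDerivative fun j => (x j : ComplexGrassmann).soul)^[k]
      (fun w => (h w).conj) z
        = ((soulDerivative fun j => (x j : ComplexGrassmann).soul)^[k] h z).conj := by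
    induction k with
    | zero => exact fun z _ => rfl
    | succ k ih =>
      intro z hz
      rw [Function.iterate_succ_apply', Function.iterate_succ_apply', soulDerivative_congr hU _ ih hz,
        soulDerivative_conj hU _ (hh.iterate_soulDerivative hU _ k) hz]
  funext l
  rw [conj_apply]
  unfold superEval
  rw [map_sum]
  refine Finset.sum_congr rfl fun k _ => ?_
  rw [h1 k _ hx, conj_apply, map_mul, map_inv₀, map_natCast]

/-! ### Holomorphic functions -/

/-- The Cauchy–Riemann equations: complex linearity of the derivative makes the two halves of the
operator cancel. -/
theorem wirt_eq_zero_of_differentiableAt {f : BodySpace n → ℂ} {z : BodySpace n}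
    (hf : DifferentiableAt ℂ f z) (j : Fin n) : wirt Complex.I j f z = 0 := by
  have h1 := hf.fderiv_restrictScalars ℝ
  have h2 : (Pi.single j Complex.I : BodySpace n) = Complex.I • Pi.single j 1 := by
    rw [← Pi.single_smul, smul_eq_mul, mul_one]
  unfold wirt
  rw [h1, h2]
  simp only [ContinuousLinearMap.coe_restrictScalars', map_smul, smul_smul, Complex.I_mul_I,
    neg_one_smul, add_neg_cancel, smul_zero]

theorem wirt_trunc_eq_zero (hU : IsOpen U) {h : BodySpace n → evenPart}
    (hh : GrassmannHolomorphicOn (fun z => (h z : ComplexGrassmann)) U) (j : Fin n)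
    {z : BodySpace n} (hz : z ∈ U) : wirt Complex.I j (fun w => trunc L (h w)) z = 0 := by
  rw [wirt_trunc hU (hh.smoothOn hU) hz]
  have h1 : wirt Complex.I j (fun w => res L (h w : ComplexGrassmann)) z = 0 := by
    funext m
    rw [wirt_res hU (hh.smoothOn hU) hz]
    exact wirt_eq_zero_of_differentiableAt ((hh m).differentiableAt (hU.mem_nhds hz)) j
  rw [h1, map_zero]

theorem smoothOn_conj_evenPart {h : BodySpace n → evenPart}
    (hh : GrassmannSmoothOn (fun z => (h z : ComplexGrassmann)) U) (L : Finset ℕ) :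
    ContDiffOn ℝ ∞ (fun z => truncConj L (h z)) U :=
  GrassmannSmoothOn.trunc (h := fun z => ⟨_, conj_mem_evenPart (h z).2⟩) hh.conj L

theorem wirt_truncConj_eq_zero (hU : IsOpen U) {h : BodySpace n → evenPart}
    (hh : GrassmannHolomorphicOn (fun z => (h z : ComplexGrassmann)) U) (j : Fin n)
    {z : BodySpace n} (hz : z ∈ U) : wirt (-Complex.I) j (fun w => truncConj L (h w)) z = 0 := by
  have hs := hh.smoothOn hU
  have h2 := wirt_trunc (L := L) (κ := -Complex.I) (j := j) hU
    (h := fun z => ⟨_, conj_mem_evenPart (h z).2⟩) hs.conj hz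
  refine h2.trans ?_
  rw [wirt_res_eq_dWirtinger hU hs.conj j hz, dWirtinger_conj hU hs j hz]
  have h1 : dbarWirtinger j (fun w => (h w : ComplexGrassmann)) z = 0 := by
    funext l
    rw [dbarWirtinger_apply]
    exact wirt_eq_zero_of_differentiableAt ((hh l).differentiableAt (hU.mem_nhds hz)) j
  rw [h1]
  have h3 : (0 : ComplexGrassmann).conj = 0 := funext fun l => map_zero (starRingEnd ℂ)
  rw [h3, map_zero, map_zero]

theorem truncEval_truncConj_eq_zero (hU : IsOpen U) {h : BodySpace n → evenPart}
    (hh : GrassmannSmoothOn (fun z => (h z : ComplexGrassmann)) U) (x : Fin n → evenPart)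
    (hx : (fun j => (x j : ComplexGrassmann).body) ∈ U)
    (h0 : superEval (fun z => (h z : ComplexGrassmann)) x = 0) :
    truncEval L x (fun z => truncConj L (h z)) = 0 := by
  have h1 := trunc_superEval (L := L) hU (h := fun z => ⟨_, conj_mem_evenPart (h z).2⟩) hh.conj x hx
  refine h1.symm.trans ?_
  rw [← map_zero (trunc L)]
  refine trunc_eq_of_res_eq ?_
  change res L (superEval (fun z => (h z : ComplexGrassmann).conj) x) = res L 0
  rw [superEval_conj hU hh x hx, h0]
  have h3 : (0 : ComplexGrassmann).conj = 0 := funext fun l => map_zero (starRingEnd ℂ)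
  rw [h3]

theorem truncEval_trunc_eq_zero (hU : IsOpen U) {h : BodySpace n → evenPart}
    (hh : GrassmannSmoothOn (fun z => (h z : ComplexGrassmann)) U) (x : Fin n → evenPart)
    (hx : (fun j => (x j : ComplexGrassmann).body) ∈ U)
    (h0 : superEval (fun z => (h z : ComplexGrassmann)) x = 0) :
    truncEval L x (fun z => trunc L (h z)) = 0 := by
  rw [← trunc_superEval hU hh x hx, ← map_zero (trunc L)]
  refine trunc_eq_of_res_eq ?_
  change res L (superEval (fun z => (h z : ComplexGrassmann)) x) = res L 0
  rw [h0]

namespace OddVectorField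

variable (V : OddVectorField n U)

theorem trunc_gDeriv (hU : IsOpen U) (i j : Fin n) {z : BodySpace n} (hz : z ∈ U) :
    trunc L (V.gDeriv i j z) = wirtJacobian (-Complex.I) (fun i w => trunc L (V.g i w)) z i j := by
  have hs := (V.g_holomorphic i).smoothOn hU
  rw [wirtJacobian, Matrix.of_apply, wirt_trunc hU hs hz, wirt_res_eq_dWirtinger hU hs j hz]
  exact (truncOfCoeff_res (V.gDeriv i j z)).symm

/-- The function `det(JV)`, with values in the even part. -/
noncomputable def evenDetJ (z : BodySpace n) : evenPart := (Matrix.of fun i j => V.gDeriv i j z).det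

theorem trunc_evenDetJ (hU : IsOpen U) {z : BodySpace n} (hz : z ∈ U) :
    trunc L (V.evenDetJ z) = (wirtJacobian (-Complex.I) (fun i w => trunc L (V.g i w)) z).det := by
  rw [evenDetJ, RingHom.map_det]
  congr 1
  ext i j
  exact V.trunc_gDeriv hU i j hz

theorem evenDetJ_smoothOn (hU : IsOpen U) :
    GrassmannSmoothOn (fun z => (V.evenDetJ z : ComplexGrassmann)) U := by
  have h1 : (fun z => (V.evenDetJ z : ComplexGrassmann)) = fun z => ∑ σ : Equiv.Perm (Fin n),
      ((Equiv.Perm.sign σ : ℤ) : ComplexGrassmann) *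
        ((∏ i, V.gDeriv (σ i) i z : evenPart) : ComplexGrassmann) := by
    funext z
    rw [evenDetJ, Matrix.det_apply']
    simp
  rw [h1]
  refine GrassmannSmoothOn.sum fun σ _ => (grassmannSmoothOn_const _).mul ?_
  have h2 (s : Finset (Fin n)) : GrassmannSmoothOn
      (fun z => ((∏ i ∈ s, V.gDeriv (σ i) i z : evenPart) : ComplexGrassmann)) U := by
    induction s using Finset.induction_on with
    | empty => exact grassmannSmoothOn_const _
    | insert a s ha ih =>
      simp only [Finset.prod_insert ha]
      exact (((V.g_holomorphic (σ a)).smoothOn hU).dWirtinger hU a).mul ih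
  exact h2 _

end OddVectorField

end Evaluation

open ComplexGrassmann

/-! ### Exponential of a scalar plus a nilpotent form -/

namespace FormAlg

section Exponential

variable {n : ℕ} {A : Type*} [NormedCommRing A] [NormedAlgebra ℂ A] [CompleteSpace A]

/-- The shift lets each power of the nilpotent part be paired, within the same index `k`, with the
power of the scalar that the binomial theorem assigns to it. -/
theorem hasSum_shifted_exp (a : A) (j : ℕ) :
    HasSum (fun k => if j ≤ k then ((k - j).factorial : ℂ)⁻¹ • a ^ (k - j) else 0)
      (NormedSpace.exp a) := by
  have h := NormedSpace.exp_series_hasSum_exp' (𝕂 := ℂ) a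
  have hinj : Function.Injective fun k => k + j := add_left_injective j
  refine (hinj.hasSum_iff ?_).1 ?_
  · intro k hk
    refine if_neg fun hjk => hk ⟨k - j, Nat.sub_add_cancel hjk⟩
  · convert h using 2 with k
    simp

/-- The exponential of `a + y` for a scalar `a` and a nilpotent `y`. -/
theorem hasSum_exp_add_of_pow_eq_zero (a : A) {y : FormAlg n A} {N : ℕ} (hy : y ^ N = 0)
    (K : SuperMonomial n) :
    HasSum (fun k : ℕ => (k.factorial : ℂ)⁻¹ • ((a • (1 : FormAlg n A) + y) ^ k) K)
      (NormedSpace.exp a * ∑ j ∈ Finset.range N, (j.factorial : ℂ)⁻¹ • (y ^ j) K) := by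
  have h1 : HasSum (fun k : ℕ => ∑ j ∈ Finset.range N,
      (if j ≤ k then ((k - j).factorial : ℂ)⁻¹ • a ^ (k - j) else 0)
        * ((j.factorial : ℂ)⁻¹ • (y ^ j) K))
      (∑ j ∈ Finset.range N, NormedSpace.exp a * ((j.factorial : ℂ)⁻¹ • (y ^ j) K)) :=
    hasSum_sum fun j _ => (hasSum_shifted_exp a j).mul_right _
  rw [Finset.mul_sum]
  convert h1 using 2 with k
  have hcomm : Commute y (a • (1 : FormAlg n A)) := by
    rw [Commute, SemiconjBy, mul_smul_comm, smul_mul_assoc, mul_one, one_mul]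
  rw [add_comm, hcomm.add_pow, sum_apply, Finset.smul_sum]
  have h2 (j : ℕ) (hj : j ∈ Finset.range (k + 1)) :
      (k.factorial : ℂ)⁻¹ • (y ^ j * (a • (1 : FormAlg n A)) ^ (k - j) * (k.choose j : FormAlg n A)) K
        = (if j ≤ k then ((k - j).factorial : ℂ)⁻¹ • a ^ (k - j) else 0)
          * ((j.factorial : ℂ)⁻¹ • (y ^ j) K) := by
    have hjk : j ≤ k := Nat.lt_succ_iff.1 (Finset.mem_range.1 hj)
    rw [if_pos hjk, smul_pow, one_pow, mul_smul_comm, mul_one, ← nsmul_eq_mul']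
    change (k.factorial : ℂ)⁻¹ • (k.choose j • (a ^ (k - j) * (y ^ j) K)) = _
    rw [← Nat.cast_smul_eq_nsmul ℂ, smul_smul, smul_mul_smul_comm]
    congr 1
    rw [Nat.cast_choose ℂ hjk]
    field_simp [Nat.factorial_ne_zero]
  rw [Finset.sum_congr rfl h2]
  rcases le_total N (k + 1) with hN | hN
  · refine (Finset.sum_subset (Finset.range_mono hN) fun j _ hj => ?_).symm
    rw [Finset.mem_range, not_lt] at hj
    rw [pow_eq_zero_of_le hj hy, zero_apply, smul_zero, mul_zero]
  · refine Finset.sum_subset (Finset.range_mono hN) fun j _ hj => ?_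
    rw [Finset.mem_range, not_lt] at hj
    rw [if_neg (by omega), zero_mul]

end Exponential

end FormAlg

/-! ### Truncation of superforms with even coefficients -/

namespace SuperForm

open FormAlg

variable {n : ℕ} {L : Finset ℕ} {z : BodySpace n}

theorem wedge_apply (η θ : SuperForm n) (K : SuperMonomial n) (z : BodySpace n) : wedge η θ K z
    = ∑ q ∈ K.antidiagonal, SuperMonomial.sign q.1 q.2 • (η q.1 z * θ q.2 z) :=
  (SuperMonomial.sum_antidiagonal K fun I J => SuperMonomial.sign I J • (η I z * θ J z)).symm

/-- The value at `z` of the form `θ` has even coefficients, with truncations given by `x`. -/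
def Represents (L : Finset ℕ) (θ : SuperForm n) (z : BodySpace n) (x : FormAlg n (TruncAlg L)) :
    Prop :=
  ∀ K, ∃ h : θ K z ∈ evenPart, trunc L ⟨θ K z, h⟩ = x K

theorem represents_zero : Represents L (0 : SuperForm n) z 0 := fun _ =>
  ⟨zero_mem _, map_zero (trunc L)⟩

theorem Represents.add {η θ : SuperForm n} {x y : FormAlg n (TruncAlg L)}
    (hη : Represents L η z x) (hθ : Represents L θ z y) : Represents L (η + θ) z (x + y) := by
  intro K
  obtain ⟨h1, h2⟩ := hη K
  obtain ⟨h3, h4⟩ := hθ K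
  refine ⟨add_mem h1 h3, ?_⟩
  rw [FormAlg.add_apply, ← h2, ← h4, ← map_add]
  rfl

theorem Represents.sum {ι : Type*} {s : Finset ι} {η : ι → SuperForm n}
    {x : ι → FormAlg n (TruncAlg L)} (h : ∀ i ∈ s, Represents L (η i) z (x i)) :
    Represents L (∑ i ∈ s, η i) z (∑ i ∈ s, x i) := by
  classical
  induction s using Finset.induction_on with
  | empty => exact represents_zero
  | insert a s ha ih =>
    rw [Finset.sum_insert ha, Finset.sum_insert ha]
    exact (h a (Finset.mem_insert_self a s)).add
      (ih fun i hi => h i (Finset.mem_insert_of_mem hi))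

theorem Represents.smul (c : ℂ) {η : SuperForm n} {x : FormAlg n (TruncAlg L)}
    (hη : Represents L η z x) : Represents L (c • η) z (algebraMap ℂ (TruncAlg L) c • x) := by
  intro K
  obtain ⟨h1, h2⟩ := hη K
  refine ⟨smul_mem_evenPart c h1, ?_⟩
  rw [FormAlg.smul_apply, ← h2, ← Algebra.smul_def, ← trunc_smul]
  rfl

theorem Represents.wedge {η θ : SuperForm n} {x y : FormAlg n (TruncAlg L)}
    (hη : Represents L η z x) (hθ : Represents L θ z y) : Represents L (wedge η θ) z (x * y) := by
  choose h1 h2 using hη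
  choose h3 h4 using hθ
  intro K
  have h5 : SuperForm.wedge η θ K z = ((∑ q ∈ K.antidiagonal, SuperMonomial.sign q.1 q.2 •
      ((⟨η q.1 z, h1 q.1⟩ : evenPart) * ⟨θ q.2 z, h3 q.2⟩) : evenPart) : ComplexGrassmann) := by
    rw [wedge_apply, AddSubmonoidClass.coe_finsetSum]
    rfl
  refine ⟨h5 ▸ Subtype.property _, ?_⟩
  have h6 : (⟨SuperForm.wedge η θ K z, h5 ▸ Subtype.property _⟩ : evenPart)
      = ∑ q ∈ K.antidiagonal, SuperMonomial.sign q.1 q.2 •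
        ((⟨η q.1 z, h1 q.1⟩ : evenPart) * ⟨θ q.2 z, h3 q.2⟩) := Subtype.ext h5
  rw [h6, map_sum, FormAlg.mul_apply]
  refine Finset.sum_congr rfl fun q _ => ?_
  rw [map_zsmul, map_mul, h2, h4]

theorem represents_term (I : SuperMonomial n) (a : BodySpace n → evenPart) :
    Represents L (term I fun z => (a z : ComplexGrassmann)) z (single I (trunc L (a z))) := by
  intro K
  by_cases hK : K = I
  · subst hK
    have h1 : term K (fun z => (a z : ComplexGrassmann)) K z = a z := by simp [term]
    refine ⟨h1 ▸ (a z).2, ?_⟩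
    rw [single_same]
    congr 1
    exact Subtype.ext h1
  · have h1 : term I (fun z => (a z : ComplexGrassmann)) K z = 0 := by simp [term, hK]
    refine ⟨h1 ▸ zero_mem _, ?_⟩
    rw [single_of_ne hK, ← map_zero (trunc L)]
    congr 1
    exact Subtype.ext h1

theorem represents_term_one (I : SuperMonomial n) : Represents L (term I 1) z (single I 1) := by
  have := represents_term (L := L) (z := z) I 1
  rwa [Pi.one_apply, map_one] at this

theorem Represents.wedgePow {η : SuperForm n} {x : FormAlg n (TruncAlg L)}
    (hη : Represents L η z x) (k : ℕ) : Represents L (wedgePow η k) z (x ^ k) := by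
  induction k with
  | zero => exact represents_term_one _
  | succ k ih =>
    rw [pow_succ]
    exact ih.wedge hη

/-- The exponential of a form whose value at `z` is the sum of a scalar and a nilpotent form. -/
theorem Represents.exp {η : SuperForm n} {a : TruncAlg L} {y : FormAlg n (TruncAlg L)}
    (hη : Represents L η z (a • 1 + y)) {N : ℕ} (hy : y ^ N = 0) :
    Represents L (SuperForm.exp η) z
      (NormedSpace.exp a • ∑ j ∈ Finset.range N, algebraMap ℂ (TruncAlg L) (j.factorial : ℂ)⁻¹ • y ^ j)
      := by
  intro K
  -- Each partial sum has even coefficients, so in the odd components every term of the series is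
  -- zero.
  have heven : SuperForm.exp η K z ∈ evenPart := by
    intro l hl
    unfold SuperForm.exp
    have h0 (k : ℕ) : (k.factorial : ℂ)⁻¹ * SuperForm.wedgePow η k K z l = 0 := by
      obtain ⟨h1, _⟩ := hη.wedgePow k K
      rw [h1 l hl, mul_zero]
    simp only [h0, tsum_zero]
  refine ⟨heven, eq_of_smul_res_one ?_⟩
  rw [trunc_smul_res_one, FormAlg.smul_apply, FormAlg.sum_apply]
  funext m
  -- A continuous functional takes convergence in the truncated algebra to convergence of the series
  -- of components that defines the exponential of the form.
  have h1 := ((ContinuousLinearMap.proj (R := ℂ) (φ := fun _ : L.powerset => ℂ) m).comp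
    (truncCoeff L)).hasSum (hasSum_exp_add_of_pow_eq_zero a hy K)
  have h2 (k : ℕ) : ((ContinuousLinearMap.proj (R := ℂ) (φ := fun _ : L.powerset => ℂ) m).comp
      (truncCoeff L)) ((k.factorial : ℂ)⁻¹ • ((a • (1 : FormAlg n (TruncAlg L)) + y) ^ k) K)
        = (k.factorial : ℂ)⁻¹ * SuperForm.wedgePow η k K z m := by
    obtain ⟨h3, h4⟩ := hη.wedgePow k K
    rw [map_smul, ← h4]
    change (k.factorial : ℂ)⁻¹ • truncCoeff L (trunc L ⟨SuperForm.wedgePow η k K z, h3⟩) m = _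
    rw [truncCoeff_trunc]
    rfl
  simp only [h2] at h1
  refine h1.tsum_eq.trans ?_
  simp only [Algebra.smul_def, FormAlg.smul_apply]
  rfl

/-- The top coefficient of the product of an arbitrary form and a form with even coefficients. -/
theorem res_wedge_top (η : SuperForm n) {θ : SuperForm n} {x : FormAlg n (TruncAlg L)}
    (hθ : Represents L θ z x) : res L (wedge η θ ⟨Finset.univ, 1, Finset.univ⟩ z)
      = topPair (fun I => res L (η I z)) x := by
  rw [wedge_apply, map_sum, topPair_apply]
  refine Finset.sum_congr rfl fun q _ => ?_
  obtain ⟨h1, h2⟩ := hθ q.2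
  -- Only the coefficients of `θ` need to be even. They commute with those of `η`, and on the left
  -- they act through the truncated algebra.
  rw [map_zsmul, ← h2, trunc_smul_res, mul_comm_of_mem_evenPart h1]

end SuperForm

open ComplexGrassmann

/-! ### Differential and contraction of 1-forms such as ω -/

namespace SuperForm

open FormAlg

variable {n : ℕ} {L : Finset ℕ}

/-- The 1-form `∑ dz_i a_i + ∑ dξ_i a_i`. -/
noncomputable def linearForm (a : Fin n → BodySpace n → ComplexGrassmann) : SuperForm n :=
  ∑ i, term ⟨{hol i}, 0, ∅⟩ (a i) + ∑ i, term ⟨∅, Pi.single (hol i) 1, ∅⟩ (a i)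

theorem term_apply_self (I : SuperMonomial n) (a : BodySpace n → ComplexGrassmann) :
    term I a I = a := by
  simp [term]

theorem term_apply_of_ne {I K : SuperMonomial n} (h : K ≠ I) (a : BodySpace n → ComplexGrassmann) :
    term I a K = 0 := by
  simp [term, h]

theorem dz_monomial_inj {i j : Fin n}
    (h : (⟨{hol i}, 0, ∅⟩ : SuperMonomial n) = ⟨{hol j}, 0, ∅⟩) : i = j :=
  hol_injective (Finset.singleton_injective (congrArg SuperMonomial.A h))

theorem dxi_monomial_inj {i j : Fin n}
    (h : (⟨∅, Pi.single (hol i) 1, ∅⟩ : SuperMonomial n) = ⟨∅, Pi.single (hol j) 1, ∅⟩) :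
    i = j := by
  have h1 := congrFun (congrArg SuperMonomial.m h) (hol i)
  simp only [Pi.single_eq_same] at h1
  by_contra hne
  rw [Pi.single_eq_of_ne fun h => hne (hol_injective h)] at h1
  exact one_ne_zero h1

theorem dz_monomial_ne_dxi_monomial (i j : Fin n) :
    (⟨{hol i}, 0, ∅⟩ : SuperMonomial n) ≠ ⟨∅, Pi.single (hol j) 1, ∅⟩ := fun h =>
  Finset.singleton_ne_empty _ (congrArg SuperMonomial.A h)

theorem linearForm_dz (a : Fin n → BodySpace n → ComplexGrassmann) (j : Fin n) :
    linearForm a ⟨{hol j}, 0, ∅⟩ = a j := by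
  unfold linearForm
  rw [Pi.add_apply, Finset.sum_apply, Finset.sum_apply, Finset.sum_eq_single j,
    Finset.sum_eq_zero, add_zero, term_apply_self]
  · exact fun i _ => term_apply_of_ne (dz_monomial_ne_dxi_monomial j i) _
  · exact fun i _ hi => term_apply_of_ne (fun h => hi (dz_monomial_inj h).symm) _
  · exact fun h => absurd (Finset.mem_univ j) h

theorem linearForm_dxi (a : Fin n → BodySpace n → ComplexGrassmann) (j : Fin n) :
    linearForm a ⟨∅, Pi.single (hol j) 1, ∅⟩ = a j := by
  unfold linearForm
  rw [Pi.add_apply, Finset.sum_apply, Finset.sum_apply, Finset.sum_eq_zero, zero_add,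
    Finset.sum_eq_single j, term_apply_self]
  · exact fun i _ hi => term_apply_of_ne (fun h => hi (dxi_monomial_inj h).symm) _
  · exact fun h => absurd (Finset.mem_univ j) h
  · exact fun i _ => term_apply_of_ne (dz_monomial_ne_dxi_monomial i j).symm _

theorem linearForm_eq_zero (a : Fin n → BodySpace n → ComplexGrassmann) {I : SuperMonomial n}
    (h1 : ∀ j, I ≠ ⟨{hol j}, 0, ∅⟩) (h2 : ∀ j, I ≠ ⟨∅, Pi.single (hol j) 1, ∅⟩) :
    linearForm a I = 0 := by
  unfold linearForm
  rw [Pi.add_apply, Finset.sum_apply, Finset.sum_apply, Finset.sum_eq_zero, zero_add,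
    Finset.sum_eq_zero]
  · exact fun i _ => term_apply_of_ne (h2 i) _
  · exact fun i _ => term_apply_of_ne (h1 i) _

theorem dbarWirtinger_zero (i : Fin n) :
    dbarWirtinger i (0 : BodySpace n → ComplexGrassmann) = 0 := by
  funext z l
  rw [dbarWirtinger_apply]
  exact wirt_const _ _ 0 z

theorem dbarEven_linearForm (i : Fin n) (a : Fin n → BodySpace n → ComplexGrassmann) :
    dbarEven i (linearForm a) = linearForm fun k => dbarWirtinger i (a k) := by
  funext I
  change dbarWirtinger i (linearForm a I) = _
  by_cases h1 : ∃ j, I = ⟨{hol j}, 0, ∅⟩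
  · obtain ⟨j, rfl⟩ := h1
    rw [linearForm_dz, linearForm_dz]
  by_cases h2 : ∃ j, I = ⟨∅, Pi.single (hol j) 1, ∅⟩
  · obtain ⟨j, rfl⟩ := h2
    rw [linearForm_dxi, linearForm_dxi]
  rw [not_exists] at h1 h2
  rw [linearForm_eq_zero _ h1 h2, linearForm_eq_zero _ h1 h2, dbarWirtinger_zero]

theorem dbarOdd_linearForm (j : Fin n) (a : Fin n → BodySpace n → ComplexGrassmann) :
    dbarOdd j (linearForm a) = 0 := by
  funext I
  unfold dbarOdd
  split_ifs
  · rfl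
  · rw [linearForm_eq_zero _ (fun k h => ?_) fun k h => ?_, smul_zero]
    · rfl
    · exact Finset.insert_ne_empty _ _ (congrArg SuperMonomial.Q h)
    · exact Finset.insert_ne_empty _ _ (congrArg SuperMonomial.Q h)

theorem contractEven_linearForm (j : Fin n) (a : Fin n → BodySpace n → ComplexGrassmann) :
    contractEven j (linearForm a) = term (SuperMonomial.unit n) (a j) := by
  funext I
  by_cases hI : I = SuperMonomial.unit n
  · subst hI
    rw [term_apply_self]
    have h1 : (⟨insert (hol j) ∅, 0, ∅⟩ : SuperMonomial n) = ⟨{hol j}, 0, ∅⟩ := by simp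
    simp only [contractEven, SuperMonomial.unit, Finset.notMem_empty, if_false,
      Finset.filter_empty, Finset.card_empty, pow_zero, one_smul, h1, linearForm_dz]
  · rw [term_apply_of_ne hI]
    unfold contractEven
    split_ifs with hj
    · rfl
    · rw [linearForm_eq_zero _ (fun k h => ?_) fun k h => ?_, smul_zero]
      · apply hI
        have hA := congrArg SuperMonomial.A h
        simp only at hA
        have hk : hol j = hol k := Finset.mem_singleton.1 (hA ▸ Finset.mem_insert_self (hol j) I.A)
        ext1
        · refine Finset.eq_empty_of_forall_notMem fun c hc => hj ?_
          have : c = hol k := Finset.mem_singleton.1 (hA ▸ Finset.mem_insert_of_mem hc)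
          rwa [hk, ← this]
        · have hm := congrArg SuperMonomial.m h
          exact hm
        · have hQ := congrArg SuperMonomial.Q h
          exact hQ
      · exact Finset.insert_ne_empty _ _ (congrArg SuperMonomial.A h)

theorem contractOdd_linearForm (j : Fin n) (a : Fin n → BodySpace n → ComplexGrassmann) :
    contractOdd j (linearForm a) = term (SuperMonomial.unit n) (a j) := by
  funext I
  by_cases hI : I = SuperMonomial.unit n
  · subst hI
    rw [term_apply_self]
    simp only [contractOdd, SuperMonomial.unit, Finset.card_empty, pow_zero, zero_add,
      Pi.zero_apply, Nat.cast_zero, one_mul, one_smul, linearForm_dxi]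
  · rw [term_apply_of_ne hI]
    unfold contractOdd
    rw [linearForm_eq_zero _ (fun k h => ?_) fun k h => ?_, smul_zero]
    · have hm := congrFun (congrArg SuperMonomial.m h) (hol j)
      simp at hm
    · apply hI
      have hm := congrArg SuperMonomial.m h
      simp only at hm
      have hkj : k = j := by
        by_contra hne
        have := congrFun hm (hol j)
        rw [Pi.add_apply, Pi.single_eq_same,
          Pi.single_eq_of_ne fun h => hne (hol_injective h).symm] at this
        exact Nat.succ_ne_zero _ this
      ext1
      · have hA := congrArg SuperMonomial.A h
        exact hA
      · rw [hkj] at hm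
        exact add_eq_right.1 hm
      · have hQ := congrArg SuperMonomial.Q h
        exact hQ

theorem represents_linearForm (a : Fin n → BodySpace n → evenPart) (z : BodySpace n) :
    Represents L (linearForm fun k w => (a k w : ComplexGrassmann)) z
      (∑ k, trunc L (a k z) • dz k + ∑ k, trunc L (a k z) • dxi k) := by
  simp only [dz, dxi, smul_single, mul_one]
  exact (Represents.sum fun k _ => represents_term _ (a k)).add
    (Represents.sum fun k _ => represents_term _ (a k))

theorem single_unit {R : Type*} [CommRing R] (r : R) :
    (single (SuperMonomial.unit n) r : FormAlg n R) = r • 1 := by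
  rw [one_def, smul_single, mul_one]

theorem sum_mul_single_unit {R : Type*} [CommRing R] (g h : Fin n → R) (f : Fin n → FormAlg n R) :
    ∑ j, f j * single (SuperMonomial.unit n) (h j)
      + ∑ j, single (SuperMonomial.unit n) (g j) * single (SuperMonomial.unit n) (h j)
      = (∑ j, g j * h j) • 1 + ∑ j, h j • f j := by
  rw [add_comm, Finset.sum_smul]
  simp only [single_unit, mul_smul_comm, mul_one, smul_smul, mul_comm]

end SuperForm

theorem dbarWirtinger_mem_evenPart {n : ℕ} (j : Fin n) {h : BodySpace n → ComplexGrassmann}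
    (hh : ∀ z, h z ∈ evenPart) (z : BodySpace n) : dbarWirtinger j h z ∈ evenPart := by
  intro l hl
  have : (fun w => h w l) = fun _ => 0 := funext fun w => hh w l hl
  rw [dbarWirtinger_apply, this, wirt_const]

/-! ### The form ∂̄ω + i_V(ω) -/

namespace OddVectorField

open SuperForm FormAlg

variable {n : ℕ} {L : Finset ℕ} {U : Set (BodySpace n)} (V : OddVectorField n U)

/-- The truncated functions `g_i`. -/
noncomputable def truncG (L : Finset ℕ) (i : Fin n) (z : BodySpace n) : TruncAlg L :=
  trunc L (V.g i z)

/-- The truncated functions `ḡ_i`. -/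
noncomputable def truncH (L : Finset ℕ) (i : Fin n) (z : BodySpace n) : TruncAlg L :=
  truncConj L (V.g i z)

/-- The truncated superfunctions `f_i`. -/
noncomputable def truncF (L : Finset ℕ) (i : Fin n) (z : BodySpace n) : FormAlg n (TruncAlg L) :=
  ∑ μ : Finset (Fin n), single ⟨∅, 0, μ.image hol⟩ (trunc L (V.f i μ z))

/-- The nilpotent part of `∂̄ω + i_V(ω)`. -/
noncomputable def nilpotentPart (L : Finset ℕ) (z : BodySpace n) : FormAlg n (TruncAlg L) :=
  evenTwoForm (wirtJacobian Complex.I (V.truncH L) z).transpose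
    + (oddTwoForm (wirtJacobian Complex.I (V.truncH L) z).transpose
      + ∑ j, V.truncH L j z • V.truncF L j z)

/-- The coefficients of `ω` do not involve the odd coordinates, so only their derivatives by the z̄
contribute, and each produces a `dz` and a `dξ` term with the same coefficient. -/
theorem represents_dbar_omega (hU : IsOpen U) {z : BodySpace n} (hz : z ∈ U) :
    Represents L (dbar V.omega) z (evenTwoForm (wirtJacobian Complex.I (V.truncH L) z).transpose
      + oddTwoForm (wirtJacobian Complex.I (V.truncH L) z).transpose) := by
  let h (k : Fin n) (w : BodySpace n) : evenPart :=
    ⟨(V.g k w : ComplexGrassmann).conj, conj_mem_evenPart (V.g k w).2⟩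
  have hω : V.omega = linearForm fun k w => (h k w : ComplexGrassmann) := rfl
  let d (i k : Fin n) (w : BodySpace n) : evenPart :=
    ⟨dbarWirtinger i (fun w => (h k w : ComplexGrassmann)) w,
      dbarWirtinger_mem_evenPart i (fun w => (h k w).2) w⟩
  have hd (i k : Fin n) : trunc L (d i k z) = wirtJacobian Complex.I (V.truncH L) z k i := by
    have hs : GrassmannSmoothOn (fun w => (h k w : ComplexGrassmann)) U :=
      ((V.g_holomorphic k).smoothOn hU).conj
    refine (truncOfCoeff_res (d i k z)).symm.trans ?_
    change truncOfCoeff L (res L (dbarWirtinger i (fun w => (h k w : ComplexGrassmann)) z)) = _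
    rw [← wirt_res_eq_dbarWirtinger hU hs i hz, ← wirt_trunc hU hs hz]
    rfl
  have h1 : Represents L (dbar V.omega) z
      (∑ i, dzbar i * (∑ k, trunc L (d i k z) • dz k + ∑ k, trunc L (d i k z) • dxi k)
        + ∑ j : Fin n, single ⟨∅, Pi.single (anti j) 1, ∅⟩ 1 * 0) := by
    unfold dbar
    refine (Represents.sum fun i _ => (represents_term_one _).wedge ?_).add
      (Represents.sum fun j _ => (represents_term_one _).wedge ?_)
    · rw [hω, dbarEven_linearForm]
      exact represents_linearForm (d i) z
    · rw [hω, dbarOdd_linearForm]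
      exact represents_zero
  convert h1 using 1
  simp only [mul_zero, Finset.sum_const_zero, add_zero, mul_add, Finset.sum_add_distrib,
    Finset.mul_sum, mul_smul_comm, evenTwoForm, oddTwoForm, theta, Finset.sum_mul, smul_mul_assoc,
    hd, Matrix.transpose_apply]
  rw [Finset.sum_comm]
  congr 1
  exact Finset.sum_comm

/-- Contraction of `dz_j` yields `f_j` and of `dξ_j` yields `g_j`, both with the coefficient `ḡ_j`;
the second gives the phase. -/
theorem represents_contract_omega (z : BodySpace n) :
    Represents L (V.contract V.omega) z ((∑ j, V.truncG L j z * V.truncH L j z) • 1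
      + ∑ j, V.truncH L j z • V.truncF L j z) := by
  let h (k : Fin n) (w : BodySpace n) : evenPart :=
    ⟨(V.g k w : ComplexGrassmann).conj, conj_mem_evenPart (V.g k w).2⟩
  have hω : V.omega = linearForm fun k w => (h k w : ComplexGrassmann) := rfl
  have h1 : Represents L (V.contract V.omega) z
      (∑ j, V.truncF L j z * single (SuperMonomial.unit n) (trunc L (h j z))
        + ∑ j, single (SuperMonomial.unit n) (trunc L (V.g j z))
          * single (SuperMonomial.unit n) (trunc L (h j z))) := by
    unfold contract
    refine (Represents.sum fun j _ => Represents.wedge ?_ ?_).add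
      (Represents.sum fun j _ => Represents.wedge ?_ ?_)
    · exact Represents.sum fun μ _ => represents_term _ _
    · rw [hω, contractEven_linearForm]
      exact represents_term _ (h j)
    · exact represents_term _ _
    · rw [hω, contractOdd_linearForm]
      exact represents_term _ (h j)
  rw [sum_mul_single_unit] at h1
  exact h1

theorem represents_total (hU : IsOpen U) {z : BodySpace n} (hz : z ∈ U) :
    Represents L (dbar V.omega + V.contract V.omega) z
      ((∑ j, V.truncG L j z * V.truncH L j z) • 1 + V.nilpotentPart L z) := by
  convert (V.represents_dbar_omega hU hz).add (V.represents_contract_omega z) using 1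
  unfold nilpotentPart
  abel

/-- Since `f_j` is odd, each surviving monomial is a product of an odd number of odd coordinates. -/
theorem hasType_sum_truncF {z : BodySpace n}
    (hz : z ∈ U) : (∑ j, V.truncH L j z • V.truncF L j z).SupportedOn (HasType 0 1) := by
  refine SupportedOn.sum fun j _ => SupportedOn.smul ?_ _
  refine SupportedOn.sum fun μ _ => ?_
  by_cases hμ : Even μ.card
  · rw [V.f_odd j μ hμ z hz, map_zero]
    intro K hK
    by_cases h : K = ⟨∅, 0, μ.image hol⟩
    · subst h
      exact absurd (single_same _ _) hK
    · exact absurd (single_of_ne h _) hK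
  · refine supportedOn_single ?_ _
    rw [Nat.not_even_iff_odd] at hμ
    have hc : (μ.image (hol : Fin n → CoordIndex n)).card = μ.card :=
      Finset.card_image_of_injective _ hol_injective
    refine ⟨by simp [SuperMonomial.degree], ?_⟩
    simpa [SuperMonomial.parity, hc] using Nat.odd_iff.1 hμ

end OddVectorField

open ComplexGrassmann

/-! ### Smooth dependence of form-valued functions on the point -/

namespace FormAlg

section Smooth

variable {n : ℕ} {A : Type*} [NormedCommRing A] [NormedAlgebra ℂ A] {U : Set (BodySpace n)}

/-- A function with values in the algebra of forms has smooth coefficients. -/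
def SmoothOn (x : BodySpace n → FormAlg n A) (U : Set (BodySpace n)) : Prop :=
  ∀ K, ContDiffOn ℝ ∞ (fun z => x z K) U

theorem SmoothOn.add {x y : BodySpace n → FormAlg n A} (hx : SmoothOn x U) (hy : SmoothOn y U) :
    SmoothOn (fun z => x z + y z) U := fun K => (hx K).add (hy K)

theorem SmoothOn.sum {ι : Type*} {s : Finset ι} {x : ι → BodySpace n → FormAlg n A}
    (hx : ∀ i ∈ s, SmoothOn (x i) U) : SmoothOn (fun z => ∑ i ∈ s, x i z) U := by
  intro K
  simp only [sum_apply]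
  exact ContDiffOn.sum fun i hi => hx i hi K

theorem SmoothOn.mul {x y : BodySpace n → FormAlg n A} (hx : SmoothOn x U) (hy : SmoothOn y U) :
    SmoothOn (fun z => x z * y z) U := by
  intro K
  simp only [mul_apply, ← Int.cast_smul_eq_zsmul ℝ]
  exact ContDiffOn.sum fun q _ => ((hx q.1).mul (hy q.2)).const_smul _

theorem smoothOn_const (x : FormAlg n A) : SmoothOn (fun _ : BodySpace n => x) U := fun _ =>
  contDiffOn_const

theorem SmoothOn.pow {x : BodySpace n → FormAlg n A} (hx : SmoothOn x U) (k : ℕ) :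
    SmoothOn (fun z => x z ^ k) U := by
  induction k with
  | zero =>
    simp only [pow_zero]
    exact smoothOn_const 1
  | succ k ih =>
    simp only [pow_succ]
    exact ih.mul hx

theorem SmoothOn.smul {a : BodySpace n → A} {x : BodySpace n → FormAlg n A}
    (ha : ContDiffOn ℝ ∞ a U) (hx : SmoothOn x U) : SmoothOn (fun z => a z • x z) U := fun K =>
  ha.mul (hx K)

theorem smoothOn_single (I : SuperMonomial n) {a : BodySpace n → A} (ha : ContDiffOn ℝ ∞ a U) :
    SmoothOn (fun z => single I (a z)) U := by
  have h : (fun z => single I (a z)) = fun z => a z • single I 1 := by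
    funext z
    rw [smul_single, mul_one]
  rw [h]
  exact SmoothOn.smul ha (smoothOn_const _)

theorem smoothOn_theta {v : BodySpace n → Fin n → A}
    (hv : ∀ i, ContDiffOn ℝ ∞ (fun z => v z i) U) : SmoothOn (fun z => theta (v z)) U :=
  SmoothOn.sum fun i _ => SmoothOn.smul (hv i) (smoothOn_const _)

theorem smoothOn_evenTwoForm {M : BodySpace n → Matrix (Fin n) (Fin n) A}
    (hM : ∀ i k, ContDiffOn ℝ ∞ (fun z => M z i k) U) : SmoothOn (fun z => evenTwoForm (M z)) U :=
  SmoothOn.sum fun k _ => (smoothOn_theta fun i => hM i k).mul (smoothOn_const _)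

theorem smoothOn_oddTwoForm {M : BodySpace n → Matrix (Fin n) (Fin n) A}
    (hM : ∀ i k, ContDiffOn ℝ ∞ (fun z => M z i k) U) : SmoothOn (fun z => oddTwoForm (M z)) U :=
  SmoothOn.sum fun k _ => (smoothOn_theta fun i => hM i k).mul (smoothOn_const _)

attribute [local instance] isScalarTower_real smulCommClass_complex

theorem SmoothOn.topPair {M : Type*} [NormedAddCommGroup M] [NormedSpace ℂ M] [Module A M]
    [IsBoundedSMul A M] [IsScalarTower ℂ A M] {η : BodySpace n → SuperMonomial n → M}
    (hη : ∀ I, ContDiffOn ℝ ∞ (fun z => η z I) U) {x : BodySpace n → FormAlg n A}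
    (hx : SmoothOn x U) : ContDiffOn ℝ ∞ (fun z => topPair (η z) (x z)) U := by
  simp only [topPair_apply, ← Int.cast_smul_eq_zsmul ℝ]
  exact ContDiffOn.sum fun q _ => ((hx q.2).smul (hη q.1)).const_smul _

end Smooth

end FormAlg

/-! ### Expansion of the localized form in powers of 1/t -/

namespace OddVectorField

open SuperForm FormAlg

variable {n : ℕ} {L : Finset ℕ} {U : Set (BodySpace n)} (V : OddVectorField n U)

theorem contDiffOn_truncG (hU : IsOpen U) (i : Fin n) : ContDiffOn ℝ ∞ (V.truncG L i) U :=
  ((V.g_holomorphic i).smoothOn hU).trunc L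

theorem contDiffOn_truncH (hU : IsOpen U) (i : Fin n) : ContDiffOn ℝ ∞ (V.truncH L i) U :=
  smoothOn_conj_evenPart ((V.g_holomorphic i).smoothOn hU) L

theorem smoothOn_truncF (hU : IsOpen U) (i : Fin n) : SmoothOn (V.truncF L i) U :=
  SmoothOn.sum fun μ _ => smoothOn_single _ (((V.f_holomorphic i μ).smoothOn hU).trunc L)

theorem contDiffOn_wirtJacobian_truncH (hU : IsOpen U) (i k : Fin n) : ContDiffOn ℝ ∞
    (fun z => (wirtJacobian Complex.I (V.truncH L) z).transpose i k) U :=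
  (V.contDiffOn_truncH hU k).wirt hU

theorem smoothOn_nilpotentPart (hU : IsOpen U) : SmoothOn (V.nilpotentPart L) U :=
  (smoothOn_evenTwoForm fun i k => V.contDiffOn_wirtJacobian_truncH hU i k).add
    ((smoothOn_oddTwoForm fun i k => V.contDiffOn_wirtJacobian_truncH hU i k).add
      (SmoothOn.sum fun j _ => SmoothOn.smul (V.contDiffOn_truncH hU j) (V.smoothOn_truncF hU j)))

/-- The top coefficient of the localized form, as a polynomial in `1/t` times an exponential. -/
theorem res_localizedForm (hU : IsOpen U) (η : SuperForm n) (t : ℝ) {z : BodySpace n}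
    (hz : z ∈ U) : res L (V.localizedForm η t ⟨Finset.univ, 1, Finset.univ⟩ z)
      = NormedSpace.exp (-(t⁻¹ • ∑ j, V.truncG L j z * V.truncH L j z)) •
        ∑ j ∈ Finset.range (n + 2), ((j.factorial : ℂ)⁻¹ * (-((t⁻¹ : ℝ) : ℂ)) ^ j) •
          topPair (fun I => res L (η I z)) (V.nilpotentPart L z ^ j) := by
  set c : ℂ := -((1 / t : ℝ) : ℂ) with hc
  set r : TruncAlg L := algebraMap ℂ (TruncAlg L) c with hr
  have h1 := (V.represents_total (L := L) hU hz).smul c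
  rw [← hr, smul_add r, smul_smul] at h1
  -- This bounds the exponential by the terms of weight at most `n + 1`.
  have hnil : (r • V.nilpotentPart L z) ^ (n + 2) = 0 := by
    rw [smul_pow, nilpotentPart, total_pow_eq_zero _ (V.hasType_sum_truncF hz), smul_zero]
  have h2 := SuperForm.res_wedge_top η (h1.exp hnil)
  unfold localizedForm
  rw [h2, map_smul, map_sum]
  congr 1
  · rw [hr, ← Algebra.smul_def, hc, one_div, neg_smul, Complex.coe_smul]
  · refine Finset.sum_congr rfl fun j _ => ?_
    rw [smul_pow, smul_smul, map_smul, hr, ← map_pow, ← map_mul, algebraMap_smul, hc, one_div]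

theorem topPair_nilpotentPart_pow_succ {η : SuperForm n}
    (hpar : η.coeffTopOdd.HasDimensionParityOn U) {z : BodySpace n} (hz : z ∈ U) :
    topPair (fun I => res L (η I z)) (V.nilpotentPart L z ^ (n + 1)) = 0 := by
  refine topPair_total_pow_succ _ (V.hasType_sum_truncF hz) _ ?_
  refine SupportedOn.sum fun j _ => SupportedOn.smul (SupportedOn.sum fun μ _ => ?_) _
  by_cases hμ : Even μ.card
  · rw [V.f_odd j μ hμ z hz, map_zero]
    intro K hK
    by_cases h : K = ⟨∅, 0, μ.image hol⟩
    · subst h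
      exact absurd (single_same _ _) hK
    · exact absurd (single_of_ne h _) hK
  · refine supportedOn_single ⟨rfl, rfl, ?_⟩ _
    -- The coordinates missing in the monomial of `f_j` include all the `ξ̄` and `n - |μ|` of the
    -- `ξ`. As `|μ|` is odd, this number differs from `n` in parity, and the corresponding
    -- coefficient of `η` is zero by assumption.
    have h1 : (Finset.univ.filter fun i : Fin n =>
        hol i ∈ Finset.univ \ μ.image (hol : Fin n → CoordIndex n)) = Finset.univ \ μ := by
      ext i
      simp [hol_injective.eq_iff]
    have h2 : (Finset.univ \ μ).card + μ.card = n := by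
      rw [Finset.card_sdiff_add_card_eq_card (Finset.subset_univ μ), Finset.card_univ,
        Fintype.card_fin]
    have h3 := hpar (Finset.univ \ μ.image hol) (by
      rw [h1]
      rw [Nat.not_even_iff] at hμ
      omega) z hz
    change res L (η.coeffTopOdd (Finset.univ \ μ.image hol) z) = 0
    rw [h3, map_zero]

theorem topPair_nilpotentPart_pow (η : SuperForm n) {z : BodySpace n} (hz : z ∈ U) :
    topPair (fun I => res L (η I z)) (V.nilpotentPart L z ^ n)
      = (n.factorial * (orientationSign n * (wirtJacobian Complex.I (V.truncH L) z).det)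
          : TruncAlg L) • res L (η.coeffTopOdd.top z + η.coeffStar.top z)
        + ∑ j, V.truncH L j z • (n • topPair (fun I => res L (η I z))
          (evenTwoForm (wirtJacobian Complex.I (V.truncH L) z).transpose ^ (n - 1)
            * V.truncF L j z)) := by
  unfold nilpotentPart
  rw [topPair_total_pow _ (V.hasType_sum_truncF hz), Matrix.det_transpose]
  congr 1
  · congr 1
    rw [map_add]
    congr 1
    change _ = res L ((∑ j : Fin n, η ⟨{hol j}, Function.update 1 (hol j) 0, Finset.univ⟩) z)
    rw [Finset.sum_apply, map_sum]
    rfl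
  · rw [Finset.mul_sum, map_sum, Finset.smul_sum]
    refine Finset.sum_congr rfl fun j _ => ?_
    rw [mul_smul_comm, map_smul, smul_comm]

end OddVectorField

open ComplexGrassmann

/-! ### Rules for evaluation in the truncated algebra -/

section TruncEval

attribute [local instance] isScalarTower_real smulCommClass_complex

variable {n : ℕ} {L : Finset ℕ} {U : Set (BodySpace n)} {M : Type*} [NormedAddCommGroup M]
  [NormedSpace ℂ M] [Module (TruncAlg L) M] [IsBoundedSMul (TruncAlg L) M]
  [IsScalarTower ℂ (TruncAlg L) M] {x : Fin n → evenPart}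

theorem truncEval_congr (hU : IsOpen U) (hx : (fun j => (x j : ComplexGrassmann).body) ∈ U)
    {f g : BodySpace n → M} (h : Set.EqOn f g U) : truncEval L x f = truncEval L x g :=
  taylorEval_congr _ _ hU h _ hx

theorem truncEval_add (hU : IsOpen U) (hx : (fun j => (x j : ComplexGrassmann).body) ∈ U)
    {f g : BodySpace n → M} (hf : ContDiffOn ℝ ∞ f U) (hg : ContDiffOn ℝ ∞ g U) :
    truncEval L x (fun z => f z + g z) = truncEval L x f + truncEval L x g :=
  taylorEval_add _ _ hU hf hg _ hx

theorem truncEval_sum (hU : IsOpen U) (hx : (fun j => (x j : ComplexGrassmann).body) ∈ U)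
    {ι : Type*} (s : Finset ι) {f : ι → BodySpace n → M} (hf : ∀ i ∈ s, ContDiffOn ℝ ∞ (f i) U) :
    truncEval L x (fun z => ∑ i ∈ s, f i z) = ∑ i ∈ s, truncEval L x (f i) :=
  taylorEval_sum _ _ hU s hf _ hx

theorem truncEval_smul [FiniteDimensional ℂ M] (hU : IsOpen U)
    (hx : (fun j => (x j : ComplexGrassmann).body) ∈ U) {a : BodySpace n → TruncAlg L}
    {f : BodySpace n → M} (ha : ContDiffOn ℝ ∞ a U) (hf : ContDiffOn ℝ ∞ f U) :
    truncEval L x (fun z => a z • f z) = truncEval L x a • truncEval L x f :=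
  taylorEval_smul (I := RingHom.ker (truncBody L)) hU
    (fun j => truncBody_trunc_evenSoul (x j)) (fun j => truncBody_truncConj_evenSoul (x j))
    ker_truncBody_pow ha hf hx

theorem truncEval_mul (hU : IsOpen U) (hx : (fun j => (x j : ComplexGrassmann).body) ∈ U)
    {a f : BodySpace n → TruncAlg L} (ha : ContDiffOn ℝ ∞ a U) (hf : ContDiffOn ℝ ∞ f U) :
    truncEval L x (fun z => a z * f z) = truncEval L x a * truncEval L x f :=
  truncEval_smul (M := TruncAlg L) hU hx ha hf

theorem truncEval_const_smul [FiniteDimensional ℂ M] (hU : IsOpen U)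
    (hx : (fun j => (x j : ComplexGrassmann).body) ∈ U) (c : ℂ) {f : BodySpace n → M}
    (hf : ContDiffOn ℝ ∞ f U) : truncEval L x (fun z => c • f z) = c • truncEval L x f := by
  have h := truncEval_smul (a := fun _ => algebraMap ℂ (TruncAlg L) c) hU hx contDiffOn_const hf
  have h1 : truncEval L x (fun _ => algebraMap ℂ (TruncAlg L) c) = algebraMap ℂ (TruncAlg L) c :=
    taylorEval_const _ _ _ (Nat.succ_pos _) _
  rw [h1, algebraMap_smul] at h
  simpa only [algebraMap_smul] using h

end TruncEval

section Exponential

open MeasureTheory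

attribute [local instance] isScalarTower_real smulCommClass_complex

variable {n : ℕ} {U : Set (BodySpace n)} {A M : Type*} [NormedCommRing A] [NormedAlgebra ℂ A]
  [CompleteSpace A] [NormedAddCommGroup M] [NormedSpace ℂ M] [Module A M] [IsBoundedSMul A M]
  [IsScalarTower ℂ A M]

theorem integrableOn_exp_smul_bodyBall {p : BodySpace n} {ε : ℝ} (hε : 0 < ε)
    (hεU : bodyClosedBall p ε ⊆ U) {f : BodySpace n → A} (hf : ContDiffOn ℝ ∞ f U)
    {ψ : BodySpace n → M} (hψ : ContDiffOn ℝ ∞ ψ U) :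
    IntegrableOn (fun z => NormedSpace.exp (f z) • ψ z) (bodyBall p ε) := by
  let _ : NormedAlgebra ℚ A := NormedAlgebra.restrictScalars ℚ ℂ A
  have h : ContinuousOn (fun z => NormedSpace.exp (f z) • ψ z) U :=
    (NormedSpace.exp_continuous.comp_continuousOn hf.continuousOn).smul hψ.continuousOn
  exact ((h.mono hεU).integrableOn_compact (isCompact_bodyClosedBall p hε)).mono_set
    (bodyBall_subset_bodyClosedBall p ε)

theorem integrableOn_const_smul {S : Set (BodySpace n)} {f : BodySpace n → M}
    (hf : IntegrableOn f S) (c : ℂ) : IntegrableOn (fun z => c • f z) S :=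
  Integrable.smul c hf

end Exponential

/-! ### Isolating radii and the coefficient of top weight -/

namespace OddVectorField

open SuperForm FormAlg MeasureTheory

attribute [local instance] isScalarTower_real smulCommClass_complex

variable {n : ℕ} {L : Finset ℕ} {U : Set (BodySpace n)} (V : OddVectorField n U)

theorem truncBody_truncG (i : Fin n) (z : BodySpace n) :
    truncBody L (V.truncG L i z) = (V.g i z : ComplexGrassmann).body := truncBody_trunc _

theorem truncBody_truncH (i : Fin n) (z : BodySpace n) :
    truncBody L (V.truncH L i z) = starRingEnd ℂ (truncBody L (V.truncG L i z)) := by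
  rw [truncBody_truncG]
  exact truncBody_trunc _

theorem truncBody_det_wirtJacobian_truncH (hU : IsOpen U) {z : BodySpace n} (hz : z ∈ U) :
    truncBody L (wirtJacobian Complex.I (V.truncH L) z).det
      = starRingEnd ℂ (truncBody L (wirtJacobian (-Complex.I) (V.truncG L) z).det) := by
  rw [AlgHom.map_det, AlgHom.map_det, RingHom.map_det]
  congr 1
  ext i j
  change truncBody L (wirt Complex.I j (V.truncH L i) z)
    = starRingEnd ℂ (truncBody L (wirt (-Complex.I) j (V.truncG L i) z))
  have hG := (V.contDiffOn_truncG (L := L) hU i).differentiableAt_of_isOpen hU hz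
  have hH := (V.contDiffOn_truncH (L := L) hU i).differentiableAt_of_isOpen hU hz
  rw [← wirt_body (truncBody L) hG, ← wirt_body (truncBody L) hH]
  simp only [truncBody_truncH]
  have hb : DifferentiableAt ℝ (fun w => truncBody L (V.truncG L i w)) z :=
    ((LinearMap.toContinuousLinearMap
      (truncBody L).toLinearMap).restrictScalars ℝ).differentiableAt.comp z hG
  rw [wirt_conj hb, Complex.conj_I]

/-- The value of `det(JV)` at a point, as an even element. -/
noncomputable def evalDetJ (p : SuperPoint n) : evenPart :=
  ⟨superEval V.detJ p.z, superEval_mem_evenPart (fun z => (V.evenDetJ z).2) p.z⟩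

theorem contDiffOn_det_wirtJacobian_truncG (hU : IsOpen U) :
    ContDiffOn ℝ ∞ (fun z => (wirtJacobian (-Complex.I) (V.truncG L) z).det) U :=
  ((V.evenDetJ_smoothOn hU).trunc L).congr fun _ hz => (V.trunc_evenDetJ hU hz).symm

theorem truncEval_det_wirtJacobian (hU : IsOpen U) {p : SuperPoint n} (hp : p.body ∈ U) :
    truncEval L p.z (fun z => (wirtJacobian (-Complex.I) (V.truncG L) z).det)
      = trunc L (V.evalDetJ p) := by
  refine Eq.trans ?_ (trunc_superEval (L := L) hU (V.evenDetJ_smoothOn hU) p.z hp).symm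
  exact taylorEval_congr _ _ hU (fun z hz => (V.trunc_evenDetJ hU hz).symm) _ hp

theorem truncBody_truncEval (hU : IsOpen U) {p : SuperPoint n} (hp : p.body ∈ U)
    {f : BodySpace n → TruncAlg L} (hf : ContDiffOn ℝ ∞ f U) :
    truncBody L (truncEval L p.z f) = truncBody L (f p.body) := by
  have h := taylorEval_sub_mem (I := RingHom.ker (truncBody L)) hU
    (fun j => truncBody_trunc_evenSoul (p.z j)) (fun j => truncBody_truncConj_evenSoul (p.z j))
    (Nat.succ_pos L.card) hf hp
  rw [RingHom.mem_ker, map_sub, sub_eq_zero] at h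
  exact h

theorem truncBody_det_wirtJacobian_ne_zero (hU : IsOpen U) {p : SuperPoint n} (hp : p.body ∈ U)
    (hnd : V.IsNondegenerateAt p) :
    truncBody L (wirtJacobian (-Complex.I) (V.truncG L) p.body).det ≠ 0 := by
  rw [← truncBody_truncEval hU hp (V.contDiffOn_det_wirtJacobian_truncG hU),
    V.truncEval_det_wirtJacobian hU hp, truncBody_trunc]
  exact hnd

theorem contDiffOn_det_wirtJacobian_truncH (hU : IsOpen U) :
    ContDiffOn ℝ ∞ (fun z => (wirtJacobian Complex.I (V.truncH L) z).det) U := by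
  have h : (fun z => (wirtJacobian Complex.I (V.truncH L) z).det) = fun z =>
      ∑ σ : Equiv.Perm (Fin n), (Equiv.Perm.sign σ : ℤ) •
        ∏ i, wirtJacobian Complex.I (V.truncH L) z (σ i) i := by
    funext z
    rw [Matrix.det_apply]
    rfl
  rw [h]
  simp only [← Int.cast_smul_eq_zsmul ℝ]
  refine ContDiffOn.sum fun σ _ => ContDiffOn.const_smul _ ?_
  exact contDiffOn_prod fun i _ => (V.contDiffOn_truncH hU (σ i)).wirt hU

/-- Radii that isolate a nondegenerate singularity exist. -/
theorem exists_isIsolatingRadius (hU : IsOpen U) {p : SuperPoint n} (hp : p ∈ V.singularSet)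
    (hnd : V.IsNondegenerateAt p) : ∃ ε, V.IsIsolatingRadius p ε := by
  have hpU := hp.1
  -- The truncation to `L = ∅` retains the bodies only, which is all that the choice of a radius
  -- requires.
  set g : Fin n → BodySpace n → ℂ := fun i z => truncBody ∅ (V.truncG ∅ i z) with hg
  have hGd (i : Fin n) : DifferentiableAt ℝ (V.truncG ∅ i) p.body :=
    (V.contDiffOn_truncG hU i).differentiableAt_of_isOpen hU hpU
  have h0 (i : Fin n) : g i p.body = 0 := by
    rw [hg]
    simp only
    rw [← truncBody_truncEval hU hpU (V.contDiffOn_truncG hU i)]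
    have h1 := truncEval_trunc_eq_zero (L := ∅) hU ((V.g_holomorphic i).smoothOn hU) p.z hpU
      (hp.2.2 i)
    exact (congrArg (truncBody ∅) h1).trans (map_zero _)
  have hdet : (wirtJacobian (-Complex.I) g p.body).det ≠ 0 := by
    have h1 := V.truncBody_det_wirtJacobian_ne_zero (L := ∅) hU hpU hnd
    rw [AlgHom.map_det] at h1
    convert h1 using 2
    ext i j
    exact wirt_body (truncBody ∅) (hGd i)
  obtain ⟨c, hc, r, hr, hcr⟩ := exists_sum_normSq_ge (g := g) (p := p.body)
    (fun i => ((LinearMap.toContinuousLinearMap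
      (truncBody ∅).toLinearMap).restrictScalars ℝ).differentiableAt.comp p.body (hGd i))
    (fun i j => by
      refine (wirt_body (truncBody ∅) (hGd i)).trans ?_
      rw [show V.truncG ∅ i = fun w => trunc ∅ (V.g i w) from rfl,
        wirt_trunc_eq_zero hU (V.g_holomorphic i) j hpU, map_zero])
    h0 (fun i j => rfl) hdet
  obtain ⟨R, hR, hRU⟩ := Metric.isOpen_iff.1 hU p.body hpU
  have hε : 0 < min r R / 2 := half_pos (lt_min hr hR)
  have hlt : min r R / 2 < min r R := half_lt_self (lt_min hr hR)
  refine ⟨min r R / 2, hε, ?_, ?_⟩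
  · exact (bodyClosedBall_subset_closedBall p.body hε).trans
      ((Metric.closedBall_subset_ball (hlt.trans_le (min_le_right r R))).trans hRU)
  · intro z hz hgz
    have hz1 := bodyClosedBall_subset_closedBall p.body hε hz
    rw [mem_closedBall_iff_norm] at hz1
    -- The parameter `1` of the segment is `g` itself: near `p` the sum of the squared moduli is at
    -- least a multiple of the squared distance, so it has no other zero.
    have h1 := hcr z (hz1.trans_lt (hlt.trans_le (min_le_left r R))) 1 (by simp)
    have h2 (i : Fin n) : g i z = 0 := (V.truncBody_truncG i z).trans (hgz i)
    simp only [h2, Complex.ofReal_one, one_mul, zero_sub, add_neg_cancel, map_zero,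
      Finset.sum_const_zero] at h1
    have h3 : ‖z - p.body‖ ^ 2 ≤ 0 := by
      by_contra! h
      nlinarith
    exact sub_eq_zero.1 (norm_eq_zero.1 (pow_eq_zero_iff two_ne_zero |>.1
      (le_antisymm h3 (sq_nonneg _))))

section Limit

variable {p : SuperPoint n} {ε : ℝ}

theorem contDiffOn_phase (hU : IsOpen U) (t : ℝ) :
    ContDiffOn ℝ ∞ (fun z => -(t⁻¹ • ∑ i, V.truncG L i z * V.truncH L i z)) U :=
  ((ContDiffOn.sum fun i _ =>
    (V.contDiffOn_truncG hU i).mul (V.contDiffOn_truncH hU i)).const_smul t⁻¹).neg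

/-- The top coefficients of the powers of the nilpotent part, paired with `η`. -/
noncomputable def topCoeff (L : Finset ℕ) (η : SuperForm n) (j : ℕ) (z : BodySpace n) :
    TruncSpace L :=
  topPair (fun I => res L (η I z)) (V.nilpotentPart L z ^ j)

theorem contDiffOn_topCoeff (hU : IsOpen U) {η : SuperForm n} (hη : η.SmoothOn U) (j : ℕ) :
    ContDiffOn ℝ ∞ (V.topCoeff L η j) U :=
  SmoothOn.topPair (fun I => GrassmannSmoothOn.res (hη I) L) ((V.smoothOn_nilpotentPart hU).pow j)

/-- The term of weight `n + 1` is removed by the parity assumption, so the highest weight is the `n`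
that matches the normalization of the integrals. -/
theorem setIntegral_res_localizedForm (hU : IsOpen U) {η : SuperForm n} (hη : η.SmoothOn U)
    (hpar : η.coeffTopOdd.HasDimensionParityOn U) (hε : 0 < ε)
    (hεU : bodyClosedBall p.body ε ⊆ U) (t : ℝ) :
    IntegrableOn (fun z => res L (V.localizedForm η t ⟨Finset.univ, 1, Finset.univ⟩ z))
      (bodyBall p.body ε) ∧
    ∫ z in bodyBall p.body ε, res L (V.localizedForm η t ⟨Finset.univ, 1, Finset.univ⟩ z)
      = ∑ j ∈ Finset.range (n + 1), ((j.factorial : ℂ)⁻¹ * (-((t⁻¹ : ℝ) : ℂ)) ^ j) •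
        ∫ z in bodyBall p.body ε,
          NormedSpace.exp (-(t⁻¹ • ∑ i, V.truncG L i z * V.truncH L i z)) • V.topCoeff L η j z := by
  have hBU : bodyBall p.body ε ⊆ U := (bodyBall_subset_bodyClosedBall p.body ε).trans hεU
  have hm : MeasurableSet (bodyBall p.body ε) := (isOpen_bodyBall p.body ε).measurableSet
  have h1 : Set.EqOn (fun z => res L (V.localizedForm η t ⟨Finset.univ, 1, Finset.univ⟩ z))
      (fun z => ∑ j ∈ Finset.range (n + 1), ((j.factorial : ℂ)⁻¹ * (-((t⁻¹ : ℝ) : ℂ)) ^ j) •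
        NormedSpace.exp (-(t⁻¹ • ∑ i, V.truncG L i z * V.truncH L i z)) • V.topCoeff L η j z)
      (bodyBall p.body ε) := by
    intro z hz
    simp only
    rw [V.res_localizedForm hU η t (hBU hz), Finset.sum_range_succ,
      V.topPair_nilpotentPart_pow_succ hpar (hBU hz), smul_zero, add_zero, Finset.smul_sum]
    exact Finset.sum_congr rfl fun j _ => smul_comm _ _ _
  have h2 (j : ℕ) : IntegrableOn (fun z => ((j.factorial : ℂ)⁻¹ * (-((t⁻¹ : ℝ) : ℂ)) ^ j) •
      NormedSpace.exp (-(t⁻¹ • ∑ i, V.truncG L i z * V.truncH L i z)) • V.topCoeff L η j z)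
      (bodyBall p.body ε) :=
    integrableOn_const_smul (integrableOn_exp_smul_bodyBall hε hεU (V.contDiffOn_phase hU t)
      (V.contDiffOn_topCoeff hU hη j)) _
  refine ⟨(integrableOn_congr_fun h1 hm).2 (integrable_finsetSum _ fun j _ => h2 j), ?_⟩
  rw [setIntegral_congr_fun hm h1, integral_finsetSum _ fun j _ => h2 j]
  exact Finset.sum_congr rfl fun j _ => integral_smul _ _

/-- The terms of top weight coming from `i_V(dz_j) = f_j` carry a factor `ḡ_j`, which evaluates to
zero at the singularity because `g_j` does. -/
theorem truncEval_topCoeff (hU : IsOpen U) (hp : p ∈ V.singularSet) {η : SuperForm n}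
    (hη : η.SmoothOn U) : truncEval L p.z (V.topCoeff L η n)
      = (n.factorial * orientationSign n : ℂ) •
        (truncEval L p.z (fun z => (wirtJacobian Complex.I (V.truncH L) z).det)
          • res L (superEval η.coeffTopOdd.top p.z + superEval η.coeffStar.top p.z)) := by
  have hpU := hp.1
  set c : ℂ := n.factorial * orientationSign n with hc
  set D := fun z => (wirtJacobian Complex.I (V.truncH L) z).det with hD
  have hDs : ContDiffOn ℝ ∞ D U := V.contDiffOn_det_wirtJacobian_truncH hU
  set χ : Fin n → BodySpace n → TruncSpace L := fun j z => n • topPair (fun I => res L (η I z))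
    (evenTwoForm (wirtJacobian Complex.I (V.truncH L) z).transpose ^ (n - 1) * V.truncF L j z)
    with hχ
  have hχs (j : Fin n) : ContDiffOn ℝ ∞ (χ j) U := by
    simp only [hχ, ← Nat.cast_smul_eq_nsmul ℝ]
    refine ContDiffOn.const_smul _ (SmoothOn.topPair (fun I => GrassmannSmoothOn.res (hη I) L) ?_)
    exact ((smoothOn_evenTwoForm fun i k => V.contDiffOn_wirtJacobian_truncH hU i k).pow _).mul
      (V.smoothOn_truncF hU j)
  have htop : GrassmannSmoothOn η.coeffTopOdd.top U := hη _
  have hstar : GrassmannSmoothOn η.coeffStar.top U := by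
    have : η.coeffStar.top = fun z => ∑ j : Fin n,
        η ⟨{hol j}, Function.update 1 (hol j) 0, Finset.univ⟩ z := by
      funext z
      unfold SuperFunction.top coeffStar
      rw [Finset.sum_apply]
    rw [this]
    exact GrassmannSmoothOn.sum fun j _ => hη _
  have h1 : Set.EqOn (V.topCoeff L η n) (fun z => c • D z • (res L (η.coeffTopOdd.top z)
      + res L (η.coeffStar.top z)) + ∑ j, V.truncH L j z • χ j z) U := by
    intro z hz
    refine (V.topPair_nilpotentPart_pow η hz).trans ?_
    simp only [hD]
    rw [map_add, ← mul_assoc, mul_smul, ← map_natCast (algebraMap ℂ (TruncAlg L)),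
      ← map_intCast (algebraMap ℂ (TruncAlg L)), ← map_mul, algebraMap_smul]
  have hsum : ContDiffOn ℝ ∞ (fun z => res L (η.coeffTopOdd.top z)
      + res L (η.coeffStar.top z)) U := (htop.res L).add (hstar.res L)
  have hχH (j : Fin n) : ContDiffOn ℝ ∞ (fun z => V.truncH L j z • χ j z) U :=
    (V.contDiffOn_truncH (L := L) hU j).smul (hχs j)
  have hDsum : ContDiffOn ℝ ∞ (fun z => D z • (res L (η.coeffTopOdd.top z)
      + res L (η.coeffStar.top z))) U := hDs.smul hsum
  have h3 : truncEval L p.z (fun z => ∑ j, V.truncH L j z • χ j z) = 0 := by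
    rw [truncEval_sum hU hpU Finset.univ fun j _ => hχH j]
    refine Finset.sum_eq_zero fun j _ => ?_
    have h4 : truncEval L p.z (fun z => V.truncH L j z) = 0 :=
      truncEval_truncConj_eq_zero hU ((V.g_holomorphic j).smoothOn hU) p.z hpU (hp.2.2 j)
    rw [truncEval_smul hU hpU (V.contDiffOn_truncH hU j) (hχs j), h4, zero_smul]
  have h6 : truncEval L p.z (fun z => res L (η.coeffTopOdd.top z) + res L (η.coeffStar.top z))
      = res L (superEval η.coeffTopOdd.top p.z + superEval η.coeffStar.top p.z) := by
    rw [map_add, res_superEval hU htop p.z hpU, res_superEval hU hstar p.z hpU]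
    exact truncEval_add hU hpU (htop.res L) (hstar.res L)
  rw [truncEval_congr hU hpU h1, truncEval_add hU hpU (hDsum.const_smul c)
    (ContDiffOn.sum fun j _ => hχH j), h3, add_zero, truncEval_const_smul hU hpU c hDsum,
    truncEval_smul hU hpU hDs hsum, h6]

end Limit

end OddVectorField

open ComplexGrassmann

/-! ### The limit and its constant -/

/-- A sum of integrals with polynomial weights is dominated by the one of top weight. -/
theorem tendsto_sum_smul_of_tendsto_inv_pow_smul {M : Type*} [NormedAddCommGroup M]
    [NormedSpace ℂ M] {m : ℕ} {I : ℕ → ℝ → M} {Λ : ℕ → M}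
    (h : ∀ j, Filter.Tendsto (fun t : ℝ => t⁻¹ ^ m • I j t) (𝓝[>] 0) (𝓝 (Λ j))) :
    Filter.Tendsto (fun t : ℝ => ∑ j ∈ Finset.range (m + 1),
      ((j.factorial : ℂ)⁻¹ * (-((t⁻¹ : ℝ) : ℂ)) ^ j) • I j t) (𝓝[>] 0)
      (𝓝 (((m.factorial : ℂ)⁻¹ * (-1) ^ m) • Λ m)) := by
  -- Each integral converges after multiplication by `t⁻¹ ^ m`, so the summand of weight `j` is `t ^
  -- (m - j)` times a convergent quantity.
  have h1 (j : ℕ) : Filter.Tendsto (fun t : ℝ => ((j.factorial : ℂ)⁻¹ * (-1) ^ j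
      * (t : ℂ) ^ (m - j)) • (t⁻¹ ^ m • I j t)) (𝓝[>] 0)
      (𝓝 (((j.factorial : ℂ)⁻¹ * (-1) ^ j * 0 ^ (m - j)) • Λ j)) := by
    refine Filter.Tendsto.smul (Filter.Tendsto.const_mul _ ?_) (h j)
    have : Filter.Tendsto (fun t : ℝ => (t : ℂ) ^ (m - j)) (𝓝 0) (𝓝 (((0 : ℝ) : ℂ) ^ (m - j))) :=
      (Complex.continuous_ofReal.pow (m - j)).tendsto 0
    rw [Complex.ofReal_zero] at this
    exact this.mono_left nhdsWithin_le_nhds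
  have h2 := tendsto_finsetSum (Finset.range (m + 1)) fun j _ => h1 j
  have h3 : ∑ j ∈ Finset.range (m + 1), ((j.factorial : ℂ)⁻¹ * (-1) ^ j * 0 ^ (m - j)) • Λ j
      = ((m.factorial : ℂ)⁻¹ * (-1) ^ m) • Λ m := by
    rw [Finset.sum_eq_single m]
    · rw [Nat.sub_self, pow_zero, mul_one]
    · intro j hj hjm
      have : m - j ≠ 0 := by
        rw [Finset.mem_range] at hj
        omega
      rw [zero_pow this, mul_zero, zero_smul]
    · exact fun hm => absurd (Finset.self_mem_range_succ m) hm
  rw [h3] at h2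
  refine h2.congr' ?_
  filter_upwards [self_mem_nhdsWithin] with t ht
  have ht0 : (t : ℂ) ≠ 0 := Complex.ofReal_ne_zero.2 (ne_of_gt ht)
  refine Finset.sum_congr rfl fun j hj => ?_
  have hjm : j ≤ m := Nat.lt_succ_iff.1 (Finset.mem_range.1 hj)
  rw [← Complex.coe_smul, smul_smul]
  congr 1
  obtain ⟨k, rfl⟩ := Nat.exists_eq_add_of_le hjm
  push_cast
  rw [Nat.add_sub_cancel_left, neg_pow (t : ℂ)⁻¹, pow_add]
  have hk : (t : ℂ) ^ k * (t : ℂ)⁻¹ ^ k = 1 := by rw [← mul_pow, mul_inv_cancel₀ ht0, one_pow]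
  linear_combination ((j.factorial : ℂ)⁻¹ * (-1) ^ j * (t : ℂ)⁻¹ ^ j) * hk

/-- The sign of the volume form times the sign from reordering the `dz̄_k dz_k` is `(-1)ⁿ`. It
cancels the `(-1)ⁿ` from the power of `-1/t`, and `(-2πi)ⁿ = (2π/i)ⁿ` remains. -/
theorem FormAlg.residue_prefactor (n : ℕ) :
    (-1 : ℂ) ^ (n * (n - 1) / 2) * (-2 * Complex.I) ^ n
      * ((-1) ^ n * orientationSign n * (Real.pi : ℂ) ^ n) = (2 * Real.pi / Complex.I) ^ n := by
  have h1 : (-1 : ℂ) ^ (n * (n - 1) / 2) * orientationSign n = (-1) ^ n := by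
    induction n with
    | zero => simp [orientationSign]
    | succ k ih =>
      rw [orientationSign_succ]
      have h2 : (k + 1) * (k + 1 - 1) / 2 = k * (k - 1) / 2 + k := by
        rw [Nat.add_sub_cancel, ← Nat.add_mul_div_right _ _ two_pos]
        congr 1
        cases k with
        | zero => rfl
        | succ k =>
          rw [Nat.add_sub_cancel]
          ring
      rw [h2, pow_add]
      push_cast
      calc _ = ((-1 : ℂ) ^ k * (-1) ^ (k + 1)) * ((-1) ^ (k * (k - 1) / 2) * orientationSign k) := by
            ring
        _ = (-1) ^ (k + 1) := by
            rw [ih, pow_succ]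
            have : (-1 : ℂ) ^ k * (-1) ^ k = 1 := by rw [← mul_pow]; norm_num
            linear_combination ((-1 : ℂ) ^ k * (-1)) * this
  calc _ = ((-1 : ℂ) ^ (n * (n - 1) / 2) * orientationSign n)
        * ((-1) ^ n * ((-2 * Complex.I) ^ n * (Real.pi : ℂ) ^ n)) := by ring
    _ = _ := by
      rw [h1, ← mul_pow, ← mul_pow, ← mul_pow]
      congr 1
      rw [div_eq_mul_inv, Complex.inv_I]
      ring

/-! ### The residue formula -/

namespace OddVectorField

open SuperForm FormAlg MeasureTheory

attribute [local instance] isScalarTower_real smulCommClass_complex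

variable {n : ℕ} {L : Finset ℕ} {U : Set (BodySpace n)} (V : OddVectorField n U)
  {p : SuperPoint n} {ε : ℝ}

theorem isUnit_evalDetJ (hnd : V.IsNondegenerateAt p) : IsUnit (V.evalDetJ p) :=
  isUnit_of_mem_evenPart _ hnd

theorem coe_inverse_evalDetJ (hnd : V.IsNondegenerateAt p) :
    ((Ring.inverse (V.evalDetJ p) : evenPart) : ComplexGrassmann)
      = Ring.inverse (superEval V.detJ p.z) := by
  have h := congrArg (Subtype.val : evenPart → ComplexGrassmann)
    (Ring.mul_inverse_cancel _ (V.isUnit_evalDetJ hnd))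
  have hu : IsUnit (superEval V.detJ p.z) := (V.isUnit_evalDetJ hnd).map evenPart.subtype
  have h1 : superEval V.detJ p.z * ((Ring.inverse (V.evalDetJ p) : evenPart) : ComplexGrassmann)
      = 1 := h
  exact (hu.mul_left_cancel (h1.trans (Ring.mul_inverse_cancel _ hu).symm))

/-- Evaluation is multiplicative, so the antiholomorphic determinant in the density of the limit
cancels the one produced by the top power of `∂̄ω`. -/
theorem inverse_truncEval_det (hU : IsOpen U) (hpU : p.body ∈ U) (hnd : V.IsNondegenerateAt p) :
    Ring.inverse (truncEval L p.z fun z => (wirtJacobian (-Complex.I) (V.truncG L) z).det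
        * (wirtJacobian Complex.I (V.truncH L) z).det)
      * truncEval L p.z (fun z => (wirtJacobian Complex.I (V.truncH L) z).det)
      = trunc L (Ring.inverse (V.evalDetJ p)) := by
  set E := truncEval L p.z fun z => (wirtJacobian Complex.I (V.truncH L) z).det with hE
  have hEu : IsUnit E := by
    refine isUnit_of_body_ne_zero (b := truncBody L) (N := L.card + 1) ker_truncBody_pow ?_
    rw [hE, truncBody_truncEval hU hpU (V.contDiffOn_det_wirtJacobian_truncH hU),
      V.truncBody_det_wirtJacobian_truncH hU hpU, map_ne_zero]
    exact V.truncBody_det_wirtJacobian_ne_zero hU hpU hnd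
  have hd := V.isUnit_evalDetJ hnd
  have hdu : IsUnit (trunc L (V.evalDetJ p)) := hd.map (trunc L)
  rw [truncEval_mul hU hpU (V.contDiffOn_det_wirtJacobian_truncG hU)
    (V.contDiffOn_det_wirtJacobian_truncH hU), V.truncEval_det_wirtJacobian hU hpU]
  refine (hdu.mul hEu).mul_left_cancel ?_
  rw [← mul_assoc, Ring.mul_inverse_cancel _ (hdu.mul hEu), one_mul, mul_right_comm, ← map_mul,
    Ring.mul_inverse_cancel _ hd, map_one, one_mul]

theorem tendsto_integral_topCoeff (hU : IsOpen U) (hp : p ∈ V.singularSet)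
    (hnd : V.IsNondegenerateAt p) (hε : V.IsIsolatingRadius p ε) {ψ : BodySpace n → TruncSpace L}
    (hψ : ContDiffOn ℝ ∞ ψ U) :
    Filter.Tendsto (fun t : ℝ => t⁻¹ ^ n • ∫ z in bodyBall p.body ε,
        NormedSpace.exp (-(t⁻¹ • ∑ i, V.truncG L i z * V.truncH L i z)) • ψ z) (𝓝[>] 0)
      (𝓝 ((algebraMap ℂ (TruncAlg L) ((Real.pi : ℂ) ^ n) * Ring.inverse (truncEval L p.z fun z =>
          (wirtJacobian (-Complex.I) (V.truncG L) z).det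
            * (wirtJacobian Complex.I (V.truncH L) z).det)) • truncEval L p.z ψ)) := by
  refine tendsto_setIntegral_bodyBall (b := truncBody L) ker_truncBody_pow (Nat.succ_pos L.card) hU
    (fun i => V.contDiffOn_truncG hU i) (fun i => V.contDiffOn_truncH hU i) ?_ ?_ ?_ hε.1 hε.2.1 ?_
    (fun j => truncBody_trunc_evenSoul (p.z j)) (fun j => truncBody_truncConj_evenSoul (p.z j))
    ?_ ?_ (V.truncBody_det_wirtJacobian_ne_zero hU hp.1 hnd) hψ
  · exact fun z hz i j => wirt_trunc_eq_zero hU (V.g_holomorphic i) j hz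
  · exact fun z hz i j => wirt_truncConj_eq_zero hU (V.g_holomorphic i) j hz
  · exact fun z _ i => V.truncBody_truncH i z
  · exact fun z hz h => hε.2.2 z hz fun i => (V.truncBody_truncG i z).symm.trans (h i)
  · exact fun i => truncEval_trunc_eq_zero hU ((V.g_holomorphic i).smoothOn hU) p.z hp.1 (hp.2.2 i)
  · exact fun i =>
      truncEval_truncConj_eq_zero hU ((V.g_holomorphic i).smoothOn hU) p.z hp.1 (hp.2.2 i)

theorem tendsto_setIntegral_res_localizedForm (hU : IsOpen U) (hp : p ∈ V.singularSet)
    (hnd : V.IsNondegenerateAt p) (hε : V.IsIsolatingRadius p ε) {η : SuperForm n}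
    (hη : η.SmoothOn U) (hpar : η.coeffTopOdd.HasDimensionParityOn U) :
    Filter.Tendsto (fun t : ℝ => ∫ z in bodyBall p.body ε,
        res L (V.localizedForm η t ⟨Finset.univ, 1, Finset.univ⟩ z)) (𝓝[>] 0)
      (𝓝 (((-1) ^ n * orientationSign n * (Real.pi : ℂ) ^ n) •
        res L ((superEval η.coeffTopOdd.top p.z + superEval η.coeffStar.top p.z)
          * Ring.inverse (superEval V.detJ p.z)))) := by
  have h1 := tendsto_sum_smul_of_tendsto_inv_pow_smul fun j =>
    V.tendsto_integral_topCoeff hU hp hnd hε (V.contDiffOn_topCoeff (L := L) hU hη j)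
  simp only [← (V.setIntegral_res_localizedForm hU hη hpar hε.1 hε.2.1 _).2] at h1
  have h2 : (((-1) ^ n * orientationSign n * (Real.pi : ℂ) ^ n) •
        res L ((superEval η.coeffTopOdd.top p.z + superEval η.coeffStar.top p.z)
          * Ring.inverse (superEval V.detJ p.z)))
      = ((n.factorial : ℂ)⁻¹ * (-1) ^ n) • ((algebraMap ℂ (TruncAlg L) ((Real.pi : ℂ) ^ n) *
        Ring.inverse (truncEval L p.z fun z => (wirtJacobian (-Complex.I) (V.truncG L) z).det
          * (wirtJacobian Complex.I (V.truncH L) z).det)) • truncEval L p.z (V.topCoeff L η n)) := by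
    have hf : (n.factorial : ℂ) ≠ 0 := Nat.cast_ne_zero.2 n.factorial_ne_zero
    rw [V.truncEval_topCoeff hU hp hη, ← V.coe_inverse_evalDetJ hnd,
      ← mul_comm_of_mem_evenPart (Ring.inverse (V.evalDetJ p)).2, ← trunc_smul_res,
      ← V.inverse_truncEval_det hU hp.1 hnd, smul_comm (_ * _ : TruncAlg L),
      smul_smul (_ * _ : TruncAlg L), mul_assoc (algebraMap ℂ (TruncAlg L) _),
      mul_smul (algebraMap ℂ (TruncAlg L) _), algebraMap_smul, smul_smul, smul_smul]
    congr 1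
    field_simp
  rw [h2]
  exact h1

theorem hasResidue (hU : IsOpen U) (hp : p ∈ V.singularSet) (hnd : V.IsNondegenerateAt p)
    {η : SuperForm n} (hη : η.SmoothOn U) (hpar : η.coeffTopOdd.HasDimensionParityOn U) :
    V.HasResidue η p ((2 * Real.pi / Complex.I : ℂ) ^ n •
      ((superEval η.coeffTopOdd.top p.z + superEval η.coeffStar.top p.z)
        * Ring.inverse (superEval V.detJ p.z))) := by
  refine ⟨V.exists_isIsolatingRadius hU hp hnd, fun ε hε l => ?_⟩
  -- For the component `l` it is enough to truncate to the subsets of `l`; the projection to `l`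
  -- itself commutes with the integral and with the limit.
  let π : TruncSpace l →L[ℂ] ℂ := ContinuousLinearMap.proj ⟨l, Finset.mem_powerset_self l⟩
  have h1 := (π.continuous.tendsto _).comp
    (V.tendsto_setIntegral_res_localizedForm (L := l) hU hp hnd hε hη hpar)
  have h2 := h1.const_mul ((-1 : ℂ) ^ (n * (n - 1) / 2) * (-2 * Complex.I) ^ n)
  convert h2 using 2 with t
  · unfold SuperForm.integral
    congr 1
    exact π.integral_comp_comm (V.setIntegral_res_localizedForm hU hη hpar hε.1 hε.2.1 t).1
  · rw [map_smul, smul_eq_mul, ← mul_assoc, residue_prefactor]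
    rfl

end OddVectorField

theorem theorem3p15 (n : ℕ) (U : Set (BodySpace n)) (hU : IsOpen U) (V : OddVectorField n U)
    (p : SuperPoint n) (hiso : V.IsIsolatedSingularity p) (hnd : V.IsNondegenerateAt p)
    (η : SuperForm n) (hη : η.SmoothOn U)
    (hpar₀ : η.coeffTopOdd.HasDimensionParityOn U)
    (hpar₁ : η.coeffStar.HasDimensionParityOn U) :
    V.HasResidue η p
      ((2 * Real.pi / Complex.I : ℂ) ^ n •
        ((superEval η.coeffTopOdd.top p.z + superEval η.coeffStar.top p.z)
          * Ring.inverse (superEval V.detJ p.z))) :=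
  V.hasResidue hU hiso.1 hnd hη hpar₀
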